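/- Fix a field $F$. **Weights, blocks.** A *weight* is a labelling by $\circ,\times,\vee,\wedge$ of the vertices of a number line, indexed by a (finite or infinite) set of consecutive integers, such that outside some finite set of vertices no two vertices are labelled $\vee\,\wedge$ in that order from left to right. Two weights are equivalent if they differ by a finite permutation of $\vee$'s and $\wedge$'s; a *block* $\Lambda$ is an equivalence class. A weight (and its block) is *bounded* if it has finitely many vertices. **Diagrams.** A *cup diagram* consists of finitely many cups and some (possibly infinitely many) rays attached below to vertices of a number line, without intersections; vertices not used are free. A *cap diagram* is the mirror image $c^*$ of a cup diagram $c$. The diagram $c\lambda$ is *oriented* if free vertices are labelled $\circ$ or $\times$, the ends of each cup are one $\vee$ and one $\wedge$, the rays are labelled $\vee$ or $\wedge$, and no two rays are labelled $\vee\,\wedge$ from left to right; $\lambda b$ is oriented if $b^*\lambda$ is. Write $\underline{\alpha}$ for the unique cup diagram such that $\underline{\alpha}\alpha$ is oriented and all cups have left end labelled $\vee$, and $\overline\alpha=\underline\alpha^*$. An *oriented circle diagram* $a\lambda b$ is an oriented cup diagram $a\lambda$ glued under an oriented cap diagram $\lambda b$. It is *closed* if it has no rays. A circle is anti-clockwise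 (type $1$) or clockwise (type $x$) if its leftmost vertex is labelled $\vee$ or $\wedge$; a component with rays is a line (type $y$). **The vector space $K_\Lambda$** has as basis the vectors $(a\lambda b)$ for all oriented circle diagrams with $\lambda\in\Lambda$; equivalently $a=\underline{\alpha}$, $b=\overline\beta$ with $\alpha,\beta\in\Lambda$. **Generalised surgery.** Consider a consistently oriented diagram with two number lines, having a cup diagram at the bottom, a cap diagram at the top, and a middle section which consists of vertical line segments and symmetric cap-cup pairs (a cap on the bottom number line, and its mirror image, a cup, on the top one). Choose a cap-cup pair which can be connected without crossings, i.e. is not enclosed by another pair, and replace it by two vertical line segments joining its left ends and its right ends. Re-orient the new components, keeping the labels of all vertices on other components and at all ends of rays, according to the following rules for the types of the component(s) containing the cap and the cup, before and after (tensor factors in either order): $$1\otimes1\mapsto1,\quad 1\otimes x\mapsto x,\quad x\otimes x\mapsto0,\quad 1\mapsto1\otimes x+x\otimes1,\quad x\mapsto x\otimes x,$$ $$1\otimes y\mapsto y,\quad x\otimes y\mapsto 0,\quad y\mapsto x\otimes y,$$ and $y\otimes y\mapsto y\otimes y$ if both rays of one of the two lines are oriented $\wedge$ and both rays of the other are oriented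 $\vee$, while $y\otimes y\mapsto 0$ otherwise. The result is a disjoint union of zero, one or two consistently oriented diagrams. **The multiplication of $K_\Lambda$.** (1) Let $\Delta$ be a block of bounded weights with equally many $\wedge$'s and $\vee$'s. Khovanov's algebra $H_\Delta$ has as basis the closed oriented circle diagrams with weight in $\Delta$. Put $(a\lambda b)(c\mu d)=0$ if $c\ne b^*$; if $c=b^*$, draw $a\lambda b$ under $c\mu d$, perform surgeries (only rules for circles occur) until the middle section has only vertical segments, identify the two number lines in each resulting diagram, and sum the corresponding basis vectors. (For definiteness, surgeries are taken in the order of the left ends of the pairs.) (2) Let $\Lambda$ be bounded, with $p$ $\wedge$'s and $q$ $\vee$'s in each weight. The closure $\mathrm{cl}(\lambda)$ adds $p$ vertices labelled $\vee$ at the left end and $q$ vertices labelled $\wedge$ at the right end; let $\Delta$ be the block of all these closures and set $\mathrm{cl}(\underline\alpha\lambda\overline\beta)=\underline{\mathrm{cl}(\alpha)}\,\mathrm{cl}(\lambda)\,\overline{\mathrm{cl}(\beta)}$. The product of two basis vectors of $K_\Lambda$ is the image of the product of their closures under the linear map $H_\Delta\to K_\Lambda$ which sends $\mathrm{cl}(a\lambda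 b)$ to $(a\lambda b)$ and all basis vectors which are not closures to $0$. (3) For weights write $\lambda\prec\mu$ if $\lambda$ is bounded, its vertices are vertices of $\mu$ with the same labels, and among the other vertices of $\mu$ no two are labelled $\vee\,\wedge$ from left to right; write $\Gamma\prec\Lambda$ if $\lambda\prec\mu$ for some $\lambda\in\Gamma$, $\mu\in\Lambda$. Then each $\lambda\in\Gamma$ has a unique extension $\mathrm{ex}(\lambda)\in\Lambda$ with $\lambda\prec\mathrm{ex}(\lambda)$, and one sets $\mathrm{ex}(\underline\alpha\lambda\overline\beta)=\underline{\mathrm{ex}(\alpha)}\,\mathrm{ex}(\lambda)\,\overline{\mathrm{ex}(\beta)}$. For unbounded $\Lambda$, the product of two basis vectors is computed by choosing $\Gamma\prec\Lambda$ such that both are extensions of basis vectors of $K_\Gamma$ and all their cups and caps lie on the number line of $\Gamma$, multiplying in $K_\Gamma$, and extending back. **Theorem 6.1.** Let $\Lambda$ be any block and let $(a\lambda b)$ and $(b^*\mu d)$ be basis vectors of $K_\Lambda$. (i) Draw $a\lambda b$ underneath $b^*\mu d$ and stitch corresponding rays of $b$ and $b^*$ together. Corresponding rays are oriented in the same direction,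 and the result is a consistently oriented diagram with a symmetric middle section. (ii) Starting from it, iterate the generalised surgery procedure in any order, each time replacing one diagram of the current disjoint union by the outcome of one generalised surgery on it. Any such partial computation can be continued until no diagram has any cap-cup pair left in its middle section. (iii) Whenever this stage is reached, by whatever sequence of surgeries, in each of the resulting diagrams the labels on the top and bottom number lines agree, and identifying these lines gives an oriented circle diagram $a\nu d$ with $\nu\in\Lambda$. The product $(a\lambda b)(b^*\mu d)$ in $K_\Lambda$ is the sum, with multiplicities, of the basis vectors $(a\nu d)$ so obtained. -/

import Mathlib

open scoped Classical

noncomputable section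

namespace DiagramAlgebra

/-! ## Weights and blocks -/

/-- The four possible labels of a vertex: `∘`, `×`, `∨`, `∧`. -/
inductive Label
  | nought
  | cross
  | down
  | up

/-- A weight.  The number line is the set of `i : ℤ` with `label i ≠ none`; its vertices are indexed
by a set of consecutive integers.  Outside of some finite set of vertices one cannot find two
vertices labelled `∨ ∧` in that order from left to right. -/
@[ext] structure Weight where
  label : ℤ → Option Label
  ordConnected : {i | label i ≠ none}.OrdConnected
  eventually_sorted : ∃ S : Set ℤ, S.Finite ∧ ∀ i j, i ∉ S → j ∉ S → i < j →
    ¬ (label i = some Label.down ∧ label j = some Label.up)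

namespace Weight

/-- The vertex `i` is labelled `∨` or `∧`. -/
def IsArrow (w : Weight) (i : ℤ) : Prop :=
  w.label i = some Label.down ∨ w.label i = some Label.up

/-- `μ` is obtained from `lam` by a (finite) permutation of its `∨`'s and `∧`'s, doing nothing to the
`∘`'s and `×`'s. -/
def Equivalent (lam μ : Weight) : Prop :=
  ∃ σ : Equiv.Perm ℤ, {i | σ i ≠ i}.Finite ∧ (∀ i, ¬ lam.IsArrow i → σ i = i) ∧
    ∀ i, μ.label i = lam.label (σ i)

/-- A weight is bounded if it has only finitely many vertices. -/
def Bounded (w : Weight) : Prop := {i | w.label i ≠ none}.Finite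

end Weight

theorem perm_mem_arrow {w : Weight} {σ : Equiv.Perm ℤ} (h : ∀ i, ¬ w.IsArrow i → σ i = i) (i : ℤ) :
    w.IsArrow (σ i) ↔ w.IsArrow i := by
  constructor
  · intro hi
    by_contra hc
    rw [h i hc] at hi
    exact hc hi
  · intro hi
    by_contra hc
    have := σ.injective (h (σ i) hc)
    rw [this] at hc
    exact hc hi

theorem Weight.Equivalent.arrow_iff {a b : Weight} (h : a.Equivalent b) (i : ℤ) :
    b.IsArrow i ↔ a.IsArrow i := by
  obtain ⟨σ, -, h2, h3⟩ := h
  rw [← perm_mem_arrow h2 i]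
  simp only [Weight.IsArrow, h3]

theorem Weight.Equivalent.refl (a : Weight) : a.Equivalent a :=
  ⟨1, by simp, by simp, by simp⟩

theorem Weight.Equivalent.symm {a b : Weight} (h : a.Equivalent b) : b.Equivalent a := by
  have ha := h.arrow_iff
  obtain ⟨σ, h1, h2, h3⟩ := h
  refine ⟨σ⁻¹, ?_, ?_, ?_⟩
  · convert h1 using 1
    ext i
    simp only [Set.mem_ofPred_eq, ne_eq, not_iff_not, Equiv.Perm.inv_eq_iff_eq]
    exact eq_comm
  · intro i hi
    rw [Equiv.Perm.inv_eq_iff_eq, h2 i ((ha i).not.mp hi)]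
  · intro i
    rw [h3]
    simp

theorem Weight.Equivalent.trans {a b c : Weight} (h : a.Equivalent b) (h' : b.Equivalent c) :
    a.Equivalent c := by
  have ha := h.arrow_iff
  obtain ⟨σ, h1, h2, h3⟩ := h
  obtain ⟨τ, k1, k2, k3⟩ := h'
  refine ⟨σ * τ, ?_, ?_, ?_⟩
  · refine (h1.union k1).subset ?_
    intro i hi
    by_contra hc
    simp only [Set.mem_union, Set.mem_ofPred_eq, not_or, not_not] at hc
    apply hi
    rw [Equiv.Perm.mul_apply, hc.2, hc.1]
  · intro i hi
    rw [Equiv.Perm.mul_apply, k2 i ((ha i).not.mpr hi), h2 i hi]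
  · intro i
    rw [k3, h3, Equiv.Perm.mul_apply]

theorem Weight.Equivalent.none_iff {a b : Weight} (h : a.Equivalent b) (i : ℤ) :
    b.label i = none ↔ a.label i = none := by
  have ha := h.arrow_iff i
  obtain ⟨σ, -, h2, h3⟩ := h
  by_cases hi : a.IsArrow i
  · have hb := ha.mpr hi
    constructor
    · intro h0
      simp [Weight.IsArrow, h0] at hb
    · intro h0
      simp [Weight.IsArrow, h0] at hi
  · rw [h3, h2 i hi]

theorem Weight.Equivalent.bounded {a b : Weight} (h : a.Equivalent b) (ha : a.Bounded) :
    b.Bounded := by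
  unfold Weight.Bounded at *
  convert ha using 2
  ext i
  exact (h.none_iff i).not

instance weightSetoid : Setoid Weight where
  r := Weight.Equivalent
  iseqv := ⟨Weight.Equivalent.refl, Weight.Equivalent.symm, Weight.Equivalent.trans⟩

/-- Blocks are the equivalence classes of weights. -/
def Block : Type := Quotient weightSetoid

/-- The block containing a weight. -/
def Weight.block (w : Weight) : Block := Quotient.mk weightSetoid w

instance : Membership Weight Block := ⟨fun Λ w => w.block = Λ⟩

theorem Block.equivalent {Λ : Block} {a b : Weight} (ha : a ∈ Λ) (hb : b ∈ Λ) : a.Equivalent b := by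
  have h : a.block = b.block := Eq.trans ha (Eq.symm hb)
  exact Quotient.exact h

theorem Weight.Equivalent.block_eq {a b : Weight} (h : a.Equivalent b) : a.block = b.block :=
  Quotient.sound h

/-- The block consists of bounded weights. -/
def Block.Bounded (Λ : Block) : Prop := ∀ w : Weight, w ∈ Λ → w.Bounded

/-! ## Cup and cap diagrams -/

/-- What happens at a vertex of a cup (or cap) diagram: it is free, it is the end of a ray, or it is
joined by a cup (or cap) to the vertex `j`. -/
inductive Node
  | free
  | ray
  | arc (j : ℤ)

/-- The combinatorial data of a cup diagram on a number line (`node i = none` means that `i` is not a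
vertex): finitely many cups and some rays, with no intersections.  The same data describes the cap
diagram which is the mirror image in the number line, so that the mirror image operation `*` does
not change the data; whether it is drawn as cups or as caps is determined by the position in
which it is used. -/
@[ext] structure ArcDiagram where
  node : ℤ → Option Node
  ordConnected : {i | node i ≠ none}.OrdConnected
  arc_symm : ∀ i j, node i = some (Node.arc j) → j ≠ i ∧ node j = some (Node.arc i)
  finite_arcs : {i | ∃ j, node i = some (Node.arc j)}.Finite
  ray_not_under : ∀ i j k, node i = some (Node.arc j) → i < k → k < j → node k ≠ some Node.ray
  noncrossing : ∀ i j k l, node i = some (Node.arc j) → i < k → k < j →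
    node k = some (Node.arc l) → i < l ∧ l < j

/-- A closed cup or cap diagram has no rays. -/
def ArcDiagram.Closed (c : ArcDiagram) : Prop := ∀ i, c.node i ≠ some Node.ray

/-- The labels `x`, `y` are one `∨` and one `∧`. -/
def Opposite (x y : Option Label) : Prop :=
  (x = some Label.down ∧ y = some Label.up) ∨ (x = some Label.up ∧ y = some Label.down)

/-- Gluing the cup diagram `c` under the weight `w` gives an oriented cup diagram (equivalently,
gluing the mirror image of `c` on top of `w` gives an oriented cap diagram). -/
structure Oriented (c : ArcDiagram) (w : Weight) : Prop where
  line : ∀ i, c.node i = none ↔ w.label i = none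
  free : ∀ i, c.node i = some Node.free →
    w.label i = some Label.nought ∨ w.label i = some Label.cross
  arc : ∀ i j, c.node i = some (Node.arc j) → Opposite (w.label i) (w.label j)
  ray : ∀ i, c.node i = some Node.ray → w.IsArrow i
  rays_sorted : ∀ i j, c.node i = some Node.ray → c.node j = some Node.ray → i < j →
    ¬ (w.label i = some Label.down ∧ w.label j = some Label.up)

/-! ## The cup diagram of a weight -/

/-- `∨` counts `1`, `∧` counts `-1`, everything else counts `0`. -/
def val : Option Label → ℤ
  | some Label.down => 1
  | some Label.up => -1
  | _ => 0

/-- The number of `∨`'s minus the number of `∧`'s on the vertices `i, …, j - 1`. -/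
def Weight.height (w : Weight) (i j : ℤ) : ℤ := ∑ k ∈ Finset.Ico i j, val (w.label k)

/-- The `∨` at `i` and the `∧` at `j` get joined when one repeatedly joins neighbouring `∨ ∧` pairs:
read from `i`, the `∨`'s outnumber the `∧`'s until `j`, where they balance for the first time. -/
def Weight.Matched (w : Weight) (i j : ℤ) : Prop :=
  i < j ∧ w.height i (j + 1) = 0 ∧ ∀ k, i < k → k ≤ j → 0 < w.height i k

theorem Weight.height_split (w : Weight) {i m j : ℤ} (h1 : i ≤ m) (h2 : m ≤ j) :
    w.height i j = w.height i m + w.height m j := by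
  unfold Weight.height
  rw [← Finset.sum_union]
  · congr 1
    ext k
    simp only [Finset.mem_union, Finset.mem_Ico]
    omega
  · rw [Finset.disjoint_left]
    intro k
    simp only [Finset.mem_Ico]
    omega

theorem Weight.height_one (w : Weight) (i : ℤ) : w.height i (i + 1) = val (w.label i) := by
  unfold Weight.height
  have : Finset.Ico i (i + 1) = {i} := by
    ext k
    simp only [Finset.mem_Ico, Finset.mem_singleton]
    omega
  rw [this, Finset.sum_singleton]

theorem val_cases (x : Option Label) :
    (val x = 1 ∧ x = some Label.down) ∨ (val x = -1 ∧ x = some Label.up) ∨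
      (val x = 0 ∧ x ≠ some Label.down ∧ x ≠ some Label.up) := by
  rcases x with _ | ⟨_ | _ | _ | _⟩ <;> simp [val]

theorem val_down : val (some Label.down) = 1 := rfl

theorem val_up : val (some Label.up) = -1 := rfl

theorem Weight.Matched.labels {w : Weight} {i j : ℤ} (h : w.Matched i j) :
    w.label i = some Label.down ∧ w.label j = some Label.up := by
  obtain ⟨h1, h2, h3⟩ := h
  have hi := h3 (i + 1) (by omega) (by omega)
  rw [w.height_one] at hi
  have hj := h3 j h1 le_rfl
  rw [w.height_split (m := j) (by omega) (by omega), w.height_one] at h2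
  have c1 := val_cases (w.label i)
  have c2 := val_cases (w.label j)
  constructor
  · rcases c1 with c | c | c
    · exact c.2
    · omega
    · omega
  · rcases c2 with c | c | c
    · omega
    · exact c.2
    · omega

theorem Weight.Matched.right_unique {w : Weight} {i j j' : ℤ} (h : w.Matched i j)
    (h' : w.Matched i j') : j = j' := by
  rcases lt_trichotomy j j' with hlt | heq | hlt
  · have := h'.2.2 (j + 1) (by have := h.1; omega) (by omega)
    have := h.2.1
    omega
  · exact heq
  · have := h.2.2 (j' + 1) (by have := h'.1; omega) (by omega)
    have := h'.2.1
    omega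

/-- If the `∨` at `i` is joined to the `∧` at `j`, the suffixes of the enclosed interval that are
proper have negative height. -/
theorem Weight.Matched.suffix_neg {w : Weight} {i j k : ℤ} (h : w.Matched i j) (h1 : i < k)
    (h2 : k ≤ j) : w.height k (j + 1) < 0 := by
  have h3 := h.2.2 k h1 h2
  have h4 := h.2.1
  rw [w.height_split (m := k) (by omega) (by omega)] at h4
  omega

theorem Weight.Matched.left_unique {w : Weight} {i i' j : ℤ} (h : w.Matched i j)
    (h' : w.Matched i' j) : i = i' := by
  rcases lt_trichotomy i i' with hlt | heq | hlt
  · have := h.suffix_neg hlt h'.1.le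
    have := h'.2.1
    omega
  · exact heq
  · have := h'.suffix_neg hlt h.1.le
    have := h.2.1
    omega

/-- Unmatched `∨`. -/
theorem Weight.height_pos_of_unmatched {w : Weight} {i : ℤ} (hi : w.label i = some Label.down)
    (hu : ∀ j, ¬ w.Matched i j) : ∀ k, i < k → 0 < w.height i k := by
  suffices H : ∀ n : ℕ, ∀ k, i < k → k ≤ i + 1 + n → 0 < w.height i k by
    intro k hk
    exact H (k - i).toNat k hk (by omega)
  intro n
  induction n with
  | zero =>
    intro k h1 h2
    have : k = i + 1 := by push_cast at h2; omega
    rw [this, w.height_one, hi, val_down]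
    norm_num
  | succ n ih =>
    intro k h1 h2
    push_cast at h2
    by_cases hk : k ≤ i + 1 + n
    · exact ih k h1 hk
    have hk' : k = (k - 1) + 1 := by omega
    have hp := ih (k - 1) (by omega) (by omega)
    have hsplit := w.height_split (i := i) (m := k - 1) (j := k) (by omega) (by omega)
    have hone := w.height_one (k - 1)
    rw [← hk'] at hone
    by_contra hc
    have hzero : w.height i k = 0 := by
      have := val_cases (w.label (k - 1))
      omega
    apply hu (k - 1)
    refine ⟨by omega, by rw [← hk']; exact hzero, fun m hm1 hm2 => ih m hm1 (by omega)⟩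

/-- Unmatched `∧`. -/
theorem Weight.height_neg_of_unmatched {w : Weight} {j : ℤ} (hj : w.label j = some Label.up)
    (hu : ∀ i, ¬ w.Matched i j) : ∀ k, k ≤ j → w.height k (j + 1) < 0 := by
  suffices H : ∀ n : ℕ, ∀ k, k ≤ j → j - n ≤ k → w.height k (j + 1) < 0 by
    intro k hk
    exact H (j - k).toNat k hk (by omega)
  intro n
  induction n with
  | zero =>
    intro k h1 h2
    have : k = j := by push_cast at h2; omega
    rw [this, w.height_one, hj, val_up]
    norm_num
  | succ n ih =>
    intro k h1 h2
    push_cast at h2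
    by_cases hk : j - n ≤ k
    · exact ih k h1 hk
    have hp := ih (k + 1) (by omega) (by omega)
    have hsplit := w.height_split (i := k) (m := k + 1) (j := j + 1) (by omega) (by omega)
    have hone := w.height_one k
    by_contra hc
    have hzero : w.height k (j + 1) = 0 := by
      have := val_cases (w.label k)
      omega
    apply hu k
    refine ⟨by omega, hzero, fun m hm1 hm2 => ?_⟩
    have h3 := ih m (by omega) (by omega)
    rw [w.height_split (m := m) (by omega) (by omega)] at hzero
    omega

/-- The node at the vertex `i` of the cup diagram of a weight. -/
def Weight.cupNode (w : Weight) (i : ℤ) : Option Node :=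
  match w.label i with
  | none => none
  | some Label.nought => some Node.free
  | some Label.cross => some Node.free
  | some Label.down =>
      if h : ∃ j, w.Matched i j then some (Node.arc h.choose) else some Node.ray
  | some Label.up =>
      if h : ∃ j, w.Matched j i then some (Node.arc h.choose) else some Node.ray

theorem Weight.cupNode_none {w : Weight} {i : ℤ} : w.cupNode i = none ↔ w.label i = none := by
  unfold Weight.cupNode
  split <;> simp_all <;> split <;> simp

theorem Weight.cupNode_free {w : Weight} {i : ℤ} : w.cupNode i = some Node.free ↔
    (w.label i = some Label.nought ∨ w.label i = some Label.cross) := by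
  unfold Weight.cupNode
  split <;> simp_all <;> split <;> simp

theorem Weight.cupNode_arc {w : Weight} {i j : ℤ} : w.cupNode i = some (Node.arc j) ↔
    (w.Matched i j ∨ w.Matched j i) := by
  unfold Weight.cupNode
  constructor
  · intro h
    split at h
    · simp at h
    · simp at h
    · simp at h
    · split at h
      · rename_i hx
        simp only [Option.some.injEq, Node.arc.injEq] at h
        exact Or.inl (h ▸ hx.choose_spec)
      · simp at h
    · split at h
      · rename_i hx
        simp only [Option.some.injEq, Node.arc.injEq] at h
        exact Or.inr (h ▸ hx.choose_spec)
      · simp at h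
  · rintro (h | h)
    · have hx : ∃ j, w.Matched i j := ⟨j, h⟩
      simp only [h.labels.1, hx, dite_true, Option.some.injEq, Node.arc.injEq]
      exact hx.choose_spec.right_unique h
    · have hx : ∃ j, w.Matched j i := ⟨j, h⟩
      simp only [h.labels.2, hx, dite_true, Option.some.injEq, Node.arc.injEq]
      exact hx.choose_spec.left_unique h

theorem Weight.cupNode_ray {w : Weight} {i : ℤ} : w.cupNode i = some Node.ray ↔
    ((w.label i = some Label.down ∧ ∀ j, ¬ w.Matched i j) ∨
      (w.label i = some Label.up ∧ ∀ j, ¬ w.Matched j i)) := by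
  unfold Weight.cupNode
  split <;> simp_all

theorem Weight.Matched.finite (w : Weight) :
    {i | ∃ j, w.Matched i j ∨ w.Matched j i}.Finite := by
  obtain ⟨S, hS, hs⟩ := w.eventually_sorted
  have hsub : {i | ∃ j, w.Matched i j ∨ w.Matched j i} ⊆
      S ∪ ⋃ s ∈ S, {i | w.Matched i s ∨ w.Matched s i} := by
    rintro i ⟨j, hj⟩
    by_cases hi : i ∈ S
    · exact Or.inl hi
    right
    have hjS : j ∈ S := by
      by_contra hjS
      rcases hj with h | h
      · exact hs i j hi hjS h.1 h.labels
      · exact hs j i hjS hi h.1 h.labels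
    simp only [Set.mem_iUnion, Set.mem_ofPred_eq]
    exact ⟨j, hjS, hj⟩
  refine (hS.union (hS.biUnion fun s _ => ?_)).subset hsub
  refine (Set.Subsingleton.finite ?_).union (Set.Subsingleton.finite ?_) (s := {i | w.Matched i s})
    (t := {i | w.Matched s i})
  · intro a ha b hb
    exact Weight.Matched.left_unique ha hb
  · intro a ha b hb
    exact Weight.Matched.right_unique ha hb

/-- The cup diagram associated to a weight; as data it is also the associated cap diagram. -/
def Weight.cup (w : Weight) : ArcDiagram where
  node := w.cupNode
  ordConnected := by
    have : {i | w.cupNode i ≠ none} = {i | w.label i ≠ none} := by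
      ext i
      exact Weight.cupNode_none.not
    rw [this]
    exact w.ordConnected
  arc_symm := by
    intro i j h
    rw [Weight.cupNode_arc] at h ⊢
    refine ⟨?_, h.symm⟩
    rcases h with h | h
    · exact h.1.ne'
    · exact h.1.ne
  finite_arcs := by
    simpa only [Weight.cupNode_arc] using Weight.Matched.finite w
  ray_not_under := by
    intro i j k h h1 h2 hr
    rw [Weight.cupNode_arc] at h
    rw [Weight.cupNode_ray] at hr
    rcases h with h | h
    · rcases hr with hr | hr
      · have a := Weight.height_pos_of_unmatched hr.1 hr.2 (j + 1) (by omega)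
        have b := h.suffix_neg h1 h2.le
        omega
      · have a := Weight.height_neg_of_unmatched hr.1 hr.2 i h1.le
        have b := h.2.2 (k + 1) (by omega) (by omega)
        omega
    · have := h.1
      omega
  noncrossing := by
    intro i j k l h h1 h2 hk
    rw [Weight.cupNode_arc] at h hk
    rcases h with h | h
    · rcases hk with hk | hk
      · refine ⟨h1.trans hk.1, ?_⟩
        by_contra hc
        rcases eq_or_lt_of_le (not_lt.mp hc) with he | hl
        · subst he
          have := h.left_unique hk
          omega
        · have a := hk.2.2 (j + 1) (by omega) (by omega)
          have b := h.suffix_neg h1 h2.le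
          omega
      · refine ⟨?_, hk.1.trans h2⟩
        by_contra hc
        rcases eq_or_lt_of_le (not_lt.mp hc) with he | hl
        · subst he
          have := h.right_unique hk
          omega
        · have a := hk.suffix_neg hl h1.le
          have b := h.2.2 (k + 1) (by omega) (by omega)
          omega
    · have := h.1
      omega

/-- The cup diagram of `w`, glued under `w`, is oriented. -/
theorem Weight.cup_oriented (w : Weight) : Oriented w.cup w where
  line _ := Weight.cupNode_none
  free _ h := Weight.cupNode_free.mp h
  arc i j h := by
    rcases Weight.cupNode_arc.mp h with h | h
    · exact Or.inl h.labels
    · exact Or.inr ⟨h.labels.2, h.labels.1⟩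
  ray i h := by
    rcases Weight.cupNode_ray.mp h with h | h
    · exact Or.inl h.1
    · exact Or.inr h.1
  rays_sorted i j hi hj hij h := by
    rcases Weight.cupNode_ray.mp hi with hi | hi
    · rcases Weight.cupNode_ray.mp hj with hj | hj
      · rw [hj.1] at h
        simp at h
      · have a := Weight.height_pos_of_unmatched hi.1 hi.2 (j + 1) (by omega)
        have b := Weight.height_neg_of_unmatched hj.1 hj.2 i hij.le
        omega
    · rw [hi.1] at h
      simp at h

/-- All cups of the cup diagram of `w` are anti-clockwise. -/
theorem Weight.cup_anticlockwise (w : Weight) (i j : ℤ) (h : w.cup.node i = some (Node.arc j))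
    (hij : i < j) : w.label i = some Label.down ∧ w.label j = some Label.up := by
  rcases Weight.cupNode_arc.mp h with h | h
  · exact h.labels
  · have := h.1
    omega

/-- The relation `α ⊂ lam`. -/
def Weight.Sub (α lam : Weight) : Prop := α.Equivalent lam ∧ Oriented α.cup lam

theorem Weight.Equivalent.label_eq {a b : Weight} (h : a.Equivalent b) {i : ℤ}
    (hi : ¬ a.IsArrow i) : b.label i = a.label i := by
  obtain ⟨σ, -, h2, h3⟩ := h
  rw [h3, h2 i hi]

theorem Weight.cup_arrow_cases (w : Weight) {i : ℤ} (h : w.IsArrow i) :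
    w.cup.node i = some Node.ray ∨ ∃ j, w.cup.node i = some (Node.arc j) := by
  have h1 := (Weight.cupNode_none (w := w) (i := i)).mp
  have h2 := (Weight.cupNode_free (w := w) (i := i)).mp
  change w.cupNode i = _ ∨ ∃ j, w.cupNode i = _
  rcases hc : w.cupNode i with _ | ⟨_ | _ | j⟩
  · simp [Weight.IsArrow, h1 hc] at h
  · rcases h2 hc with h' | h' <;> simp [Weight.IsArrow, h'] at h
  · simp
  · simp

/-- The other end of the cup at `i` (and `i` itself if there is none). -/
def ArcDiagram.partner (c : ArcDiagram) (i : ℤ) : ℤ :=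
  match c.node i with
  | some (Node.arc j) => j
  | _ => i

theorem ArcDiagram.partner_eq {c : ArcDiagram} {i j : ℤ} (h : c.node i = some (Node.arc j)) :
    c.partner i = j := by
  unfold ArcDiagram.partner
  rw [h]

theorem Opposite.val_add {x y : Option Label} (h : Opposite x y) : val x + val y = 0 := by
  rcases h with ⟨rfl, rfl⟩ | ⟨rfl, rfl⟩ <;> simp [val]

/-- If `α ⊂ lam` (both bounded), then the two weights agree at the rays. -/
theorem Weight.Sub.rays_agree {α lam : Weight} (hb : α.Bounded) (h : α.Sub lam) (k : ℤ)
    (hk : α.cup.node k = some Node.ray) : lam.label k = α.label k := by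
  obtain ⟨he, ho⟩ := h
  have hα := α.cup_oriented
  have hmemF : ∀ i, i ∈ hb.toFinset ↔ α.label i ≠ none := fun i => Set.Finite.mem_toFinset hb
  set d : ℤ → ℤ := fun i => val (lam.label i) - val (α.label i) with hd
  have htot : ∑ i ∈ hb.toFinset, d i = 0 := by
    have hne := he.none_iff
    obtain ⟨σ, h1, h2, h3⟩ := he
    rw [hd, Finset.sum_sub_distrib, sub_eq_zero]
    refine Finset.sum_equiv σ ?_ ?_
    · intro i
      rw [hmemF, hmemF]
      rw [← h3]
      exact (hne i).not.symm
    · intro i _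
      rw [h3]
  have hz : ∀ i, ¬ α.IsArrow i → d i = 0 := by
    intro i hi
    have : ¬ lam.IsArrow i := (he.arrow_iff i).not.mpr hi
    simp only [hd, he.label_eq hi, sub_self]
  have harc : ∑ i ∈ hb.toFinset with ∃ j, α.cup.node i = some (Node.arc j), d i = 0 := by
    refine Finset.sum_involution (fun i _ => α.cup.partner i) ?_ ?_ ?_ ?_
    · intro i hi
      obtain ⟨j, hj⟩ := (Finset.mem_filter.mp hi).2
      rw [ArcDiagram.partner_eq hj]
      have a := (ho.arc i j hj).val_add
      have b := (hα.arc i j hj).val_add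
      simp only [hd]
      omega
    · intro i hi _
      obtain ⟨j, hj⟩ := (Finset.mem_filter.mp hi).2
      rw [ArcDiagram.partner_eq hj]
      exact (α.cup.arc_symm i j hj).1
    · intro i hi
      obtain ⟨j, hj⟩ := (Finset.mem_filter.mp hi).2
      have hs := (α.cup.arc_symm i j hj).2
      rw [ArcDiagram.partner_eq hj, Finset.mem_filter]
      refine ⟨?_, i, hs⟩
      rw [hmemF]
      rw [Ne, ← hα.line, hs]
      simp
    · intro i hi
      obtain ⟨j, hj⟩ := (Finset.mem_filter.mp hi).2
      have hs := (α.cup.arc_symm i j hj).2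
      simp only [ArcDiagram.partner_eq hj, ArcDiagram.partner_eq hs]
  have hray : ∑ i ∈ hb.toFinset with ¬ ∃ j, α.cup.node i = some (Node.arc j), d i = 0 := by
    have := Finset.sum_filter_add_sum_filter_not hb.toFinset
      (fun i => ∃ j, α.cup.node i = some (Node.arc j)) d
    omega
  have hkF : k ∈ hb.toFinset.filter (fun i => ¬ ∃ j, α.cup.node i = some (Node.arc j)) := by
    rw [Finset.mem_filter]
    refine ⟨?_, by rintro ⟨j, hj⟩; rw [hk] at hj; simp at hj⟩
    rw [hmemF]
    rw [Ne, ← hα.line, hk]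
    simp
  have harrow : ∀ i ∈ hb.toFinset.filter (fun i => ¬ ∃ j, α.cup.node i = some (Node.arc j)),
      α.IsArrow i → α.cup.node i = some Node.ray := by
    intro i hi ha
    rcases α.cup_arrow_cases ha with h | h
    · exact h
    · exact absurd h (Finset.mem_filter.mp hi).2
  by_contra hne
  have a1 := hα.ray k hk
  have a2 := ho.ray k hk
  have key : (∀ i ∈ hb.toFinset.filter (fun i => ¬ ∃ j, α.cup.node i = some (Node.arc j)),
        0 ≤ d i) ∧ 0 < d k ∨
      (∀ i ∈ hb.toFinset.filter (fun i => ¬ ∃ j, α.cup.node i = some (Node.arc j)),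
        0 ≤ - d i) ∧ 0 < - d k := by
    rcases a1 with a1 | a1 <;> rcases a2 with a2 | a2
    · exact absurd (a2.trans a1.symm) hne
    · right
      refine ⟨?_, by simp [hd, a1, a2, val]⟩
      intro i hi
      by_cases ha : α.IsArrow i
      · have hr := harrow i hi ha
        have b1 := hα.ray i hr
        have b2 := ho.ray i hr
        rcases b1 with b1 | b1 <;> rcases b2 with b2 | b2 <;> simp [hd, b1, b2, val]
        rcases lt_trichotomy i k with hik | hik | hik
        · exact ho.rays_sorted i k hr hk hik ⟨b2, a2⟩
        · subst hik
          rw [a1] at b1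
          simp at b1
        · exact hα.rays_sorted k i hk hr hik ⟨a1, b1⟩
      · rw [hz i ha]
        simp
    · left
      refine ⟨?_, by simp [hd, a1, a2, val]⟩
      intro i hi
      by_cases ha : α.IsArrow i
      · have hr := harrow i hi ha
        have b1 := hα.ray i hr
        have b2 := ho.ray i hr
        rcases b1 with b1 | b1 <;> rcases b2 with b2 | b2 <;> simp [hd, b1, b2, val]
        rcases lt_trichotomy i k with hik | hik | hik
        · exact hα.rays_sorted i k hr hk hik ⟨b1, a1⟩
        · subst hik
          rw [a1] at b1
          simp at b1
        · exact ho.rays_sorted k i hk hr hik ⟨a2, b2⟩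
      · rw [hz i ha]
    · exact absurd (a2.trans a1.symm) hne
  rcases key with ⟨k1, k2⟩ | ⟨k1, k2⟩
  · have := Finset.single_le_sum k1 hkF
    omega
  · have := Finset.single_le_sum k1 hkF
    rw [Finset.sum_neg_distrib] at this
    omega

theorem Weight.height_congr {a b : Weight} {i j : ℤ}
    (h : ∀ k, i ≤ k → k < j → a.label k = b.label k) : a.height i j = b.height i j := by
  unfold Weight.height
  refine Finset.sum_congr rfl fun k hk => ?_
  rw [Finset.mem_Ico] at hk
  rw [h k hk.1 hk.2]

theorem Weight.matched_congr {a b : Weight} {i j : ℤ}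
    (h : ∀ k, i ≤ k → k ≤ j → a.label k = b.label k) : a.Matched i j ↔ b.Matched i j := by
  unfold Weight.Matched
  refine and_congr_right fun hij => ?_
  rw [Weight.height_congr (a := a) (b := b) (fun k h1 h2 => h k h1 (by omega))]
  refine and_congr_right fun _ => ?_
  refine forall_congr' fun k => forall_congr' fun h1 => forall_congr' fun h2 => ?_
  rw [Weight.height_congr (a := a) (b := b) (fun m m1 m2 => h m m1 (by omega))]

/-- If `α ⊂ lam` are bounded and both are extended by the same labels at the same new vertices,
the relation `⊂` is preserved. -/
theorem Weight.Sub.extend {α lam α' lam' : Weight} (hb : α.Bounded) (h : α.Sub lam)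
    (hα : ∀ i, α.label i ≠ none → α'.label i = α.label i)
    (hl : ∀ i, α.label i ≠ none → lam'.label i = lam.label i)
    (hout : ∀ i, α.label i = none → lam'.label i = α'.label i)
    (he : α'.Equivalent lam') : α'.Sub lam' := by
  have hm : ∀ i j, α.label i ≠ none → α.label j ≠ none → (α'.Matched i j ↔ α.Matched i j) := by
    intro i j hi hj
    apply Weight.matched_congr
    intro k h1 h2
    exact hα k (α.ordConnected.out hi hj ⟨h1, h2⟩)
  have hm' : ∀ i j, α.Matched i j → α'.Matched i j := by
    intro i j hij
    refine (hm i j ?_ ?_).mpr hij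
    · rw [hij.labels.1]
      simp
    · rw [hij.labels.2]
      simp
  have hs : ∀ i j, (α'.Matched i j ∨ α'.Matched j i) → ¬ (α.Matched i j ∨ α.Matched j i) →
      lam'.label i = α'.label i := by
    intro i j hij hn
    by_cases hi : α.label i = none
    · exact hout i hi
    rw [hl i hi, hα i hi]
    have ha : α.IsArrow i := by
      unfold Weight.IsArrow
      rw [← hα i hi]
      rcases hij with hij | hij
      · exact Or.inl hij.labels.1
      · exact Or.inr hij.labels.2
    rcases α.cup_arrow_cases ha with hr | ⟨m, hr⟩
    · exact h.rays_agree hb i hr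
    · exfalso
      rcases Weight.cupNode_arc.mp hr with hr | hr
      · have h1 := hm' _ _ hr
        rcases hij with hij | hij
        · rw [h1.right_unique hij] at hr
          exact hn (Or.inl hr)
        · have h2 := hij.labels.2
          rw [h1.labels.1] at h2
          simp at h2
      · have h1 := hm' _ _ hr
        rcases hij with hij | hij
        · have h2 := hij.labels.1
          rw [h1.labels.2] at h2
          simp at h2
        · rw [h1.left_unique hij] at hr
          exact hn (Or.inr hr)
  have hray : ∀ i, α'.cup.node i = some Node.ray → lam'.label i = α'.label i := by
    intro i hr
    by_cases hi : α.label i = none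
    · exact hout i hi
    rw [hl i hi, hα i hi]
    refine h.rays_agree hb i (Weight.cupNode_ray.mpr ?_)
    rw [← hα i hi]
    rcases Weight.cupNode_ray.mp hr with ⟨a, b⟩ | ⟨a, b⟩
    · exact Or.inl ⟨a, fun j hj => b j (hm' _ _ hj)⟩
    · exact Or.inr ⟨a, fun j hj => b j (hm' _ _ hj)⟩
  have hc := α'.cup_oriented
  refine ⟨he, ?_, ?_, ?_, ?_, ?_⟩
  · intro i
    rw [hc.line, he.none_iff]
  · intro i hi
    have hf := hc.free i hi
    rw [he.label_eq]
    · exact hf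
    · unfold Weight.IsArrow
      rcases hf with hf | hf <;> simp [hf]
  · intro i j hij
    have h1 := Weight.cupNode_arc.mp hij
    by_cases hn : α.Matched i j ∨ α.Matched j i
    · have hi : α.label i ≠ none := by
        rcases hn with hn | hn
        · rw [hn.labels.1]
          simp
        · rw [hn.labels.2]
          simp
      have hj : α.label j ≠ none := by
        rcases hn with hn | hn
        · rw [hn.labels.2]
          simp
        · rw [hn.labels.1]
          simp
      rw [hl i hi, hl j hj]
      exact h.2.arc i j (Weight.cupNode_arc.mpr hn)
    · rw [hs i j h1 hn, hs j i h1.symm (fun h => hn h.symm)]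
      exact hc.arc i j hij
  · intro i hi
    rw [he.arrow_iff]
    exact hc.ray i hi
  · intro i j hi hj hij
    rw [hray i hi, hray j hj]
    exact hc.rays_sorted i j hi hj hij

/-! ## The vector spaces `K` and `H` -/

/-- The basis vectors of `K_Λ`: the oriented circle diagrams `a wt b`, where `a` is the cup diagram of
`left`, `b` is the cap diagram of `right`, and `left ⊂ wt ⊃ right` all lie in `Λ`. -/
@[ext] structure Basis (Λ : Block) where
  left : Weight
  wt : Weight
  right : Weight
  left_mem : left ∈ Λ
  wt_mem : wt ∈ Λ
  right_mem : right ∈ Λ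
  left_sub : left.Sub wt
  right_sub : right.Sub wt

/-- The vector space underlying `K_Λ`. -/
abbrev K (F : Type*) [Field F] (Λ : Block) := Basis Λ →₀ F

/-- The basis vectors of Khovanov's algebra `H_Δ`: the closed oriented circle diagrams (`Δ` will be a
Khovanov block). -/
@[ext] structure ClosedBasis (Δ : Block) extends Basis Δ where
  left_closed : left.cup.Closed
  right_closed : right.cup.Closed

/-- The vector space underlying `H_Δ`. -/
abbrev H (F : Type*) [Field F] (Δ : Block) := ClosedBasis Δ →₀ F

/-! ## Diagrams with a symmetric middle section -/

/-- The unoriented diagrams occurring in the surgery procedure: there are two number lines; the cup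
diagram `bot` is attached below the bottom number line and the cap diagram `top` above the top
number line.  An arc joining `i`, `j` in `mid` stands for the symmetric cap-cup pair in the middle
section (a cap on the bottom number line and a cup on the top number line), and a ray of `mid` at `i`
stands for a vertical line segment joining the two vertices `i`. -/
structure Skeleton where
  bot : ArcDiagram
  mid : ArcDiagram
  top : ArcDiagram

/-- The vertices of a diagram with two number lines. -/
inductive Vertex
  | bot (i : ℤ)
  | top (i : ℤ)

/-- The horizontal coordinate of a vertex. -/
def Vertex.pos : Vertex → ℤ
  | Vertex.bot i => i
  | Vertex.top i => i

namespace Skeleton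

/-- Two vertices are joined by a cup, a cap or a vertical line segment. -/
inductive Adj (s : Skeleton) : Vertex → Vertex → Prop
  | bot_cup (i j : ℤ) : s.bot.node i = some (Node.arc j) → Adj s (Vertex.bot i) (Vertex.bot j)
  | mid_cap (i j : ℤ) : s.mid.node i = some (Node.arc j) → Adj s (Vertex.bot i) (Vertex.bot j)
  | mid_cup (i j : ℤ) : s.mid.node i = some (Node.arc j) → Adj s (Vertex.top i) (Vertex.top j)
  | top_cap (i j : ℤ) : s.top.node i = some (Node.arc j) → Adj s (Vertex.top i) (Vertex.top j)
  | up (i : ℤ) : s.mid.node i = some Node.ray → Adj s (Vertex.bot i) (Vertex.top i)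
  | down (i : ℤ) : s.mid.node i = some Node.ray → Adj s (Vertex.top i) (Vertex.bot i)

/-- Two vertices lie on the same circle or line. -/
def Conn (s : Skeleton) : Vertex → Vertex → Prop := Relation.ReflTransGen s.Adj

/-- A ray to infinity starts at the vertex. -/
def IsRayEnd (s : Skeleton) : Vertex → Prop
  | Vertex.bot i => s.bot.node i = some Node.ray
  | Vertex.top i => s.top.node i = some Node.ray

end Skeleton

/-- A diagram with a symmetric middle section together with labels on its two number lines. -/
structure Stack extends Skeleton where
  wBot : Weight
  wTop : Weight

/-- The types of the components: anti-clockwise circle, clockwise circle, line. -/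
inductive CompType
  | one
  | x
  | y

namespace Stack

/-- The label at a vertex. -/
def label (s : Stack) : Vertex → Option Label
  | Vertex.bot i => s.wBot.label i
  | Vertex.top i => s.wTop.label i

/-- The diagram is consistently oriented. -/
structure Consistent (s : Stack) : Prop where
  bot : Oriented s.bot s.wBot
  top : Oriented s.top s.wTop
  mid_line : ∀ i, (s.mid.node i = none ↔ s.wBot.label i = none) ∧
    (s.mid.node i = none ↔ s.wTop.label i = none)
  mid_free : ∀ i, s.mid.node i = some Node.free → s.wBot.label i = s.wTop.label i ∧
    (s.wBot.label i = some Label.nought ∨ s.wBot.label i = some Label.cross)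
  mid_arc : ∀ i j, s.mid.node i = some (Node.arc j) →
    Opposite (s.wBot.label i) (s.wBot.label j) ∧ Opposite (s.wTop.label i) (s.wTop.label j)
  mid_ray : ∀ i, s.mid.node i = some Node.ray → s.wBot.label i = s.wTop.label i ∧
    s.wBot.IsArrow i

/-- The vertex `v` lies on a line. -/
def OnLine (s : Stack) (v : Vertex) : Prop := ∃ u, s.Conn v u ∧ s.IsRayEnd u

/-- `u` is a leftmost vertex of the component of `v`. -/
def Leftmost (s : Stack) (v u : Vertex) : Prop :=
  s.Conn v u ∧ ∀ u', s.Conn v u' → u.pos ≤ u'.pos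

/-- The type of the component containing the vertex `v`: a circle is anti-clockwise (type `1`) or
clockwise (type `x`) according to whether its leftmost vertex is labelled `∨` or `∧`. -/
inductive HasType (s : Stack) (v : Vertex) : CompType → Prop
  | one (u : Vertex) : ¬ s.OnLine v → s.Leftmost v u → s.label u = some Label.down →
      HasType s v CompType.one
  | x (u : Vertex) : ¬ s.OnLine v → s.Leftmost v u → s.label u = some Label.up →
      HasType s v CompType.x
  | y : s.OnLine v → HasType s v CompType.y

/-- All rays of the component of `v` are labelled `l`. -/
def RaysLabelled (s : Stack) (v : Vertex) (l : Label) : Prop :=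
  ∀ u, s.Conn v u → s.IsRayEnd u → s.label u = some l

end Stack

/-! ## The (generalised) surgery procedure -/

/-- Two components are merged into one: `1 ⊗ 1 ↦ 1`, `1 ⊗ x ↦ x`, `x ⊗ 1 ↦ x`, `1 ⊗ y ↦ y`
(in either order).  The cases `x ⊗ x ↦ 0` and `x ⊗ y ↦ 0` produce nothing. -/
inductive MergeRule : CompType → CompType → CompType → Prop
  | one_one : MergeRule CompType.one CompType.one CompType.one
  | one_x : MergeRule CompType.one CompType.x CompType.x
  | x_one : MergeRule CompType.x CompType.one CompType.x
  | one_y : MergeRule CompType.one CompType.y CompType.y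
  | y_one : MergeRule CompType.y CompType.one CompType.y

/-- One component is split into two: `1 ↦ 1 ⊗ x + x ⊗ 1`, `x ↦ x ⊗ x`, `y ↦ x ⊗ y` (the circle may be
on either side). -/
inductive SplitRule : CompType → CompType → CompType → Prop
  | one_left : SplitRule CompType.one CompType.one CompType.x
  | one_right : SplitRule CompType.one CompType.x CompType.one
  | x : SplitRule CompType.x CompType.x CompType.x
  | y_left : SplitRule CompType.y CompType.x CompType.y
  | y_right : SplitRule CompType.y CompType.y CompType.x

/-- The re-orientation rules, where `s` is the diagram before, and `t` the diagram after cutting the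
cap at the vertices `i`, `j` on the bottom number line and the cup at the vertices `i`, `j` on the top
number line. -/
inductive Rule (s : Stack) (i j : ℤ) (t : Stack) : Prop
  | merge (A B C : CompType) : ¬ s.Conn (Vertex.bot i) (Vertex.top i) →
      s.HasType (Vertex.bot i) A → s.HasType (Vertex.top i) B → MergeRule A B C →
      t.HasType (Vertex.bot i) C → Rule s i j t
  | split (A B C : CompType) : s.Conn (Vertex.bot i) (Vertex.top i) →
      s.HasType (Vertex.bot i) A → SplitRule A B C →
      t.HasType (Vertex.bot i) B → t.HasType (Vertex.bot j) C → Rule s i j t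
  | lines : ¬ s.Conn (Vertex.bot i) (Vertex.top i) →
      s.HasType (Vertex.bot i) CompType.y → s.HasType (Vertex.top i) CompType.y →
      ((s.RaysLabelled (Vertex.bot i) Label.up ∧ s.RaysLabelled (Vertex.top i) Label.down) ∨
        (s.RaysLabelled (Vertex.bot i) Label.down ∧ s.RaysLabelled (Vertex.top i) Label.up)) →
      t.HasType (Vertex.bot i) CompType.y → t.HasType (Vertex.bot j) CompType.y → Rule s i j t

/-- `t` is one of the diagrams produced from `s` by the surgery at the cap-cup pair at `i`, `j`: the
pair gets replaced by two vertical line segments, and the result is re-oriented according to the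
rules.  Only vertices on the new components may change, and the orientations at the ends of rays never
change. -/
structure Outcome (s : Stack) (i j : ℤ) (t : Stack) : Prop where
  bot : t.bot = s.bot
  top : t.top = s.top
  mid : t.mid.node =
    Function.update (Function.update s.mid.node i (some Node.ray)) j (some Node.ray)
  consistent : t.Consistent
  unchanged : ∀ v, ¬ t.Conn (Vertex.bot i) v → ¬ t.Conn (Vertex.bot j) v → t.label v = s.label v
  rays_unchanged : ∀ v, t.IsRayEnd v → t.label v = s.label v
  rule : Rule s i j t

theorem Opposite.unique {a b c : Option Label} (h : Opposite a b) (h' : Opposite a c) : b = c := by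
  rcases h with h | h <;> rcases h' with h' | h' <;> simp_all

theorem Stack.Consistent.propagate {t t' : Stack} (h : t.Consistent) (h' : t'.Consistent)
    (hs : t.toSkeleton = t'.toSkeleton) {u v : Vertex} (hc : t.Conn u v)
    (hu : t.label u = t'.label u) : t.label v = t'.label v := by
  induction hc with
  | refl => exact hu
  | tail _ hadj ih =>
    have hb : t'.bot = t.bot := by rw [hs]
    have hm : t'.mid = t.mid := by rw [hs]
    have ht : t'.top = t.top := by rw [hs]
    cases hadj with
    | bot_cup i j e =>
      have a := h.bot.arc i j e
      have b := h'.bot.arc i j (by rw [hb]; exact e)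
      simp only [Stack.label] at ih ⊢
      rw [← ih] at b
      exact a.unique b
    | mid_cap i j e =>
      have a := (h.mid_arc i j e).1
      have b := (h'.mid_arc i j (by rw [hm]; exact e)).1
      simp only [Stack.label] at ih ⊢
      rw [← ih] at b
      exact a.unique b
    | mid_cup i j e =>
      have a := (h.mid_arc i j e).2
      have b := (h'.mid_arc i j (by rw [hm]; exact e)).2
      simp only [Stack.label] at ih ⊢
      rw [← ih] at b
      exact a.unique b
    | top_cap i j e =>
      have a := h.top.arc i j e
      have b := h'.top.arc i j (by rw [ht]; exact e)
      simp only [Stack.label] at ih ⊢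
      rw [← ih] at b
      exact a.unique b
    | up i e =>
      have a := (h.mid_ray i e).1
      have b := (h'.mid_ray i (by rw [hm]; exact e)).1
      simp only [Stack.label] at ih ⊢
      rw [← a, ← b, ih]
    | down i e =>
      have a := (h.mid_ray i e).1
      have b := (h'.mid_ray i (by rw [hm]; exact e)).1
      simp only [Stack.label] at ih ⊢
      rw [a, b, ih]

instance : Finite Label := by
  refine Finite.of_injective
    (fun l : Label => (match l with
      | Label.nought => 0
      | Label.cross => 1
      | Label.down => 2
      | Label.up => 3 : Fin 4)) ?_
  intro a b h
  cases a <;> cases b <;> simp_all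

theorem outcome_finite (s : Stack) (i j : ℤ) : {t | Outcome s i j t}.Finite := by
  refine Set.Finite.of_finite_image (f := fun t : Stack =>
    (t.label (Vertex.bot i), t.label (Vertex.bot j))) (Set.toFinite _) ?_
  intro t ht t' ht' heq
  have ht : Outcome s i j t := ht
  have ht' : Outcome s i j t' := ht'
  have e1 : t.label (Vertex.bot i) = t'.label (Vertex.bot i) := congrArg Prod.fst heq
  have e2 : t.label (Vertex.bot j) = t'.label (Vertex.bot j) := congrArg Prod.snd heq
  have hm : t.mid = t'.mid := ArcDiagram.ext (ht.mid.trans ht'.mid.symm)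
  have hb : t.bot = t'.bot := ht.bot.trans ht'.bot.symm
  have htop : t.top = t'.top := ht.top.trans ht'.top.symm
  have hs : t.toSkeleton = t'.toSkeleton := by
    rcases t with ⟨⟨_, _, _⟩, _, _⟩
    rcases t' with ⟨⟨_, _, _⟩, _, _⟩
    simp only at hm hb htop
    subst hm hb htop
    rfl
  have hl : ∀ v, t.label v = t'.label v := by
    intro v
    by_cases hi : t.Conn (Vertex.bot i) v
    · exact ht.consistent.propagate ht'.consistent hs hi e1
    by_cases hj : t.Conn (Vertex.bot j) v
    · exact ht.consistent.propagate ht'.consistent hs hj e2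
    rw [ht.unchanged v hi hj, ht'.unchanged v (by rw [← hs]; exact hi) (by rw [← hs]; exact hj)]
  have hwb : t.wBot = t'.wBot := Weight.ext (funext fun k => hl (Vertex.bot k))
  have hwt : t.wTop = t'.wTop := Weight.ext (funext fun k => hl (Vertex.top k))
  rcases t with ⟨_, _, _⟩
  rcases t' with ⟨_, _, _⟩
  simp only at hs hwb hwt
  subst hs hwb hwt
  rfl

/-- The disjoint union of the diagrams produced from `s` by the surgery at `i`, `j`. -/
def outcomes (s : Stack) (i j : ℤ) : Multiset Stack := (outcome_finite s i j).toFinset.val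

/-- There is a cap-cup pair at `i < j` in the middle section which can be connected without crossings:
no other such pair encloses it. -/
def Surgerable (s : Stack) (i j : ℤ) : Prop :=
  i < j ∧ s.mid.node i = some (Node.arc j) ∧
    ∀ k l, s.mid.node k = some (Node.arc l) → ¬ (k < i ∧ j < l)

/-- One iteration: in a disjoint union of diagrams, one diagram is replaced by the outcomes of one
surgery on it. -/
inductive SurgeryStep : Multiset Stack → Multiset Stack → Prop
  | mk (s : Stack) (R : Multiset Stack) (i j : ℤ) : Surgerable s i j →
      SurgeryStep (s ::ₘ R) (outcomes s i j + R)

/-- Any number of iterations, in any order. -/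
def Surgeries : Multiset Stack → Multiset Stack → Prop := Relation.ReflTransGen SurgeryStep

/-- No diagram has any cap-cup pair left in its middle section. -/
def Finished (R : Multiset Stack) : Prop :=
  ∀ s ∈ R, ∀ i j, s.mid.node i ≠ some (Node.arc j)

/-- The diagram obtained by drawing `x` underneath `y` and stitching corresponding rays in the middle
(meaningful when the cap diagram of `x` is the mirror image of the cup diagram of `y`). -/
def stitch {Λ : Block} (x y : Basis Λ) : Stack where
  bot := x.left.cup
  mid := x.right.cup
  top := y.right.cup
  wBot := x.wt
  wTop := y.wt

/-- Identifying the top and bottom number lines of `t` (whose middle section consists of vertical line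
segments only) gives the oriented circle diagram `z`. -/
structure IdentifiesTo {Λ : Block} (t : Stack) (z : Basis Λ) : Prop where
  mid : ∀ i j, t.mid.node i ≠ some (Node.arc j)
  bot : t.bot = z.left.cup
  top : t.top = z.right.cup
  wBot : t.wBot = z.wt
  wTop : t.wTop = z.wt

/-! ## Khovanov's algebra -/

section Multiplication

variable (F : Type*) [Field F]

theorem ArcDiagram.finite_leftEnds (c : ArcDiagram) : {i | i < c.partner i}.Finite := by
  refine c.finite_arcs.subset ?_
  intro i hi
  have hi : i < c.partner i := hi
  unfold ArcDiagram.partner at hi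
  split at hi
  · rename_i j hj
    exact ⟨j, hj⟩
  · omega

/-- The left ends of the arcs, from left to right. -/
def ArcDiagram.leftEnds (c : ArcDiagram) : List ℤ := c.finite_leftEnds.toFinset.sort (· ≤ ·)

/-- The disjoint union of diagrams obtained from `s` by performing the surgery at all cap-cup pairs,
in the order of their left ends (so that enclosing pairs come first). -/
def allSurgeries (s : Stack) : Multiset Stack :=
  s.mid.leftEnds.foldl (fun R i => R.bind fun t => outcomes t i (s.mid.partner i)) {s}

/-- The basis vector obtained by identifying the number lines of `t` (such a basis vector exists and is
unique for the diagrams `t` that occur). -/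
def H.collapse {Δ : Block} (t : Stack) : H F Δ :=
  if h : ∃ z : ClosedBasis Δ, IdentifiesTo t z.toBasis then Finsupp.single h.choose 1 else 0

/-- The product of two basis vectors `a lam b` and `c μ d` of `H_Δ`: zero unless `b` is the mirror image
of `c`, in which case it is computed by the surgery procedure.  There are no lines in these
diagrams, so only the rules for circles matter. -/
def H.mulBasis {Δ : Block} (X Y : ClosedBasis Δ) : H F Δ :=
  if X.right.cup = Y.left.cup then
    ((allSurgeries (stitch X.toBasis Y.toBasis)).map (H.collapse F)).sum
  else 0

/-- The multiplication of Khovanov's algebra `H_Δ`. -/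
def H.mul (Δ : Block) : H F Δ →ₗ[F] H F Δ →ₗ[F] H F Δ :=
  Finsupp.linearCombination F fun X => Finsupp.linearCombination F fun Y => H.mulBasis F X Y

end Multiplication

/-! ## Closures -/

namespace Weight

/-- The leftmost vertex (of a bounded weight with at least one vertex). -/
def lo (w : Weight) : ℤ := sInf {i | w.label i ≠ none}

/-- The rightmost vertex (of a bounded weight with at least one vertex). -/
def hi (w : Weight) : ℤ := sSup {i | w.label i ≠ none}

/-- The number of `∧`'s. -/
def numUp (w : Weight) : ℕ := {i | w.label i = some Label.up}.ncard

/-- The number of `∨`'s. -/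
def numDown (w : Weight) : ℕ := {i | w.label i = some Label.down}.ncard

/-- The labels of the closure: with `p` the number of `∧`'s and `q` the number of `∨`'s, one adds `p`
new vertices labelled `∨` at the left end and `q` new vertices labelled `∧` at the right end. -/
def clLabel (w : Weight) (i : ℤ) : Option Label :=
  if w.label i ≠ none then w.label i
  else if w.lo - w.numUp ≤ i ∧ i < w.lo then some Label.down
  else if w.hi < i ∧ i ≤ w.hi + w.numDown then some Label.up
  else none

theorem Bounded.mem_iff {w : Weight} (h : w.Bounded) (hne : ∃ i, w.label i ≠ none) (i : ℤ) :
    w.label i ≠ none ↔ w.lo ≤ i ∧ i ≤ w.hi := by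
  have hlo : w.label w.lo ≠ none := Int.csInf_mem (s := {i | w.label i ≠ none}) hne h.bddBelow
  have hhi : w.label w.hi ≠ none := Int.csSup_mem (s := {i | w.label i ≠ none}) hne h.bddAbove
  constructor
  · intro hi
    exact ⟨csInf_le (s := {i | w.label i ≠ none}) h.bddBelow hi,
      le_csSup (s := {i | w.label i ≠ none}) h.bddAbove hi⟩
  · intro hi
    exact w.ordConnected.out hlo hhi hi

theorem numUp_empty {w : Weight} (h : ∀ i, w.label i = none) : w.numUp = 0 := by
  unfold numUp
  convert Set.ncard_empty ℤ
  simp [h]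

theorem numDown_empty {w : Weight} (h : ∀ i, w.label i = none) : w.numDown = 0 := by
  unfold numDown
  convert Set.ncard_empty ℤ
  simp [h]

theorem clLabel_empty {w : Weight} (h : ∀ i, w.label i = none) (i : ℤ) : w.clLabel i = none := by
  unfold clLabel
  rw [numUp_empty h, numDown_empty h]
  rw [if_neg (by simp [h i]), if_neg (by omega), if_neg (by omega)]

theorem clLabel_ne {w : Weight} (h : w.Bounded) (hne : ∃ i, w.label i ≠ none) (i : ℤ) :
    w.clLabel i ≠ none ↔ w.lo - w.numUp ≤ i ∧ i ≤ w.hi + w.numDown := by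
  have hm := h.mem_iff hne
  obtain ⟨k, hk⟩ := hne
  have hlohi := (hm k).mp hk
  unfold clLabel
  by_cases h1 : w.label i ≠ none
  · rw [if_pos h1]
    have := (hm i).mp h1
    simp only [h1, ne_eq, not_false_eq_true, true_iff]
    omega
  · rw [if_neg h1]
    have := (hm i).not.mp h1
    split_ifs with h2 h3
    · simp
      omega
    · simp
      omega
    · simp only [ne_eq, not_true_eq_false, false_iff]
      omega

/-- The closure of a bounded weight. -/
def cl (w : Weight) (h : w.Bounded) : Weight where
  label := w.clLabel
  ordConnected := by
    by_cases hne : ∃ i, w.label i ≠ none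
    · have : {i | w.clLabel i ≠ none} = Set.Icc (w.lo - w.numUp) (w.hi + w.numDown) := by
        ext i
        exact clLabel_ne h hne i
      rw [this]
      exact Set.ordConnected_Icc
    · push Not at hne
      have : {i | w.clLabel i ≠ none} = ∅ := by
        ext i
        simp [clLabel_empty hne i]
      rw [this]
      exact Set.ordConnected_empty
  eventually_sorted := by
    by_cases hne : ∃ i, w.label i ≠ none
    · refine ⟨Set.Icc (w.lo - w.numUp) (w.hi + w.numDown), Set.finite_Icc _ _, ?_⟩
      intro i j hi _ _ hc
      exact hi ((clLabel_ne h hne i).mp (by rw [hc.1]; simp))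
    · push Not at hne
      refine ⟨∅, Set.finite_empty, ?_⟩
      intro i j _ _ _ hc
      rw [clLabel_empty hne] at hc
      simp at hc

theorem cl_label_of_ne {w : Weight} (h : w.Bounded) {i : ℤ} (hi : w.label i ≠ none) :
    (w.cl h).label i = w.label i := if_pos hi

theorem cl_bounded {w : Weight} (h : w.Bounded) : (w.cl h).Bounded := by
  unfold Bounded
  by_cases hne : ∃ i, w.label i ≠ none
  · refine (Set.finite_Icc (w.lo - w.numUp) (w.hi + w.numDown)).subset ?_
    intro i hi
    exact (clLabel_ne h hne i).mp hi
  · push Not at hne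
    refine Set.finite_empty.subset ?_
    intro i hi
    exact hi (clLabel_empty hne i)

theorem Equivalent.same_line {a b : Weight} (h : a.Equivalent b) :
    a.lo = b.lo ∧ a.hi = b.hi := by
  have : {i | b.label i ≠ none} = {i | a.label i ≠ none} := by
    ext i
    exact (h.none_iff i).not
  unfold lo hi
  rw [this]
  exact ⟨rfl, rfl⟩

theorem Equivalent.same_num {a b : Weight} (h : a.Equivalent b) :
    a.numUp = b.numUp ∧ a.numDown = b.numDown := by
  obtain ⟨σ, -, -, h3⟩ := h
  have key : ∀ l : Label, {i | a.label i = some l}.ncard = {i | b.label i = some l}.ncard := by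
    intro l
    have : {i | a.label i = some l} = σ '' {i | b.label i = some l} := by
      ext i
      rw [Set.mem_image]
      constructor
      · intro hi
        refine ⟨σ.symm i, ?_, by simp⟩
        change b.label _ = _
        rw [h3]
        simpa using hi
      · rintro ⟨k, hk, rfl⟩
        change a.label _ = _
        rw [← h3]
        exact hk
    rw [this, Set.ncard_image_of_injective _ σ.injective]
  exact ⟨key _, key _⟩

theorem Equivalent.cl_out {a b : Weight} (h : a.Equivalent b) (ha : a.Bounded) (hb : b.Bounded)
    {i : ℤ} (hi : a.label i = none) : (b.cl hb).label i = (a.cl ha).label i := by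
  have hi' : b.label i = none := (h.none_iff i).mpr hi
  change b.clLabel i = a.clLabel i
  unfold clLabel
  rw [h.same_line.1, h.same_line.2, h.same_num.1, h.same_num.2]
  simp [hi, hi']

theorem Equivalent.cl {a b : Weight} (h : a.Equivalent b) (ha : a.Bounded) (hb : b.Bounded) :
    (a.cl ha).Equivalent (b.cl hb) := by
  have hn := h.none_iff
  have ho := fun i => h.cl_out ha hb (i := i)
  obtain ⟨σ, h1, h2, h3⟩ := h
  have hfix : ∀ i, a.label i = none → σ i = i := by
    intro i hi
    exact h2 i (by simp [IsArrow, hi])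
  refine ⟨σ, h1, ?_, ?_⟩
  · intro i hi
    by_cases hc : a.label i = none
    · exact hfix i hc
    · apply h2
      unfold IsArrow at hi ⊢
      rwa [cl_label_of_ne ha hc] at hi
  · intro i
    by_cases hc : a.label i = none
    · rw [hfix i hc, ho i hc]
    · have hb' : b.label i ≠ none := (hn i).not.mpr hc
      rw [cl_label_of_ne hb hb', h3]
      rw [cl_label_of_ne ha]
      rw [← h3]
      exact hb'

theorem Sub.cl {α lam : Weight} (h : α.Sub lam) (ha : α.Bounded) (hl : lam.Bounded) :
    (α.cl ha).Sub (lam.cl hl) :=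
  h.extend ha (fun _ hi => cl_label_of_ne ha hi)
    (fun i hi => cl_label_of_ne hl ((h.1.none_iff i).not.mpr hi))
    (fun _ hi => h.1.cl_out ha hl hi) (h.1.cl ha hl)

theorem height_eq_card (w : Weight) (i j : ℤ) : w.height i j =
    ((Finset.Ico i j).filter (fun k => w.label k = some Label.down)).card -
      ((Finset.Ico i j).filter (fun k => w.label k = some Label.up)).card := by
  unfold height
  rw [Finset.card_filter, Finset.card_filter]
  push_cast
  rw [← Finset.sum_sub_distrib]
  refine Finset.sum_congr rfl fun k _ => ?_
  rcases val_cases (w.label k) with h | h | h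
  · rw [h.1]
    simp [h.2]
  · rw [h.1]
    simp [h.2]
  · rw [h.1]
    simp [h.2.1, h.2.2]

theorem Bounded.card_le {w : Weight} (h : w.Bounded) (l : Label) (i j : ℤ) :
    ((Finset.Ico i j).filter (fun k => w.label k = some l)).card ≤
      {k | w.label k = some l}.ncard := by
  rw [← Set.ncard_coe_finset]
  refine Set.ncard_le_ncard ?_ (h.subset ?_)
  · intro k hk
    simp only [Finset.coe_filter] at hk
    exact hk.2
  · intro k hk
    have hk : w.label k = some l := hk
    change w.label k ≠ none
    rw [hk]
    simp

theorem Bounded.card_eq {w : Weight} (h : w.Bounded) (hne : ∃ i, w.label i ≠ none) (l : Label) :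
    ((Finset.Ico w.lo (w.hi + 1)).filter (fun k => w.label k = some l)).card =
      {k | w.label k = some l}.ncard := by
  rw [← Set.ncard_coe_finset]
  congr 1
  ext k
  simp only [Finset.coe_filter, Finset.mem_Ico]
  change (_ ∧ w.label k = some l) ↔ w.label k = some l
  refine ⟨fun hk => hk.2, fun hk => ⟨?_, hk⟩⟩
  have := (h.mem_iff hne k).mp (by rw [hk]; simp)
  omega

/-- The cup diagram of a closure is closed. -/
theorem cl_closed {w : Weight} (h : w.Bounded) : (w.cl h).cup.Closed := by
  intro i hr
  by_cases hne : ∃ i, w.label i ≠ none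
  swap
  · push Not at hne
    have h1 : (w.cl h).label i = none := clLabel_empty hne i
    rcases cupNode_ray.mp hr with hr | hr
    · rw [h1] at hr
      simp at hr
    · rw [h1] at hr
      simp at hr
  have hm := h.mem_iff hne
  have hcl := clLabel_ne h hne
  have hlh : w.lo ≤ w.hi := by
    obtain ⟨k, hk⟩ := hne
    have := (hm k).mp hk
    omega
  have hin : ∀ a b, w.lo ≤ a → b ≤ w.hi + 1 → (w.cl h).height a b = w.height a b := by
    intro a b ha hb
    apply height_congr
    intro k h1 h2
    exact cl_label_of_ne h ((hm k).mpr (by omega))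
  have hleft : ∀ k, w.lo - w.numUp ≤ k → k < w.lo → (w.cl h).label k = some Label.down := by
    intro k h1 h2
    change w.clLabel k = _
    unfold clLabel
    rw [if_neg ((hm k).not.mpr (by omega)), if_pos ⟨h1, h2⟩]
  have hright : ∀ k, w.hi < k → k ≤ w.hi + w.numDown → (w.cl h).label k = some Label.up := by
    intro k h1 h2
    change w.clLabel k = _
    unfold clLabel
    rw [if_neg ((hm k).not.mpr (by omega)), if_neg (by omega), if_pos ⟨h1, h2⟩]
  have hL : ∀ a, w.lo - w.numUp ≤ a → a ≤ w.lo → (w.cl h).height a w.lo = w.lo - a := by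
    intro a h1 h2
    unfold height
    rw [Finset.sum_congr rfl (g := fun _ => (1 : ℤ))]
    · simp [h2]
    · intro k hk
      rw [Finset.mem_Ico] at hk
      rw [hleft k (by omega) hk.2, val_down]
  have hR : ∀ b, w.hi + 1 ≤ b → b ≤ w.hi + w.numDown + 1 →
      (w.cl h).height (w.hi + 1) b = - (b - (w.hi + 1)) := by
    intro b h1 h2
    unfold height
    rw [Finset.sum_congr rfl (g := fun _ => (-1 : ℤ))]
    · simp [h1]
    · intro k hk
      rw [Finset.mem_Ico] at hk
      rw [hright k (by omega) (by omega), val_up]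
  have hM : w.height w.lo (w.hi + 1) = w.numDown - w.numUp := by
    rw [height_eq_card, h.card_eq hne, h.card_eq hne]
    rfl
  have hle : ∀ a b, w.height a b ≤ w.numDown ∧ - (w.numUp : ℤ) ≤ w.height a b := by
    intro a b
    rw [height_eq_card]
    have c1 := h.card_le Label.down a b
    have c2 := h.card_le Label.up a b
    change _ ≤ w.numDown at c1
    change _ ≤ w.numUp at c2
    omega
  have hrange := (hcl i).mp (by
    rcases cupNode_ray.mp hr with hr | hr
    · change (w.cl h).label i ≠ none
      rw [hr.1]
      simp
    · change (w.cl h).label i ≠ none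
      rw [hr.1]
      simp)
  rcases cupNode_ray.mp hr with ⟨h1, h2⟩ | ⟨h1, h2⟩
  · have hpos := height_pos_of_unmatched h1 h2 (w.hi + w.numDown + 1) (by omega)
    have hi : i ≤ w.hi := by
      by_contra hc
      rw [hright i (by omega) hrange.2] at h1
      simp at h1
    rw [height_split _ (m := w.hi + 1) (by omega) (by omega), hR _ (by omega) (by omega)] at hpos
    by_cases hil : w.lo ≤ i
    · rw [hin _ _ hil le_rfl] at hpos
      have := (hle i (w.hi + 1)).1
      omega
    · rw [height_split _ (m := w.lo) (by omega) (by omega), hL i hrange.1 (by omega),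
        hin _ _ le_rfl le_rfl, hM] at hpos
      omega
  · have hneg := height_neg_of_unmatched h1 h2 (w.lo - w.numUp) (by omega)
    have hi : w.lo ≤ i := by
      by_contra hc
      rw [hleft i hrange.1 (by omega)] at h1
      simp at h1
    rw [height_split _ (m := w.lo) (by omega) (by omega), hL _ le_rfl (by omega)] at hneg
    by_cases hil : i ≤ w.hi
    · rw [hin _ _ le_rfl (by omega)] at hneg
      have := (hle w.lo (i + 1)).2
      omega
    · rw [height_split _ (m := w.hi + 1) (by omega) (by omega), hR _ (by omega) (by omega),
        hin _ _ le_rfl le_rfl, hM] at hneg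
      omega

theorem cl_injective {a b : Weight} (h : a.Equivalent b) (ha : a.Bounded) (hb : b.Bounded)
    (hc : a.cl ha = b.cl hb) : a = b := by
  ext1
  funext i
  by_cases hi : a.label i = none
  · rw [hi, (h.none_iff i).mpr hi]
  · rw [← cl_label_of_ne ha hi, ← cl_label_of_ne hb ((h.none_iff i).not.mpr hi), hc]

end Weight

theorem Block.out_mem (Λ : Block) : (Quotient.out Λ : Weight) ∈ Λ := Quotient.out_eq Λ

/-- The unique block containing the closures of all weights in `Λ`. -/
def Block.cl (Λ : Block) (h : Λ.Bounded) : Block :=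
  (Weight.cl (Quotient.out Λ) (h _ Λ.out_mem)).block

theorem Block.cl_mem {Λ : Block} (h : Λ.Bounded) {w : Weight} (hw : w ∈ Λ) :
    w.cl (h w hw) ∈ Λ.cl h :=
  ((Block.equivalent hw Λ.out_mem).cl _ _).block_eq

/-- The closure of an oriented circle diagram. -/
def Basis.cl {Λ : Block} (h : Λ.Bounded) (x : Basis Λ) : ClosedBasis (Λ.cl h) where
  left := x.left.cl (h _ x.left_mem)
  wt := x.wt.cl (h _ x.wt_mem)
  right := x.right.cl (h _ x.right_mem)
  left_mem := Block.cl_mem h x.left_mem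
  wt_mem := Block.cl_mem h x.wt_mem
  right_mem := Block.cl_mem h x.right_mem
  left_sub := x.left_sub.cl _ _
  right_sub := x.right_sub.cl _ _
  left_closed := Weight.cl_closed _
  right_closed := Weight.cl_closed _

theorem Basis.cl_injective {Λ : Block} (h : Λ.Bounded) :
    Function.Injective (Basis.cl h) := by
  intro x y hxy
  have h1 : (x.cl h).left = (y.cl h).left := by rw [hxy]
  have h2 : (x.cl h).wt = (y.cl h).wt := by rw [hxy]
  have h3 : (x.cl h).right = (y.cl h).right := by rw [hxy]
  exact Basis.ext
    (Weight.cl_injective (Block.equivalent x.left_mem y.left_mem)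
      (h _ x.left_mem) (h _ y.left_mem) h1)
    (Weight.cl_injective (Block.equivalent x.wt_mem y.wt_mem)
      (h _ x.wt_mem) (h _ y.wt_mem) h2)
    (Weight.cl_injective (Block.equivalent x.right_mem y.right_mem)
      (h _ x.right_mem) (h _ y.right_mem) h3)

section Multiplication

variable (F : Type*) [Field F]

/-- The projection of `H_Δ` onto `H_Δ / I_Λ`, identified with `K_Λ`: it sends the closure of `x` to `x`
and kills the basis vectors which are not closures. -/
def K.opening {Λ : Block} (h : Λ.Bounded) : H F (Λ.cl h) →ₗ[F] K F Λ :=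
  Finsupp.lcomapDomain (Basis.cl h) (Basis.cl_injective h)

/-- The product of basis vectors in the bounded case: close, multiply in Khovanov's algebra modulo the
ideal `I_Λ`, and open again. -/
def K.mulBounded {Λ : Block} (h : Λ.Bounded) : K F Λ →ₗ[F] K F Λ →ₗ[F] K F Λ :=
  (((H.mul F (Λ.cl h)).compl₁₂ (Finsupp.lmapDomain F F (Basis.cl h))
    (Finsupp.lmapDomain F F (Basis.cl h))).compr₂ (K.opening F h))

end Multiplication

/-! ## Extensions -/

/-- The relation `lam ≺ μ`. -/
structure Weight.Prec (lam μ : Weight) : Prop where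
  bounded : lam.Bounded
  agree : ∀ i, lam.label i ≠ none → μ.label i = lam.label i
  sorted : ∀ i j, lam.label i = none → lam.label j = none → i < j →
    ¬ (μ.label i = some Label.down ∧ μ.label j = some Label.up)

/-- The relation `Γ ≺ Λ`. -/
def Block.Prec (Γ Λ : Block) : Prop := ∃ lam ∈ Γ, ∃ μ ∈ Λ, lam.Prec μ

theorem Block.Prec.bounded {Γ Λ : Block} (h : Γ.Prec Λ) : Γ.Bounded := by
  obtain ⟨lam, h1, μ, h2, h3⟩ := h
  intro w hw
  exact (Block.equivalent h1 hw).bounded h3.bounded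

/-- The extension of a weight `w` from `Γ` to `Λ`: the labels at the new vertices are those of any
`μ ∈ Λ` such that `lam ≺ μ` for some `lam ∈ Γ`. -/
def Weight.ex {Γ Λ : Block} (h : Γ.Prec Λ) (w : Weight) (hw : w ∈ Γ) : Weight where
  label i := if w.label i = none then h.choose_spec.2.choose.label i else w.label i
  ordConnected := by
    have h1 := h.choose_spec.1
    obtain ⟨h2, h3⟩ := h.choose_spec.2.choose_spec
    have : {i | (if w.label i = none then h.choose_spec.2.choose.label i else w.label i) ≠ none} =
        {i | h.choose_spec.2.choose.label i ≠ none} := by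
      ext i
      change (if w.label i = none then h.choose_spec.2.choose.label i else w.label i) ≠ none ↔
        h.choose_spec.2.choose.label i ≠ none
      split_ifs with hi
      · exact Iff.rfl
      · have hi' := ((Block.equivalent hw h1).none_iff i).not.mpr hi
        rw [h3.agree i hi']
        exact iff_of_true hi hi'
    rw [this]
    exact Weight.ordConnected _
  eventually_sorted := by
    obtain ⟨S, hS, hs⟩ := h.choose_spec.2.choose.eventually_sorted
    refine ⟨S ∪ {i | w.label i ≠ none}, hS.union (h.bounded w hw), ?_⟩
    intro i j hi hj hij
    have hi1 : w.label i = none := by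
      by_contra hc
      exact hi (Or.inr hc)
    have hj1 : w.label j = none := by
      by_contra hc
      exact hj (Or.inr hc)
    rw [if_pos hi1, if_pos hj1]
    exact hs i j (fun hc => hi (Or.inl hc)) (fun hc => hj (Or.inl hc)) hij

theorem Weight.ex_mem {Γ Λ : Block} (h : Γ.Prec Λ) (w : Weight) (hw : w ∈ Γ) :
    Weight.ex h w hw ∈ Λ := by
  have h1 := h.choose_spec.1
  obtain ⟨h2, h3⟩ := h.choose_spec.2.choose_spec
  have he := Block.equivalent h1 hw
  have hn := he.none_iff
  suffices H : h.choose_spec.2.choose.Equivalent (Weight.ex h w hw) from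
    H.block_eq.symm.trans h2
  obtain ⟨σ, k1, k2, k3⟩ := he
  have hfix : ∀ i, h.choose.label i = none → σ i = i := by
    intro i hi
    exact k2 i (by simp [Weight.IsArrow, hi])
  refine ⟨σ, k1, ?_, ?_⟩
  · intro i hi
    by_cases hc : h.choose.label i = none
    · exact hfix i hc
    · apply k2
      unfold Weight.IsArrow at hi ⊢
      rwa [h3.agree i hc] at hi
  · intro i
    change (if w.label i = none then _ else w.label i) = _
    split_ifs with hi
    · rw [hfix i ((hn i).mp hi)]
    · rw [h3.agree, k3]
      rw [← k3]
      exact hi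

theorem Weight.prec_ex {Γ Λ : Block} (h : Γ.Prec Λ) (w : Weight) (hw : w ∈ Γ) :
    w.Prec (Weight.ex h w hw) where
  bounded := h.bounded w hw
  agree i hi := if_neg hi
  sorted i j hi hj hij := by
    have h1 := h.choose_spec.1
    obtain ⟨h2, h3⟩ := h.choose_spec.2.choose_spec
    change ¬ ((if w.label i = none then _ else w.label i) = _ ∧
      (if w.label j = none then _ else w.label j) = _)
    rw [if_pos hi, if_pos hj]
    have hn := (Block.equivalent hw h1).none_iff
    exact h3.sorted i j ((hn i).mpr hi) ((hn j).mpr hj) hij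

theorem Weight.Sub.ex {Γ Λ : Block} (h : Γ.Prec Λ) {α lam : Weight} (hs : α.Sub lam) (hα : α ∈ Γ)
    (hl : lam ∈ Γ) : (Weight.ex h α hα).Sub (Weight.ex h lam hl) := by
  refine hs.extend (h.bounded α hα) ?_ ?_ ?_
    (Block.equivalent (Weight.ex_mem h α hα) (Weight.ex_mem h lam hl))
  · intro i hi
    exact if_neg hi
  · intro i hi
    exact if_neg ((hs.1.none_iff i).not.mpr hi)
  · intro i hi
    exact (if_pos ((hs.1.none_iff i).mpr hi)).trans (if_pos hi).symm

/-- The extension of an oriented circle diagram from `Γ` to `Λ`. -/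
def Basis.ex {Γ Λ : Block} (h : Γ.Prec Λ) (x : Basis Γ) : Basis Λ where
  left := Weight.ex h x.left x.left_mem
  wt := Weight.ex h x.wt x.wt_mem
  right := Weight.ex h x.right x.right_mem
  left_mem := Weight.ex_mem h _ _
  wt_mem := Weight.ex_mem h _ _
  right_mem := Weight.ex_mem h _ _
  left_sub := x.left_sub.ex h _ _
  right_sub := x.right_sub.ex h _ _

theorem Weight.label_eq_of_val {x y : Option Label} (hx : x = some Label.down ∨ x = some Label.up)
    (hy : y = some Label.down ∨ y = some Label.up) (h : val x = val y) : x = y := by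
  rcases hx with rfl | rfl <;> rcases hy with rfl | rfl <;> simp [val] at h ⊢

/-- There is at most one `μ` in a given block with `lam ≺ μ`. -/
theorem Weight.Prec.unique {lam μ ν : Weight} (hμ : lam.Prec μ) (hν : lam.Prec ν)
    (he : μ.Equivalent ν) : μ = ν := by
  have ha := he.arrow_iff
  have hl := fun i => he.label_eq (i := i)
  obtain ⟨σ, h1, h2, h3⟩ := he
  set d : ℤ → ℤ := fun i => val (ν.label i) - val (μ.label i) with hd
  have hmemF : ∀ i, i ∈ h1.toFinset ↔ σ i ≠ i := fun i => Set.Finite.mem_toFinset h1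
  have htot : ∑ i ∈ h1.toFinset, d i = 0 := by
    rw [hd, Finset.sum_sub_distrib, sub_eq_zero]
    refine Finset.sum_equiv σ ?_ ?_
    · intro i
      rw [hmemF, hmemF]
      exact (σ.injective.eq_iff).not.symm
    · intro i _
      rw [h3]
  have hz : ∀ i, lam.label i ≠ none ∨ ¬ μ.IsArrow i → d i = 0 := by
    rintro i (hi | hi)
    · simp only [hd, hμ.agree i hi, hν.agree i hi, sub_self]
    · simp only [hd, hl i hi, sub_self]
  suffices H : ∀ k, d k = 0 by
    ext1
    funext k
    by_cases hk : μ.IsArrow k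
    · refine Weight.label_eq_of_val hk ((ha k).mpr hk) ?_
      have := H k
      simp only [hd] at this
      omega
    · exact (hl k hk).symm
  intro k
  by_contra hk
  have hk1 : lam.label k = none := by
    by_contra hc
    exact hk (hz k (Or.inl hc))
  have hk2 : μ.IsArrow k := by
    by_contra hc
    exact hk (hz k (Or.inr hc))
  have hkF : k ∈ h1.toFinset := by
    rw [hmemF]
    intro hc
    apply hk
    simp only [hd, h3, hc, sub_self]
  have key : (∀ i ∈ h1.toFinset, 0 ≤ d i) ∧ 0 < d k ∨
      (∀ i ∈ h1.toFinset, 0 ≤ - d i) ∧ 0 < - d k := by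
    have hk3 := (ha k).mpr hk2
    rcases hk2 with a1 | a1 <;> rcases hk3 with a2 | a2
    · exact absurd (by simp [hd, a1, a2]) hk
    · right
      refine ⟨?_, by simp [hd, a1, a2, val]⟩
      intro i _
      by_cases hc : lam.label i = none
      · by_cases hi : μ.IsArrow i
        · have hi' := (ha i).mpr hi
          rcases hi with b1 | b1 <;> rcases hi' with b2 | b2 <;> simp [hd, b1, b2, val]
          rcases lt_trichotomy i k with hik | hik | hik
          · exact hν.sorted i k hc hk1 hik ⟨b2, a2⟩
          · subst hik
            rw [a1] at b1
            simp at b1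
          · exact hμ.sorted k i hk1 hc hik ⟨a1, b1⟩
        · rw [hz i (Or.inr hi)]
          simp
      · rw [hz i (Or.inl hc)]
        simp
    · left
      refine ⟨?_, by simp [hd, a1, a2, val]⟩
      intro i _
      by_cases hc : lam.label i = none
      · by_cases hi : μ.IsArrow i
        · have hi' := (ha i).mpr hi
          rcases hi with b1 | b1 <;> rcases hi' with b2 | b2 <;> simp [hd, b1, b2, val]
          rcases lt_trichotomy i k with hik | hik | hik
          · exact hμ.sorted i k hc hk1 hik ⟨b1, a1⟩
          · subst hik
            rw [a1] at b1
            simp at b1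
          · exact hν.sorted k i hk1 hc hik ⟨a2, b2⟩
        · rw [hz i (Or.inr hi)]
      · rw [hz i (Or.inl hc)]
    · exact absurd (by simp [hd, a1, a2]) hk
  rcases key with ⟨k1, k2⟩ | ⟨k1, k2⟩
  · have := Finset.single_le_sum k1 hkF
    omega
  · have := Finset.single_le_sum k1 hkF
    rw [Finset.sum_neg_distrib] at this
    omega

/-- A truncation of two basis vectors `x`, `y` of `K_Λ`: a block `Γ ≺ Λ`, large enough for all cups and
caps of `x` and `y` to lie on its number line, and basis vectors of `K_Γ` with extensions `x` and `y`.
(This is the stable range of the direct limit: enlarging `Γ` further only adds the same rays to all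
diagrams.  For smaller `Γ` the extension may join rays of the truncated diagrams by new cups, and
then extension need not be multiplicative.) -/
structure Truncation {Λ : Block} (x y : Basis Λ) where
  Γ : Block
  prec : Γ.Prec Λ
  fst : Basis Γ
  snd : Basis Γ
  ex_fst : fst.ex prec = x
  ex_snd : snd.ex prec = y
  arcs_fst : ∀ i j, (x.left.cup.node i = some (Node.arc j) ∨ x.right.cup.node i = some (Node.arc j)) →
    fst.wt.label i ≠ none
  arcs_snd : ∀ i j, (y.left.cup.node i = some (Node.arc j) ∨ y.right.cup.node i = some (Node.arc j)) →
    snd.wt.label i ≠ none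

/-- The restriction of a weight to the vertices `l, …, r`. -/
def Weight.restrict (w : Weight) (l r : ℤ) : Weight where
  label i := if l ≤ i ∧ i ≤ r then w.label i else none
  ordConnected := by
    have : {i | (if l ≤ i ∧ i ≤ r then w.label i else none) ≠ none} =
        Set.Icc l r ∩ {i | w.label i ≠ none} := by
      ext i
      change (if l ≤ i ∧ i ≤ r then w.label i else none) ≠ none ↔
        (l ≤ i ∧ i ≤ r) ∧ w.label i ≠ none
      split_ifs with h <;> simp [h]
    rw [this]
    exact Set.ordConnected_Icc.inter w.ordConnected
  eventually_sorted := by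
    obtain ⟨S, hS, hs⟩ := w.eventually_sorted
    refine ⟨S, hS, ?_⟩
    intro i j hi hj hij hc
    apply hs i j hi hj hij
    split_ifs at hc <;> simp_all

theorem Weight.restrict_in {w : Weight} {l r i : ℤ} (h : l ≤ i ∧ i ≤ r) :
    (w.restrict l r).label i = w.label i := if_pos h

theorem Weight.restrict_out {w : Weight} {l r i : ℤ} (h : ¬ (l ≤ i ∧ i ≤ r)) :
    (w.restrict l r).label i = none := if_neg h

theorem Weight.Equivalent.restrict {a b : Weight} {σ : Equiv.Perm ℤ} {l r : ℤ}
    (h1 : {i | σ i ≠ i}.Finite) (h2 : ∀ i, ¬ a.IsArrow i → σ i = i)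
    (h3 : ∀ i, b.label i = a.label (σ i)) (hs : ∀ i, σ i ≠ i → l ≤ i ∧ i ≤ r) :
    (a.restrict l r).Equivalent (b.restrict l r) := by
  refine ⟨σ, h1, ?_, ?_⟩
  · intro i hi
    by_cases hc : l ≤ i ∧ i ≤ r
    · apply h2
      unfold Weight.IsArrow at hi ⊢
      rwa [Weight.restrict_in hc] at hi
    · by_contra hn
      exact hc (hs i hn)
  · intro i
    by_cases hn : σ i = i
    · have := h3 i
      rw [hn] at this ⊢
      by_cases hc : l ≤ i ∧ i ≤ r
      · rw [Weight.restrict_in hc, Weight.restrict_in hc, this]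
      · rw [Weight.restrict_out hc, Weight.restrict_out hc]
    · have hn' : σ (σ i) ≠ σ i := fun hc => hn (σ.injective hc)
      rw [Weight.restrict_in (hs i hn), Weight.restrict_in (hs _ hn'), h3]

theorem Weight.Sub.restrict {α lam : Weight} {l r : ℤ} (h : α.Sub lam)
    (hs : ∀ i j, α.Matched i j → (l ≤ i ∧ i ≤ r) ∧ (l ≤ j ∧ j ≤ r))
    (he : (α.restrict l r).Equivalent (lam.restrict l r)) :
    (α.restrict l r).Sub (lam.restrict l r) := by
  have hlab : ∀ i, (α.restrict l r).label i ≠ none →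
      (l ≤ i ∧ i ≤ r) ∧ (α.restrict l r).label i = α.label i := by
    intro i hi
    by_cases hc : l ≤ i ∧ i ≤ r
    · exact ⟨hc, Weight.restrict_in hc⟩
    · exact absurd (Weight.restrict_out hc) hi
  have hm : ∀ i j, (α.restrict l r).Matched i j ↔ α.Matched i j := by
    intro i j
    constructor
    · intro hij
      have h1 := (hlab i (by rw [hij.labels.1]; simp)).1
      have h2 := (hlab j (by rw [hij.labels.2]; simp)).1
      refine (Weight.matched_congr ?_).mp hij
      intro k k1 k2
      exact Weight.restrict_in (by omega)
    · intro hij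
      have h1 := hs i j hij
      refine (Weight.matched_congr ?_).mpr hij
      intro k k1 k2
      exact Weight.restrict_in (by omega)
  have hray : ∀ i, (α.restrict l r).cup.node i = some Node.ray →
      (l ≤ i ∧ i ≤ r) ∧ α.cup.node i = some Node.ray := by
    intro i hi
    have hi1 : (α.restrict l r).label i ≠ none := by
      rw [Ne, ← (α.restrict l r).cup_oriented.line, hi]
      simp
    refine ⟨(hlab i hi1).1, Weight.cupNode_ray.mpr ?_⟩
    have := Weight.cupNode_ray.mp hi
    simpa only [hm, (hlab i hi1).2] using this
  have hc := (α.restrict l r).cup_oriented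
  refine ⟨he, ?_, ?_, ?_, ?_, ?_⟩
  · intro i
    rw [hc.line, he.none_iff]
  · intro i hi
    have hf := hc.free i hi
    rw [he.label_eq]
    · exact hf
    · unfold Weight.IsArrow
      rcases hf with hf | hf <;> simp [hf]
  · intro i j hij
    have h1 := Weight.cupNode_arc.mp hij
    rw [hm, hm] at h1
    have h2 : (l ≤ i ∧ i ≤ r) ∧ (l ≤ j ∧ j ≤ r) := by
      rcases h1 with h1 | h1
      · exact hs i j h1
      · exact (hs j i h1).symm
    rw [Weight.restrict_in h2.1, Weight.restrict_in h2.2]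
    exact h.2.arc i j (Weight.cupNode_arc.mpr h1)
  · intro i hi
    rw [he.arrow_iff]
    exact hc.ray i hi
  · intro i j hi hj hij
    have h1 := hray i hi
    have h2 := hray j hj
    rw [Weight.restrict_in h1.1, Weight.restrict_in h2.1]
    exact h.2.rays_sorted i j h1.2 h2.2 hij

theorem Basis.exists_truncation {Λ : Block} (x y : Basis Λ) : Nonempty (Truncation x y) := by
  have key : ∀ w : Weight, w ∈ Λ → ∃ σ : Equiv.Perm ℤ, {i | σ i ≠ i}.Finite ∧
      (∀ i, ¬ x.wt.IsArrow i → σ i = i) ∧ ∀ i, w.label i = x.wt.label (σ i) :=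
    fun w hw => Block.equivalent x.wt_mem hw
  obtain ⟨S, hS, hs⟩ := x.wt.eventually_sorted
  set W : Fin 6 → Weight := ![x.left, x.wt, x.right, y.left, y.wt, y.right] with hW
  have hWΛ : ∀ n, W n ∈ Λ := by
    intro n
    fin_cases n
    · exact x.left_mem
    · exact x.wt_mem
    · exact x.right_mem
    · exact y.left_mem
    · exact y.wt_mem
    · exact y.right_mem
  choose σ h1 h2 h3 using fun n => key (W n) (hWΛ n)
  have hfin : (S ∪ ⋃ n, ({i | σ n i ≠ i} ∪
      {i | ∃ j, (W n).Matched i j ∨ (W n).Matched j i})).Finite :=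
    hS.union (Set.finite_iUnion fun n => (h1 n).union (Weight.Matched.finite (W n)))
  obtain ⟨l, hl⟩ := hfin.bddBelow
  obtain ⟨r, hr⟩ := hfin.bddAbove
  have hin : ∀ i, i ∈ (S ∪ ⋃ n, ({i | σ n i ≠ i} ∪
      {i | ∃ j, (W n).Matched i j ∨ (W n).Matched j i})) → l ≤ i ∧ i ≤ r :=
    fun i hi => ⟨hl hi, hr hi⟩
  have hsig : ∀ n i, σ n i ≠ i → l ≤ i ∧ i ≤ r :=
    fun n i hi => hin i (Or.inr (Set.mem_iUnion.mpr ⟨n, Or.inl hi⟩))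
  have hmat : ∀ n i j, (W n).Matched i j → (l ≤ i ∧ i ≤ r) ∧ (l ≤ j ∧ j ≤ r) :=
    fun n i j hij => ⟨hin i (Or.inr (Set.mem_iUnion.mpr ⟨n, Or.inr ⟨j, Or.inl hij⟩⟩)),
      hin j (Or.inr (Set.mem_iUnion.mpr ⟨n, Or.inr ⟨i, Or.inr hij⟩⟩))⟩
  have heq : ∀ n, (x.wt.restrict l r).Equivalent ((W n).restrict l r) :=
    fun n => Weight.Equivalent.restrict (h1 n) (h2 n) (h3 n) (hsig n)
  have hprec : ∀ n, ((W n).restrict l r).Prec (W n) := by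
    intro n
    refine ⟨?_, ?_, ?_⟩
    · refine (Set.finite_Icc l r).subset ?_
      intro i hi
      by_contra hc
      exact hi (Weight.restrict_out hc)
    · intro i hi
      by_cases hc : l ≤ i ∧ i ≤ r
      · exact (Weight.restrict_in hc).symm
      · exact absurd (Weight.restrict_out hc) hi
    · intro i j hi hj hij hc
      have hout : ∀ k, (W n).IsArrow k → ((W n).restrict l r).label k = none →
          k ∉ S ∧ (W n).label k = x.wt.label k := by
        intro k ha hk
        have hk' : ¬ (l ≤ k ∧ k ≤ r) := by
          intro hk'
          rw [Weight.restrict_in hk'] at hk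
          unfold Weight.IsArrow at ha
          rw [hk] at ha
          simp at ha
        refine ⟨fun hkS => hk' (hin k (Or.inl hkS)), ?_⟩
        rw [h3]
        congr 1
        by_contra hne
        exact hk' (hsig n k hne)
      have o1 := hout i (Or.inl hc.1) hi
      have o2 := hout j (Or.inr hc.2) hj
      exact hs i j o1.1 o2.1 hij ⟨o1.2 ▸ hc.1, o2.2 ▸ hc.2⟩
  have hmem : ∀ n, (W n).restrict l r ∈ (x.wt.restrict l r).block :=
    fun n => (heq n).block_eq.symm
  have hΓ : (x.wt.restrict l r).block.Prec Λ := ⟨_, hmem 1, _, hWΛ 1, hprec 1⟩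
  have hex : ∀ n, Weight.ex hΓ _ (hmem n) = W n := fun n =>
    (Weight.prec_ex hΓ _ (hmem n)).unique (hprec n)
      (Block.equivalent (Weight.ex_mem hΓ _ (hmem n)) (hWΛ n))
  have harc : ∀ n m i j, (W n).cup.node i = some (Node.arc j) →
      ((W m).restrict l r).label i ≠ none := by
    intro n m i j hij
    have h5 : l ≤ i ∧ i ≤ r := by
      rcases Weight.cupNode_arc.mp hij with h | h
      · exact (hmat n i j h).1
      · exact (hmat n j i h).2
    rw [Weight.restrict_in h5, Ne, (Block.equivalent (hWΛ n) (hWΛ m)).none_iff,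
      ← (W n).cup_oriented.line, hij]
    simp
  refine ⟨⟨_, hΓ, ⟨_, _, _, hmem 0, hmem 1, hmem 2, ?_, ?_⟩,
    ⟨_, _, _, hmem 3, hmem 4, hmem 5, ?_, ?_⟩,
    Basis.ext (hex 0) (hex 1) (hex 2), Basis.ext (hex 3) (hex 4) (hex 5),
    fun i j h => h.elim (harc 0 1 i j) (harc 2 1 i j),
    fun i j h => h.elim (harc 3 4 i j) (harc 5 4 i j)⟩⟩
  · exact Weight.Sub.restrict x.left_sub (hmat 0) ((heq 0).symm.trans (heq 1))
  · exact Weight.Sub.restrict x.right_sub (hmat 2) ((heq 2).symm.trans (heq 1))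
  · exact Weight.Sub.restrict y.left_sub (hmat 3) ((heq 3).symm.trans (heq 4))
  · exact Weight.Sub.restrict y.right_sub (hmat 5) ((heq 5).symm.trans (heq 4))

/-! ## The algebra `K` -/

section Multiplication

variable (F : Type*) [Field F]

/-- The linear map `K_Γ → K_Λ` given by extension of oriented circle diagrams. -/
def K.ex {Γ Λ : Block} (h : Γ.Prec Λ) : K F Γ →ₗ[F] K F Λ := Finsupp.lmapDomain F F (Basis.ex h)

/-- The product of two basis vectors in the general case: truncate both to a large `Γ ≺ Λ`, multiply
in `K_Γ` and extend back. -/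
def K.mulLimit {Λ : Block} (x y : Basis Λ) : K F Λ :=
  let T : Truncation x y := Classical.choice (Basis.exists_truncation x y)
  K.ex F T.prec
    (K.mulBounded F T.prec.bounded (Finsupp.single T.fst 1) (Finsupp.single T.snd 1))

/-- The multiplication of the algebra `K_Λ`, for an arbitrary block `Λ`. -/
def K.mul (Λ : Block) : K F Λ →ₗ[F] K F Λ →ₗ[F] K F Λ :=
  if h : Λ.Bounded then K.mulBounded F h
  else Finsupp.linearCombination F fun x => Finsupp.linearCombination F fun y => K.mulLimit F x y

end Multiplication

end DiagramAlgebra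

end

open scoped Classical

noncomputable section

namespace DiagramAlgebra

/-! ## Arc diagrams: sums over arcs and cutting of arcs -/

/-! The stitched diagram is consistently oriented because two weights of one block that orient the
same diagram agree at its rays (`Weight.Equivalent.rays_agree`). Their difference has total zero and
cancels along arcs, so a discrepancy at one ray forces an opposite one at another ray, and then one
of the two weights has `∨ ∧` in this order on rays. Termination is clear, since each surgery removes
a pair from the middle section. The substance is the comparison with the product of `K`, which takes
two steps.

Circles only. Count `∨` as `1` and `∧` as `-1`. Twice the count of the labels of a circle to the
left of one of its vertices (on the same number line) plus the value of that vertex is constant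
along the circle, and equals `1` or `-1` according to the type, as one sees at the leftmost vertex.
So types can be computed at any vertex. Running along the orientation is a permutation of the
vertices whose cycles are the circles. A surgery within one circle composes it with a transposition,
so the circle splits; a surgery between two circles merges them. To a shape one attaches the ring on
variables `X v`, one for each vertex, modulo `X v = X w` for connected vertices and `X v ^ 2 = 0`;
to an orientation, the product of the variables of its clockwise circles. The rules for circles say
that a surgery multiplies by `1` (merge) or by `X i + X j` (split), see `sum_outcomes_cong`. The
factors of two surgeries do not depend on their order (`factor_cong`), and the monomials of
different orientations are independent (`eq_of_sum_cong`). So surgeries commute (`outcomes_comm`),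
and the result is independent of the order (`allSurgeries_eq`).

Lines. The product is computed on closures. Let the window `[l, r]` be the original number line. A
closed diagram is good if outside the window its arrows are `∨` on the left and `∧` on the right;
the other diagrams are killed when the closure is opened. In a good diagram a circle reaching out of
the window is anti-clockwise and meets each side at most once on each number line
(`type_one_of_good`, `left_unique_of_good`). A surgery with a good outcome started from a good
diagram (`good_of_outcome`), so bad diagrams may be dropped at every stage. The lines of a diagram
lie on circles of its closure that reach out of the window. Thus `y` behaves like `1`, and the rules
involving `y` are the rules for circles with bad outcomes omitted; `rel_outcomes` makes this a
bijection of outcomes. The closure may have further cap-cup pairs in the middle which leave the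
window. They are cut first: each such surgery has exactly one good outcome, and that keeps all
labels (`filter_outcomes_outer`, `exists_inner`). For unbounded blocks the window is the line of a
truncation, and the same comparison applies. -/

/-- A function on a number line which is compatible with an arc diagram: it is antisymmetric along
arcs, and is supported at the ends of arcs and rays. -/
structure ArcDiagram.Compat (c : ArcDiagram) (f : ℤ → ℤ) : Prop where
  arc : ∀ i j, c.node i = some (Node.arc j) → f i + f j = 0
  support : ∀ i, f i ≠ 0 → c.node i = some Node.ray ∨ ∃ j, c.node i = some (Node.arc j)

/-- The part of a function supported at the rays of an arc diagram. -/
def ArcDiagram.onRays (c : ArcDiagram) (f : ℤ → ℤ) (i : ℤ) : ℤ :=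
  if c.node i = some Node.ray then f i else 0

/-- Swapping the two ends of an arc is a sign-reversing involution, so only the rays survive.
Closure of `A` under arcs is asked for only where `f` is nonzero, so `A` may be cut off where `f`
vanishes. -/
theorem ArcDiagram.Compat.sum_eq {c : ArcDiagram} {f : ℤ → ℤ} (h : c.Compat f) (A : Finset ℤ)
    (hA : ∀ i j, i ∈ A → f i ≠ 0 → c.node i = some (Node.arc j) → j ∈ A) :
    ∑ i ∈ A, f i = ∑ i ∈ A, c.onRays f i := by
  rw [← sub_eq_zero, ← Finset.sum_sub_distrib]
  -- The involution fixes the zeros of `f`, whose partners need not lie in `A`.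
  refine Finset.sum_involution (fun i _ => if ∃ j, f i ≠ 0 ∧ c.node i = some (Node.arc j) then
    c.partner i else i) ?_ ?_ ?_ ?_
  · intro i hi
    split_ifs with hc
    · obtain ⟨j, hj0, hj⟩ := hc
      rw [ArcDiagram.partner_eq hj]
      have := h.arc i j hj
      simp only [ArcDiagram.onRays, hj, (c.arc_symm i j hj).2]
      simp
      omega
    · have : f i - c.onRays f i = 0 := by
        unfold ArcDiagram.onRays
        split_ifs with hr
        · omega
        · by_contra hne
          have hne : f i ≠ 0 := by omega
          rcases h.support i hne with h' | ⟨j, h'⟩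
          · exact hr h'
          · exact hc ⟨j, hne, h'⟩
      omega
  · intro i hi hne
    have hc : ∃ j, f i ≠ 0 ∧ c.node i = some (Node.arc j) := by
      have : f i ≠ 0 := by
        intro h0
        apply hne
        unfold ArcDiagram.onRays
        split_ifs <;> omega
      rcases h.support i this with h' | ⟨j, h'⟩
      · simp [ArcDiagram.onRays, h'] at hne
      · exact ⟨j, this, h'⟩
    rw [if_pos hc]
    obtain ⟨j, -, hj⟩ := hc
    rw [ArcDiagram.partner_eq hj]
    exact (c.arc_symm i j hj).1
  · intro i hi
    split_ifs with hc
    · obtain ⟨j, hj0, hj⟩ := hc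
      rw [ArcDiagram.partner_eq hj]
      exact hA i j hi hj0 hj
    · exact hi
  · intro i hi
    by_cases hc : ∃ j, f i ≠ 0 ∧ c.node i = some (Node.arc j)
    · rw [if_pos hc]
      obtain ⟨j, hj0, hj⟩ := hc
      have hs := (c.arc_symm i j hj).2
      have := h.arc i j hj
      rw [ArcDiagram.partner_eq hj, if_pos ⟨i, by omega, hs⟩, ArcDiagram.partner_eq hs]
    · rw [if_neg hc, if_neg hc]

/-- The values strictly under an arc sum up to zero. -/
theorem ArcDiagram.Compat.sum_under {c : ArcDiagram} {f : ℤ → ℤ} (h : c.Compat f) {i j : ℤ}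
    (hij : c.node i = some (Node.arc j)) : ∑ p ∈ Finset.Ioo i j, f p = 0 := by
  rw [h.sum_eq]
  · refine Finset.sum_eq_zero fun p hp => ?_
    rw [Finset.mem_Ioo] at hp
    exact if_neg (c.ray_not_under i j p hij hp.1 hp.2)
  · intro p q hp _ hpq
    rw [Finset.mem_Ioo] at hp ⊢
    exact c.noncrossing i j p q hij hp.1 hp.2 hpq

/-- No arc passes over or ends at the right of `k` while starting at its left. -/
def ArcDiagram.CutAt (c : ArcDiagram) (k : ℤ) : Prop :=
  ∀ i j, c.node i = some (Node.arc j) → i < k → j < k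

/-- Arcs with nonzero values cannot leave the interval: to the left of `a` the values vanish, and no
arc crosses `k`. -/
theorem ArcDiagram.Compat.sum_cut {c : ArcDiagram} {f : ℤ → ℤ} (h : c.Compat f) {a k : ℤ}
    (ha : ∀ p, p < a → f p = 0) (hk : c.CutAt k) :
    ∑ p ∈ Finset.Ico a k, f p = ∑ p ∈ Finset.Ico a k, c.onRays f p := by
  refine h.sum_eq _ ?_
  intro i j hi hne hij
  rw [Finset.mem_Ico] at hi ⊢
  refine ⟨?_, hk i j hij hi.2⟩
  by_contra hc
  have := ha j (by omega)
  have := h.arc i j hij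
  omega

theorem ArcDiagram.cutAt_ray {c : ArcDiagram} {k : ℤ} (hk : c.node k = some Node.ray) :
    c.CutAt k := by
  intro i j hij hik
  rcases lt_trichotomy j k with h | h | h
  · exact h
  · subst h
    rw [(c.arc_symm i j hij).2] at hk
    simp at hk
  · exact absurd hk (c.ray_not_under i j k hij hik h)

/-! ### Cutting outermost arcs -/

/-- The arc at `i < j` is not enclosed by another one. -/
def ArcDiagram.Outermost (c : ArcDiagram) (i j : ℤ) : Prop :=
  i < j ∧ c.node i = some (Node.arc j) ∧ ∀ k l, c.node k = some (Node.arc l) → ¬ (k < i ∧ j < l)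

/-- By non-crossing, an arc from the left of `i` to its right would enclose `j` as well. -/
theorem ArcDiagram.Outermost.cutAt {c : ArcDiagram} {i j : ℤ} (h : c.Outermost i j) :
    c.CutAt i := by
  intro k l hkl hki
  obtain ⟨h1, h2, h3⟩ := h
  by_contra hc
  rcases eq_or_lt_of_le (not_lt.mp hc) with he | hl
  · subst he
    have := (c.arc_symm k i hkl).2
    rw [h2] at this
    simp only [Option.some.injEq, Node.arc.injEq] at this
    omega
  · have := c.noncrossing k l i j hkl hki hl h2
    exact h3 k l hkl ⟨hki, this.2⟩

theorem surgerable_iff {s : Stack} {i j : ℤ} : Surgerable s i j ↔ s.mid.Outermost i j := Iff.rfl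

theorem update_ray_arc {f : ℤ → Option Node} {i j p q : ℤ}
    (h : Function.update (Function.update f i (some Node.ray)) j (some Node.ray) p =
      some (Node.arc q)) : f p = some (Node.arc q) ∧ p ≠ i ∧ p ≠ j := by
  by_cases h1 : p = j
  · subst h1
    simp at h
  by_cases h2 : p = i
  · subst h2
    simp [h1] at h
  simp only [Function.update_apply, h1, h2, if_false] at h
  exact ⟨h, h2, h1⟩

/-- Replace an outermost arc by two rays. -/
def ArcDiagram.cut (c : ArcDiagram) (i j : ℤ) : ArcDiagram :=
  -- A ray cannot lie under an arc, so only outermost arcs can be replaced; in all other cases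
  -- nothing is done.
  if h : c.Outermost i j then
    { node := Function.update (Function.update c.node i (some Node.ray)) j (some Node.ray)
      ordConnected := by
        have hj := (c.arc_symm i j h.2.1).2
        have : {p | Function.update (Function.update c.node i (some Node.ray)) j
            (some Node.ray) p ≠ none} = {p | c.node p ≠ none} := by
          ext p
          change _ ≠ none ↔ c.node p ≠ none
          by_cases h1 : p = j
          · subst h1
            simp [hj]
          · by_cases h2 : p = i
            · subst h2
              simp [h1, h.2.1]
            · simp [h1, h2]
        rw [this]
        exact c.ordConnected
      arc_symm := by
        intro p q hpq
        have hj := (c.arc_symm i j h.2.1).2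
        by_cases h1 : p = j
        · subst h1
          simp at hpq
        by_cases h2 : p = i
        · subst h2
          simp [h1] at hpq
        simp only [Function.update_apply, h1, h2, if_false] at hpq ⊢
        obtain ⟨h3, h4⟩ := c.arc_symm p q hpq
        refine ⟨h3, ?_⟩
        rw [if_neg, if_neg]
        · exact h4
        · rintro rfl
          rw [h.2.1] at h4
          simp at h4
          exact h1 h4.symm
        · rintro rfl
          rw [hj] at h4
          simp at h4
          exact h2 h4.symm
      finite_arcs := by
        refine c.finite_arcs.subset ?_
        rintro p ⟨q, hpq⟩
        refine ⟨q, ?_⟩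
        exact (update_ray_arc hpq).1
      ray_not_under := by
        intro p q k hpq h1 h2 hr
        replace hpq := (update_ray_arc hpq).1
        simp only [Function.update_apply] at hr
        split_ifs at hr with h3 h4
        -- An arc over the new ray at `j` also passes over `i`, and so would enclose the outermost
        -- arc.
        · subst h3
          have hj := (c.arc_symm i k h.2.1).2
          have := c.noncrossing p q k i hpq h1 h2 hj
          have := c.noncrossing p q i k hpq this.1 this.2 h.2.1
          exact h.2.2 p q hpq ⟨by omega, by omega⟩
        · subst h4
          have := c.noncrossing p q k j hpq h1 h2 h.2.1
          exact h.2.2 p q hpq ⟨by omega, by omega⟩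
        · exact c.ray_not_under p q k hpq h1 h2 hr
      noncrossing := by
        intro p q k l hpq h1 h2 hkl
        exact c.noncrossing p q k l (update_ray_arc hpq).1 h1 h2 (update_ray_arc hkl).1 }
  else c

theorem ArcDiagram.cut_node {c : ArcDiagram} {i j : ℤ} (h : c.Outermost i j) :
    (c.cut i j).node =
      Function.update (Function.update c.node i (some Node.ray)) j (some Node.ray) := by
  unfold ArcDiagram.cut
  rw [dif_pos h]

theorem ArcDiagram.cut_left {c : ArcDiagram} {i j : ℤ} (h : c.Outermost i j) :
    (c.cut i j).node i = some Node.ray := by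
  rw [c.cut_node h, Function.update_of_ne (by have := h.1; omega)]
  simp

theorem ArcDiagram.cut_right {c : ArcDiagram} {i j : ℤ} (h : c.Outermost i j) :
    (c.cut i j).node j = some Node.ray := by
  rw [c.cut_node h]
  simp

theorem ArcDiagram.cut_of_ne {c : ArcDiagram} {i j p : ℤ} (h : c.Outermost i j) (h1 : p ≠ i)
    (h2 : p ≠ j) : (c.cut i j).node p = c.node p := by
  rw [c.cut_node h]
  simp [h1, h2]

theorem ArcDiagram.cut_arc {c : ArcDiagram} {i j p q : ℤ} (h : c.Outermost i j) :
    (c.cut i j).node p = some (Node.arc q) ↔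
      c.node p = some (Node.arc q) ∧ p ≠ i ∧ p ≠ j := by
  by_cases h1 : p = i
  · subst h1
    simp [c.cut_left h]
  · by_cases h2 : p = j
    · subst h2
      simp [c.cut_right h]
    · simp [c.cut_of_ne h h1 h2, h1, h2]

theorem ArcDiagram.cut_none {c : ArcDiagram} {i j p : ℤ} (h : c.Outermost i j) :
    (c.cut i j).node p = none ↔ c.node p = none := by
  by_cases h1 : p = i
  · subst h1
    simp [c.cut_left h, h.2.1]
  · by_cases h2 : p = j
    · subst h2
      simp [c.cut_right h, (c.arc_symm i p h.2.1).2]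
    · simp [c.cut_of_ne h h1 h2]

theorem ArcDiagram.cut_free {c : ArcDiagram} {i j p : ℤ} (h : c.Outermost i j) :
    (c.cut i j).node p = some Node.free ↔ c.node p = some Node.free := by
  by_cases h1 : p = i
  · subst h1
    simp [c.cut_left h, h.2.1]
  · by_cases h2 : p = j
    · subst h2
      simp [c.cut_right h, (c.arc_symm i p h.2.1).2]
    · simp [c.cut_of_ne h h1 h2]

theorem ArcDiagram.cut_ray {c : ArcDiagram} {i j p : ℤ} (h : c.Outermost i j) :
    (c.cut i j).node p = some Node.ray ↔ c.node p = some Node.ray ∨ p = i ∨ p = j := by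
  by_cases h1 : p = i
  · subst h1
    simp [c.cut_left h]
  · by_cases h2 : p = j
    · subst h2
      simp [c.cut_right h]
    · simp [c.cut_of_ne h h1 h2, h1, h2]

/-- The number of ends of arcs. -/
def ArcDiagram.numEnds (c : ArcDiagram) : ℕ := {i | ∃ j, c.node i = some (Node.arc j)}.ncard

/-- This is the measure for the inductions on the surgery procedure. -/
theorem ArcDiagram.numEnds_cut_lt {c : ArcDiagram} {i j : ℤ} (h : c.Outermost i j) :
    (c.cut i j).numEnds < c.numEnds := by
  refine Set.ncard_lt_ncard ?_ c.finite_arcs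
  rw [Set.ssubset_iff_exists]
  refine ⟨?_, i, ⟨j, h.2.1⟩, ?_⟩
  · rintro p ⟨q, hq⟩
    exact ⟨q, ((ArcDiagram.cut_arc h).mp hq).1⟩
  · rintro ⟨q, hq⟩
    exact ((ArcDiagram.cut_arc h).mp hq).2.1 rfl

/-- The leftmost arc with a given property which is inherited by enclosing arcs is outermost. -/
theorem ArcDiagram.exists_outermost (c : ArcDiagram) (P : ℤ → ℤ → Prop)
    (hP : ∀ i j k l, P i j → k < i → j < l → P k l) {i j : ℤ} (hij : i < j)
    (h : c.node i = some (Node.arc j)) (hp : P i j) : ∃ k l, c.Outermost k l ∧ P k l := by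
  obtain ⟨k, ⟨l, hkl, hkl', hpl⟩, hmin⟩ := Set.exists_min_image
    {k | ∃ l, k < l ∧ c.node k = some (Node.arc l) ∧ P k l} id
    (c.finite_arcs.subset (fun k ⟨l, _, hl, _⟩ => ⟨l, hl⟩)) ⟨i, j, hij, h, hp⟩
  refine ⟨k, l, ⟨hkl, hkl', ?_⟩, hpl⟩
  rintro k' l' h' ⟨h1, h2⟩
  have := hmin k' ⟨l', by omega, h', hP k l k' l' hpl h1 h2⟩
  simp only [id] at this
  omega

/-! ## The procedure terminates -/

theorem Outcome.mid_eq {s t : Stack} {i j : ℤ} (h : Surgerable s i j) (ho : Outcome s i j t) :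
    t.mid = s.mid.cut i j :=
  ArcDiagram.ext (ho.mid.trans (ArcDiagram.cut_node (surgerable_iff.mp h)).symm)

theorem mem_outcomes {s t : Stack} {i j : ℤ} : t ∈ outcomes s i j ↔ Outcome s i j t := by
  unfold outcomes
  simp

theorem Surgeries.add_right {A B : Multiset Stack} (h : Surgeries A B) (C : Multiset Stack) :
    Surgeries (A + C) (B + C) := by
  induction h with
  | refl => exact Relation.ReflTransGen.refl
  | tail _ h2 ih =>
    refine ih.tail ?_
    obtain ⟨s, R, i, j, hij⟩ := h2
    rw [Multiset.cons_add, add_assoc]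
    exact SurgeryStep.mk s _ i j hij

/-- The members of a disjoint union evolve independently, so they can be finished one at a time. -/
theorem exists_finished_of_forall (A : Multiset Stack)
    (hA : ∀ s ∈ A, ∃ R, Surgeries {s} R ∧ Finished R) : ∃ R, Surgeries A R ∧ Finished R := by
  induction A using Multiset.induction_on with
  | empty => exact ⟨0, Relation.ReflTransGen.refl, by simp [Finished]⟩
  | cons a A ihA =>
    obtain ⟨R, h1, h2⟩ := hA a (Multiset.mem_cons_self a A)
    obtain ⟨R', h3, h4⟩ := ihA fun s hs => hA s (Multiset.mem_cons_of_mem hs)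
    refine ⟨R + R', ?_, ?_⟩
    · have e1 := h1.add_right A
      have e2 := h3.add_right R
      rw [Multiset.singleton_add] at e1
      rw [add_comm A R, add_comm R' R] at e2
      exact e1.trans e2
    · intro s hs
      rcases Multiset.mem_add.mp hs with hs | hs
      · exact h2 s hs
      · exact h4 s hs

theorem ArcDiagram.exists_left_end {c : ArcDiagram} {i j : ℤ}
    (h : c.node i = some (Node.arc j)) : ∃ i j, i < j ∧ c.node i = some (Node.arc j) := by
  obtain ⟨h1, h2⟩ := c.arc_symm i j h
  rcases lt_or_gt_of_ne h1 with h3 | h3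
  · exact ⟨j, i, h3, h2⟩
  · exact ⟨i, j, h3, h⟩

theorem exists_finished_single (s : Stack) : ∃ R, Surgeries {s} R ∧ Finished R := by
  induction hn : s.mid.numEnds using Nat.strong_induction_on generalizing s with
  | _ n ih =>
  by_cases hf : Finished {s}
  · exact ⟨{s}, Relation.ReflTransGen.refl, hf⟩
  unfold Finished at hf
  push Not at hf
  obtain ⟨s', hs', i, j, hij⟩ := hf
  rw [Multiset.mem_singleton] at hs'
  subst hs'
  obtain ⟨i, j, hlt, hij⟩ := ArcDiagram.exists_left_end hij
  obtain ⟨k, l, hkl, -⟩ := s'.mid.exists_outermost (fun _ _ => True) (by simp) hlt hij trivial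
  -- Every outcome has fewer arc ends in its middle section, so the induction hypothesis covers all
  -- of them; there may be none.
  obtain ⟨R, h1, h2⟩ := exists_finished_of_forall (outcomes s' k l) fun t ht => ih _ (by
    rw [(mem_outcomes.mp ht).mid_eq hkl, ← hn]
    exact ArcDiagram.numEnds_cut_lt hkl) t rfl
  refine ⟨R, Relation.ReflTransGen.head ?_ h1, h2⟩
  have := SurgeryStep.mk s' 0 k l hkl
  rwa [add_zero, Multiset.cons_zero] at this

theorem exists_finished (R : Multiset Stack) : ∃ R', Surgeries R R' ∧ Finished R' :=
  exists_finished_of_forall R fun s _ => exists_finished_single s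

end DiagramAlgebra

namespace DiagramAlgebra

/-! ## Components and winding numbers -/

theorem Opposite.symm {x y : Option Label} (h : Opposite x y) : Opposite y x :=
  h.elim (fun h => Or.inr ⟨h.2, h.1⟩) (fun h => Or.inl ⟨h.2, h.1⟩)

theorem Opposite.ne {x y : Option Label} (h : Opposite x y) : x ≠ y := by
  rcases h with ⟨rfl, rfl⟩ | ⟨rfl, rfl⟩ <;> simp

namespace Skeleton

theorem Adj.symm {s : Skeleton} {v w : Vertex} (h : s.Adj v w) : s.Adj w v := by
  cases h with
  | bot_cup i j e => exact Adj.bot_cup _ _ (s.bot.arc_symm i j e).2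
  | mid_cap i j e => exact Adj.mid_cap _ _ (s.mid.arc_symm i j e).2
  | mid_cup i j e => exact Adj.mid_cup _ _ (s.mid.arc_symm i j e).2
  | top_cap i j e => exact Adj.top_cap _ _ (s.top.arc_symm i j e).2
  | up i e => exact Adj.down _ e
  | down i e => exact Adj.up _ e

theorem Conn.refl {s : Skeleton} (v : Vertex) : s.Conn v v := Relation.ReflTransGen.refl

theorem Conn.symm {s : Skeleton} {v w : Vertex} (h : s.Conn v w) : s.Conn w v := by
  induction h with
  | refl => exact Conn.refl v
  | tail _ h2 ih => exact Relation.ReflTransGen.head h2.symm ih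

theorem Conn.trans {s : Skeleton} {u v w : Vertex} (h : s.Conn u v) (h' : s.Conn v w) :
    s.Conn u w := Relation.ReflTransGen.trans h h'

theorem Adj.conn {s : Skeleton} {v w : Vertex} (h : s.Adj v w) : s.Conn v w :=
  Relation.ReflTransGen.single h

/-- The vertices of the component containing `v`. -/
def comp (s : Skeleton) (v : Vertex) : Set Vertex := {u | s.Conn v u}

/-- A union of components. -/
def Stable (s : Skeleton) (D : Set Vertex) : Prop := ∀ v w, v ∈ D → s.Adj v w → w ∈ D

theorem stable_comp (s : Skeleton) (v : Vertex) : s.Stable (s.comp v) :=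
  fun _ _ hu h => Relation.ReflTransGen.tail hu h

theorem Stable.conn {s : Skeleton} {D : Set Vertex} (hD : s.Stable D) {v w : Vertex}
    (h : s.Conn v w) (hv : v ∈ D) : w ∈ D := by
  induction h with
  | refl => exact hv
  | tail _ h2 ih => exact hD _ _ ih h2

theorem Stable.conn_iff {s : Skeleton} {D : Set Vertex} (hD : s.Stable D) {v w : Vertex}
    (h : s.Conn v w) : v ∈ D ↔ w ∈ D :=
  ⟨hD.conn h, hD.conn h.symm⟩

theorem Stable.adj_iff {s : Skeleton} {D : Set Vertex} (hD : s.Stable D) {v w : Vertex}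
    (h : s.Adj v w) : v ∈ D ↔ w ∈ D := hD.conn_iff h.conn

end Skeleton

/-- The number line of a vertex. -/
def Vertex.line : Vertex → ℤ → Vertex
  | Vertex.bot _ => Vertex.bot
  | Vertex.top _ => Vertex.top

theorem Vertex.line_pos (v : Vertex) : v.line v.pos = v := by cases v <;> rfl

/-- The vertex is labelled `∨` or `∧`. -/
def Stack.Arrow (s : Stack) (v : Vertex) : Prop :=
  s.label v = some Label.down ∨ s.label v = some Label.up

theorem Opposite.left_arrow {x y : Option Label} (h : Opposite x y) :
    x = some Label.down ∨ x = some Label.up := h.imp (fun h => h.1) (fun h => h.1)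

theorem Stack.Consistent.adj_arrow {s : Stack} (h : s.Consistent) {v w : Vertex}
    (ha : s.Adj v w) : s.Arrow v := by
  cases ha with
  | bot_cup i j e => exact (h.bot.arc i j e).left_arrow
  | mid_cap i j e => exact (h.mid_arc i j e).1.left_arrow
  | mid_cup i j e => exact (h.mid_arc i j e).2.left_arrow
  | top_cap i j e => exact (h.top.arc i j e).left_arrow
  | up i e => exact (h.mid_ray i e).2
  | down i e =>
    have := h.mid_ray i e
    change s.wTop.label i = _ ∨ s.wTop.label i = _
    rw [← this.1]
    exact this.2

theorem Stack.Consistent.conn_arrow {s : Stack} (h : s.Consistent) {v w : Vertex}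
    (hc : s.Conn v w) (hv : s.Arrow v) : s.Arrow w := by
  rcases Relation.ReflTransGen.cases_tail hc with rfl | ⟨u, -, hu⟩
  · exact hv
  · exact h.adj_arrow hu.symm

theorem Stack.Arrow.val_cases {s : Stack} {v : Vertex} (h : s.Arrow v) :
    (val (s.label v) = 1 ∧ s.label v = some Label.down) ∨
      (val (s.label v) = -1 ∧ s.label v = some Label.up) := by
  rcases h with h | h <;> simp [h, val]

theorem Stack.arrow_of_val_ne {s : Stack} {v : Vertex} (h : val (s.label v) ≠ 0) : s.Arrow v := by
  rcases DiagramAlgebra.val_cases (s.label v) with h' | h' | h'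
  · exact Or.inl h'.2
  · exact Or.inr h'.2
  · exact absurd h'.1 h

/-! ### Charges and heights -/

/-- The vertices of `D` on a number line, counted with sign `1` for `∨` and `-1` for `∧`. -/
def Stack.charge (s : Stack) (D : Set Vertex) (ln : ℤ → Vertex) (p : ℤ) : ℤ :=
  if ln p ∈ D then val (s.label (ln p)) else 0

theorem Oriented.arrow_node {c : ArcDiagram} {w : Weight} (h : Oriented c w) {i : ℤ}
    (hi : w.IsArrow i) : c.node i = some Node.ray ∨ ∃ j, c.node i = some (Node.arc j) := by
  rcases hc : c.node i with _ | ⟨_ | _ | j⟩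
  · have := (h.line i).mp hc
    simp [Weight.IsArrow, this] at hi
  · rcases h.free i hc with h' | h' <;> simp [Weight.IsArrow, h'] at hi
  · simp
  · simp

namespace Stack.Consistent

variable {s : Stack}

theorem mid_node (h : s.Consistent) {i : ℤ} (hi : s.wBot.IsArrow i ∨ s.wTop.IsArrow i) :
    s.mid.node i = some Node.ray ∨ ∃ j, s.mid.node i = some (Node.arc j) := by
  rcases hc : s.mid.node i with _ | ⟨_ | _ | j⟩
  · have h1 := (h.mid_line i).1.mp hc
    have h2 := (h.mid_line i).2.mp hc
    simp [Weight.IsArrow, h1, h2] at hi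
  · obtain ⟨h1, h2⟩ := h.mid_free i hc
    unfold Weight.IsArrow at hi
    rw [← h1] at hi
    rcases h2 with h2 | h2 <;> simp [h2] at hi
  · simp
  · simp

/-- Handles uniformly the outer diagrams and the middle section as seen from either number line;
`ln` selects the line. -/
theorem compat_aux {c : ArcDiagram} {D : Set Vertex} {ln : ℤ → Vertex}
    (h1 : ∀ i j, c.node i = some (Node.arc j) → Opposite (s.label (ln i)) (s.label (ln j)))
    (h2 : ∀ i j, c.node i = some (Node.arc j) → (ln i ∈ D ↔ ln j ∈ D))
    (h3 : ∀ i, s.Arrow (ln i) → c.node i = some Node.ray ∨ ∃ j, c.node i = some (Node.arc j)) :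
    c.Compat (s.charge D ln) where
  arc i j hij := by
    unfold Stack.charge
    have := (h1 i j hij).val_add
    by_cases hi : ln i ∈ D
    · rw [if_pos hi, if_pos ((h2 i j hij).mp hi)]
      exact this
    · rw [if_neg hi, if_neg ((h2 i j hij).not.mp hi)]
      rfl
  support i hi := by
    apply h3
    apply Stack.arrow_of_val_ne
    unfold Stack.charge at hi
    split_ifs at hi with hd
    · exact hi
    · exact absurd rfl hi

variable {D : Set Vertex}

theorem compat_bot (h : s.Consistent) (hD : s.Stable D) :
    s.bot.Compat (s.charge D Vertex.bot) :=
  compat_aux h.bot.arc (fun i j e => hD.adj_iff (Skeleton.Adj.bot_cup i j e))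
    (fun _ => h.bot.arrow_node)

theorem compat_top (h : s.Consistent) (hD : s.Stable D) :
    s.top.Compat (s.charge D Vertex.top) :=
  compat_aux h.top.arc (fun i j e => hD.adj_iff (Skeleton.Adj.top_cap i j e))
    (fun _ => h.top.arrow_node)

theorem compat_mid_bot (h : s.Consistent) (hD : s.Stable D) :
    s.mid.Compat (s.charge D Vertex.bot) :=
  compat_aux (fun i j e => (h.mid_arc i j e).1) (fun i j e => hD.adj_iff (Skeleton.Adj.mid_cap i j e))
    (fun _ hi => h.mid_node (Or.inl hi))

theorem compat_mid_top (h : s.Consistent) (hD : s.Stable D) :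
    s.mid.Compat (s.charge D Vertex.top) :=
  compat_aux (fun i j e => (h.mid_arc i j e).2) (fun i j e => hD.adj_iff (Skeleton.Adj.mid_cup i j e))
    (fun _ hi => h.mid_node (Or.inr hi))

/-- The two ends of a vertical segment carry the same label and lie in the same component. -/
theorem onRays_mid (h : s.Consistent) (hD : s.Stable D) :
    s.mid.onRays (s.charge D Vertex.bot) = s.mid.onRays (s.charge D Vertex.top) := by
  funext i
  unfold ArcDiagram.onRays
  split_ifs with hi
  · unfold Stack.charge
    have h1 := hD.adj_iff (Skeleton.Adj.up i hi)
    have h2 := (h.mid_ray i hi).1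
    have h3 : s.label (Vertex.bot i) = s.label (Vertex.top i) := h2
    simp only [h1, h3]
  · rfl

end Stack.Consistent

/-- The height of a vertex: the number of `∨`'s minus the number of `∧`'s to its left that belong to
`D` (and are not to the left of `a`). -/
def Stack.ht (s : Stack) (D : Set Vertex) (a : ℤ) (ln : ℤ → Vertex) (k : ℤ) : ℤ :=
  ∑ p ∈ Finset.Ico a k, s.charge D ln p

theorem Stack.ht_succ (s : Stack) (D : Set Vertex) {a k : ℤ} (ln : ℤ → Vertex) (h : a ≤ k) :
    s.ht D a ln (k + 1) = s.ht D a ln k + s.charge D ln k := by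
  unfold Stack.ht
  have : Finset.Ico a (k + 1) = insert k (Finset.Ico a k) := by
    ext p
    simp only [Finset.mem_Ico, Finset.mem_insert]
    omega
  rw [this, Finset.sum_insert (by simp), add_comm]

theorem sum_Ico_split (f : ℤ → ℤ) {a k l : ℤ} (h : a ≤ k) (h' : k ≤ l) :
    ∑ p ∈ Finset.Ico a l, f p = ∑ p ∈ Finset.Ico a k, f p + ∑ p ∈ Finset.Ico k l, f p := by
  rw [← Finset.sum_union]
  · congr 1
    ext p
    simp only [Finset.mem_union, Finset.mem_Ico]
    omega
  · rw [Finset.disjoint_left]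
    intro p
    simp only [Finset.mem_Ico]
    omega

theorem Stack.ht_split (s : Stack) (D : Set Vertex) {a k l : ℤ} (ln : ℤ → Vertex) (h : a ≤ k)
    (h' : k ≤ l) : s.ht D a ln l = s.ht D a ln k + ∑ p ∈ Finset.Ico k l, s.charge D ln p :=
  sum_Ico_split _ h h'

/-- The values strictly under the arc cancel, so from the left end `i` to the right end `j` the
partial sum grows by `f i`; since `f j = - f i`, this is compensated by the last summand. -/
theorem ArcDiagram.Compat.arc_invariant {c : ArcDiagram} {f : ℤ → ℤ} (h : c.Compat f) {a i j : ℤ}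
    (hij : c.node i = some (Node.arc j)) (hi : a ≤ i) (hj : a ≤ j) :
    2 * ∑ p ∈ Finset.Ico a i, f p + f i = 2 * ∑ p ∈ Finset.Ico a j, f p + f j := by
  have key : ∀ i j, c.node i = some (Node.arc j) → a ≤ i → i < j →
      2 * ∑ p ∈ Finset.Ico a i, f p + f i = 2 * ∑ p ∈ Finset.Ico a j, f p + f j := by
    intro i j hij hi hlt
    have h1 := h.sum_under hij
    have h2 := h.arc i j hij
    rw [sum_Ico_split f hi hlt.le]
    have : Finset.Ico i j = insert i (Finset.Ioo i j) := by
      ext p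
      simp only [Finset.mem_Ico, Finset.mem_insert, Finset.mem_Ioo]
      omega
    rw [this, Finset.sum_insert (by simp), h1]
    omega
  obtain ⟨h1, h2⟩ := c.arc_symm i j hij
  rcases lt_or_gt_of_ne h1 with h3 | h3
  · exact (key j i h2 hj h3).symm
  · exact key i j hij hi h3

namespace Stack.Consistent

variable {s : Stack} {D : Set Vertex} {a : ℤ}

/-- All vertices of `D` are weakly to the right of `a`. -/
theorem charge_eq_zero (ha : ∀ v ∈ D, a ≤ v.pos) (u : Vertex) {p : ℤ} (hp : p < a) :
    s.charge D u.line p = 0 := by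
  refine if_neg fun hc => ?_
  have := ha _ hc
  cases u <;> simp only [Vertex.line, Vertex.pos] at this <;> omega

/-- To the left of a position that no middle arc crosses, the middle arcs cancel on both number
lines. What remains are the vertical segments, which contribute equally to both. -/
theorem ht_bot_eq_top (h : s.Consistent) (hD : s.Stable D) (ha : ∀ v ∈ D, a ≤ v.pos) {k : ℤ}
    (hk : s.mid.CutAt k) : s.ht D a Vertex.bot k = s.ht D a Vertex.top k := by
  unfold Stack.ht
  rw [(h.compat_mid_bot hD).sum_cut (fun p hp => charge_eq_zero ha (Vertex.bot 0) hp) hk,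
    (h.compat_mid_top hD).sum_cut (fun p hp => charge_eq_zero ha (Vertex.top 0) hp) hk,
    h.onRays_mid hD]

/-- Twice the height plus the charge is constant along components. -/
theorem ht_adj (h : s.Consistent) (hD : s.Stable D) (ha : ∀ v ∈ D, a ≤ v.pos) {v w : Vertex}
    (hv : v ∈ D) (hvw : s.Adj v w) :
    2 * s.ht D a v.line v.pos + val (s.label v) = 2 * s.ht D a w.line w.pos + val (s.label w) := by
  have hw := hD v w hv hvw
  have key : ∀ c : ArcDiagram, ∀ ln : ℤ → Vertex, c.Compat (s.charge D ln) → ∀ i j,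
      c.node i = some (Node.arc j) → a ≤ i → a ≤ j → ln i ∈ D → ln j ∈ D →
      2 * s.ht D a ln i + val (s.label (ln i)) = 2 * s.ht D a ln j + val (s.label (ln j)) := by
    intro c ln hc i j hij h1 h2 h3 h4
    have := hc.arc_invariant hij h1 h2
    rwa [show s.charge D ln i = val (s.label (ln i)) from if_pos h3,
      show s.charge D ln j = val (s.label (ln j)) from if_pos h4] at this
  cases hvw with
  | bot_cup i j e => exact key _ _ (h.compat_bot hD) i j e (ha _ hv) (ha _ hw) hv hw
  | mid_cap i j e => exact key _ _ (h.compat_mid_bot hD) i j e (ha _ hv) (ha _ hw) hv hw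
  | mid_cup i j e => exact key _ _ (h.compat_mid_top hD) i j e (ha _ hv) (ha _ hw) hv hw
  | top_cap i j e => exact key _ _ (h.compat_top hD) i j e (ha _ hv) (ha _ hw) hv hw
  | up i e =>
    have h1 := h.ht_bot_eq_top hD ha (ArcDiagram.cutAt_ray e)
    have h2 := (h.mid_ray i e).1
    simp only [Vertex.line, Vertex.pos, Stack.label, h1, h2]
  | down i e =>
    have h1 := h.ht_bot_eq_top hD ha (ArcDiagram.cutAt_ray e)
    have h2 := (h.mid_ray i e).1
    simp only [Vertex.line, Vertex.pos, Stack.label, h1, h2]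

theorem ht_conn (h : s.Consistent) (hD : s.Stable D) (ha : ∀ v ∈ D, a ≤ v.pos) {v w : Vertex}
    (hv : v ∈ D) (hvw : s.Conn v w) :
    2 * s.ht D a v.line v.pos + val (s.label v) = 2 * s.ht D a w.line w.pos + val (s.label w) := by
  induction hvw with
  | refl => rfl
  | tail h1 h2 ih => exact ih.trans (h.ht_adj hD ha (hD.conn h1 hv) h2)

end Stack.Consistent

/-! ## Closed diagrams -/

/-- The diagram consists of finitely many circles. -/
structure Stack.Closed (s : Stack) : Prop where
  consistent : s.Consistent
  bot : s.bot.Closed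
  top : s.top.Closed
  bounded : s.wBot.Bounded

namespace Stack.Closed

variable {s : Stack}

theorem label_ne_iff (h : s.Closed) (v : Vertex) :
    s.label v ≠ none ↔ s.wBot.label v.pos ≠ none := by
  cases v with
  | bot i => rfl
  | top i =>
    have := h.consistent.mid_line i
    exact (this.2.symm.trans this.1).not

theorem exists_bounds (h : s.Closed) :
    ∃ a b : ℤ, ∀ v, s.label v ≠ none → a ≤ v.pos ∧ v.pos < b := by
  obtain ⟨a, ha⟩ := h.bounded.bddBelow
  obtain ⟨b, hb⟩ := h.bounded.bddAbove
  refine ⟨a, b + 1, fun v hv => ?_⟩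
  rw [h.label_ne_iff] at hv
  have h1 := ha hv
  have h2 := hb hv
  omega

theorem Arrow.label_ne {v : Vertex} (h : s.Arrow v) : s.label v ≠ none := by
  rcases h with h | h <;> simp [h]

theorem finite_pos (h : s.Closed) {D : Set Vertex} (hD : ∀ v ∈ D, s.Arrow v) : D.Finite := by
  have hfin : (Vertex.bot '' {i | s.wBot.label i ≠ none} ∪
      Vertex.top '' {i | s.wBot.label i ≠ none}).Finite :=
    (Set.Finite.image _ h.bounded).union (Set.Finite.image _ h.bounded)
  refine hfin.subset fun v hv => ?_
  have := (h.label_ne_iff v).mp (Arrow.label_ne (hD v hv))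
  cases v with
  | bot i => exact Or.inl ⟨i, this, rfl⟩
  | top i => exact Or.inr ⟨i, this, rfl⟩

theorem not_onLine (h : s.Closed) (v : Vertex) : ¬ s.OnLine v := by
  rintro ⟨u, -, hu⟩
  cases u with
  | bot i => exact h.bot i hu
  | top i => exact h.top i hu

theorem comp_arrow (h : s.Closed) {v : Vertex} (hv : s.Arrow v) : ∀ u ∈ s.comp v, s.Arrow u :=
  fun _ hu => h.consistent.conn_arrow hu hv

theorem exists_leftmost (h : s.Closed) {v : Vertex} (hv : s.Arrow v) : ∃ u, s.Leftmost v u := by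
  obtain ⟨u, hu, hmin⟩ := Set.exists_min_image (s.comp v) Vertex.pos
    (h.finite_pos (h.comp_arrow hv)) ⟨v, Skeleton.Conn.refl v⟩
  exact ⟨u, hu, hmin⟩

/-- The heights along a circle are governed by its orientation. -/
def Winds (s : Stack) (D : Set Vertex) (χ : ℤ) : Prop :=
  ∀ a, (∀ v ∈ D, a ≤ v.pos) → ∀ u ∈ D, 2 * s.ht D a u.line u.pos + val (s.label u) = χ

/-- At a leftmost vertex the height is zero, so the invariant of the circle is the value of its
label. -/
theorem winds_aux (h : s.Closed) {v u : Vertex} (hu : s.Leftmost v u) :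
    Winds s (s.comp v) (val (s.label u)) := by
  intro a ha w hw
  have hD := s.stable_comp v
  have := h.consistent.ht_conn hD ha hw (Skeleton.Conn.trans (Skeleton.Conn.symm hw) hu.1)
  rw [this]
  have hz : s.ht (s.comp v) a u.line u.pos = 0 := by
    refine Finset.sum_eq_zero fun p hp => if_neg fun hc => ?_
    have h1 := hu.2 _ hc
    rw [Finset.mem_Ico] at hp
    have : (u.line p).pos = p := by cases u <;> rfl
    omega
  omega

theorem winds_unique (h : s.Closed) {v : Vertex} (hv : s.Arrow v) {χ χ' : ℤ}
    (h1 : Winds s (s.comp v) χ) (h2 : Winds s (s.comp v) χ') : χ = χ' := by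
  obtain ⟨a, b, hab⟩ := h.exists_bounds
  have ha : ∀ u ∈ s.comp v, a ≤ u.pos := fun u hu =>
    (hab u (Arrow.label_ne (h.comp_arrow hv u hu))).1
  exact (h1 a ha v (Skeleton.Conn.refl v)).symm.trans (h2 a ha v (Skeleton.Conn.refl v))

/-- Frees the type from the leftmost vertex: it can be read off from the height and label of any
vertex of the circle. -/
theorem hasType_one_iff (h : s.Closed) {v : Vertex} (hv : s.Arrow v) :
    s.HasType v CompType.one ↔ Winds s (s.comp v) 1 := by
  constructor
  · rintro ⟨u, -, hu, hl⟩
    have := h.winds_aux hu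
    rwa [hl] at this
  · intro hw
    obtain ⟨u, hu⟩ := h.exists_leftmost hv
    have h1 := h.winds_unique hv hw (h.winds_aux hu)
    refine HasType.one u (h.not_onLine v) hu ?_
    rcases (h.consistent.conn_arrow hu.1 hv).val_cases with h2 | h2
    · exact h2.2
    · omega

theorem hasType_x_iff (h : s.Closed) {v : Vertex} (hv : s.Arrow v) :
    s.HasType v CompType.x ↔ Winds s (s.comp v) (-1) := by
  constructor
  · rintro ⟨⟩
    rename_i u _ hu hl
    have := h.winds_aux hu
    rwa [hl] at this
  · intro hw
    obtain ⟨u, hu⟩ := h.exists_leftmost hv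
    have h1 := h.winds_unique hv hw (h.winds_aux hu)
    refine HasType.x u (h.not_onLine v) hu ?_
    rcases (h.consistent.conn_arrow hu.1 hv).val_cases with h2 | h2
    · omega
    · exact h2.2

theorem not_hasType_y (h : s.Closed) (v : Vertex) : ¬ s.HasType v CompType.y := by
  rintro ⟨⟩
  rename_i hy
  exact h.not_onLine v hy

theorem hasType_cases (h : s.Closed) {v : Vertex} (hv : s.Arrow v) :
    s.HasType v CompType.one ∨ s.HasType v CompType.x := by
  obtain ⟨u, hu⟩ := h.exists_leftmost hv
  rcases h.consistent.conn_arrow hu.1 hv with h1 | h1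
  · exact Or.inl (HasType.one u (h.not_onLine v) hu h1)
  · exact Or.inr (HasType.x u (h.not_onLine v) hu h1)

theorem not_one_and_x (h : s.Closed) {v : Vertex} (hv : s.Arrow v)
    (h1 : s.HasType v CompType.one) (h2 : s.HasType v CompType.x) : False := by
  have := h.winds_unique hv ((h.hasType_one_iff hv).mp h1) ((h.hasType_x_iff hv).mp h2)
  omega

theorem not_x_iff (h : s.Closed) {v : Vertex} (hv : s.Arrow v) :
    ¬ s.HasType v CompType.x ↔ s.HasType v CompType.one :=
  ⟨fun h1 => (h.hasType_cases hv).resolve_right h1, fun h1 h2 => h.not_one_and_x hv h1 h2⟩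

theorem comp_eq {s : Skeleton} {v w : Vertex} (h : s.Conn v w) : s.comp v = s.comp w := by
  ext u
  exact ⟨fun hu => h.symm.trans hu, fun hu => h.trans hu⟩

/-- The total charge of a union of circles on the bottom number line vanishes. -/
theorem sum_eq_zero (h : s.Closed) {D : Set Vertex} (hD : s.Stable D) {a b : ℤ}
    (hab : ∀ v ∈ D, a ≤ v.pos ∧ v.pos < b) (u : Vertex) : s.ht D a u.line b = 0 := by
  have hz : ∀ p, b ≤ p → s.charge D u.line p = 0 := by
    intro p hp
    refine if_neg fun hc => ?_
    have := hab _ hc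
    cases u <;> simp only [Vertex.line, Vertex.pos] at this <;> omega
  have hz' : ∀ p, p < a → s.charge D u.line p = 0 :=
    fun p hp => Stack.Consistent.charge_eq_zero (fun v hv => (hab v hv).1) u hp
  have key : ∀ c : ArcDiagram, c.Closed → c.Compat (s.charge D u.line) →
      s.ht D a u.line b = 0 := by
    intro c hc hcomp
    unfold Stack.ht
    rw [hcomp.sum_eq]
    · exact Finset.sum_eq_zero fun p _ => if_neg (hc p)
    · intro i j hi hne hij
      have h1 : s.charge D u.line j ≠ 0 := by
        have := hcomp.arc i j hij
        omega
      rw [Finset.mem_Ico]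
      constructor
      · by_contra hlt
        exact h1 (hz' j (by omega))
      · by_contra hlt
        exact h1 (hz j (by omega))
  cases u with
  | bot i => exact key _ h.bot (h.consistent.compat_bot hD)
  | top i => exact key _ h.top (h.consistent.compat_top hD)

/-- The ends of an outermost cap-cup pair carry the same labels if they are on the same circle. -/
theorem label_eq_of_conn (h : s.Closed) {i j : ℤ} (hij : Surgerable s i j)
    (hc : s.Conn (Vertex.bot i) (Vertex.top i)) : s.wBot.label i = s.wTop.label i := by
  have hv : s.Arrow (Vertex.bot i) := h.consistent.adj_arrow (Skeleton.Adj.mid_cap i j hij.2.1)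
  have hv' : s.Arrow (Vertex.top i) := h.consistent.adj_arrow (Skeleton.Adj.mid_cup i j hij.2.1)
  obtain ⟨a, b, hab⟩ := h.exists_bounds
  have ha : ∀ u ∈ s.comp (Vertex.bot i), a ≤ u.pos := fun u hu =>
    (hab u (Arrow.label_ne (h.comp_arrow hv u hu))).1
  have h1 := h.consistent.ht_conn (s.stable_comp _) ha (Skeleton.Conn.refl _) hc
  -- The pair is outermost, so no middle arc crosses `i` and the heights of the two vertices agree.
  -- The invariant of the circle then forces equal labels.
  have h2 := h.consistent.ht_bot_eq_top (s.stable_comp (Vertex.bot i)) ha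
    (surgerable_iff.mp hij).cutAt
  simp only [Vertex.line, Vertex.pos] at h1
  refine Weight.label_eq_of_val hv hv' ?_
  have : val (s.label (Vertex.bot i)) = val (s.label (Vertex.top i)) := by omega
  exact this

end Stack.Closed

end DiagramAlgebra

namespace DiagramAlgebra

/-! ## Cycles of permutations -/

section Perm

variable {α : Type*} (π : Equiv.Perm α)

/-- A finite set that is mapped into itself by a permutation is permuted, so it is also closed under
the inverse. -/
theorem perm_apply_mem_iff {E : Set α} (hE : E.Finite) (h : ∀ x ∈ E, π x ∈ E) (x : α) :
    π x ∈ E ↔ x ∈ E := by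
  refine ⟨fun hx => ?_, h x⟩
  have : π '' E = E := by
    refine Set.eq_of_subset_of_ncard_le ?_ ?_ hE
    · rintro _ ⟨y, hy, rfl⟩
      exact h y hy
    · rw [Set.ncard_image_of_injective _ π.injective]
  rw [← this] at hx
  obtain ⟨y, hy, he⟩ := hx
  rwa [← π.injective he]

theorem sameCycle_mem {E : Set α} (hE : E.Finite) (h : ∀ x ∈ E, π x ∈ E) {x y : α}
    (hxy : π.SameCycle x y) (hx : x ∈ E) : y ∈ E := by
  obtain ⟨n, rfl⟩ := hxy
  induction n using Int.induction_on with
  | zero => simpa using hx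
  | succ n ih =>
    rw [add_comm, zpow_add, zpow_one, Equiv.Perm.mul_apply]
    exact h _ ih
  | pred n ih =>
    rw [sub_eq_neg_add, zpow_add, zpow_neg_one, Equiv.Perm.mul_apply]
    rw [← perm_apply_mem_iff π hE h]
    simpa using ih

theorem exists_pow_eq_of_finite {a b : α} (hfin : {x | π.SameCycle a x}.Finite)
    (h : π.SameCycle a b) : ∃ n : ℕ, (π ^ n) a = b := by
  have hsub : {x | ∃ n : ℕ, (π ^ n) a = x} ⊆ {x | π.SameCycle a x} := by
    rintro x ⟨n, rfl⟩
    exact ⟨n, by simp⟩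
  refine sameCycle_mem π (E := {x | ∃ n : ℕ, (π ^ n) a = x}) (hfin.subset hsub) ?_ h ⟨0, rfl⟩
  rintro x ⟨n, rfl⟩
  exact ⟨n + 1, by rw [add_comm, pow_add, pow_one, Equiv.Perm.mul_apply]⟩

/-- One gets from `a` to `b` along the cycle without passing through `b`. -/
theorem path_of_sameCycle {a b : α} (hfin : {x | π.SameCycle a x}.Finite)
    (h : π.SameCycle a b) :
    Relation.ReflTransGen (fun x y => y = π x ∧ x ≠ b ∧ π.SameCycle a x) a b := by
  have hex := exists_pow_eq_of_finite π hfin h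
  have hmin := fun m => Nat.find_min hex (m := m)
  have key : ∀ m ≤ Nat.find hex,
      Relation.ReflTransGen (fun x y => y = π x ∧ x ≠ b ∧ π.SameCycle a x) a ((π ^ m) a) := by
    intro m
    induction m with
    | zero => intro _; exact Relation.ReflTransGen.refl
    | succ m ih =>
      intro hm
      refine (ih (by omega)).tail ⟨?_, hmin m (by omega), ⟨m, by simp⟩⟩
      rw [add_comm, pow_add, pow_one, Equiv.Perm.mul_apply]
  have := key _ le_rfl
  rwa [Nat.find_spec hex] at this

/-- Composition with a transposition of two points of a cycle cuts the cycle in two: the stretch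
from `π a` to the first occurrence of `b` becomes closed, as `b` is now sent to `π a`, and it does
not contain `a`. -/
theorem not_sameCycle_mul_swap [DecidableEq α] {a b : α} (hfin : {x | π.SameCycle a x}.Finite)
    (hab : a ≠ b) (h : π.SameCycle a b) : ¬ (π * Equiv.swap a b).SameCycle a b := by
  have hex : ∃ n : ℕ, (π ^ n) (π a) = b := by
    refine exists_pow_eq_of_finite π ?_ (Equiv.Perm.sameCycle_apply_left.mpr h)
    refine hfin.subset fun x hx => ?_
    exact Equiv.Perm.sameCycle_apply_left.mp hx
  set n := Nat.find hex with hn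
  have hmin : ∀ m < n, (π ^ m) (π a) ≠ b := fun m hm => Nat.find_min hex hm
  have hspec : (π ^ n) (π a) = b := Nat.find_spec hex
  -- A visit of `a` on the way would leave a shorter way from `π a` to `b`.
  have hne : ∀ m ≤ n, (π ^ m) (π a) ≠ a := by
    intro m hm hc
    have h1 : (π ^ (n - m)) a = b := by
      conv_lhs => rw [← hc]
      rw [← Equiv.Perm.mul_apply, ← pow_add, Nat.sub_add_cancel hm]
      exact hspec
    rcases hd : n - m with _ | k
    · rw [hd] at h1
      exact hab h1
    · rw [hd, pow_succ, Equiv.Perm.mul_apply] at h1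
      exact hmin k (by omega) h1
  intro hc
  have hmem : a ∈ {x | ∃ m ≤ n, (π ^ m) (π a) = x} := by
    refine sameCycle_mem (π * Equiv.swap a b) ?_ ?_ hc.symm ⟨n, le_rfl, hspec⟩
    · refine hfin.subset ?_
      rintro x ⟨m, -, rfl⟩
      exact ⟨(m : ℤ) + 1, by rw [zpow_add, zpow_one, Equiv.Perm.mul_apply, zpow_natCast]⟩
    · rintro x ⟨m, hm, rfl⟩
      rw [Equiv.Perm.mul_apply]
      by_cases hb : (π ^ m) (π a) = b
      · rw [hb, Equiv.swap_apply_right]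
        exact ⟨0, Nat.zero_le _, rfl⟩
      · rw [Equiv.swap_apply_of_ne_of_ne (hne m hm) hb]
        refine ⟨m + 1, ?_, by rw [add_comm, pow_add, pow_one, Equiv.Perm.mul_apply]⟩
        rcases Nat.lt_or_ge m n with hlt | hge
        · exact hlt
        · have : m = n := by omega
          subst this
          exact absurd hspec hb
  obtain ⟨m, hm, he⟩ := hmem
  exact hne m hm he

end Perm

/-! ## Running along circles -/

/-- The other end of the arc or segment above a vertex. -/
def Skeleton.upper (s : Skeleton) : Vertex → Vertex
  | Vertex.bot i =>
      if s.mid.node i = some Node.ray then Vertex.top i else Vertex.bot (s.mid.partner i)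
  | Vertex.top i => Vertex.top (s.top.partner i)

/-- The other end of the arc or segment below a vertex. -/
def Skeleton.lower (s : Skeleton) : Vertex → Vertex
  | Vertex.bot i => Vertex.bot (s.bot.partner i)
  | Vertex.top i =>
      if s.mid.node i = some Node.ray then Vertex.bot i else Vertex.top (s.mid.partner i)

theorem Skeleton.upper_ray {s : Skeleton} {i : ℤ} (h : s.mid.node i = some Node.ray) :
    s.upper (Vertex.bot i) = Vertex.top i := if_pos h

theorem Skeleton.upper_not_ray {s : Skeleton} {i : ℤ} (h : s.mid.node i ≠ some Node.ray) :
    s.upper (Vertex.bot i) = Vertex.bot (s.mid.partner i) := if_neg h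

theorem Skeleton.lower_ray {s : Skeleton} {i : ℤ} (h : s.mid.node i = some Node.ray) :
    s.lower (Vertex.top i) = Vertex.bot i := if_pos h

theorem Skeleton.lower_not_ray {s : Skeleton} {i : ℤ} (h : s.mid.node i ≠ some Node.ray) :
    s.lower (Vertex.top i) = Vertex.top (s.mid.partner i) := if_neg h

theorem ArcDiagram.partner_ne {c : ArcDiagram} {i : ℤ} (h : c.partner i ≠ i) :
    c.node i = some (Node.arc (c.partner i)) := by
  unfold ArcDiagram.partner at h ⊢
  split at h
  · rename_i j hj
    rw [hj]
  · exact absurd rfl h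

theorem Skeleton.adj_upper {s : Skeleton} {v : Vertex} (h : s.upper v ≠ v) :
    s.Adj v (s.upper v) := by
  cases v with
  | bot i =>
    by_cases hr : s.mid.node i = some Node.ray
    · rw [upper_ray hr]
      exact Adj.up i hr
    · rw [upper_not_ray hr] at h ⊢
      exact Adj.mid_cap i _ (ArcDiagram.partner_ne fun hc => h (by rw [hc]))
  | top i =>
    refine Adj.top_cap i _ (ArcDiagram.partner_ne fun hc => h ?_)
    simp [Skeleton.upper, hc]

theorem Skeleton.adj_lower {s : Skeleton} {v : Vertex} (h : s.lower v ≠ v) :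
    s.Adj v (s.lower v) := by
  cases v with
  | top i =>
    by_cases hr : s.mid.node i = some Node.ray
    · rw [lower_ray hr]
      exact Adj.down i hr
    · rw [lower_not_ray hr] at h ⊢
      exact Adj.mid_cup i _ (ArcDiagram.partner_ne fun hc => h (by rw [hc]))
  | bot i =>
    refine Adj.bot_cup i _ (ArcDiagram.partner_ne fun hc => h ?_)
    simp [Skeleton.lower, hc]

theorem Skeleton.Adj.eq_upper_or_lower {s : Skeleton} {v w : Vertex} (h : s.Adj v w) :
    w = s.upper v ∨ w = s.lower v := by
  cases h with
  | bot_cup i j e => right; simp [lower, ArcDiagram.partner_eq e]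
  | mid_cap i j e => left; simp [upper, e, ArcDiagram.partner_eq e]
  | mid_cup i j e => right; simp [lower, e, ArcDiagram.partner_eq e]
  | top_cap i j e => left; simp [upper, ArcDiagram.partner_eq e]
  | up i e => left; simp [upper, e]
  | down i e => right; simp [lower, e]

namespace Stack.Closed

variable {s : Stack}

/-- Either an arc is followed, the labels are opposite and one returns by `upper`; or a vertical
segment is followed, the labels agree and one returns by `lower`. This alternative makes `prevFun`
inverse to `nextFun`. -/
theorem upper_spec (h : s.Closed) {v : Vertex} (hv : s.Arrow v) :
    s.upper v ≠ v ∧ ((Opposite (s.label v) (s.label (s.upper v)) ∧ s.upper (s.upper v) = v) ∨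
      (s.label (s.upper v) = s.label v ∧ s.lower (s.upper v) = v)) := by
  cases v with
  | bot i =>
    rcases h.consistent.mid_node (Or.inl hv) with hr | ⟨j, hj⟩
    · have e : s.upper (Vertex.bot i) = Vertex.top i := by simp [Skeleton.upper, hr]
      rw [e]
      refine ⟨by simp, Or.inr ⟨(h.consistent.mid_ray i hr).1.symm, ?_⟩⟩
      simp [Skeleton.lower, hr]
    · have h1 := s.mid.arc_symm i j hj
      have e : s.upper (Vertex.bot i) = Vertex.bot j := by
        simp [Skeleton.upper, hj, ArcDiagram.partner_eq hj]
      rw [e]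
      refine ⟨by simpa using h1.1, Or.inl ⟨(h.consistent.mid_arc i j hj).1, ?_⟩⟩
      simp [Skeleton.upper, h1.2, ArcDiagram.partner_eq h1.2]
  | top i =>
    rcases h.consistent.top.arrow_node hv with hr | ⟨j, hj⟩
    · exact absurd hr (h.top i)
    · have h1 := s.top.arc_symm i j hj
      have e : s.upper (Vertex.top i) = Vertex.top j := by
        simp [Skeleton.upper, ArcDiagram.partner_eq hj]
      rw [e]
      refine ⟨by simpa using h1.1, Or.inl ⟨h.consistent.top.arc i j hj, ?_⟩⟩
      simp [Skeleton.upper, ArcDiagram.partner_eq h1.2]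

theorem lower_spec (h : s.Closed) {v : Vertex} (hv : s.Arrow v) :
    s.lower v ≠ v ∧ ((Opposite (s.label v) (s.label (s.lower v)) ∧ s.lower (s.lower v) = v) ∨
      (s.label (s.lower v) = s.label v ∧ s.upper (s.lower v) = v)) := by
  cases v with
  | top i =>
    rcases h.consistent.mid_node (Or.inr hv) with hr | ⟨j, hj⟩
    · have e : s.lower (Vertex.top i) = Vertex.bot i := by simp [Skeleton.lower, hr]
      rw [e]
      refine ⟨by simp, Or.inr ⟨(h.consistent.mid_ray i hr).1, ?_⟩⟩
      simp [Skeleton.upper, hr]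
    · have h1 := s.mid.arc_symm i j hj
      have e : s.lower (Vertex.top i) = Vertex.top j := by
        simp [Skeleton.lower, hj, ArcDiagram.partner_eq hj]
      rw [e]
      refine ⟨by simpa using h1.1, Or.inl ⟨(h.consistent.mid_arc i j hj).2, ?_⟩⟩
      simp [Skeleton.lower, h1.2, ArcDiagram.partner_eq h1.2]
  | bot i =>
    rcases h.consistent.bot.arrow_node hv with hr | ⟨j, hj⟩
    · exact absurd hr (h.bot i)
    · have h1 := s.bot.arc_symm i j hj
      have e : s.lower (Vertex.bot i) = Vertex.bot j := by
        simp [Skeleton.lower, ArcDiagram.partner_eq hj]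
      rw [e]
      refine ⟨by simpa using h1.1, Or.inl ⟨h.consistent.bot.arc i j hj, ?_⟩⟩
      simp [Skeleton.lower, ArcDiagram.partner_eq h1.2]

end Stack.Closed

/-- The next vertex in the direction of the orientation. -/
def Stack.nextFun (s : Stack) (v : Vertex) : Vertex :=
  if s.label v = some Label.up then s.upper v
  else if s.label v = some Label.down then s.lower v else v

/-- The previous vertex in the direction of the orientation. -/
def Stack.prevFun (s : Stack) (v : Vertex) : Vertex :=
  if s.label v = some Label.up then s.lower v
  else if s.label v = some Label.down then s.upper v else v

theorem Opposite.up_left {x y : Option Label} (h : Opposite x y) (hx : x = some Label.up) :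
    y = some Label.down := by
  rcases h with h | h
  · rw [hx] at h
    simp at h
  · exact h.2

theorem Opposite.down_left {x y : Option Label} (h : Opposite x y) (hx : x = some Label.down) :
    y = some Label.up := by
  rcases h with h | h
  · exact h.2
  · rw [hx] at h
    simp at h

namespace Stack.Closed

variable {s : Stack}

theorem prev_next (h : s.Closed) (v : Vertex) : s.prevFun (s.nextFun v) = v := by
  by_cases h1 : s.label v = some Label.up
  · have e : s.nextFun v = s.upper v := by simp [nextFun, h1]
    rw [e]
    rcases (h.upper_spec (Or.inr h1)).2 with ⟨h2, h3⟩ | ⟨h2, h3⟩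
    · simp [prevFun, h2.up_left h1, h3]
    · simp [prevFun, h2, h1, h3]
  · by_cases h1' : s.label v = some Label.down
    · have e : s.nextFun v = s.lower v := by simp [nextFun, h1']
      rw [e]
      rcases (h.lower_spec (Or.inl h1')).2 with ⟨h2, h3⟩ | ⟨h2, h3⟩
      · simp [prevFun, h2.down_left h1', h3]
      · simp [prevFun, h2, h1', h3]
    · simp [nextFun, prevFun, h1, h1']

theorem next_prev (h : s.Closed) (v : Vertex) : s.nextFun (s.prevFun v) = v := by
  by_cases h1 : s.label v = some Label.up
  · have e : s.prevFun v = s.lower v := by simp [prevFun, h1]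
    rw [e]
    rcases (h.lower_spec (Or.inr h1)).2 with ⟨h2, h3⟩ | ⟨h2, h3⟩
    · simp [nextFun, h2.up_left h1, h3]
    · simp [nextFun, h2, h1, h3]
  · by_cases h1' : s.label v = some Label.down
    · have e : s.prevFun v = s.upper v := by simp [prevFun, h1']
      rw [e]
      rcases (h.upper_spec (Or.inl h1')).2 with ⟨h2, h3⟩ | ⟨h2, h3⟩
      · simp [nextFun, h2.down_left h1', h3]
      · simp [nextFun, h2, h1', h3]
    · simp [nextFun, prevFun, h1, h1']

/-- Running along the circles in the direction of the orientation. -/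
def next (h : s.Closed) : Equiv.Perm Vertex :=
  ⟨s.nextFun, s.prevFun, h.prev_next, h.next_prev⟩

theorem next_up (h : s.Closed) {v : Vertex} (hv : s.label v = some Label.up) :
    h.next v = s.upper v := by
  change s.nextFun v = _
  simp [nextFun, hv]

theorem next_down (h : s.Closed) {v : Vertex} (hv : s.label v = some Label.down) :
    h.next v = s.lower v := by
  change s.nextFun v = _
  simp [nextFun, hv]

theorem next_of_not_arrow (h : s.Closed) {v : Vertex} (hv : ¬ s.Arrow v) :
    h.next v = v := by
  change s.nextFun v = _
  unfold Arrow at hv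
  push Not at hv
  simp [nextFun, hv.1, hv.2]

theorem adj_next (h : s.Closed) {v : Vertex} (hv : s.Arrow v) : s.Adj v (h.next v) := by
  rcases hv with hv | hv
  · rw [h.next_down hv]
    exact Skeleton.adj_lower (h.lower_spec (Or.inl hv)).1
  · rw [h.next_up hv]
    exact Skeleton.adj_upper (h.upper_spec (Or.inr hv)).1

theorem next_of_adj (h : s.Closed) {v w : Vertex} (hvw : s.Adj v w) :
    h.next v = w ∨ h.next w = v := by
  have hv := h.consistent.adj_arrow hvw
  rcases hv with hv | hv
  · rcases hvw.eq_upper_or_lower with rfl | rfl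
    · right
      rcases (h.upper_spec (Or.inl hv)).2 with ⟨h2, h3⟩ | ⟨h2, h3⟩
      · rw [h.next_up (h2.down_left hv), h3]
      · rw [h.next_down (h2.trans hv), h3]
    · exact Or.inl (h.next_down hv)
  · rcases hvw.eq_upper_or_lower with rfl | rfl
    · exact Or.inl (h.next_up hv)
    · right
      rcases (h.lower_spec (Or.inr hv)).2 with ⟨h2, h3⟩ | ⟨h2, h3⟩
      · rw [h.next_down (h2.up_left hv), h3]
      · rw [h.next_up (h2.trans hv), h3]

/-- Every edge is traversed by `next` in one of its two directions, so the circles are the cycles of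
a permutation. -/
theorem conn_iff_sameCycle (h : s.Closed) {v w : Vertex} :
    s.Conn v w ↔ h.next.SameCycle v w := by
  constructor
  · intro hc
    induction hc with
    | refl => exact Equiv.Perm.SameCycle.refl _ _
    | tail _ h2 ih =>
      rcases h.next_of_adj h2 with h3 | h3
      · rw [← h3]
        exact Equiv.Perm.sameCycle_apply_right.mpr ih
      · rw [← h3] at ih
        exact Equiv.Perm.sameCycle_apply_right.mp ih
  · have hstep : ∀ u, s.Conn u (h.next u) := by
      intro u
      by_cases hu : s.Arrow u
      · exact (h.adj_next hu).conn
      · rw [h.next_of_not_arrow hu]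
        exact Skeleton.Conn.refl u
    rintro ⟨n, rfl⟩
    induction n using Int.induction_on with
    | zero => exact Skeleton.Conn.refl v
    | succ n ih =>
      rw [add_comm, zpow_add, zpow_one, Equiv.Perm.mul_apply]
      exact ih.trans (hstep _)
    | pred n ih =>
      rw [sub_eq_neg_add, zpow_add, zpow_neg_one, Equiv.Perm.mul_apply]
      refine ih.trans (Skeleton.Conn.symm ?_)
      have := hstep ((h.next)⁻¹ ((h.next ^ (-(n : ℤ))) v))
      simpa using this

theorem finite_cycle (h : s.Closed) {v : Vertex} (hv : s.Arrow v) :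
    {x | h.next.SameCycle v x}.Finite := by
  refine (h.finite_pos (h.comp_arrow hv)).subset fun x hx => ?_
  exact h.conn_iff_sameCycle.mpr hx

end Stack.Closed

/-! ## Cutting a cap-cup pair -/

/-- Replace an outermost cap-cup pair by vertical line segments. -/
def Skeleton.cut (s : Skeleton) (i j : ℤ) : Skeleton := { s with mid := s.mid.cut i j }

/-- Replace an outermost cap-cup pair by vertical line segments, keeping all labels. -/
def Stack.cut (s : Stack) (i j : ℤ) : Stack := { s with toSkeleton := s.toSkeleton.cut i j }

theorem Stack.cut_label (s : Stack) (i j : ℤ) (v : Vertex) : (s.cut i j).label v = s.label v := by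
  cases v <;> rfl

theorem Outcome.toSkeleton_eq {s t : Stack} {i j : ℤ} (h : Surgerable s i j)
    (ho : Outcome s i j t) : t.toSkeleton = s.toSkeleton.cut i j := by
  have h1 := ho.bot
  have h2 := ho.mid_eq h
  have h3 := ho.top
  rcases t with ⟨⟨_, _, _⟩, _, _⟩
  simp only at h1 h2 h3
  subst h1 h2 h3
  rfl

theorem Outcome.of_toSkeleton {s t : Stack} {i j : ℤ} (h : Surgerable s i j)
    (hs : t.toSkeleton = s.toSkeleton.cut i j) (hc : t.Consistent)
    (hu : ∀ v, ¬ t.Conn (Vertex.bot i) v → ¬ t.Conn (Vertex.bot j) v → t.label v = s.label v)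
    (hr : ∀ v, t.IsRayEnd v → t.label v = s.label v) (hrule : Rule s i j t) : Outcome s i j t where
  bot := by rw [hs]; rfl
  top := by rw [hs]; rfl
  mid := by
    rw [hs]
    exact ArcDiagram.cut_node h
  consistent := hc
  unchanged := hu
  rays_unchanged := hr
  rule := hrule

/-- The two vertices are the ends of the cap or of the cup of the pair at `i`, `j`. -/
def IsPair (i j : ℤ) (v w : Vertex) : Prop :=
  (v = Vertex.bot i ∧ w = Vertex.bot j) ∨ (v = Vertex.bot j ∧ w = Vertex.bot i) ∨
    (v = Vertex.top i ∧ w = Vertex.top j) ∨ (v = Vertex.top j ∧ w = Vertex.top i)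

/-- The two vertices are the ends of a vertical segment at `i` or `j`. -/
def IsVert (i j : ℤ) (v w : Vertex) : Prop :=
  (v = Vertex.bot i ∧ w = Vertex.top i) ∨ (v = Vertex.top i ∧ w = Vertex.bot i) ∨
    (v = Vertex.bot j ∧ w = Vertex.top j) ∨ (v = Vertex.top j ∧ w = Vertex.bot j)

namespace Skeleton

variable {s : Skeleton} {i j : ℤ}

theorem cut_adj_left (h : s.mid.Outermost i j) :
    (s.cut i j).Adj (Vertex.bot i) (Vertex.top i) := Adj.up i (ArcDiagram.cut_left h)

theorem cut_adj_right (h : s.mid.Outermost i j) :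
    (s.cut i j).Adj (Vertex.bot j) (Vertex.top j) := Adj.up j (ArcDiagram.cut_right h)

theorem Adj.cut (h : s.mid.Outermost i j) {v w : Vertex} (hvw : s.Adj v w) :
    (s.cut i j).Adj v w ∨ IsPair i j v w := by
  have hj := (s.mid.arc_symm i j h.2.1).2
  have key : ∀ p q, s.mid.node p = some (Node.arc q) →
      (s.mid.cut i j).node p = some (Node.arc q) ∨ (p = i ∧ q = j) ∨ (p = j ∧ q = i) := by
    intro p q e
    by_cases h1 : p = i
    · subst h1
      rw [h.2.1] at e
      simp only [Option.some.injEq, Node.arc.injEq] at e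
      exact Or.inr (Or.inl ⟨rfl, e.symm⟩)
    · by_cases h2 : p = j
      · subst h2
        rw [hj] at e
        simp only [Option.some.injEq, Node.arc.injEq] at e
        exact Or.inr (Or.inr ⟨rfl, e.symm⟩)
      · exact Or.inl ((ArcDiagram.cut_arc h).mpr ⟨e, h1, h2⟩)
  unfold IsPair
  cases hvw with
  | bot_cup p q e => exact Or.inl (Adj.bot_cup _ _ e)
  | mid_cap p q e =>
    rcases key p q e with h1 | ⟨rfl, rfl⟩ | ⟨rfl, rfl⟩
    · exact Or.inl (Adj.mid_cap _ _ h1)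
    · simp
    · simp
  | mid_cup p q e =>
    rcases key p q e with h1 | ⟨rfl, rfl⟩ | ⟨rfl, rfl⟩
    · exact Or.inl (Adj.mid_cup _ _ h1)
    · simp
    · simp
  | top_cap p q e => exact Or.inl (Adj.top_cap _ _ e)
  | up p e => exact Or.inl (Adj.up p ((ArcDiagram.cut_ray h).mpr (Or.inl e)))
  | down p e => exact Or.inl (Adj.down p ((ArcDiagram.cut_ray h).mpr (Or.inl e)))

theorem Adj.of_cut (h : s.mid.Outermost i j) {v w : Vertex} (hvw : (s.cut i j).Adj v w) :
    s.Adj v w ∨ IsVert i j v w := by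
  unfold IsVert
  cases hvw with
  | bot_cup p q e => exact Or.inl (Adj.bot_cup _ _ e)
  | mid_cap p q e => exact Or.inl (Adj.mid_cap _ _ ((ArcDiagram.cut_arc h).mp e).1)
  | mid_cup p q e => exact Or.inl (Adj.mid_cup _ _ ((ArcDiagram.cut_arc h).mp e).1)
  | top_cap p q e => exact Or.inl (Adj.top_cap _ _ e)
  | up p e =>
    rcases (ArcDiagram.cut_ray h).mp e with h1 | rfl | rfl
    · exact Or.inl (Adj.up _ h1)
    · simp
    · simp
  | down p e =>
    rcases (ArcDiagram.cut_ray h).mp e with h1 | rfl | rfl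
    · exact Or.inl (Adj.down _ h1)
    · simp
    · simp

theorem conn_pair_bot (h : s.mid.Outermost i j) : s.Conn (Vertex.bot i) (Vertex.bot j) :=
  (Adj.mid_cap i j h.2.1).conn

theorem conn_pair_top (h : s.mid.Outermost i j) : s.Conn (Vertex.top i) (Vertex.top j) :=
  (Adj.mid_cup i j h.2.1).conn

/-- Away from the components of the new segments, nothing changes. -/
theorem Conn.cut_of_not {v w : Vertex} (h : s.mid.Outermost i j) (hvw : s.Conn v w)
    (h1 : ¬ s.Conn v (Vertex.bot i)) (h2 : ¬ s.Conn v (Vertex.top i)) :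
    (s.cut i j).Conn v w := by
  induction hvw with
  | refl => exact Conn.refl v
  | @tail x y hvx hxy ih =>
    rcases hxy.cut h with h3 | h3
    · exact Relation.ReflTransGen.tail ih h3
    · exfalso
      have hvx : s.Conn v x := hvx
      rcases h3 with ⟨rfl, -⟩ | ⟨rfl, -⟩ | ⟨rfl, -⟩ | ⟨rfl, -⟩
      · exact h1 hvx
      · exact h1 (hvx.trans (conn_pair_bot h).symm)
      · exact h2 hvx
      · exact h2 (hvx.trans (conn_pair_top h).symm)

theorem Conn.of_cut_of_not {v w : Vertex} (h : s.mid.Outermost i j) (hvw : (s.cut i j).Conn v w)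
    (h1 : ¬ (s.cut i j).Conn (Vertex.bot i) v) (h2 : ¬ (s.cut i j).Conn (Vertex.bot j) v) :
    s.Conn v w := by
  induction hvw with
  | refl => exact Conn.refl v
  | @tail x y hvx hxy ih =>
    rcases hxy.of_cut h with h3 | h3
    · exact Relation.ReflTransGen.tail ih h3
    · exfalso
      have hvx : (s.cut i j).Conn v x := hvx
      rcases h3 with ⟨rfl, -⟩ | ⟨rfl, -⟩ | ⟨rfl, -⟩ | ⟨rfl, -⟩
      · exact h1 hvx.symm
      · exact h1 ((cut_adj_left h).conn.trans hvx.symm)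
      · exact h2 hvx.symm
      · exact h2 ((cut_adj_right h).conn.trans hvx.symm)

/-- Every vertex on the old components lies on the new ones. -/
theorem Conn.cut_or (h : s.mid.Outermost i j) {v w : Vertex} (hvw : s.Conn v w)
    (hv : (s.cut i j).Conn (Vertex.bot i) v ∨ (s.cut i j).Conn (Vertex.bot j) v) :
    (s.cut i j).Conn (Vertex.bot i) w ∨ (s.cut i j).Conn (Vertex.bot j) w := by
  induction hvw with
  | refl => exact hv
  | tail hvx hxy ih =>
    rcases hxy.cut h with h3 | h3
    · exact ih.imp (fun h4 => Relation.ReflTransGen.tail h4 h3)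
        (fun h4 => Relation.ReflTransGen.tail h4 h3)
    · rcases h3 with ⟨-, rfl⟩ | ⟨-, rfl⟩ | ⟨-, rfl⟩ | ⟨-, rfl⟩
      · exact Or.inr (Conn.refl _)
      · exact Or.inl (Conn.refl _)
      · exact Or.inr (cut_adj_right h).conn
      · exact Or.inl (cut_adj_left h).conn

/-- The relation generated by a relation of connectivity and one new connection. -/
theorem Conn.of_cut (h : s.mid.Outermost i j) {v w : Vertex} (hvw : (s.cut i j).Conn v w) :
    s.Conn v w ∨ (s.Conn v (Vertex.bot i) ∧ s.Conn (Vertex.top i) w) ∨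
      (s.Conn v (Vertex.top i) ∧ s.Conn (Vertex.bot i) w) := by
  have b := conn_pair_bot h
  have t := conn_pair_top h
  have key : ∀ x y, (s.cut i j).Adj x y → s.Conn x y ∨
      (s.Conn x (Vertex.bot i) ∧ s.Conn (Vertex.top i) y) ∨
      (s.Conn x (Vertex.top i) ∧ s.Conn (Vertex.bot i) y) := by
    intro x y hxy
    rcases hxy.of_cut h with h3 | h3
    · exact Or.inl h3.conn
    · rcases h3 with ⟨rfl, rfl⟩ | ⟨rfl, rfl⟩ | ⟨rfl, rfl⟩ | ⟨rfl, rfl⟩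
      · exact Or.inr (Or.inl ⟨Conn.refl _, Conn.refl _⟩)
      · exact Or.inr (Or.inr ⟨Conn.refl _, Conn.refl _⟩)
      · exact Or.inr (Or.inl ⟨b.symm, t⟩)
      · exact Or.inr (Or.inr ⟨t.symm, b⟩)
  induction hvw with
  | refl => exact Or.inl (Conn.refl v)
  | @tail x y _ hxy ih =>
    rcases ih with h1 | ⟨h1, h2⟩ | ⟨h1, h2⟩ <;> rcases key x y hxy with h3 | ⟨h3, h4⟩ | ⟨h3, h4⟩
    · exact Or.inl (h1.trans h3)
    · exact Or.inr (Or.inl ⟨h1.trans h3, h4⟩)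
    · exact Or.inr (Or.inr ⟨h1.trans h3, h4⟩)
    · exact Or.inr (Or.inl ⟨h1, h2.trans h3⟩)
    · exact Or.inr (Or.inl ⟨h1, h4⟩)
    · exact Or.inl (h1.trans h4)
    · exact Or.inr (Or.inr ⟨h1, h2.trans h3⟩)
    · exact Or.inl (h1.trans h4)
    · exact Or.inr (Or.inr ⟨h1, h4⟩)

/-- The ends of the left segment are connected already, and those of the right one as well through
the cap and the cup; so the new segments join nothing. -/
theorem Conn.of_cut_split (h : s.mid.Outermost i j) (hs : s.Conn (Vertex.bot i) (Vertex.top i))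
    {v w : Vertex} (hvw : (s.cut i j).Conn v w) : s.Conn v w := by
  rcases hvw.of_cut h with h1 | ⟨h1, h2⟩ | ⟨h1, h2⟩
  · exact h1
  · exact (h1.trans hs).trans h2
  · exact (h1.trans hs.symm).trans h2

end Skeleton

/-- Agreement at `i` suffices: the labels at `j` are the opposite ones on both number lines. -/
theorem Stack.Consistent.cut {s : Stack} (hc : s.Consistent) {i j : ℤ} (h : Surgerable s i j)
    (hl : s.wBot.label i = s.wTop.label i) : (s.cut i j).Consistent where
  bot := hc.bot
  top := hc.top
  mid_line p := by
    change ((s.mid.cut i j).node p = none ↔ _) ∧ ((s.mid.cut i j).node p = none ↔ _)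
    rw [ArcDiagram.cut_none h]
    exact hc.mid_line p
  mid_free p hp := hc.mid_free p ((ArcDiagram.cut_free h).mp hp)
  mid_arc p q hpq := hc.mid_arc p q ((ArcDiagram.cut_arc h).mp hpq).1
  mid_ray p hp := by
    have h1 := hc.mid_arc i j h.2.1
    rcases (ArcDiagram.cut_ray h).mp hp with h2 | rfl | rfl
    · exact hc.mid_ray p h2
    · exact ⟨hl, h1.1.left_arrow⟩
    · refine ⟨?_, h1.1.symm.left_arrow⟩
      have h2 := h1.2
      rw [← hl] at h2
      exact h1.1.unique h2

theorem Stack.Closed.cut {s : Stack} (hs : s.Closed) {i j : ℤ} (h : Surgerable s i j)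
    (hl : s.wBot.label i = s.wTop.label i) : (s.cut i j).Closed :=
  ⟨hs.consistent.cut h hl, hs.bot, hs.top, hs.bounded⟩

namespace Stack.Closed

variable {s : Stack} {i j : ℤ}

theorem arrow_bot_left (hs : s.Closed) (h : Surgerable s i j) : s.Arrow (Vertex.bot i) :=
  hs.consistent.adj_arrow (Skeleton.Adj.mid_cap i j h.2.1)

theorem arrow_bot_right (hs : s.Closed) (h : Surgerable s i j) : s.Arrow (Vertex.bot j) :=
  hs.consistent.adj_arrow (Skeleton.Adj.mid_cap i j h.2.1).symm

theorem arrow_top_left (hs : s.Closed) (h : Surgerable s i j) : s.Arrow (Vertex.top i) :=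
  hs.consistent.adj_arrow (Skeleton.Adj.mid_cup i j h.2.1)

theorem arrow_top_right (hs : s.Closed) (h : Surgerable s i j) : s.Arrow (Vertex.top j) :=
  hs.consistent.adj_arrow (Skeleton.Adj.mid_cup i j h.2.1).symm

theorem upper_cut (h : s.mid.Outermost i j) {x : Vertex} (h1 : x ≠ Vertex.bot i)
    (h2 : x ≠ Vertex.bot j) : (s.cut i j).upper x = s.upper x := by
  cases x with
  | top p => rfl
  | bot p =>
    have h3 : p ≠ i := fun hc => h1 (by rw [hc])
    have h4 : p ≠ j := fun hc => h2 (by rw [hc])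
    have e : (s.cut i j).mid.node p = s.mid.node p := ArcDiagram.cut_of_ne h h3 h4
    have e' : (s.cut i j).mid.partner p = s.mid.partner p := by
      unfold ArcDiagram.partner
      rw [e]
    simp only [Skeleton.upper, e, e']

theorem lower_cut (h : s.mid.Outermost i j) {x : Vertex} (h1 : x ≠ Vertex.top i)
    (h2 : x ≠ Vertex.top j) : (s.cut i j).lower x = s.lower x := by
  cases x with
  | bot p => rfl
  | top p =>
    have h3 : p ≠ i := fun hc => h1 (by rw [hc])
    have h4 : p ≠ j := fun hc => h2 (by rw [hc])
    have e : (s.cut i j).mid.node p = s.mid.node p := ArcDiagram.cut_of_ne h h3 h4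
    have e' : (s.cut i j).mid.partner p = s.mid.partner p := by
      unfold ArcDiagram.partner
      rw [e]
    simp only [Skeleton.lower, e, e']

/-- The cap is only entered upwards from the bottom line and the cup only downwards from the top
line. The hypotheses exclude exactly these steps, so the edge taken by `next` survives the cut. -/
theorem cut_adj_next (hs : s.Closed) (h : s.mid.Outermost i j) {x : Vertex} (hx : s.Arrow x)
    (h1 : s.label x = some Label.up → x ≠ Vertex.bot i ∧ x ≠ Vertex.bot j)
    (h2 : s.label x = some Label.down → x ≠ Vertex.top i ∧ x ≠ Vertex.top j) :
    (s.cut i j).Adj x (hs.next x) := by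
  rcases hx with hx | hx
  · have h3 := h2 hx
    rw [hs.next_down hx, ← lower_cut h h3.1 h3.2]
    refine Skeleton.adj_lower ?_
    have := (hs.lower_spec (Or.inl hx)).1
    rwa [← lower_cut h h3.1 h3.2] at this
  · have h3 := h1 hx
    rw [hs.next_up hx, ← upper_cut h h3.1 h3.2]
    refine Skeleton.adj_upper ?_
    have := (hs.upper_spec (Or.inr hx)).1
    rwa [← upper_cut h h3.1 h3.2] at this

theorem exists_up_down (hs : s.Closed) (h : Surgerable s i j) :
    ∃ p q, ((p = i ∧ q = j) ∨ (p = j ∧ q = i)) ∧ s.mid.node p = some (Node.arc q) ∧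
      s.label (Vertex.bot p) = some Label.up ∧ s.label (Vertex.bot q) = some Label.down := by
  have h1 := (hs.consistent.mid_arc i j h.2.1).1
  rcases h1 with h1 | h1
  · exact ⟨j, i, Or.inr ⟨rfl, rfl⟩, (s.mid.arc_symm i j h.2.1).2, h1.2, h1.1⟩
  · exact ⟨i, j, Or.inl ⟨rfl, rfl⟩, h.2.1, h1.1, h1.2⟩

theorem exists_up_down_top (hs : s.Closed) (h : Surgerable s i j) :
    ∃ p q, ((p = i ∧ q = j) ∨ (p = j ∧ q = i)) ∧ s.mid.node p = some (Node.arc q) ∧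
      s.label (Vertex.top p) = some Label.up ∧ s.label (Vertex.top q) = some Label.down := by
  have h1 := (hs.consistent.mid_arc i j h.2.1).2
  rcases h1 with h1 | h1
  · exact ⟨j, i, Or.inr ⟨rfl, rfl⟩, (s.mid.arc_symm i j h.2.1).2, h1.2, h1.1⟩
  · exact ⟨i, j, Or.inl ⟨rfl, rfl⟩, h.2.1, h1.1, h1.2⟩

/-- Starting from the end labelled `∨` one runs away from the cap around the rest of the circle
until the other end is reached. The cap is not used on the way, and the cup lies on a different
circle. -/
theorem cut_conn_pair_bot (hs : s.Closed) (h : Surgerable s i j)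
    (hn : ¬ s.Conn (Vertex.bot i) (Vertex.top i)) :
    (s.cut i j).Conn (Vertex.bot i) (Vertex.bot j) := by
  obtain ⟨p, q, hpq, hm, hp, hq⟩ := hs.exists_up_down h
  suffices H : (s.cut i j).Conn (Vertex.bot q) (Vertex.bot p) by
    rcases hpq with ⟨rfl, rfl⟩ | ⟨rfl, rfl⟩
    · exact H.symm
    · exact H
  have hcon : s.Conn (Vertex.bot q) (Vertex.bot p) := (Skeleton.Adj.mid_cap p q hm).symm.conn
  have hpath := path_of_sameCycle hs.next (hs.finite_cycle (Or.inl hq))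
    (hs.conn_iff_sameCycle.mp hcon)
  -- The path never leaves the end labelled `∧`, which is where `next` would traverse the cap.
  refine Relation.ReflTransGen.mono ?_ _ _ hpath
  rintro x y ⟨rfl, hx, hc⟩
  have hc := hs.conn_iff_sameCycle.mpr hc
  have hb : s.Conn (Vertex.bot i) x := by
    rcases hpq with ⟨rfl, rfl⟩ | ⟨rfl, rfl⟩
    · exact hcon.symm.trans hc
    · exact hc
  refine hs.cut_adj_next h (hs.consistent.conn_arrow hc (Or.inl hq)) ?_ ?_
  · intro hl
    have h2 : x ≠ Vertex.bot q := by
      rintro rfl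
      rw [hq] at hl
      simp at hl
    rcases hpq with ⟨rfl, rfl⟩ | ⟨rfl, rfl⟩
    · exact ⟨hx, h2⟩
    · exact ⟨h2, hx⟩
  · intro hl
    constructor
    · rintro rfl
      exact hn hb
    · rintro rfl
      exact hn (hb.trans (Skeleton.conn_pair_top h).symm)

/-- The cup is left downwards at its `∨` end, so here the run starts at the end labelled `∧`. -/
theorem cut_conn_pair_top (hs : s.Closed) (h : Surgerable s i j)
    (hn : ¬ s.Conn (Vertex.bot i) (Vertex.top i)) :
    (s.cut i j).Conn (Vertex.top i) (Vertex.top j) := by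
  obtain ⟨p, q, hpq, hm, hp, hq⟩ := hs.exists_up_down_top h
  suffices H : (s.cut i j).Conn (Vertex.top p) (Vertex.top q) by
    rcases hpq with ⟨rfl, rfl⟩ | ⟨rfl, rfl⟩
    · exact H
    · exact H.symm
  have hcon : s.Conn (Vertex.top p) (Vertex.top q) := (Skeleton.Adj.mid_cup p q hm).conn
  have hpath := path_of_sameCycle hs.next (hs.finite_cycle (Or.inr hp))
    (hs.conn_iff_sameCycle.mp hcon)
  refine Relation.ReflTransGen.mono ?_ _ _ hpath
  rintro x y ⟨rfl, hx, hc⟩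
  have hc := hs.conn_iff_sameCycle.mpr hc
  have hb : s.Conn (Vertex.top i) x := by
    rcases hpq with ⟨rfl, rfl⟩ | ⟨rfl, rfl⟩
    · exact hc
    · exact hcon.symm.trans hc
  refine hs.cut_adj_next h (hs.consistent.conn_arrow hc (Or.inr hp)) ?_ ?_
  · intro hl
    constructor
    · rintro rfl
      exact hn hb.symm
    · rintro rfl
      exact hn ((Skeleton.conn_pair_bot h).trans hb.symm)
  · intro hl
    have h2 : x ≠ Vertex.top p := by
      rintro rfl
      rw [hp] at hl
      simp at hl
    rcases hpq with ⟨rfl, rfl⟩ | ⟨rfl, rfl⟩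
    · exact ⟨h2, hx⟩
    · exact ⟨hx, h2⟩

/-- Two circles get merged. -/
theorem cut_conn_merge (hs : s.Closed) (h : Surgerable s i j)
    (hn : ¬ s.Conn (Vertex.bot i) (Vertex.top i)) {v w : Vertex} (hvw : s.Conn v w) :
    (s.cut i j).Conn v w := by
  induction hvw with
  | refl => exact Skeleton.Conn.refl v
  | tail _ hxy ih =>
    refine ih.trans ?_
    rcases hxy.cut h with h1 | h1
    · exact h1.conn
    · have b := hs.cut_conn_pair_bot h hn
      have t := hs.cut_conn_pair_top h hn
      rcases h1 with ⟨rfl, rfl⟩ | ⟨rfl, rfl⟩ | ⟨rfl, rfl⟩ | ⟨rfl, rfl⟩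
      · exact b
      · exact b.symm
      · exact t
      · exact t.symm

/-- One circle is split into two. -/
theorem cut_conn_split (hs : s.Closed) (h : Surgerable s i j)
    (hc : s.Conn (Vertex.bot i) (Vertex.top i)) :
    ¬ (s.cut i j).Conn (Vertex.bot i) (Vertex.bot j) := by
  have hl := hs.label_eq_of_conn h hc
  have hT := hs.cut h hl
  obtain ⟨p, q, hpq, hm, hp, hq⟩ := hs.exists_up_down h
  have hr : (s.mid.cut i j).node p = some Node.ray ∧ (s.mid.cut i j).node q = some Node.ray := by
    rcases hpq with ⟨rfl, rfl⟩ | ⟨rfl, rfl⟩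
    · exact ⟨ArcDiagram.cut_left h, ArcDiagram.cut_right h⟩
    · exact ⟨ArcDiagram.cut_right h, ArcDiagram.cut_left h⟩
  have hm' := (s.mid.arc_symm p q hm).2
  have htq : s.label (Vertex.top q) = some Label.down :=
    ((hT.consistent.mid_ray q hr.2).1.symm.trans hq :)
  have hne : Vertex.bot p ≠ Vertex.top q := by simp
  -- From `bot p`, labelled `∧`, the new segment leads up to `top p`, where the cup used to lead
  -- from `top q`. Likewise `top q`, labelled `∨`, now leads down to `bot q`, where the cap used to
  -- lead from `bot p`. Nothing else changes.
  have hswap : hT.next = hs.next * Equiv.swap (Vertex.bot p) (Vertex.top q) := by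
    ext x
    rw [Equiv.Perm.mul_apply]
    by_cases h1 : x = Vertex.bot p
    · subst h1
      rw [Equiv.swap_apply_left, hs.next_down htq, hT.next_up (by rw [Stack.cut_label]; exact hp)]
      rw [Skeleton.upper_ray hr.1]
      simp [Skeleton.lower, hm', ArcDiagram.partner_eq hm']
    by_cases h2 : x = Vertex.top q
    · subst h2
      rw [Equiv.swap_apply_right, hs.next_up hp, hT.next_down (by rw [Stack.cut_label]; exact htq)]
      rw [Skeleton.lower_ray hr.2]
      simp [Skeleton.upper, hm, ArcDiagram.partner_eq hm]
    rw [Equiv.swap_apply_of_ne_of_ne h1 h2]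
    by_cases hx : s.Arrow x
    · rcases hx with hx | hx
      · rw [hs.next_down hx, hT.next_down (by rw [Stack.cut_label]; exact hx)]
        have h3 : x ≠ Vertex.top p := by
          rintro rfl
          have := ((hT.consistent.mid_ray p hr.1).1.symm.trans hp :)
          rw [show s.label (Vertex.top p) = some Label.up from this] at hx
          simp at hx
        rcases hpq with ⟨rfl, rfl⟩ | ⟨rfl, rfl⟩
        · rw [lower_cut h h3 h2]
        · rw [lower_cut h h2 h3]
      · rw [hs.next_up hx, hT.next_up (by rw [Stack.cut_label]; exact hx)]
        have h3 : x ≠ Vertex.bot q := by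
          rintro rfl
          rw [hq] at hx
          simp at hx
        rcases hpq with ⟨rfl, rfl⟩ | ⟨rfl, rfl⟩
        · rw [upper_cut h h1 h3]
        · rw [upper_cut h h3 h1]
    · rw [hs.next_of_not_arrow hx, hT.next_of_not_arrow]
      unfold Stack.Arrow
      rwa [Stack.cut_label]
  have hcon : s.Conn (Vertex.bot p) (Vertex.top q) := by
    rcases hpq with ⟨rfl, rfl⟩ | ⟨rfl, rfl⟩
    · exact hc.trans (Skeleton.conn_pair_top h)
    · exact (Skeleton.conn_pair_bot h).symm.trans hc
  have key := not_sameCycle_mul_swap hs.next (hs.finite_cycle (Or.inr hp)) hne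
    (hs.conn_iff_sameCycle.mp hcon)
  rw [← hswap, ← hT.conn_iff_sameCycle] at key
  intro hbad
  apply key
  have hbad' : (s.cut i j).Conn (Vertex.bot p) (Vertex.bot q) := by
    rcases hpq with ⟨rfl, rfl⟩ | ⟨rfl, rfl⟩
    · exact hbad
    · exact hbad.symm
  exact hbad'.trans (Skeleton.Adj.up q hr.2).conn

end Stack.Closed

end DiagramAlgebra

namespace DiagramAlgebra

/-! ## Reversing circles -/

/-- Exchange `∨` and `∧`. -/
def swapLabel : Option Label → Option Label
  | some Label.down => some Label.up
  | some Label.up => some Label.down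
  | x => x

theorem swapLabel_eq_none {x : Option Label} : swapLabel x = none ↔ x = none := by
  rcases x with _ | ⟨_ | _ | _ | _⟩ <;> simp [swapLabel]

theorem Opposite.swapLabel {x y : Option Label} (h : Opposite x y) :
    Opposite (swapLabel x) (swapLabel y) := by
  rcases h with ⟨rfl, rfl⟩ | ⟨rfl, rfl⟩ <;> simp [Opposite, DiagramAlgebra.swapLabel]

theorem swapLabel_of_not_arrow {x : Option Label} (h : x = some Label.nought ∨ x = some Label.cross) :
    swapLabel x = x := by
  rcases h with rfl | rfl <;> rfl

/-- Change the labels of a bounded weight. -/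
def Weight.relabel (w : Weight) (hb : w.Bounded) (f : ℤ → Option Label)
    (hf : ∀ p, f p = none ↔ w.label p = none) : Weight where
  label := f
  ordConnected := by
    have : {i | f i ≠ none} = {i | w.label i ≠ none} := by
      ext i
      exact (hf i).not
    rw [this]
    exact w.ordConnected
  eventually_sorted := by
    refine ⟨{i | w.label i ≠ none}, hb, ?_⟩
    intro i j hi _ _ hc
    apply hi
    change w.label i ≠ none
    rw [Ne, ← hf, hc.1]
    simp

theorem Stack.ext_of_label {s t : Stack} (h : s.toSkeleton = t.toSkeleton)
    (hl : ∀ v, s.label v = t.label v) : s = t := by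
  have hb : s.wBot = t.wBot := Weight.ext (funext fun k => hl (Vertex.bot k))
  have ht : s.wTop = t.wTop := Weight.ext (funext fun k => hl (Vertex.top k))
  rcases s with ⟨_, _, _⟩
  rcases t with ⟨_, _, _⟩
  simp only at h hb ht
  subst h hb ht
  rfl

theorem Stack.HasType.congr {s t : Stack} {v : Vertex} (hline : s.OnLine v ↔ t.OnLine v)
    (hcomp : s.comp v = t.comp v) (hl : ∀ u ∈ s.comp v, s.label u = t.label u) {A : CompType}
    (h : s.HasType v A) : t.HasType v A := by
  have hc : ∀ u, s.Conn v u ↔ t.Conn v u := fun u => by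
    change u ∈ s.comp v ↔ u ∈ t.comp v
    rw [hcomp]
  have hlm : ∀ u, s.Leftmost v u → t.Leftmost v u := fun u hu =>
    ⟨(hc u).mp hu.1, fun u' hu' => hu.2 u' ((hc u').mpr hu')⟩
  cases h with
  | one u h1 h2 h3 => exact HasType.one u (hline.not.mp h1) (hlm u h2) ((hl u h2.1).symm.trans h3)
  | x u h1 h2 h3 => exact HasType.x u (hline.not.mp h1) (hlm u h2) ((hl u h2.1).symm.trans h3)
  | y h1 => exact HasType.y (hline.mp h1)

namespace Stack.Closed

variable {s : Stack}

theorem bounded_top (hs : s.Closed) : s.wTop.Bounded := by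
  refine Set.Finite.subset hs.bounded fun i hi => ?_
  exact (hs.label_ne_iff (Vertex.top i)).mp hi

/-- Reverse the orientation of some circles. -/
def flip (hs : s.Closed) (D : Set Vertex) : Stack where
  toSkeleton := s.toSkeleton
  wBot := s.wBot.relabel hs.bounded
    (fun p => if Vertex.bot p ∈ D then swapLabel (s.wBot.label p) else s.wBot.label p) (by
      intro p
      split_ifs
      · exact swapLabel_eq_none
      · exact Iff.rfl)
  wTop := s.wTop.relabel hs.bounded_top
    (fun p => if Vertex.top p ∈ D then swapLabel (s.wTop.label p) else s.wTop.label p) (by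
      intro p
      split_ifs
      · exact swapLabel_eq_none
      · exact Iff.rfl)

theorem flip_label (hs : s.Closed) (D : Set Vertex) (v : Vertex) :
    (hs.flip D).label v = if v ∈ D then swapLabel (s.label v) else s.label v := by
  cases v <;> rfl

theorem flip_closed (hs : s.Closed) {D : Set Vertex} (hD : s.Stable D) : (hs.flip D).Closed := by
  have hopp : ∀ v w, s.Adj v w → Opposite (s.label v) (s.label w) →
      Opposite ((hs.flip D).label v) ((hs.flip D).label w) := by
    intro v w hvw ho
    rw [flip_label, flip_label]
    by_cases hv : v ∈ D
    · rw [if_pos hv, if_pos ((hD.adj_iff hvw).mp hv)]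
      exact ho.swapLabel
    · rw [if_neg hv, if_neg ((hD.adj_iff hvw).not.mp hv)]
      exact ho
  have hnone : ∀ v, (hs.flip D).label v = none ↔ s.label v = none := by
    intro v
    rw [flip_label]
    split_ifs
    · exact swapLabel_eq_none
    · exact Iff.rfl
  have hfree : ∀ v, (s.label v = some Label.nought ∨ s.label v = some Label.cross) →
      (hs.flip D).label v = s.label v := by
    intro v hv
    rw [flip_label]
    split_ifs
    · exact swapLabel_of_not_arrow hv
    · rfl
  refine ⟨⟨⟨?_, ?_, ?_, ?_, ?_⟩, ⟨?_, ?_, ?_, ?_, ?_⟩, ?_, ?_, ?_, ?_⟩, hs.bot, hs.top, ?_⟩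
  · intro i
    exact (hs.consistent.bot.line i).trans (hnone (Vertex.bot i)).symm
  · intro i hi
    have h1 := hs.consistent.bot.free i hi
    have h2 := hfree (Vertex.bot i) h1
    change (hs.flip D).label (Vertex.bot i) = _ ∨ (hs.flip D).label (Vertex.bot i) = _
    rw [h2]
    exact h1
  · intro i j hij
    exact hopp _ _ (Skeleton.Adj.bot_cup i j hij) (hs.consistent.bot.arc i j hij)
  · intro i hi
    exact absurd hi (hs.bot i)
  · intro i j hi
    exact absurd hi (hs.bot i)
  · intro i
    exact (hs.consistent.top.line i).trans (hnone (Vertex.top i)).symm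
  · intro i hi
    have h1 := hs.consistent.top.free i hi
    have h2 := hfree (Vertex.top i) h1
    change (hs.flip D).label (Vertex.top i) = _ ∨ (hs.flip D).label (Vertex.top i) = _
    rw [h2]
    exact h1
  · intro i j hij
    exact hopp _ _ (Skeleton.Adj.top_cap i j hij) (hs.consistent.top.arc i j hij)
  · intro i hi
    exact absurd hi (hs.top i)
  · intro i j hi
    exact absurd hi (hs.top i)
  · intro i
    have := hs.consistent.mid_line i
    exact ⟨this.1.trans (hnone (Vertex.bot i)).symm, this.2.trans (hnone (Vertex.top i)).symm⟩
  · intro i hi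
    have h1 := hs.consistent.mid_free i hi
    have h2 := hfree (Vertex.bot i) h1.2
    have h3 := hfree (Vertex.top i) (by
      change s.wTop.label i = _ ∨ s.wTop.label i = _
      rw [← h1.1]
      exact h1.2)
    change (hs.flip D).label (Vertex.bot i) = (hs.flip D).label (Vertex.top i) ∧
      ((hs.flip D).label (Vertex.bot i) = _ ∨ (hs.flip D).label (Vertex.bot i) = _)
    rw [h2, h3]
    exact h1
  · intro i j hij
    exact ⟨hopp _ _ (Skeleton.Adj.mid_cap i j hij) (hs.consistent.mid_arc i j hij).1,
      hopp _ _ (Skeleton.Adj.mid_cup i j hij) (hs.consistent.mid_arc i j hij).2⟩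
  · intro i hi
    have h1 := hs.consistent.mid_ray i hi
    have h2 := hD.adj_iff (Skeleton.Adj.up i hi)
    have h3 : s.label (Vertex.bot i) = s.label (Vertex.top i) := h1.1
    have h4 : s.Arrow (Vertex.bot i) := h1.2
    change (hs.flip D).label (Vertex.bot i) = (hs.flip D).label (Vertex.top i) ∧
      ((hs.flip D).label (Vertex.bot i) = _ ∨ (hs.flip D).label (Vertex.bot i) = _)
    simp only [flip_label, h2, h3, true_and]
    rw [Stack.Arrow, h3] at h4
    rcases h4 with h4 | h4 <;> split_ifs <;> simp [h4, swapLabel]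
  · refine Set.Finite.subset hs.bounded fun i hi => ?_
    exact (hnone (Vertex.bot i)).not.mp hi

theorem flip_hasType (hs : s.Closed) {D : Set Vertex} (hD : s.Stable D) {v : Vertex} (hv : v ∈ D) :
    (s.HasType v CompType.one → (hs.flip D).HasType v CompType.x) ∧
      (s.HasType v CompType.x → (hs.flip D).HasType v CompType.one) := by
  constructor
  · rintro ⟨u, h1, h2, h3⟩
    refine HasType.x u h1 h2 ?_
    rw [flip_label, if_pos (hD.conn h2.1 hv), h3]
    rfl
  · rintro ⟨⟩
    rename_i u h1 h2 h3
    refine HasType.one u h1 h2 ?_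
    rw [flip_label, if_pos (hD.conn h2.1 hv), h3]
    rfl

theorem flip_hasType_of_not_mem (hs : s.Closed) {D : Set Vertex} (hD : s.Stable D) {v : Vertex}
    (hv : v ∉ D) {A : CompType} (h : s.HasType v A) : (hs.flip D).HasType v A := by
  refine Stack.HasType.congr (s := s) (t := hs.flip D) (v := v) Iff.rfl rfl (fun u hu => ?_) h
  rw [flip_label, if_neg ((hD.conn_iff hu).not.mp hv)]

/-- The orientation of a circle is determined by its type. -/
theorem label_eq_of_hasType {t : Stack} (hs : s.Closed) (ht : t.Closed)
    (h : s.toSkeleton = t.toSkeleton) {v : Vertex} (hv : s.Arrow v) (hv' : t.Arrow v) {A : CompType}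
    (h1 : s.HasType v A) (h2 : t.HasType v A) {u : Vertex} (hu : s.Conn v u) :
    s.label u = t.label u := by
  obtain ⟨m, hm⟩ := hs.exists_leftmost hv
  have hm' : t.Leftmost v m := by
    unfold Leftmost at hm ⊢
    rwa [← h]
  have w1 := hs.winds_aux hm
  have w2 := ht.winds_aux hm'
  have key : val (s.label m) = val (t.label m) := by
    cases A with
    | one =>
      exact (hs.winds_unique hv w1 ((hs.hasType_one_iff hv).mp h1)).trans
        (ht.winds_unique hv' w2 ((ht.hasType_one_iff hv').mp h2)).symm
    | x =>
      exact (hs.winds_unique hv w1 ((hs.hasType_x_iff hv).mp h1)).trans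
        (ht.winds_unique hv' w2 ((ht.hasType_x_iff hv').mp h2)).symm
    | y => exact absurd h1 (hs.not_hasType_y v)
  have hl := Weight.label_eq_of_val (hs.consistent.conn_arrow hm.1 hv)
    (ht.consistent.conn_arrow hm'.1 hv') key
  exact hs.consistent.propagate ht.consistent h (hm.1.symm.trans hu) hl

/-! ## The outcomes of a surgery on a closed diagram -/

variable {i j : ℤ}

/-- A closed diagram obtained by a surgery and some re-orientation of the new components. -/
structure _root_.DiagramAlgebra.Reoriented (s : Stack) (i j : ℤ) (t : Stack) : Prop where
  closed : t.Closed
  skeleton : t.toSkeleton = s.toSkeleton.cut i j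
  unchanged : ∀ v, ¬ t.Conn (Vertex.bot i) v → ¬ t.Conn (Vertex.bot j) v → t.label v = s.label v

theorem _root_.DiagramAlgebra.Reoriented.of_outcome {t : Stack} (hs : s.Closed) (h : Surgerable s i j)
    (ho : Outcome s i j t) : Reoriented s i j t := by
  refine ⟨⟨ho.consistent, ?_, ?_, ?_⟩, ho.toSkeleton_eq h, ho.unchanged⟩
  · rw [ho.bot]
    exact hs.bot
  · rw [ho.top]
    exact hs.top
  · refine Set.Finite.subset hs.bounded fun p hp => ?_
    change s.wBot.label p ≠ none
    rwa [Ne, ← (hs.consistent.mid_line p).1, ← ArcDiagram.cut_none h, ← ho.mid_eq h,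
      (ho.consistent.mid_line p).1]

theorem _root_.DiagramAlgebra.Reoriented.outcome {t : Stack} (h : Surgerable s i j)
    (ht : Reoriented s i j t) (hrule : Rule s i j t) : Outcome s i j t := by
  refine Outcome.of_toSkeleton h ht.skeleton ht.closed.consistent ht.unchanged ?_ hrule
  intro v hv
  cases v with
  | bot p => exact absurd hv (ht.closed.bot p)
  | top p => exact absurd hv (ht.closed.top p)

theorem _root_.DiagramAlgebra.Reoriented.conn_iff {t : Stack} (ht : Reoriented s i j t) (v w : Vertex) :
    t.Conn v w ↔ (s.toSkeleton.cut i j).Conn v w := by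
  rw [ht.skeleton]

theorem _root_.DiagramAlgebra.Reoriented.arrow_left {t : Stack} (h : Surgerable s i j)
    (ht : Reoriented s i j t) : t.Arrow (Vertex.bot i) := by
  refine ht.closed.consistent.adj_arrow (w := Vertex.top i) ?_
  rw [ht.skeleton]
  exact Skeleton.cut_adj_left h

theorem _root_.DiagramAlgebra.Reoriented.arrow_right {t : Stack} (h : Surgerable s i j)
    (ht : Reoriented s i j t) : t.Arrow (Vertex.bot j) := by
  refine ht.closed.consistent.adj_arrow (w := Vertex.top j) ?_
  rw [ht.skeleton]
  exact Skeleton.cut_adj_right h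

theorem _root_.DiagramAlgebra.Reoriented.arrow_iff {t : Stack} (hs : s.Closed) (h : Surgerable s i j)
    (ht : Reoriented s i j t) (v : Vertex) : t.Arrow v ↔ s.Arrow v := by
  have key : ∀ p, (p = i ∨ p = j) → t.Conn (Vertex.bot p) v → (t.Arrow v ↔ s.Arrow v) := by
    intro p hp hv
    have h1 : t.Arrow (Vertex.bot p) := by
      rcases hp with rfl | rfl
      · exact ht.arrow_left h
      · exact ht.arrow_right h
    have h2 : s.Arrow (Vertex.bot p) := by
      rcases hp with rfl | rfl
      · exact hs.arrow_bot_left h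
      · exact hs.arrow_bot_right h
    refine iff_of_true (ht.closed.consistent.conn_arrow hv h1) ?_
    rw [ht.conn_iff] at hv
    rcases hv.of_cut h with h3 | ⟨-, h3⟩ | ⟨-, h3⟩
    · exact hs.consistent.conn_arrow h3 h2
    · exact hs.consistent.conn_arrow h3 (hs.arrow_top_left h)
    · exact hs.consistent.conn_arrow h3 (hs.arrow_bot_left h)
  by_cases h1 : t.Conn (Vertex.bot i) v
  · exact key i (Or.inl rfl) h1
  by_cases h2 : t.Conn (Vertex.bot j) v
  · exact key j (Or.inr rfl) h2
  unfold Stack.Arrow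
  rw [ht.unchanged v h1 h2]

theorem _root_.DiagramAlgebra.Reoriented.label_of_not_arrow {t : Stack} (hs : s.Closed)
    (h : Surgerable s i j) (ht : Reoriented s i j t) {v : Vertex} (hv : ¬ s.Arrow v) :
    t.label v = s.label v := by
  rw [← ht.arrow_iff hs h] at hv
  refine ht.unchanged v ?_ ?_
  · intro hc
    exact hv (ht.closed.consistent.conn_arrow hc (ht.arrow_left h))
  · intro hc
    exact hv (ht.closed.consistent.conn_arrow hc (ht.arrow_right h))

/-- A closed circle is oriented by its type, the new circles pass through `bot i` or `bot j`, and
all other labels are those of `s`. -/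
theorem _root_.DiagramAlgebra.Reoriented.eq {t t' : Stack} (h : Surgerable s i j)
    (ht : Reoriented s i j t) (ht' : Reoriented s i j t') {A B : CompType}
    (h1 : t.HasType (Vertex.bot i) A) (h1' : t'.HasType (Vertex.bot i) A)
    (h2 : t.HasType (Vertex.bot j) B) (h2' : t'.HasType (Vertex.bot j) B) : t = t' := by
  have hs := ht.skeleton.trans ht'.skeleton.symm
  refine Stack.ext_of_label hs fun v => ?_
  by_cases hi : t.Conn (Vertex.bot i) v
  · exact ht.closed.label_eq_of_hasType ht'.closed hs (ht.arrow_left h) (ht'.arrow_left h) h1 h1' hi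
  by_cases hj : t.Conn (Vertex.bot j) v
  · exact ht.closed.label_eq_of_hasType ht'.closed hs (ht.arrow_right h) (ht'.arrow_right h)
      h2 h2' hj
  rw [ht.unchanged v hi hj, ht'.unchanged v (by rwa [← hs]) (by rwa [← hs])]

theorem _root_.DiagramAlgebra.Reoriented.flip {t : Stack} (ht : Reoriented s i j t) {p : ℤ}
    (hp : p = i ∨ p = j) : Reoriented s i j (ht.closed.flip (t.comp (Vertex.bot p))) := by
  refine ⟨ht.closed.flip_closed (t.stable_comp _), ht.skeleton, ?_⟩
  intro v hi hj
  rw [flip_label, if_neg]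
  · exact ht.unchanged v hi hj
  · rcases hp with rfl | rfl
    · exact hi
    · exact hj

/-- If the labels at `i` agree on both lines, all labels can be kept. Otherwise cap and cup lie on
different circles, by `label_eq_of_conn`, and reversing the circle of the cap makes the labels
agree. -/
theorem exists_reoriented (hs : s.Closed) (h : Surgerable s i j) : ∃ t, Reoriented s i j t := by
  by_cases hl : s.wBot.label i = s.wTop.label i
  · exact ⟨s.cut i j, hs.cut h hl, rfl, fun v _ _ => s.cut_label i j v⟩
  have hn : ¬ s.Conn (Vertex.bot i) (Vertex.top i) := fun hc => hl (hs.label_eq_of_conn h hc)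
  have hD := s.stable_comp (Vertex.bot i)
  have hf := hs.flip_closed hD
  have hl' : (hs.flip (s.comp (Vertex.bot i))).wBot.label i =
      (hs.flip (s.comp (Vertex.bot i))).wTop.label i := by
    change (hs.flip (s.comp (Vertex.bot i))).label (Vertex.bot i) =
      (hs.flip (s.comp (Vertex.bot i))).label (Vertex.top i)
    rw [flip_label, flip_label, if_pos (show _ ∈ _ from Skeleton.Conn.refl _),
      if_neg (show ¬ _ ∈ _ from hn)]
    have h1 := hs.arrow_bot_left h
    have h2 := hs.arrow_top_left h
    have h3 : s.label (Vertex.bot i) ≠ s.label (Vertex.top i) := hl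
    rcases h1 with h1 | h1 <;> rcases h2 with h2 | h2 <;> simp [h1, h2, swapLabel] at h3 ⊢
  refine ⟨(hs.flip (s.comp (Vertex.bot i))).cut i j, hf.cut h hl', rfl, ?_⟩
  intro v hv _
  -- The reversed circle becomes part of the merged one, so labels away from the new component are
  -- untouched.
  rw [Stack.cut_label, flip_label, if_neg]
  intro hc
  exact hv (hs.cut_conn_merge h hn hc)

/-- Each new circle is reversed if it has the wrong type. On a single merged circle only one type
can be prescribed, which explains the condition on `C`. -/
theorem exists_reoriented_types (hs : s.Closed) (h : Surgerable s i j) (B C : CompType)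
    (hB : B ≠ CompType.y) (hC : C ≠ CompType.y) : ∃ t, Reoriented s i j t ∧
      t.HasType (Vertex.bot i) B ∧ (¬ t.Conn (Vertex.bot i) (Vertex.bot j) →
        t.HasType (Vertex.bot j) C) := by
  have key : ∀ p, (p = i ∨ p = j) → ∀ D, D ≠ CompType.y → ∀ t, Reoriented s i j t →
      ∃ t', Reoriented s i j t' ∧ t'.HasType (Vertex.bot p) D ∧
        ∀ v A, ¬ t.Conn (Vertex.bot p) v → t.HasType v A → t'.HasType v A := by
    intro p hp D hD t ht
    have ha : t.Arrow (Vertex.bot p) := by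
      rcases hp with rfl | rfl
      · exact ht.arrow_left h
      · exact ht.arrow_right h
    by_cases h1 : t.HasType (Vertex.bot p) D
    · exact ⟨t, ht, h1, fun v A _ h => h⟩
    refine ⟨_, ht.flip hp, ?_, ?_⟩
    · have h2 := ht.closed.flip_hasType (t.stable_comp (Vertex.bot p)) (Skeleton.Conn.refl _)
      have h3 := ht.closed.hasType_cases ha
      cases D with
      | one => exact h2.2 (h3.resolve_left h1)
      | x => exact h2.1 (h3.resolve_right h1)
      | y => exact absurd rfl hD
    · intro v A hv hA
      exact ht.closed.flip_hasType_of_not_mem (t.stable_comp _) hv hA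
  obtain ⟨t0, h0⟩ := hs.exists_reoriented h
  obtain ⟨t1, h1, h2, -⟩ := key i (Or.inl rfl) B hB t0 h0
  by_cases hc : t1.Conn (Vertex.bot i) (Vertex.bot j)
  · exact ⟨t1, h1, h2, fun h => absurd hc h⟩
  obtain ⟨t2, h3, h4, h5⟩ := key j (Or.inr rfl) C hC t1 h1
  exact ⟨t2, h3, h5 _ _ (fun hc' => hc hc'.symm) h2, fun _ => h4⟩

theorem hasType_conn (hs : s.Closed) {v w : Vertex} (hv : s.Arrow v) (h : s.Conn v w) {A : CompType}
    (hA : s.HasType v A) : s.HasType w A := by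
  have hw := hs.consistent.conn_arrow h hv
  cases A with
  | one =>
    rw [hs.hasType_one_iff hw, ← comp_eq h]
    exact (hs.hasType_one_iff hv).mp hA
  | x =>
    rw [hs.hasType_x_iff hw, ← comp_eq h]
    exact (hs.hasType_x_iff hv).mp hA
  | y => exact absurd hA (hs.not_hasType_y v)

theorem hasType_unique (hs : s.Closed) {v : Vertex} (hv : s.Arrow v) {A B : CompType}
    (hA : s.HasType v A) (hB : s.HasType v B) : A = B := by
  cases A <;> cases B <;> first | rfl | exact (hs.not_hasType_y v ‹_›).elim |
    exact (hs.not_one_and_x hv ‹_› ‹_›).elim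

/-- An orientation of the merged circle with the prescribed type exists, and by `Reoriented.eq`
there is no other, as `bot i` and `bot j` lie on the same circle. The hypothesis `hABC` says that
the rule has just one result. -/
theorem outcome_merge (hs : s.Closed) (h : Surgerable s i j)
    (hn : ¬ s.Conn (Vertex.bot i) (Vertex.top i)) {A B C : CompType}
    (hA : s.HasType (Vertex.bot i) A) (hB : s.HasType (Vertex.top i) B)
    (hABC : ∀ C', MergeRule A B C' ↔ C' = C) (hC : C ≠ CompType.y) :
    ∃ t, outcomes s i j = {t} ∧ Reoriented s i j t ∧ t.HasType (Vertex.bot i) C := by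
  obtain ⟨t, ht, h1, -⟩ := hs.exists_reoriented_types h C C hC hC
  have hcon : ∀ t', Reoriented s i j t' → t'.Conn (Vertex.bot i) (Vertex.bot j) := by
    intro t' ht'
    rw [ht'.conn_iff]
    exact hs.cut_conn_pair_bot h hn
  have htj := fun t' (ht' : Reoriented s i j t') {A} hA =>
    ht'.closed.hasType_conn (A := A) (ht'.arrow_left h) (hcon t' ht') hA
  have ho : Outcome s i j t :=
    ht.outcome h (Rule.merge A B C hn hA hB ((hABC C).mpr rfl) h1)
  refine ⟨t, ?_, ht, h1⟩
  have : (outcome_finite s i j).toFinset = {t} := by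
    ext t'
    simp only [Set.Finite.mem_toFinset, Finset.mem_singleton]
    constructor
    · intro (ho' : Outcome s i j t')
      have ht' := Reoriented.of_outcome hs h ho'
      suffices hC' : t'.HasType (Vertex.bot i) C from
        ht'.eq h ht hC' h1 (htj t' ht' hC') (htj t ht h1)
      rcases ho'.rule with ⟨A', B', C', -, a, b, c, d⟩ | ⟨A', B', C', a, -⟩ | ⟨-, a, -⟩
      · have e1 := hs.hasType_unique (hs.arrow_bot_left h) a hA
        have e2 := hs.hasType_unique (hs.arrow_top_left h) b hB
        subst e1 e2
        rwa [(hABC C').mp c] at d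
      · exact absurd a hn
      · exact absurd a (hs.not_hasType_y _)
    · rintro rfl
      exact ho
  unfold outcomes
  rw [this]
  rfl

theorem outcome_merge_zero (hs : s.Closed) (h : Surgerable s i j)
    (hn : ¬ s.Conn (Vertex.bot i) (Vertex.top i))
    (hA : s.HasType (Vertex.bot i) CompType.x) (hB : s.HasType (Vertex.top i) CompType.x) :
    outcomes s i j = 0 := by
  have : (outcome_finite s i j).toFinset = ∅ := by
    rw [Set.Finite.toFinset_eq_empty]
    ext t'
    simp only [Set.mem_empty_iff_false, iff_false]
    intro (ho' : Outcome s i j t')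
    rcases ho'.rule with ⟨A', B', C', -, a, b, c, d⟩ | ⟨A', B', C', a, -⟩ | ⟨-, a, -⟩
    · have e1 := hs.hasType_unique (hs.arrow_bot_left h) a hA
      have e2 := hs.hasType_unique (hs.arrow_top_left h) b hB
      subst e1 e2
      cases c
    · exact absurd a hn
    · exact absurd a (hs.not_hasType_y _)
  unfold outcomes
  rw [this]
  rfl

theorem split_rule {t : Stack} (hs : s.Closed) (h : Surgerable s i j)
    (hc : s.Conn (Vertex.bot i) (Vertex.top i)) {A : CompType} (hA : s.HasType (Vertex.bot i) A)
    (ho : Outcome s i j t) : ∃ B C, SplitRule A B C ∧ t.HasType (Vertex.bot i) B ∧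
      t.HasType (Vertex.bot j) C := by
  rcases ho.rule with ⟨A', B', C', a, -⟩ | ⟨A', B', C', -, a, b, c, d⟩ | ⟨-, a, -⟩
  · exact absurd hc a
  · have e1 := hs.hasType_unique (hs.arrow_bot_left h) a hA
    subst e1
    exact ⟨B', C', b, c, d⟩
  · exact absurd a (hs.not_hasType_y _)

theorem merge_rule {t : Stack} (hs : s.Closed)
    (hn : ¬ s.Conn (Vertex.bot i) (Vertex.top i))
    (ho : Outcome s i j t) : ∃ A B C, MergeRule A B C ∧ s.HasType (Vertex.bot i) A ∧
      s.HasType (Vertex.top i) B ∧ t.HasType (Vertex.bot i) C := by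
  rcases ho.rule with ⟨A', B', C', -, a, b, c, d⟩ | ⟨A', B', C', a, -⟩ | ⟨-, a, -⟩
  · exact ⟨A', B', C', c, a, b, d⟩
  · exact absurd a hn
  · exact absurd a (hs.not_hasType_y _)

theorem exists_split (hs : s.Closed) (h : Surgerable s i j)
    (hc : s.Conn (Vertex.bot i) (Vertex.top i)) {A B C : CompType}
    (hA : s.HasType (Vertex.bot i) A) (hABC : SplitRule A B C) (hB : B ≠ CompType.y)
    (hC : C ≠ CompType.y) :
    ∃ t, Outcome s i j t ∧ Reoriented s i j t ∧ t.HasType (Vertex.bot i) B ∧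
      t.HasType (Vertex.bot j) C := by
  obtain ⟨t, ht, h1, h2⟩ := hs.exists_reoriented_types h B C hB hC
  have h2 := h2 (by
    rw [ht.conn_iff]
    exact hs.cut_conn_split h hc)
  exact ⟨t, ht.outcome h (Rule.split A B C hc hA hABC h1 h2), ht, h1, h2⟩

theorem outcome_split_x (hs : s.Closed) (h : Surgerable s i j)
    (hc : s.Conn (Vertex.bot i) (Vertex.top i)) (hA : s.HasType (Vertex.bot i) CompType.x) :
    ∃ t, outcomes s i j = {t} ∧ Reoriented s i j t ∧ t.HasType (Vertex.bot i) CompType.x ∧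
      t.HasType (Vertex.bot j) CompType.x := by
  obtain ⟨t, ho, ht, h1, h2⟩ := hs.exists_split h hc hA SplitRule.x (by simp) (by simp)
  refine ⟨t, ?_, ht, h1, h2⟩
  have : (outcome_finite s i j).toFinset = {t} := by
    ext t'
    simp only [Set.Finite.mem_toFinset, Finset.mem_singleton]
    constructor
    · intro (ho' : Outcome s i j t')
      obtain ⟨B, C, hr, hB, hC⟩ := hs.split_rule h hc hA ho'
      cases hr
      exact (Reoriented.of_outcome hs h ho').eq h ht hB h1 hC h2
    · rintro rfl
      exact ho
  unfold outcomes
  rw [this]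
  rfl

theorem outcome_split_one (hs : s.Closed) (h : Surgerable s i j)
    (hc : s.Conn (Vertex.bot i) (Vertex.top i)) (hA : s.HasType (Vertex.bot i) CompType.one) :
    ∃ t t', outcomes s i j = {t, t'} ∧
      (Reoriented s i j t ∧ t.HasType (Vertex.bot i) CompType.x ∧
        t.HasType (Vertex.bot j) CompType.one) ∧
      (Reoriented s i j t' ∧ t'.HasType (Vertex.bot i) CompType.one ∧
        t'.HasType (Vertex.bot j) CompType.x) := by
  obtain ⟨t, ho, ht, h1, h2⟩ := hs.exists_split h hc hA SplitRule.one_right (by simp) (by simp)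
  obtain ⟨t', ho', ht', h1', h2'⟩ :=
    hs.exists_split h hc hA SplitRule.one_left (by simp) (by simp)
  refine ⟨t, t', ?_, ⟨ht, h1, h2⟩, ⟨ht', h1', h2'⟩⟩
  -- Outcomes form a set, so the two summands of `1 ⊗ x + x ⊗ 1` have to be told apart.
  have hne : t ≠ t' := by
    rintro rfl
    exact ht.closed.not_one_and_x (ht.arrow_left h) h1' h1
  have : (outcome_finite s i j).toFinset = {t, t'} := by
    ext u
    simp only [Set.Finite.mem_toFinset, Finset.mem_singleton, Finset.mem_insert]
    constructor
    · intro (hu : Outcome s i j u)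
      obtain ⟨B, C, hr, hB, hC⟩ := hs.split_rule h hc hA hu
      have hu' := Reoriented.of_outcome hs h hu
      cases hr
      · exact Or.inr (hu'.eq h ht' hB h1' hC h2')
      · exact Or.inl (hu'.eq h ht hB h1 hC h2)
    · rintro (rfl | rfl)
      · exact ho
      · exact ho'
  unfold outcomes
  rw [this, Finset.insert_val_of_notMem (by simpa using hne)]
  rfl

end Stack.Closed

end DiagramAlgebra

namespace DiagramAlgebra

/-! ## The ring of a diagram -/

open MvPolynomial

namespace Skeleton

/-- The ideal identifying the variables of connected vertices, and killing their squares. -/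
def ideal (s : Skeleton) : Ideal (MvPolynomial Vertex ℤ) :=
  Ideal.span ({p | ∃ v w, s.Conn v w ∧ p = X v - X w} ∪ {p | ∃ v, p = X v * X v})

/-- Two polynomials represent the same element in the ring of the diagram. -/
def Cong (s : Skeleton) (f g : MvPolynomial Vertex ℤ) : Prop :=
  Ideal.Quotient.mk s.ideal f = Ideal.Quotient.mk s.ideal g

theorem cong_iff {s : Skeleton} {f g : MvPolynomial Vertex ℤ} : s.Cong f g ↔ f - g ∈ s.ideal :=
  Ideal.Quotient.mk_eq_mk_iff_sub_mem f g

theorem Cong.X {s : Skeleton} {v w : Vertex} (h : s.Conn v w) : s.Cong (X v) (X w) :=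
  cong_iff.mpr (Ideal.subset_span (Or.inl ⟨v, w, h, rfl⟩))

theorem Cong.sq (s : Skeleton) (v : Vertex) : s.Cong (MvPolynomial.X v * MvPolynomial.X v) 0 := by
  rw [cong_iff, sub_zero]
  exact Ideal.subset_span (Or.inr ⟨v, rfl⟩)

theorem Cong.mul_zero {s : Skeleton} {v w : Vertex} (h : s.Conn v w) :
    s.Cong (MvPolynomial.X v * MvPolynomial.X w) 0 := by
  have h1 := Cong.X h
  have h2 := Cong.sq s v
  unfold Cong at *
  rw [map_mul] at h2 ⊢
  rwa [← h1]

theorem Cong.mul {s : Skeleton} {f g f' g' : MvPolynomial Vertex ℤ} (h : s.Cong f g)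
    (h' : s.Cong f' g') : s.Cong (f * f') (g * g') := by
  unfold Cong at *
  rw [map_mul, map_mul, h, h']

theorem Cong.add {s : Skeleton} {f g f' g' : MvPolynomial Vertex ℤ} (h : s.Cong f g)
    (h' : s.Cong f' g') : s.Cong (f + f') (g + g') := by
  unfold Cong at *
  rw [map_add, map_add, h, h']

theorem Cong.refl {s : Skeleton} (f : MvPolynomial Vertex ℤ) : s.Cong f f := rfl

theorem Cong.sum_map {s : Skeleton} {α : Type*} (M : Multiset α)
    {f g : α → MvPolynomial Vertex ℤ} (h : ∀ a ∈ M, s.Cong (f a) (g a)) :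
    s.Cong (M.map f).sum (M.map g).sum := by
  induction M using Multiset.induction_on with
  | empty => exact Cong.refl _
  | cons a M ih =>
    rw [Multiset.map_cons, Multiset.map_cons, Multiset.sum_cons, Multiset.sum_cons]
    exact (h a (Multiset.mem_cons_self a M)).add
      (ih fun b hb => h b (Multiset.mem_cons_of_mem hb))

/-- The factor by which a surgery multiplies. -/
def factor (s : Skeleton) (i j : ℤ) : MvPolynomial Vertex ℤ :=
  if s.Conn (Vertex.bot i) (Vertex.top i) then
    MvPolynomial.X (Vertex.bot i) + MvPolynomial.X (Vertex.bot j) else 1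

end Skeleton

namespace Stack

/-- The set `A` contains exactly one vertex on each clockwise circle. -/
structure Transversal (s : Stack) (A : Finset Vertex) : Prop where
  arrow : ∀ a ∈ A, s.Arrow a
  type : ∀ a ∈ A, s.HasType a CompType.x
  exists_conn : ∀ v, s.Arrow v → s.HasType v CompType.x → ∃ a ∈ A, s.Conn v a
  unique : ∀ a ∈ A, ∀ b ∈ A, s.Conn a b → a = b

/-- Two representatives of the same circle have congruent variables. -/
theorem Transversal.cong {s : Stack} {A B : Finset Vertex} (hA : s.Transversal A)
    (hB : s.Transversal B) : s.Cong (∏ a ∈ A, X a) (∏ b ∈ B, X b) := by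
  choose f hf hf' using fun a ha => hB.exists_conn a (hA.arrow a ha) (hA.type a ha)
  unfold Skeleton.Cong
  rw [map_prod, map_prod]
  refine Finset.prod_bij f hf ?_ ?_ ?_
  · intro a ha a' ha' h
    refine hA.unique a ha a' ha' ((hf' a ha).trans ?_)
    rw [h]
    exact (hf' a' ha').symm
  · intro b hb
    obtain ⟨a, ha, hba⟩ := hA.exists_conn b (hB.arrow b hb) (hB.type b hb)
    exact ⟨a, ha, (hB.unique b hb _ (hf a ha) (hba.trans (hf' a ha))).symm⟩
  · intro a ha
    exact Skeleton.Cong.X (hf' a ha)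

theorem Closed.exists_transversal {s : Stack} (hs : s.Closed) : ∃ A, s.Transversal A := by
  let r : Setoid Vertex := ⟨s.Conn, Skeleton.Conn.refl, Skeleton.Conn.symm, Skeleton.Conn.trans⟩
  have hfin : {v | s.Arrow v}.Finite := hs.finite_pos fun v hv => hv
  let rep : Vertex → Vertex := fun v => (Quotient.mk r v).out
  have hrep : ∀ v, s.Conn v (rep v) := fun v => (Quotient.mk_out (s := r) v).symm
  refine ⟨hfin.toFinset.filter fun v => s.HasType v CompType.x ∧ rep v = v, ?_, ?_, ?_, ?_⟩
  · intro a ha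
    simpa using (Finset.mem_filter.mp ha).1
  · intro a ha
    exact (Finset.mem_filter.mp ha).2.1
  · intro v hv hx
    refine ⟨rep v, ?_, hrep v⟩
    rw [Finset.mem_filter, Set.Finite.mem_toFinset]
    refine ⟨hs.consistent.conn_arrow (hrep v) hv, hs.hasType_conn hv (hrep v) hx, ?_⟩
    change (Quotient.mk r _).out = (Quotient.mk r v).out
    rw [Quotient.out_eq]
  · intro a ha b hb hab
    rw [← (Finset.mem_filter.mp ha).2.2, ← (Finset.mem_filter.mp hb).2.2]
    change (Quotient.mk r a).out = (Quotient.mk r b).out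
    rw [Quotient.sound (s := r) hab]

/-- The monomial of a closed diagram: the product of the variables of the clockwise circles. -/
def mono (s : Stack) : MvPolynomial Vertex ℤ :=
  if h : ∃ A, s.Transversal A then ∏ a ∈ h.choose, X a else 0

theorem Transversal.mono_cong {s : Stack} {A : Finset Vertex} (hA : s.Transversal A) :
    s.Cong s.mono (∏ a ∈ A, X a) := by
  have h : ∃ A, s.Transversal A := ⟨A, hA⟩
  unfold mono
  rw [dif_pos h]
  exact h.choose_spec.cong hA

/-- The diagrams differ at most by the orientation of circles. -/
structure Alike (s t : Stack) : Prop where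
  arrow_iff : ∀ v, t.Arrow v ↔ s.Arrow v
  label_eq : ∀ v, ¬ s.Arrow v → t.label v = s.label v

theorem Alike.trans {s t u : Stack} (h : s.Alike t) (h' : t.Alike u) : s.Alike u :=
  ⟨fun v => (h'.arrow_iff v).trans (h.arrow_iff v),
    fun v hv => (h'.label_eq v ((h.arrow_iff v).not.mpr hv)).trans (h.label_eq v hv)⟩

theorem Alike.symm {s t : Stack} (h : s.Alike t) : t.Alike s :=
  ⟨fun v => (h.arrow_iff v).symm, fun v hv => (h.label_eq v ((h.arrow_iff v).not.mp hv)).symm⟩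

namespace Closed

variable {s : Stack}

/-- The type of a circle determines its orientation, so the set of clockwise circles determines all
arrows. -/
theorem eq_of_alike {t : Stack} (hs : s.Closed) (ht : t.Closed) (h : s.toSkeleton = t.toSkeleton)
    (ha : s.Alike t)
    (hx : ∀ v, s.Arrow v → (s.HasType v CompType.x ↔ t.HasType v CompType.x)) : s = t := by
  refine Stack.ext_of_label h fun v => ?_
  by_cases hv : s.Arrow v
  · have hv' := (ha.arrow_iff v).mpr hv
    rcases hs.hasType_cases hv with h1 | h1
    · refine hs.label_eq_of_hasType ht h hv hv' h1 ?_ (Skeleton.Conn.refl v)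
      rw [← ht.not_x_iff hv', ← hx v hv]
      exact (hs.not_x_iff hv).mpr h1
    · exact hs.label_eq_of_hasType ht h hv hv' h1 ((hx v hv).mp h1) (Skeleton.Conn.refl v)
  · exact (ha.label_eq v hv).symm

end Closed

/-! ### Independence of the monomials of diagrams -/

section Independence

/-- Being connected is an equivalence relation. -/
def _root_.DiagramAlgebra.Skeleton.setoid (s : Skeleton) : Setoid Vertex :=
  ⟨s.Conn, Skeleton.Conn.refl, Skeleton.Conn.symm, Skeleton.Conn.trans⟩

/-- With one variable for each component the linear relations disappear, and the ideal becomes the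
monomial ideal generated by the squares. It does not affect the coefficients of squarefree
monomials. -/
theorem _root_.DiagramAlgebra.Skeleton.Cong.coeff_rename {σ : Skeleton}
    {f g : MvPolynomial Vertex ℤ} (h : σ.Cong f g) {d : Quotient σ.setoid →₀ ℕ}
    (hd : ∀ c, d c ≤ 1) :
    coeff d (rename (Quotient.mk σ.setoid) f) = coeff d (rename (Quotient.mk σ.setoid) g) := by
  have h1 : f - g ∈ (Ideal.span ((fun m => monomial m (1 : ℤ)) ''
      {m | ∃ c : Quotient σ.setoid, m = Finsupp.single c 2})).comap
      (rename (Quotient.mk σ.setoid)) := by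
    refine (Ideal.span_le.mpr ?_) (Skeleton.cong_iff.mp h)
    rintro p (⟨v, w, hvw, rfl⟩ | ⟨v, rfl⟩)
    · simp only [Ideal.coe_comap, Set.mem_preimage, map_sub, rename_X]
      rw [Quotient.sound (s := σ.setoid) hvw, sub_self]
      exact Ideal.zero_mem _
    · simp only [Ideal.coe_comap, Set.mem_preimage, map_mul, rename_X]
      refine Ideal.subset_span ⟨_, ⟨Quotient.mk σ.setoid v, rfl⟩, ?_⟩
      simp only
      rw [← pow_two, X_pow_eq_monomial]
  rw [Ideal.mem_comap, mem_ideal_span_monomial_image] at h1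
  by_contra hc
  have h2 : d ∈ (rename (Quotient.mk σ.setoid) (f - g)).support := by
    rw [mem_support_iff, map_sub, coeff_sub, sub_ne_zero]
    exact hc
  obtain ⟨_, ⟨c, rfl⟩, hle⟩ := h1 d h2
  have h3 := hle c
  rw [Finsupp.single_eq_same] at h3
  have := hd c
  omega

/-- The exponent is the indicator function of the set of clockwise circles. -/
theorem Closed.exists_exponent {t : Stack} (ht : t.Closed) :
    ∃ d : Quotient t.setoid →₀ ℕ, (∀ c, d c ≤ 1) ∧
      (∀ v, t.Arrow v → (t.HasType v CompType.x ↔ d (Quotient.mk t.setoid v) ≠ 0)) ∧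
      ∃ g, t.Cong t.mono g ∧ rename (Quotient.mk t.setoid) g = monomial d (1 : ℤ) := by
  obtain ⟨A, hA⟩ := ht.exists_transversal
  have hval : ∀ c, (∑ a ∈ A, Finsupp.single (Quotient.mk t.setoid a) 1 :
      Quotient t.setoid →₀ ℕ) c = (A.filter fun a => Quotient.mk t.setoid a = c).card := by
    intro c
    rw [Finsupp.finsetSum_apply, Finset.card_filter]
    refine Finset.sum_congr rfl fun a _ => ?_
    rw [Finsupp.single_apply]
  refine ⟨∑ a ∈ A, Finsupp.single (Quotient.mk t.setoid a) 1, ?_, ?_, _, hA.mono_cong, ?_⟩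
  · intro c
    rw [hval, Finset.card_le_one]
    intro a ha' b hb
    rw [Finset.mem_filter] at ha' hb
    refine hA.unique a ha'.1 b hb.1 ?_
    exact Quotient.exact (s := t.setoid) (ha'.2.trans hb.2.symm)
  · intro v hv
    rw [hval, Ne, Finset.card_eq_zero, ← Ne, ← Finset.nonempty_iff_ne_empty]
    constructor
    · intro hx
      obtain ⟨a, h1, h2⟩ := hA.exists_conn v hv hx
      exact ⟨a, Finset.mem_filter.mpr ⟨h1, Quotient.sound (s := t.setoid) h2.symm⟩⟩
    · rintro ⟨a, h1⟩
      rw [Finset.mem_filter] at h1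
      exact ht.hasType_conn (hA.arrow a h1.1) (Quotient.exact (s := t.setoid) h1.2)
        (hA.type a h1.1)
  · rw [map_prod, monomial_sum_one]
    exact Finset.prod_congr rfl fun a _ => rename_X _ _

/-- The coefficient of a squarefree monomial counts the diagrams with the corresponding set of
clockwise circles, and this set determines the diagram. Integral coefficients are essential: in
positive characteristic the multiplicities would be lost. -/
theorem Closed.eq_of_sum_cong {σ : Skeleton} {M N : Multiset Stack}
    (hM : ∀ t ∈ M + N, t.Closed ∧ t.toSkeleton = σ)
    (ha : ∀ t ∈ M + N, ∀ t' ∈ M + N, t.Alike t')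
    (h : σ.Cong (M.map mono).sum (N.map mono).sum) : M = N := by
  have key : ∀ t : Stack, ∃ d : Quotient σ.setoid →₀ ℕ, (∀ c, d c ≤ 1) ∧ (t.Closed →
      t.toSkeleton = σ →
      (∀ v, t.Arrow v → (t.HasType v CompType.x ↔ d (Quotient.mk σ.setoid v) ≠ 0)) ∧
      ∃ g, σ.Cong t.mono g ∧ rename (Quotient.mk σ.setoid) g = monomial d (1 : ℤ)) := by
    intro t
    by_cases ht : t.Closed ∧ t.toSkeleton = σ
    · obtain ⟨ht, rfl⟩ := ht
      obtain ⟨d, h1, h2⟩ := ht.exists_exponent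
      exact ⟨d, h1, fun _ _ => h2⟩
    · exact ⟨0, fun _ => Nat.zero_le _, fun h1 h2 => absurd ⟨h1, h2⟩ ht⟩
  choose d hd1 hd using key
  have hcount : ∀ L : Multiset Stack, (∀ t ∈ L, t ∈ M + N) → ∀ e : Quotient σ.setoid →₀ ℕ,
      (∀ c, e c ≤ 1) → coeff e (rename (Quotient.mk σ.setoid) (L.map mono).sum) =
        (((L.map d).count e : ℕ) : ℤ) := by
    intro L hL e he
    induction L using Multiset.induction_on with
    | empty => simp
    | cons t L ih =>
      rw [Multiset.map_cons, Multiset.sum_cons, map_add, coeff_add,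
        ih fun t' ht' => hL t' (Multiset.mem_cons_of_mem ht'), Multiset.map_cons,
        Multiset.count_cons]
      have ht := hM t (hL t (Multiset.mem_cons_self t L))
      obtain ⟨g, h1, h2⟩ := (hd t ht.1 ht.2).2
      rw [h1.coeff_rename he, h2, coeff_monomial]
      push_cast
      rw [add_comm]
      simp only [eq_comm]
  have hmap : M.map d = N.map d := by
    ext e
    by_cases he : ∀ c, e c ≤ 1
    · have h1 := hcount M (fun t ht => Multiset.mem_add.mpr (Or.inl ht)) e he
      have h2 := hcount N (fun t ht => Multiset.mem_add.mpr (Or.inr ht)) e he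
      have h3 := h.coeff_rename he
      rw [h1, h2] at h3
      exact_mod_cast h3
    -- Exponents of diagrams are squarefree, so `e` does not occur on either side.
    · have h0 : ∀ L : Multiset Stack, (L.map d).count e = 0 := by
        intro L
        rw [Multiset.count_eq_zero]
        intro hc
        obtain ⟨t, -, rfl⟩ := Multiset.mem_map.mp hc
        exact he (hd1 t)
      rw [h0, h0]
  rw [← Multiset.rel_eq, Multiset.rel_map] at hmap
  rw [← Multiset.rel_eq]
  refine hmap.mono fun t ht t' ht' he => ?_
  have h1 := Multiset.mem_add.mpr (Or.inl ht : t ∈ M ∨ t ∈ N)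
  have h2 := Multiset.mem_add.mpr (Or.inr ht' : t' ∈ M ∨ t' ∈ N)
  have h3 := hM t h1
  have h4 := hM t' h2
  have h5 := ha t h1 t' h2
  refine h3.1.eq_of_alike h4.1 (h3.2.trans h4.2.symm) h5 fun v hv => ?_
  rw [(hd t h3.1 h3.2).1 v hv, (hd t' h4.1 h4.2).1 v ((h5.arrow_iff v).mpr hv), he]

end Independence

end Stack

end DiagramAlgebra

namespace DiagramAlgebra

/-! ## Confluence of the surgery procedure for closed diagrams -/

open MvPolynomial

namespace Stack

variable {s : Stack} {i j : ℤ}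

theorem _root_.DiagramAlgebra.Reoriented.alike {t : Stack} (hs : s.Closed) (h : Surgerable s i j)
    (ht : Reoriented s i j t) : s.Alike t :=
  ⟨ht.arrow_iff hs h, fun _ hv => ht.label_of_not_arrow hs h hv⟩

/-- The type of a component which does not take part in the surgery. -/
theorem _root_.DiagramAlgebra.Reoriented.hasType_iff {t : Stack} (h : Surgerable s i j)
    (ht : Reoriented s i j t) {v : Vertex}
    (h1 : ¬ t.Conn (Vertex.bot i) v) (h2 : ¬ t.Conn (Vertex.bot j) v) (hs : s.Closed) (A : CompType) :
    t.HasType v A ↔ s.HasType v A := by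
  have hcomp : t.comp v = s.comp v := by
    ext u
    change t.Conn v u ↔ s.Conn v u
    constructor
    · intro hvu
      have := (ht.conn_iff v u).mp hvu
      rw [ht.conn_iff] at h1 h2
      exact this.of_cut_of_not h h1 h2
    · intro hvu
      rw [ht.conn_iff] at h1 h2 ⊢
      by_contra hc
      have h3 : ¬ (s.toSkeleton.cut i j).Conn (Vertex.bot i) v ∧
        ¬ (s.toSkeleton.cut i j).Conn (Vertex.bot j) v := ⟨h1, h2⟩
      refine hc (hvu.cut_of_not h ?_ ?_)
      · intro h4
        have := h4.symm.cut_or h (Or.inl (Skeleton.Conn.refl _))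
        tauto
      · intro h4
        have := h4.symm.cut_or h (Or.inl (Skeleton.cut_adj_left h).conn)
        tauto
  have hlab : ∀ u ∈ s.comp v, t.label u = s.label u := by
    intro u hu
    rw [← hcomp] at hu
    exact ht.unchanged u (fun h3 => h1 (h3.trans hu.symm)) (fun h3 => h2 (h3.trans hu.symm))
  have hl : t.OnLine v ↔ s.OnLine v :=
    iff_of_false (ht.closed.not_onLine v) (hs.not_onLine v)
  constructor
  · exact fun h3 => h3.congr hl hcomp fun u hu => hlab u (hcomp ▸ hu)
  · exact fun h3 => h3.congr hl.symm hcomp.symm fun u hu => (hlab u hu).symm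

/-- Two connected vertices contribute the square of one variable. -/
theorem _root_.DiagramAlgebra.Skeleton.Cong.prod_X {σ : Skeleton} {A : Finset Vertex} {a b : Vertex}
    (ha : a ∈ A) (hb : b ∈ A) (hne : a ≠ b) (h : σ.Conn a b) :
    σ.Cong (∏ v ∈ A, X v) 0 := by
  rw [← Finset.mul_prod_erase A _ ha, ← Finset.mul_prod_erase (A.erase a) _
    (Finset.mem_erase.mpr ⟨hne.symm, hb⟩), ← mul_assoc]
  have := (Skeleton.Cong.mul_zero h).mul (Skeleton.Cong.refl (s := σ)
    (∏ v ∈ (A.erase a).erase b, X v))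
  rwa [zero_mul] at this

namespace Closed

/-- At most one of the merged circles is clockwise, so at most one element of `A` lies on the new
circle, and `A` can be kept. -/
theorem transversal_merge {t : Stack} (hs : s.Closed) (h : Surgerable s i j)
    (hn : ¬ s.Conn (Vertex.bot i) (Vertex.top i)) (ht : Reoriented s i j t) {A : Finset Vertex}
    (hA : s.Transversal A)
    (hx : t.HasType (Vertex.bot i) CompType.x ↔
      (s.HasType (Vertex.bot i) CompType.x ∨ s.HasType (Vertex.top i) CompType.x))
    (hxx : ¬ (s.HasType (Vertex.bot i) CompType.x ∧ s.HasType (Vertex.top i) CompType.x)) :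
    t.Transversal A := by
  have hij : t.Conn (Vertex.bot i) (Vertex.bot j) := by
    rw [ht.conn_iff]
    exact hs.cut_conn_pair_bot h hn
  have hup : ∀ v w, s.Conn v w → t.Conn v w := by
    intro v w hvw
    rw [ht.conn_iff]
    exact hs.cut_conn_merge h hn hvw
  have hv : t.Conn (Vertex.bot i) (Vertex.top i) := by
    rw [ht.conn_iff]
    exact (Skeleton.cut_adj_left h).conn
  have hdown : ∀ v w, t.Conn v w → s.Conn v w ∨
      (s.Conn v (Vertex.bot i) ∧ s.Conn (Vertex.top i) w) ∨
      (s.Conn v (Vertex.top i) ∧ s.Conn (Vertex.bot i) w) := by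
    intro v w hvw
    rw [ht.conn_iff] at hvw
    exact hvw.of_cut h
  have hbi := hs.arrow_bot_left h
  have hti := hs.arrow_top_left h
  have hai := ht.arrow_left h
  refine ⟨?_, ?_, ?_, ?_⟩
  · intro a ha
    exact (ht.arrow_iff hs h a).mpr (hA.arrow a ha)
  · intro a ha
    by_cases hc : t.Conn (Vertex.bot i) a
    · refine ht.closed.hasType_conn hai hc (hx.mpr ?_)
      rcases hdown _ _ hc with h1 | ⟨-, h1⟩ | ⟨h1, -⟩
      · exact Or.inl (hs.hasType_conn (hA.arrow a ha) h1.symm (hA.type a ha))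
      · exact Or.inr (hs.hasType_conn (hA.arrow a ha) h1.symm (hA.type a ha))
      · exact absurd h1 hn
    · exact (ht.hasType_iff h hc (fun h' => hc (hij.trans h')) hs _).mpr (hA.type a ha)
  · intro v hv1 hv2
    by_cases hc : t.Conn (Vertex.bot i) v
    · rcases hx.mp (ht.closed.hasType_conn hv1 hc.symm hv2) with h1 | h1
      · obtain ⟨a, h2, h3⟩ := hA.exists_conn _ hbi h1
        exact ⟨a, h2, hc.symm.trans (hup _ _ h3)⟩
      · obtain ⟨a, h2, h3⟩ := hA.exists_conn _ hti h1
        exact ⟨a, h2, hc.symm.trans (hv.trans (hup _ _ h3))⟩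
    · obtain ⟨a, h2, h3⟩ := hA.exists_conn v ((ht.arrow_iff hs h v).mp hv1)
        ((ht.hasType_iff h hc (fun h' => hc (hij.trans h')) hs _).mp hv2)
      exact ⟨a, h2, hup _ _ h3⟩
  · intro a ha b hb hab
    rcases hdown _ _ hab with h1 | ⟨h1, h2⟩ | ⟨h1, h2⟩
    · exact hA.unique a ha b hb h1
    · exact absurd ⟨hs.hasType_conn (hA.arrow a ha) h1 (hA.type a ha),
        hs.hasType_conn (hA.arrow b hb) h2.symm (hA.type b hb)⟩ hxx
    · exact absurd ⟨hs.hasType_conn (hA.arrow b hb) h2.symm (hA.type b hb),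
        hs.hasType_conn (hA.arrow a ha) h1 (hA.type a ha)⟩ hxx

/-- The representative of the split circle, if there is one, is replaced by those of `bot i`, `bot
j` that lie on clockwise parts; these are collected in `C`. -/
theorem transversal_split {t : Stack} (hs : s.Closed) (h : Surgerable s i j)
    (hc : s.Conn (Vertex.bot i) (Vertex.top i)) (ht : Reoriented s i j t) {A C : Finset Vertex}
    (hA : s.Transversal A) (hC : C ⊆ {Vertex.bot i, Vertex.bot j})
    (hi : t.HasType (Vertex.bot i) CompType.x ↔ Vertex.bot i ∈ C)
    (hj : t.HasType (Vertex.bot j) CompType.x ↔ Vertex.bot j ∈ C) :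
    t.Transversal ((A.filter fun a => ¬ s.Conn (Vertex.bot i) a) ∪ C) := by
  have hn : ¬ t.Conn (Vertex.bot i) (Vertex.bot j) := by
    rw [ht.conn_iff]
    exact hs.cut_conn_split h hc
  have hdown : ∀ v w, t.Conn v w → s.Conn v w := by
    intro v w hvw
    rw [ht.conn_iff] at hvw
    exact Skeleton.Conn.of_cut_split h hc hvw
  have hpair := Skeleton.conn_pair_bot h
  have hoff : ∀ v, ¬ s.Conn (Vertex.bot i) v →
      ¬ t.Conn (Vertex.bot i) v ∧ ¬ t.Conn (Vertex.bot j) v := fun v hv =>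
    ⟨fun h1 => hv (hdown _ _ h1), fun h1 => hv (hpair.trans (hdown _ _ h1))⟩
  have hon : ∀ v, s.Conn (Vertex.bot i) v →
      t.Conn (Vertex.bot i) v ∨ t.Conn (Vertex.bot j) v := by
    intro v hv
    rw [ht.conn_iff, ht.conn_iff]
    exact hv.cut_or h (Or.inl (Skeleton.Conn.refl _))
  have hai := ht.arrow_left h
  have haj := ht.arrow_right h
  have hCs : ∀ a ∈ C, s.Conn (Vertex.bot i) a := by
    intro a ha
    have := hC ha
    rw [Finset.mem_insert, Finset.mem_singleton] at this
    rcases this with rfl | rfl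
    · exact Skeleton.Conn.refl _
    · exact hpair
  refine ⟨?_, ?_, ?_, ?_⟩
  · intro a ha
    rw [ht.arrow_iff hs h]
    rcases Finset.mem_union.mp ha with ha | ha
    · exact hA.arrow a (Finset.mem_filter.mp ha).1
    · exact hs.consistent.conn_arrow (hCs a ha) (hs.arrow_bot_left h)
  · intro a ha
    rcases Finset.mem_union.mp ha with ha | ha
    · rw [Finset.mem_filter] at ha
      have := hoff a ha.2
      exact (ht.hasType_iff h this.1 this.2 hs _).mpr (hA.type a ha.1)
    · have := hC ha
      rw [Finset.mem_insert, Finset.mem_singleton] at this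
      rcases this with rfl | rfl
      · exact hi.mpr ha
      · exact hj.mpr ha
  · intro v hv1 hv2
    by_cases hv : s.Conn (Vertex.bot i) v
    · rcases hon v hv with h1 | h1
      · exact ⟨_, Finset.mem_union_right _ (hi.mp (ht.closed.hasType_conn hv1 h1.symm hv2)),
          h1.symm⟩
      · exact ⟨_, Finset.mem_union_right _ (hj.mp (ht.closed.hasType_conn hv1 h1.symm hv2)),
          h1.symm⟩
    · have h1 := hoff v hv
      obtain ⟨a, h2, h3⟩ := hA.exists_conn v ((ht.arrow_iff hs h v).mp hv1)
        ((ht.hasType_iff h h1.1 h1.2 hs _).mp hv2)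
      refine ⟨a, Finset.mem_union_left _ (Finset.mem_filter.mpr
        ⟨h2, fun h4 => hv (h4.trans h3.symm)⟩), ?_⟩
      rw [ht.conn_iff]
      refine h3.cut_of_not h (fun h4 => hv h4.symm) (fun h4 => hv (hc.trans h4.symm))
  · intro a ha b hb hab
    rcases Finset.mem_union.mp ha with ha | ha <;> rcases Finset.mem_union.mp hb with hb | hb
    · exact hA.unique a (Finset.mem_filter.mp ha).1 b (Finset.mem_filter.mp hb).1 (hdown _ _ hab)
    · exact absurd ((hCs b hb).trans (hdown _ _ hab).symm) (Finset.mem_filter.mp ha).2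
    · exact absurd ((hCs a ha).trans (hdown _ _ hab)) (Finset.mem_filter.mp hb).2
    · have h1 := hC ha
      have h2 := hC hb
      rw [Finset.mem_insert, Finset.mem_singleton] at h1 h2
      rcases h1 with rfl | rfl <;> rcases h2 with rfl | rfl
      · rfl
      · exact absurd hab hn
      · exact absurd hab.symm hn
      · rfl

/-- Multiplication by the factor is well defined from the ring of `s` to the ring of the cut shape.
In a split, variables that were identified may become different, but the squares vanish, so both `X
i` and `X j` times `X i + X j` give `X i * X j`. -/
theorem factor_mul_cong (hs : s.Closed) (h : Surgerable s i j) {f g : MvPolynomial Vertex ℤ}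
    (hfg : s.Cong f g) :
    (s.toSkeleton.cut i j).Cong (f * s.factor i j) (g * s.factor i j) := by
  rw [Skeleton.cong_iff] at hfg ⊢
  rw [← sub_mul]
  generalize f - g = p at hfg
  unfold Skeleton.ideal at hfg
  induction hfg using Submodule.span_induction with
  | zero =>
    rw [zero_mul]
    exact Ideal.zero_mem _
  | add x y _ _ hx hy =>
    rw [add_mul]
    exact Ideal.add_mem _ hx hy
  | smul a x _ hx =>
    rw [smul_eq_mul, mul_assoc]
    exact Ideal.mul_mem_left _ _ hx
  | mem x hx =>
    rcases hx with ⟨v, w, hvw, rfl⟩ | ⟨v, rfl⟩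
    · rw [sub_mul, ← Skeleton.cong_iff]
      unfold Skeleton.factor
      split_ifs with hc
      · have hmul : ∀ v w, (s.toSkeleton.cut i j).Conn v w → ∀ p,
            (s.toSkeleton.cut i j).Cong (X v * p) (X w * p) :=
          fun v w hvw p => (Skeleton.Cong.X hvw).mul (Skeleton.Cong.refl p)
        by_cases hv : s.Conn (Vertex.bot i) v
        · have key : ∀ u, s.Conn (Vertex.bot i) u → (s.toSkeleton.cut i j).Cong
              (X u * (X (Vertex.bot i) + X (Vertex.bot j)))
              (X (Vertex.bot i) * X (Vertex.bot j)) := by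
            intro u hu
            have h1 := Skeleton.Cong.sq (s.toSkeleton.cut i j) (Vertex.bot i)
            have h2 := Skeleton.Cong.sq (s.toSkeleton.cut i j) (Vertex.bot j)
            rcases hu.cut_or h (Or.inl (Skeleton.Conn.refl _)) with h3 | h3
            · refine (hmul _ _ h3.symm _).trans ?_
              have := h1.add (Skeleton.Cong.refl (X (Vertex.bot i) * X (Vertex.bot j)))
              rwa [← mul_add, zero_add] at this
            · refine (hmul _ _ h3.symm _).trans ?_
              have := (Skeleton.Cong.refl (X (Vertex.bot i) * X (Vertex.bot j))).add h2
              rwa [← add_mul, add_zero, mul_comm] at this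
          exact (key v hv).trans (key w (hv.trans hvw)).symm
        · exact hmul v w (hvw.cut_of_not h (fun h1 => hv h1.symm)
            (fun h1 => hv (hc.trans h1.symm))) _
      · exact (Skeleton.Cong.X (hs.cut_conn_merge h hc hvw)).mul (Skeleton.Cong.refl _)
    · exact Ideal.mul_mem_right _ _ (Ideal.subset_span (Or.inr ⟨v, rfl⟩))

/-- The rules for circles are the multiplication and comultiplication of the ring of dual numbers.
Merging identifies variables. Splitting sends `1` to `X i + X j` and `x` to `X i * X j`, which in
both cases is multiplication by `X i + X j`. -/
theorem sum_outcomes_cong (hs : s.Closed) (h : Surgerable s i j) :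
    (s.toSkeleton.cut i j).Cong ((outcomes s i j).map mono).sum (s.mono * s.factor i j) := by
  obtain ⟨A, hA⟩ := hs.exists_transversal
  refine Eq.trans ?_ (hs.factor_mul_cong h hA.mono_cong).symm
  have hmono : ∀ t : Stack, Reoriented s i j t → ∀ B, t.Transversal B →
      (s.toSkeleton.cut i j).Cong t.mono (∏ b ∈ B, X b) := by
    intro t ht B hB
    rw [← ht.skeleton]
    exact hB.mono_cong
  have hbi := hs.arrow_bot_left h
  have hti := hs.arrow_top_left h
  by_cases hc : s.Conn (Vertex.bot i) (Vertex.top i)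
  · have hf : s.factor i j = X (Vertex.bot i) + X (Vertex.bot j) := if_pos hc
    rw [hf]
    have hd : ∀ C : Finset Vertex, C ⊆ {Vertex.bot i, Vertex.bot j} →
        Disjoint (A.filter fun a => ¬ s.Conn (Vertex.bot i) a) C := by
      intro C hC
      rw [Finset.disjoint_left]
      intro a ha hac
      have := hC hac
      rw [Finset.mem_insert, Finset.mem_singleton] at this
      refine (Finset.mem_filter.mp ha).2 ?_
      rcases this with rfl | rfl
      · exact Skeleton.Conn.refl _
      · exact Skeleton.conn_pair_bot h
    have hne : Vertex.bot i ≠ Vertex.bot j := by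
      intro he
      injection he with he
      exact h.1.ne he
    have hprod : ∀ C : Finset Vertex, C ⊆ {Vertex.bot i, Vertex.bot j} →
        ∏ a ∈ (A.filter fun a => ¬ s.Conn (Vertex.bot i) a) ∪ C, X a =
        (∏ a ∈ A.filter fun a => ¬ s.Conn (Vertex.bot i) a, X a) *
          ∏ a ∈ C, (X a : MvPolynomial Vertex ℤ) :=
      fun C hC => Finset.prod_union (hd C hC)
    rcases hs.hasType_cases hbi with h1 | h1
    · obtain ⟨t, t', ho, ⟨ht, h2, h3⟩, ⟨ht', h2', h3'⟩⟩ := hs.outcome_split_one h hc h1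
      have hA' : (A.filter fun a => ¬ s.Conn (Vertex.bot i) a) = A := by
        rw [Finset.filter_eq_self]
        intro a ha hca
        exact hs.not_one_and_x hbi h1
          (hs.hasType_conn (hA.arrow a ha) hca.symm (hA.type a ha))
      have e1 := hs.transversal_split h hc ht hA (C := {Vertex.bot i}) (by simp)
        (iff_of_true h2 (by simp))
        (iff_of_false (ht.closed.not_x_iff (ht.arrow_right h) |>.mpr h3) (by simpa using hne.symm))
      have e2 := hs.transversal_split h hc ht' hA (C := {Vertex.bot j}) (by simp)
        (iff_of_false (ht'.closed.not_x_iff (ht'.arrow_left h) |>.mpr h2') (by simpa using hne))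
        (iff_of_true h3' (by simp))
      have f1 := hmono t ht _ e1
      have f2 := hmono t' ht' _ e2
      rw [hprod _ (by simp), Finset.prod_singleton, hA'] at f1 f2
      rw [ho, Multiset.insert_eq_cons, Multiset.map_cons, Multiset.map_singleton,
        Multiset.sum_cons, Multiset.sum_singleton, mul_add]
      exact f1.add f2
    · obtain ⟨t, ho, ht, h2, h3⟩ := hs.outcome_split_x h hc h1
      have e1 := hs.transversal_split h hc ht hA (C := {Vertex.bot i, Vertex.bot j}) subset_rfl
        (iff_of_true h2 (by simp)) (iff_of_true h3 (by simp))
      have f1 := hmono t ht _ e1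
      rw [hprod _ subset_rfl, Finset.prod_pair hne] at f1
      rw [ho, Multiset.map_singleton, Multiset.sum_singleton]
      refine Eq.trans f1 ?_
      obtain ⟨a, h4, h5⟩ := hA.exists_conn _ hbi h1
      have hA' : (A.filter fun a => ¬ s.Conn (Vertex.bot i) a) = A.erase a := by
        ext b
        rw [Finset.mem_filter, Finset.mem_erase, and_comm]
        refine and_congr_left fun hb => ?_
        constructor
        · rintro h6 rfl
          exact h6 h5
        · intro h6 h7
          exact h6 (hA.unique b hb a h4 (h7.symm.trans h5))
      -- The representative `a` of the split circle ends up on one of the two parts, and `X a * (X i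
      -- + X j)` is congruent to `X i * X j` either way.
      rw [hA', ← Finset.mul_prod_erase A _ h4, mul_comm (X a), mul_assoc]
      refine (Skeleton.Cong.refl _).mul ?_
      have h6 := Skeleton.Cong.sq (s.toSkeleton.cut i j) (Vertex.bot i)
      have h7 := Skeleton.Cong.sq (s.toSkeleton.cut i j) (Vertex.bot j)
      rcases h5.cut_or h (Or.inl (Skeleton.Conn.refl _)) with h8 | h8
      · refine Eq.trans ?_ ((Skeleton.Cong.X h8).mul
          (Skeleton.Cong.refl (X (Vertex.bot i) + X (Vertex.bot j))))
        have := h6.add (Skeleton.Cong.refl (X (Vertex.bot i) * X (Vertex.bot j)))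
        rw [← mul_add, zero_add] at this
        exact this.symm
      · refine Eq.trans ?_ ((Skeleton.Cong.X h8).mul
          (Skeleton.Cong.refl (X (Vertex.bot i) + X (Vertex.bot j))))
        have := (Skeleton.Cong.refl (X (Vertex.bot i) * X (Vertex.bot j))).add h7
        rw [← add_mul, add_zero, mul_comm (_ + _)] at this
        exact this.symm
  · have hf : s.factor i j = 1 := if_neg hc
    rw [hf, mul_one]
    have single : ∀ (t : Stack) , outcomes s i j = {t} → Reoriented s i j t →
        t.Transversal A → (s.toSkeleton.cut i j).Cong ((outcomes s i j).map mono).sum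
          (∏ a ∈ A, X a) := by
      intro t ho ht hA'
      rw [ho, Multiset.map_singleton, Multiset.sum_singleton]
      exact hmono t ht A hA'
    rcases hs.hasType_cases hbi with h1 | h1 <;> rcases hs.hasType_cases hti with h2 | h2
    · obtain ⟨t, ho, ht, h3⟩ := hs.outcome_merge h hc (C := CompType.one) h1 h2
        (fun C' => ⟨fun h => by cases h; rfl, fun h => h ▸ MergeRule.one_one⟩) (by simp)
      have n1 := (hs.not_x_iff hbi).mpr h1
      have n2 := (hs.not_x_iff hti).mpr h2
      have n3 := (ht.closed.not_x_iff (ht.arrow_left h)).mpr h3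
      exact single t ho ht (hs.transversal_merge h hc ht hA (by tauto) (by tauto))
    · obtain ⟨t, ho, ht, h3⟩ := hs.outcome_merge h hc (C := CompType.x) h1 h2
        (fun C' => ⟨fun h => by cases h; rfl, fun h => h ▸ MergeRule.one_x⟩) (by simp)
      have n1 := (hs.not_x_iff hbi).mpr h1
      exact single t ho ht (hs.transversal_merge h hc ht hA (by tauto) (by tauto))
    · obtain ⟨t, ho, ht, h3⟩ := hs.outcome_merge h hc (C := CompType.x) h1 h2
        (fun C' => ⟨fun h => by cases h; rfl, fun h => h ▸ MergeRule.x_one⟩) (by simp)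
      have n2 := (hs.not_x_iff hti).mpr h2
      exact single t ho ht (hs.transversal_merge h hc ht hA (by tauto) (by tauto))
    · rw [hs.outcome_merge_zero h hc h1 h2, Multiset.map_zero, Multiset.sum_zero]
      obtain ⟨a, h3, h4⟩ := hA.exists_conn _ hbi h1
      obtain ⟨b, h5, h6⟩ := hA.exists_conn _ hti h2
      -- The representatives of the two clockwise circles become connected, so the monomial dies, in
      -- accordance with `x ⊗ x ↦ 0`.
      refine (Skeleton.Cong.prod_X h3 h5 ?_ ?_).symm
      · rintro rfl
        exact hc (h4.trans h6.symm)
      · exact (hs.cut_conn_merge h hc h4).symm.trans ((Skeleton.cut_adj_left h).conn.trans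
          (hs.cut_conn_merge h hc h6))

end Closed

end Stack

end DiagramAlgebra

/-! ### Interchanging two surgeries -/

namespace DiagramAlgebra

open MvPolynomial

theorem ArcDiagram.Outermost.ne {c : ArcDiagram} {i j k l : ℤ} (h : c.Outermost i j)
    (h' : c.Outermost k l) (hne : i ≠ k) : i ≠ l ∧ j ≠ k ∧ j ≠ l := by
  obtain ⟨h1, h2, -⟩ := h
  obtain ⟨h3, h4, -⟩ := h'
  have h5 := (c.arc_symm _ _ h2).2
  have h6 := (c.arc_symm _ _ h4).2
  refine ⟨?_, ?_, ?_⟩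
  · rintro rfl
    rw [h2] at h6
    simp only [Option.some.injEq, Node.arc.injEq] at h6
    omega
  · rintro rfl
    rw [h5] at h4
    simp only [Option.some.injEq, Node.arc.injEq] at h4
    omega
  · rintro rfl
    rw [h5] at h6
    simp only [Option.some.injEq, Node.arc.injEq] at h6
    exact hne h6

theorem ArcDiagram.Outermost.of_cut {c : ArcDiagram} {i j k l : ℤ} (h : c.Outermost i j)
    (h' : c.Outermost k l) (hne : i ≠ k) : (c.cut i j).Outermost k l := by
  have hd := h.ne h' hne
  refine ⟨h'.1, (ArcDiagram.cut_arc h).mpr ⟨h'.2.1, hne.symm, hd.2.1.symm⟩, ?_⟩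
  intro p q hpq
  exact h'.2.2 p q ((ArcDiagram.cut_arc h).mp hpq).1

theorem ArcDiagram.cut_comm {c : ArcDiagram} {i j k l : ℤ} (h : c.Outermost i j)
    (h' : c.Outermost k l) (hne : i ≠ k) : (c.cut i j).cut k l = (c.cut k l).cut i j := by
  have hd := h.ne h' hne
  ext1
  rw [ArcDiagram.cut_node (h.of_cut h' hne), ArcDiagram.cut_node (h'.of_cut h hne.symm),
    ArcDiagram.cut_node h, ArcDiagram.cut_node h']
  funext p
  simp only [Function.update_apply]
  split_ifs <;> rfl

theorem Skeleton.cut_comm {s : Skeleton} {i j k l : ℤ} (h : s.mid.Outermost i j)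
    (h' : s.mid.Outermost k l) (hne : i ≠ k) : (s.cut i j).cut k l = (s.cut k l).cut i j := by
  unfold Skeleton.cut
  rw [ArcDiagram.cut_comm h h' hne]

theorem Reoriented.surgerable {s t : Stack} {i j k l : ℤ} (h : Surgerable s i j)
    (h' : Surgerable s k l) (hne : i ≠ k) (ht : Reoriented s i j t) : Surgerable t k l := by
  rw [surgerable_iff] at *
  have : t.mid = s.mid.cut i j := by
    rw [show t.mid = t.toSkeleton.mid from rfl, ht.skeleton]
    rfl
  rw [this]
  exact h.of_cut h' hne

namespace Stack.Closed

variable {s : Stack} {i j k l : ℤ}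

/-- Of two surgeries which both merge, but which split after the other one. -/
theorem factor_cong_merge (hs : s.Closed) (h : Surgerable s i j) (h' : Surgerable s k l)
    (h2 : ¬ s.Conn (Vertex.bot k) (Vertex.top k))
    (h3 : (s.toSkeleton.cut i j).Conn (Vertex.bot k) (Vertex.top k)) :
    (s.toSkeleton.cut k l).Conn (Vertex.bot i) (Vertex.top i) := by
  have v := (Skeleton.cut_adj_left h').conn
  have hm := fun {a b} (hab : s.Conn a b) => hs.cut_conn_merge h' h2 hab
  rcases h3.of_cut h with h4 | ⟨h4, h5⟩ | ⟨h4, h5⟩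
  · exact absurd h4 h2
  · exact (hm h4).symm.trans (v.trans (hm h5).symm)
  · exact (hm h5).trans (v.symm.trans (hm h4))

/-- A case distinction on whether each surgery splits or merges when it comes first and when it
comes second. Either the same factors occur in both orders, or the variables in the two factors are
identified in the final shape. -/
theorem factor_cong (hs : s.Closed) (h : Surgerable s i j) (h' : Surgerable s k l) (hne : i ≠ k) :
    ((s.toSkeleton.cut i j).cut k l).Cong
      (s.factor i j * (s.toSkeleton.cut i j).factor k l)
      (s.factor k l * (s.toSkeleton.cut k l).factor i j) := by
  -- The intermediate shapes are given some orientation only to make the results on oriented closed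
  -- diagrams available for them.
  obtain ⟨t, ht⟩ := hs.exists_reoriented h
  obtain ⟨t', ht'⟩ := hs.exists_reoriented h'
  have hP' := ht'.surgerable h' h hne.symm
  have hQ' := ht.surgerable h h' hne
  have hcomm := Skeleton.cut_comm h h' hne
  have st := ht.skeleton
  have st' := ht'.skeleton
  have oQ : (s.toSkeleton.cut i j).mid.Outermost k l := ArcDiagram.Outermost.of_cut h h' hne
  have oP : (s.toSkeleton.cut k l).mid.Outermost i j := ArcDiagram.Outermost.of_cut h' h hne.symm
  have splitQ : (s.toSkeleton.cut i j).Conn (Vertex.bot k) (Vertex.top k) →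
      ¬ ((s.toSkeleton.cut i j).cut k l).Conn (Vertex.bot k) (Vertex.bot l) := by
    have : t.toSkeleton.Conn (Vertex.bot k) (Vertex.top k) →
        ¬ (t.toSkeleton.cut k l).Conn (Vertex.bot k) (Vertex.bot l) :=
      ht.closed.cut_conn_split hQ'
    rwa [st] at this
  have splitP : (s.toSkeleton.cut k l).Conn (Vertex.bot i) (Vertex.top i) →
      ¬ ((s.toSkeleton.cut i j).cut k l).Conn (Vertex.bot i) (Vertex.bot j) := by
    have : t'.toSkeleton.Conn (Vertex.bot i) (Vertex.top i) →
        ¬ (t'.toSkeleton.cut i j).Conn (Vertex.bot i) (Vertex.bot j) :=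
      ht'.closed.cut_conn_split hP'
    rwa [st', ← hcomm] at this
  have mergeQ : ¬ (s.toSkeleton.cut i j).Conn (Vertex.bot k) (Vertex.top k) →
      ((s.toSkeleton.cut i j).cut k l).Conn (Vertex.bot k) (Vertex.bot l) := by
    have : ¬ t.toSkeleton.Conn (Vertex.bot k) (Vertex.top k) →
        (t.toSkeleton.cut k l).Conn (Vertex.bot k) (Vertex.bot l) :=
      ht.closed.cut_conn_pair_bot hQ'
    rwa [st] at this
  have mergeP : ¬ (s.toSkeleton.cut k l).Conn (Vertex.bot i) (Vertex.top i) →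
      ((s.toSkeleton.cut i j).cut k l).Conn (Vertex.bot i) (Vertex.bot j) := by
    have : ¬ t'.toSkeleton.Conn (Vertex.bot i) (Vertex.top i) →
        (t'.toSkeleton.cut i j).Conn (Vertex.bot i) (Vertex.bot j) :=
      ht'.closed.cut_conn_pair_bot hP'
    rwa [st', ← hcomm] at this
  unfold Skeleton.factor
  by_cases c1 : s.Conn (Vertex.bot i) (Vertex.top i) <;>
    by_cases c2 : s.Conn (Vertex.bot k) (Vertex.top k)
  · by_cases c3 : (s.toSkeleton.cut i j).Conn (Vertex.bot k) (Vertex.top k) <;>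
      by_cases c4 : (s.toSkeleton.cut k l).Conn (Vertex.bot i) (Vertex.top i)
    · rw [if_pos c1, if_pos c2, if_pos c3, if_pos c4, mul_comm]
      exact Skeleton.Cong.refl _
    -- After cutting at `k`, `l`, the cap and cup at `i` lie on the two parts containing `bot k` and
    -- `bot l`, so that the second surgery joins these. In the other order the last surgery
    -- separates `bot k` from `bot l`.
    · exfalso
      refine splitQ c3 ?_
      have e1 : s.Conn (Vertex.bot k) (Vertex.bot i) := by
        by_contra hc
        exact c4 (c1.cut_of_not h' (fun h5 => hc h5.symm) (fun h5 => hc (c2.trans h5.symm)))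
      have e2 := e1.cut_or h' (Or.inl (Skeleton.Conn.refl _))
      have e3 := (e1.trans c1).cut_or h' (Or.inl (Skeleton.Conn.refl _))
      have vert := (Skeleton.cut_adj_left oP).conn
      have up := fun {a b} (hab : (s.toSkeleton.cut k l).Conn a b) =>
        (st' ▸ ht'.closed.cut_conn_merge hP' (by rwa [st']) (st' ▸ hab) :
          ((s.toSkeleton.cut k l).cut i j).Conn a b)
      rw [hcomm]
      rcases e2 with e2 | e2 <;> rcases e3 with e3 | e3
      · exact absurd (e2.symm.trans e3) c4
      · exact (up e2).trans (vert.trans (up e3).symm)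
      · exact (up e3).trans (vert.symm.trans (up e2).symm)
      · exact absurd (e2.symm.trans e3) c4
    · exfalso
      refine splitP c4 ?_
      have e1 : s.Conn (Vertex.bot i) (Vertex.bot k) := by
        by_contra hc
        exact c3 (c2.cut_of_not h (fun h5 => hc h5.symm) (fun h5 => hc (c1.trans h5.symm)))
      have e2 := e1.cut_or h (Or.inl (Skeleton.Conn.refl _))
      have e3 := (e1.trans c2).cut_or h (Or.inl (Skeleton.Conn.refl _))
      have vert := (Skeleton.cut_adj_left oQ).conn
      have up := fun {a b} (hab : (s.toSkeleton.cut i j).Conn a b) =>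
        (st ▸ ht.closed.cut_conn_merge hQ' (by rwa [st]) (st ▸ hab) :
          ((s.toSkeleton.cut i j).cut k l).Conn a b)
      rcases e2 with e2 | e2 <;> rcases e3 with e3 | e3
      · exact absurd (e2.symm.trans e3) c3
      · exact (up e2).trans (vert.trans (up e3).symm)
      · exact (up e3).trans (vert.symm.trans (up e2).symm)
      · exact absurd (e2.symm.trans e3) c3
    -- Either surgery undoes the splitting by the other one. In the end all four variables belong to
    -- one circle.
    · rw [if_pos c1, if_pos c2, if_neg c3, if_neg c4, mul_one, mul_one]
      have e1 : s.Conn (Vertex.bot i) (Vertex.bot k) := by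
        by_contra hc
        exact c3 (c2.cut_of_not h (fun h5 => hc h5.symm) (fun h5 => hc (c1.trans h5.symm)))
      have up := fun {a b} (hab : (s.toSkeleton.cut i j).Conn a b) =>
        (st ▸ ht.closed.cut_conn_merge hQ' (by rwa [st]) (st ▸ hab) :
          ((s.toSkeleton.cut i j).cut k l).Conn a b)
      have m1 := mergeP c4
      have m2 := mergeQ c3
      have m3 : ((s.toSkeleton.cut i j).cut k l).Conn (Vertex.bot i) (Vertex.bot k) := by
        rcases e1.cut_or h (Or.inl (Skeleton.Conn.refl _)) with e2 | e2
        · exact up e2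
        · exact m1.trans (up e2)
      exact (Skeleton.Cong.X m3).add (Skeleton.Cong.X (m1.symm.trans (m3.trans m2)))
  · have c4 : (s.toSkeleton.cut k l).Conn (Vertex.bot i) (Vertex.top i) :=
      hs.cut_conn_merge h' c2 c1
    have c3 : ¬ (s.toSkeleton.cut i j).Conn (Vertex.bot k) (Vertex.top k) :=
      fun hc => c2 (Skeleton.Conn.of_cut_split h c1 hc)
    rw [if_pos c1, if_neg c2, if_neg c3, if_pos c4, mul_one, one_mul]
    exact Skeleton.Cong.refl _
  · have c3 : (s.toSkeleton.cut i j).Conn (Vertex.bot k) (Vertex.top k) :=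
      hs.cut_conn_merge h c1 c2
    have c4 : ¬ (s.toSkeleton.cut k l).Conn (Vertex.bot i) (Vertex.top i) :=
      fun hc => c1 (Skeleton.Conn.of_cut_split h' c2 hc)
    rw [if_neg c1, if_pos c2, if_pos c3, if_neg c4, mul_one, one_mul]
    exact Skeleton.Cong.refl _
  · rw [if_neg c1, if_neg c2, one_mul, one_mul]
    by_cases c3 : (s.toSkeleton.cut i j).Conn (Vertex.bot k) (Vertex.top k)
    -- Two circles are joined twice. The final shape has two circles there, each containing one of
    -- `bot i`, `bot j` and one of `bot k`, `bot l`, so both factors are the sum of the same two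
    -- variables.
    · have c4 := hs.factor_cong_merge h h' c2 c3
      rw [if_pos c3, if_pos c4]
      have vP := (Skeleton.cut_adj_left h).conn
      have c5 : (s.toSkeleton.cut k l).Conn (Vertex.bot i) (Vertex.bot k) := by
        have hm := fun {a b} (hab : s.Conn a b) => hs.cut_conn_merge h' c2 hab
        have vQ := (Skeleton.cut_adj_left h').conn
        rcases c3.of_cut h with h4 | ⟨h4, h5⟩ | ⟨h4, h5⟩
        · exact absurd h4 c2
        · exact (hm h4).symm
        · exact (hm h5).trans vQ.symm
      have c6 : (s.toSkeleton.cut k l).Conn (Vertex.bot k) (Vertex.bot l) :=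
        hs.cut_conn_pair_bot h' c2
      have d1 := c5.cut_or oP (Or.inl (Skeleton.Conn.refl _))
      have d2 := (c5.trans c6).cut_or oP (Or.inl (Skeleton.Conn.refl _))
      rw [← hcomm] at d1 d2
      have n := splitQ c3
      rcases d1 with d1 | d1 <;> rcases d2 with d2 | d2
      · exact absurd (d1.symm.trans d2) n
      · exact (Skeleton.Cong.X d1.symm).add (Skeleton.Cong.X d2.symm)
      · rw [add_comm]
        exact (Skeleton.Cong.X d2.symm).add (Skeleton.Cong.X d1.symm)
      · exact absurd (d1.symm.trans d2) n
    · have c4 : ¬ (s.toSkeleton.cut k l).Conn (Vertex.bot i) (Vertex.top i) :=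
        fun hc => c3 (hs.factor_cong_merge h' h c1 hc)
      rw [if_neg c3, if_neg c4]
      exact Skeleton.Cong.refl _

/-- The sum over the outcomes of two consecutive surgeries. -/
theorem sum_bind_outcomes_cong (hs : s.Closed) (h : Surgerable s i j) (h' : Surgerable s k l)
    (hne : i ≠ k) :
    ((s.toSkeleton.cut i j).cut k l).Cong
      (((outcomes s i j).bind fun t => outcomes t k l).map mono).sum
      (s.mono * (s.factor i j * (s.toSkeleton.cut i j).factor k l)) := by
  obtain ⟨t0, ht0⟩ := hs.exists_reoriented h
  have hQ := ht0.surgerable h h' hne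
  -- Each surgery contributes its factor; the first congruence is carried over to the ring of the
  -- final shape by `factor_mul_cong`.
  rw [Multiset.map_bind, Multiset.sum_bind]
  have h1 : ((s.toSkeleton.cut i j).cut k l).Cong
      ((outcomes s i j).map fun t => ((outcomes t k l).map mono).sum).sum
      ((outcomes s i j).map fun t => t.mono * (s.toSkeleton.cut i j).factor k l).sum := by
    refine Skeleton.Cong.sum_map _ fun t ht => ?_
    have ht' := Reoriented.of_outcome hs h (mem_outcomes.mp ht)
    have := ht'.closed.sum_outcomes_cong (ht'.surgerable h h' hne)
    rwa [ht'.skeleton] at this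
  refine h1.trans ?_
  rw [Multiset.sum_map_mul_right, ← mul_assoc]
  have h2 := hs.sum_outcomes_cong h
  rw [← ht0.skeleton] at h2
  have h3 := ht0.closed.factor_mul_cong hQ h2
  rwa [ht0.skeleton] at h3

/-- Two surgeries may be interchanged. -/
theorem outcomes_comm (hs : s.Closed) (h : Surgerable s i j) (h' : Surgerable s k l)
    (hne : i ≠ k) :
    ((outcomes s i j).bind fun t => outcomes t k l) =
      (outcomes s k l).bind fun t => outcomes t i j := by
  have hmem : ∀ {i j k l}, Surgerable s i j → Surgerable s k l → i ≠ k →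
      ∀ u ∈ (outcomes s i j).bind fun t => outcomes t k l,
        u.Closed ∧ u.toSkeleton = (s.toSkeleton.cut i j).cut k l ∧ s.Alike u := by
    intro i j k l h h' hne u hu
    obtain ⟨t, ht, hu⟩ := Multiset.mem_bind.mp hu
    have ht := Reoriented.of_outcome hs h (mem_outcomes.mp ht)
    have hQ := ht.surgerable h h' hne
    have hu := Reoriented.of_outcome ht.closed hQ (mem_outcomes.mp hu)
    refine ⟨hu.closed, ?_, (ht.alike hs h).trans (hu.alike ht.closed hQ)⟩
    rw [hu.skeleton, ht.skeleton]
  have hcomm := Skeleton.cut_comm h h' hne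
  refine Closed.eq_of_sum_cong (σ := (s.toSkeleton.cut i j).cut k l) ?_ ?_ ?_
  · intro u hu
    rcases Multiset.mem_add.mp hu with hu | hu
    · have := hmem h h' hne u hu
      exact ⟨this.1, this.2.1⟩
    · have := hmem h' h hne.symm u hu
      exact ⟨this.1, this.2.1.trans hcomm.symm⟩
  · have : ∀ u ∈ ((outcomes s i j).bind fun t => outcomes t k l) +
        (outcomes s k l).bind fun t => outcomes t i j, s.Alike u := by
      intro u hu
      rcases Multiset.mem_add.mp hu with hu | hu
      · exact (hmem h h' hne u hu).2.2
      · exact (hmem h' h hne.symm u hu).2.2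
    exact fun u hu u' hu' => (this u hu).symm.trans (this u' hu')
  · refine (hs.sum_bind_outcomes_cong h h' hne).trans ?_
    have h1 := hs.sum_bind_outcomes_cong h' h hne.symm
    rw [← hcomm] at h1
    exact ((Skeleton.Cong.refl _).mul (hs.factor_cong h h' hne)).trans h1.symm

end Stack.Closed

/-! ## Performing all surgeries -/

/-- The fold treats the members of the disjoint union independently. -/
theorem foldl_bind {α β : Type*} (f : α → β → Multiset α) (L : List β) (R : Multiset α) :
    L.foldl (fun R b => R.bind fun a => f a b) R =
      R.bind fun a => L.foldl (fun R b => R.bind fun a => f a b) {a} := by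
  induction L generalizing R with
  | nil => exact (Multiset.bind_singleton R id).trans (Multiset.map_id R) |>.symm
  | cons b L ih =>
    simp only [List.foldl_cons]
    rw [ih, Multiset.bind_assoc]
    refine Multiset.bind_congr fun a _ => ?_
    rw [Multiset.singleton_bind, ← ih]

theorem ArcDiagram.mem_leftEnds {c : ArcDiagram} {i : ℤ} :
    i ∈ c.leftEnds ↔ ∃ j, i < j ∧ c.node i = some (Node.arc j) := by
  unfold ArcDiagram.leftEnds
  rw [Finset.mem_sort, Set.Finite.mem_toFinset]
  constructor
  · intro (h : i < c.partner i)
    exact ⟨_, h, ArcDiagram.partner_ne h.ne'⟩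
  · rintro ⟨j, h1, h2⟩
    change i < c.partner i
    rwa [ArcDiagram.partner_eq h2]

/-- An enclosing arc would start further to the left, so the first arc is outermost. Cutting it
removes it from the list and keeps all other arcs, so the fold over left ends always performs
admissible surgeries. -/
theorem ArcDiagram.leftEnds_eq_cons {c : ArcDiagram} {i : ℤ} {L : List ℤ}
    (h : c.leftEnds = i :: L) :
    c.Outermost i (c.partner i) ∧ (c.cut i (c.partner i)).leftEnds = L ∧
      ∀ k ∈ L, (c.cut i (c.partner i)).partner k = c.partner k := by
  have hsort : c.leftEnds.Pairwise (· ≤ ·) := Finset.pairwise_sort _ _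
  have hnd : c.leftEnds.Nodup := Finset.sort_nodup _ _
  have hmem := fun k => c.mem_leftEnds (i := k)
  rw [h] at hsort hnd hmem
  obtain ⟨j, hij, hi⟩ := (hmem i).mp (List.mem_cons_self)
  have hp : c.partner i = j := ArcDiagram.partner_eq hi
  rw [hp]
  have ho : c.Outermost i j := by
    refine ⟨hij, hi, ?_⟩
    intro k l hkl hc
    have h1 := (hmem k).mpr ⟨l, by omega, hkl⟩
    rcases List.mem_cons.mp h1 with rfl | h1
    · omega
    · have := (List.pairwise_cons.mp hsort).1 k h1
      omega
  have hL : ∀ k, k ∈ L ↔ ∃ l, k < l ∧ (c.cut i j).node k = some (Node.arc l) := by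
    intro k
    constructor
    · intro hk
      obtain ⟨l, h1, h2⟩ := (hmem k).mp (List.mem_cons_of_mem _ hk)
      refine ⟨l, h1, (ArcDiagram.cut_arc ho).mpr ⟨h2, ?_, ?_⟩⟩
      · rintro rfl
        exact (List.nodup_cons.mp hnd).1 hk
      · rintro rfl
        rw [(c.arc_symm _ _ hi).2] at h2
        simp only [Option.some.injEq, Node.arc.injEq] at h2
        omega
    · rintro ⟨l, h1, h2⟩
      obtain ⟨h3, h4, -⟩ := (ArcDiagram.cut_arc ho).mp h2
      exact (List.mem_cons.mp ((hmem k).mpr ⟨l, h1, h3⟩)).resolve_left h4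
  refine ⟨ho, ?_, ?_⟩
  · have hperm : (c.cut i j).leftEnds.Perm L := by
      refine (List.perm_ext_iff_of_nodup (Finset.sort_nodup _ _) (List.nodup_cons.mp hnd).2).mpr ?_
      intro k
      rw [hL]
      exact ArcDiagram.mem_leftEnds
    exact hperm.eq_of_pairwise' (Finset.pairwise_sort _ _) (List.pairwise_cons.mp hsort).2
  · intro k hk
    obtain ⟨l, h1, h2⟩ := (hL k).mp hk
    rw [ArcDiagram.partner_eq h2, ArcDiagram.partner_eq ((ArcDiagram.cut_arc ho).mp h2).1]

theorem allSurgeries_of_nil {s : Stack} (h : s.mid.leftEnds = []) : allSurgeries s = {s} := by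
  unfold allSurgeries
  rw [h]
  rfl

theorem allSurgeries_of_cons {s : Stack} {i : ℤ} {L : List ℤ} (h : s.mid.leftEnds = i :: L) :
    allSurgeries s = (outcomes s i (s.mid.partner i)).bind allSurgeries := by
  obtain ⟨ho, hL, hp⟩ := ArcDiagram.leftEnds_eq_cons h
  unfold allSurgeries
  rw [h, List.foldl_cons, Multiset.singleton_bind,
    foldl_bind (fun t i => outcomes t i (s.mid.partner i))]
  refine Multiset.bind_congr fun t ht => ?_
  have hm : t.mid = _ := (mem_outcomes.mp ht).mid_eq (surgerable_iff.mpr ho)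
  rw [hm, hL]
  refine List.foldl_ext _ _ _ fun R k hk => ?_
  rw [hp k hk]

theorem ArcDiagram.leftEnds_eq_nil {c : ArcDiagram} :
    c.leftEnds = [] ↔ ∀ i j, c.node i ≠ some (Node.arc j) := by
  rw [List.eq_nil_iff_forall_not_mem]
  constructor
  · intro h i j hij
    obtain ⟨k, l, h1, h2⟩ := ArcDiagram.exists_left_end hij
    exact h k (c.mem_leftEnds.mpr ⟨l, h1, h2⟩)
  · intro h i hi
    obtain ⟨j, -, hj⟩ := c.mem_leftEnds.mp hi
    exact h i j hj

/-- The result does not depend on the order of the surgeries. -/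
theorem Stack.Closed.allSurgeries_eq {s : Stack} (hs : s.Closed) {i j : ℤ} (h : Surgerable s i j) :
    allSurgeries s = (outcomes s i j).bind allSurgeries := by
  induction hn : s.mid.numEnds using Nat.strong_induction_on generalizing s i j with
  | _ n ih =>
  subst hn
  rcases hL : s.mid.leftEnds with _ | ⟨k, L⟩
  · exact absurd h.2.1 (ArcDiagram.leftEnds_eq_nil.mp hL i j)
  rw [allSurgeries_of_cons hL]
  have hk := (ArcDiagram.leftEnds_eq_cons hL).1
  by_cases hne : i = k
  · subst hne
    rw [ArcDiagram.partner_eq h.2.1]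
  have hk' := surgerable_iff.mpr hk
  -- By induction the surgeries remaining after the first one may start with any other admissible
  -- pair. The two orders then differ only by an interchange of two surgeries.
  have step : ∀ {a b c d : ℤ}, Surgerable s a b → Surgerable s c d → a ≠ c →
      (outcomes s a b).bind allSurgeries =
        ((outcomes s a b).bind fun t => outcomes t c d).bind allSurgeries := by
    intro a b c d h1 h2 h3
    rw [Multiset.bind_assoc]
    refine Multiset.bind_congr fun t ht => ?_
    have ht := mem_outcomes.mp ht
    have hr := Reoriented.of_outcome hs h1 ht
    refine ih _ ?_ hr.closed (hr.surgerable h1 h2 h3) rfl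
    rw [ht.mid_eq h1]
    exact ArcDiagram.numEnds_cut_lt h1
  rw [step hk' h (Ne.symm hne), step h hk' hne, hs.outcomes_comm h hk' hne]

end DiagramAlgebra

namespace DiagramAlgebra

/-! ## Circles reaching out of a window -/

theorem Vertex.line_line (v : Vertex) (q : ℤ) : (v.line q).line = v.line := by cases v <;> rfl

theorem Vertex.pos_line (v : Vertex) (q : ℤ) : (v.line q).pos = q := by cases v <;> rfl

/-- The vertices to the left of the window `[l, r]` are labelled `∨`, those to the right of it are
labelled `∧`, if they carry an arrow at all. -/
structure Stack.Good (l r : ℤ) (s : Stack) : Prop where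
  left : ∀ v : Vertex, v.pos < l → s.label v ≠ some Label.up
  right : ∀ v : Vertex, r < v.pos → s.label v ≠ some Label.down

namespace Stack.Closed

variable {s : Stack} {l r : ℤ}

theorem charge_line (D : Set Vertex) (v : Vertex) (q : ℤ) :
    s.charge D v.line q = if v.line q ∈ D then val (s.label (v.line q)) else 0 := rfl

/-- All charges to the left of `v` are nonnegative, and a further vertex of `D` with an arrow
contributes `1`. -/
theorem left_height {D : Set Vertex} {a : ℤ} (v : Vertex)
    (h0 : ∀ p, p < v.pos → v.line p ∈ D → s.label (v.line p) ≠ some Label.up) :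
    0 ≤ s.ht D a v.line v.pos ∧
      ∀ p, a ≤ p → p < v.pos → v.line p ∈ D → s.Arrow (v.line p) → 1 ≤ s.ht D a v.line v.pos := by
  have hpos : ∀ p ∈ Finset.Ico a v.pos, 0 ≤ s.charge D v.line p := by
    intro p hp
    rw [Finset.mem_Ico] at hp
    rw [charge_line]
    split_ifs with h1
    · have := h0 p hp.2 h1
      rcases val_cases (s.label (v.line p)) with c | c | c
      · omega
      · exact absurd c.2 this
      · omega
    · rfl
  refine ⟨Finset.sum_nonneg hpos, ?_⟩
  intro p h1 h2 h3 h4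
  have h5 := Finset.single_le_sum hpos (Finset.mem_Ico.mpr ⟨h1, h2⟩)
  rw [charge_line, if_pos h3] at h5
  have h6 : s.label (v.line p) = some Label.down := h4.resolve_right (h0 p h2 h3)
  rw [h6] at h5
  exact h5

/-- Mirror image of `left_height`: the total charge of `D` on the number line vanishes, and the
charges to the right of `v` are nonpositive. -/
theorem right_height (hs : s.Closed) {D : Set Vertex} (hD : s.Stable D) {a b : ℤ}
    (hab : ∀ v ∈ D, a ≤ v.pos ∧ v.pos < b) (v : Vertex) (hv : v ∈ D)
    (h0 : ∀ p, v.pos < p → v.line p ∈ D → s.label (v.line p) ≠ some Label.down) :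
    - val (s.label v) ≤ s.ht D a v.line v.pos ∧
      ∀ p, v.pos < p → v.line p ∈ D → s.Arrow (v.line p) →
        1 - val (s.label v) ≤ s.ht D a v.line v.pos := by
  have h1 := hs.sum_eq_zero hD hab v
  have h2 := hab v hv
  rw [s.ht_split D v.line (k := v.pos + 1) (by omega) (by omega), s.ht_succ D v.line h2.1,
    charge_line, v.line_pos, if_pos hv] at h1
  have hneg : ∀ p ∈ Finset.Ico (v.pos + 1) b, 0 ≤ - s.charge D v.line p := by
    intro p hp
    rw [Finset.mem_Ico] at hp
    rw [charge_line]
    split_ifs with h3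
    · have := h0 p (by omega) h3
      rcases val_cases (s.label (v.line p)) with c | c | c
      · exact absurd c.2 this
      · omega
      · omega
    · simp
  have h4 := Finset.sum_nonneg hneg
  rw [Finset.sum_neg_distrib] at h4
  refine ⟨by omega, ?_⟩
  intro p h5 h6 h7
  have h8 := hab _ h6
  rw [Vertex.pos_line] at h8
  have h9 := Finset.single_le_sum hneg (Finset.mem_Ico.mpr ⟨by omega, h8.2⟩)
  rw [charge_line, if_pos h6, h7.resolve_left (h0 p h5 h6), Finset.sum_neg_distrib, val_up] at h9
  omega

theorem exists_comp_bounds (hs : s.Closed) {v : Vertex} (hv : s.Arrow v) :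
    ∃ a b : ℤ, ∀ u ∈ s.comp v, a ≤ u.pos ∧ u.pos < b := by
  obtain ⟨a, b, hab⟩ := hs.exists_bounds
  exact ⟨a, b, fun u hu => hab u (Arrow.label_ne (hs.comp_arrow hv u hu))⟩

theorem exists_winds (hs : s.Closed) {v : Vertex} (hv : s.Arrow v) :
    (Winds s (s.comp v) 1 ∧ s.HasType v CompType.one) ∨
      (Winds s (s.comp v) (-1) ∧ s.HasType v CompType.x) :=
  (hs.hasType_cases hv).imp (fun h => ⟨(hs.hasType_one_iff hv).mp h, h⟩)
    (fun h => ⟨(hs.hasType_x_iff hv).mp h, h⟩)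

/-- A vertex that has no other vertex of the same circle to its left has the label determined by the
orientation. -/
theorem label_of_first (hs : s.Closed) {v : Vertex} (hv : s.Arrow v)
    (h1 : s.HasType v CompType.one) (h0 : ∀ p, p < v.pos → ¬ s.Conn v (v.line p)) :
    s.label v = some Label.down := by
  obtain ⟨a, b, hab⟩ := hs.exists_comp_bounds hv
  have hw := (hs.hasType_one_iff hv).mp h1 a (fun u hu => (hab u hu).1) v (Skeleton.Conn.refl v)
  have h2 := (left_height (s := s) (D := s.comp v) (a := a) v (fun p hp hc => absurd hc (h0 p hp))).1
  rcases hv with h | h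
  · exact h
  · rw [h, val_up] at hw
    have h3 : s.ht (s.comp v) a v.line v.pos = 0 := by
      unfold Stack.ht
      refine Finset.sum_eq_zero fun p hp => ?_
      exact if_neg (h0 p (Finset.mem_Ico.mp hp).2)
    omega

/-- With total charge zero and nothing to the right, the height at `v` is minus its value. So the
invariant is minus the value, and it equals `1` only for `∧`. -/
theorem label_of_last (hs : s.Closed) {v : Vertex} (hv : s.Arrow v)
    (h1 : s.HasType v CompType.one) (h0 : ∀ p, v.pos < p → ¬ s.Conn v (v.line p)) :
    s.label v = some Label.up := by
  obtain ⟨a, b, hab⟩ := hs.exists_comp_bounds hv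
  have hw := (hs.hasType_one_iff hv).mp h1 a (fun u hu => (hab u hu).1) v (Skeleton.Conn.refl v)
  have h2 := (hab v (Skeleton.Conn.refl v))
  have h3 := hs.sum_eq_zero (s.stable_comp v) hab v
  rw [s.ht_split _ v.line (k := v.pos + 1) (by omega) (by omega), s.ht_succ _ v.line h2.1,
    charge_line, v.line_pos, if_pos (show v ∈ s.comp v from Skeleton.Conn.refl v),
    Finset.sum_eq_zero (s := Finset.Ico (v.pos + 1) b)] at h3
  · rcases hv with h | h
    · rw [h, val_down] at hw h3
      omega
    · exact h
  · intro p hp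
    exact if_neg (h0 p (by have := (Finset.mem_Ico.mp hp).1; omega))

/-- On the left of the window the label is `∨` and the height nonnegative; on the right the label is
`∧` and the height at least `1`. Either way the invariant is positive. -/
theorem type_one_of_good (hs : s.Closed) (hg : s.Good l r) {v : Vertex} (hv : s.Arrow v)
    (ho : v.pos < l ∨ r < v.pos) : s.HasType v CompType.one := by
  rcases hs.exists_winds hv with h | ⟨hw, -⟩
  · exact h.2
  exfalso
  obtain ⟨a, b, hab⟩ := hs.exists_comp_bounds hv
  have hw := hw a (fun u hu => (hab u hu).1) v (Skeleton.Conn.refl v)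
  rcases ho with ho | ho
  · have h1 := (left_height (s := s) (D := s.comp v) (a := a) v
      (fun p hp _ => hg.left _ (by rw [Vertex.pos_line]; omega))).1
    rw [hv.resolve_right (hg.left v ho), val_down] at hw
    omega
  · have h1 := (hs.right_height (s.stable_comp v) hab v (Skeleton.Conn.refl v)
      (fun p hp _ => hg.right _ (by rw [Vertex.pos_line]; omega))).1
    rw [hv.resolve_left (hg.right v ho), val_up] at hw h1
    omega

/-- A second vertex on the left would raise the height of the right one of the two to `1`, so that
the invariant would be at least `3`. -/
theorem left_unique_of_good (hs : s.Closed) (hg : s.Good l r) {v : Vertex} (hv : s.Arrow v)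
    {q : ℤ} (hc : s.Conn v (v.line q)) (h1 : v.pos < l) (h2 : q < l) : q = v.pos := by
  have key : ∀ (v : Vertex) (q : ℤ), s.Arrow v → s.Conn v (v.line q) → v.pos < l → q < v.pos →
      False := by
    intro v q hv hc h1 h2
    obtain ⟨a, b, hab⟩ := hs.exists_comp_bounds hv
    have hw := (hs.hasType_one_iff hv).mp (hs.type_one_of_good hg hv (Or.inl h1)) a
      (fun u hu => (hab u hu).1) v (Skeleton.Conn.refl v)
    have h3 := (hab _ hc).1
    rw [Vertex.pos_line] at h3
    have h4 := (left_height (s := s) (D := s.comp v) (a := a) v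
      (fun p hp _ => hg.left _ (by rw [Vertex.pos_line]; omega))).2 q h3 h2 hc
      (hs.consistent.conn_arrow hc hv)
    rw [hv.resolve_right (hg.left v h1), val_down] at hw
    omega
  rcases lt_trichotomy q v.pos with h | h | h
  · exact (key v q hv hc h1 h).elim
  · exact h
  · refine (key (v.line q) v.pos (hs.consistent.conn_arrow hc hv) ?_ ?_ ?_).elim
    · rw [Vertex.line_line, Vertex.line_pos]
      exact hc.symm
    · rwa [Vertex.pos_line]
    · rwa [Vertex.pos_line]

/-- Mirror image: if `q` is to the right of `v`, then the height of `v` is at least `2`, so the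
invariant would be at least `3`. -/
theorem right_unique_of_good (hs : s.Closed) (hg : s.Good l r) {v : Vertex} (hv : s.Arrow v)
    {q : ℤ} (hc : s.Conn v (v.line q)) (h1 : r < v.pos) (h2 : r < q) : q = v.pos := by
  have key : ∀ (v : Vertex) (q : ℤ), s.Arrow v → s.Conn v (v.line q) → r < v.pos → v.pos < q →
      False := by
    intro v q hv hc h1 h2
    obtain ⟨a, b, hab⟩ := hs.exists_comp_bounds hv
    have hw := (hs.hasType_one_iff hv).mp (hs.type_one_of_good hg hv (Or.inr h1)) a
      (fun u hu => (hab u hu).1) v (Skeleton.Conn.refl v)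
    have h4 := (hs.right_height (s.stable_comp v) hab v (Skeleton.Conn.refl v)
      (fun p hp _ => hg.right _ (by rw [Vertex.pos_line]; omega))).2 q h2 hc
      (hs.consistent.conn_arrow hc hv)
    rw [hv.resolve_left (hg.right v h1), val_up] at hw h4
    omega
  rcases lt_trichotomy q v.pos with h | h | h
  · refine (key (v.line q) v.pos (hs.consistent.conn_arrow hc hv) ?_ ?_ ?_).elim
    · rw [Vertex.line_line, Vertex.line_pos]
      exact hc.symm
    · rwa [Vertex.pos_line]
    · rwa [Vertex.pos_line]
  · exact h
  · exact (key v q hv hc h1 h).elim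

theorem not_x_of_good (hs : s.Closed) (hg : s.Good l r) {v u : Vertex} (hv : s.Arrow v)
    (hx : s.HasType v CompType.x) (hc : s.Conn v u) : ¬ (u.pos < l ∨ r < u.pos) := fun ho =>
  hs.not_one_and_x (hs.consistent.conn_arrow hc hv)
    (hs.type_one_of_good hg (hs.consistent.conn_arrow hc hv) ho) (hs.hasType_conn hv hc hx)

/-- Surgery can only produce a diagram with good labels from one with good labels. -/
theorem good_of_outcome (hs : s.Closed) {i j : ℤ} (h : Surgerable s i j) {t : Stack}
    (ho : Outcome s i j t) (hg : t.Good l r) : s.Good l r := by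
  have ht := Reoriented.of_outcome hs h ho
  have hbi := hs.arrow_bot_left h
  have hti := hs.arrow_top_left h
  have hai := ht.arrow_left h
  have haj := ht.arrow_right h
  -- Circles of `s` in the surgery that reach out of the window are anti-clockwise, and their
  -- vertices outside the window stay together. Uniqueness of the outside vertices in `t` then makes
  -- such a vertex the first or last one of its circle in `s`, which determines its label.
  have key : ∀ v, (v.pos < l ∨ r < v.pos) → s.Arrow v →
      (t.Conn (Vertex.bot i) v ∨ t.Conn (Vertex.bot j) v) →
      s.HasType v CompType.one ∧
        ∀ u, (u.pos < l ∨ r < u.pos) → s.Conn v u → t.Conn v u := by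
    intro v hv hva hvc
    by_cases hc : s.Conn (Vertex.bot i) (Vertex.top i)
    · have hsv : s.Conn (Vertex.bot i) v := by
        rcases hvc with hvc | hvc
        · exact Skeleton.Conn.of_cut_split h hc ((ht.conn_iff _ _).mp hvc)
        · exact (Skeleton.conn_pair_bot h).trans
            (Skeleton.Conn.of_cut_split h hc ((ht.conn_iff _ _).mp hvc))
      have hon : ∀ u, s.Conn v u → t.Conn (Vertex.bot i) u ∨ t.Conn (Vertex.bot j) u := by
        intro u hu
        rw [ht.conn_iff, ht.conn_iff]
        exact (hsv.trans hu).cut_or h (Or.inl (Skeleton.Conn.refl _))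
      rcases hs.hasType_cases hbi with h1 | h1
      · refine ⟨hs.hasType_conn hbi hsv h1, ?_⟩
        intro u hu hvu
        have hu' := hon u hvu
        obtain ⟨B, C, hr, h2, h3⟩ := hs.split_rule h hc h1 ho
        -- The clockwise part of the split circle stays inside the window, hence all outside
        -- vertices lie on the other part.
        have n1 : B = CompType.x → ∀ w, t.Conn (Vertex.bot i) w → ¬ (w.pos < l ∨ r < w.pos) := by
          rintro rfl w hw
          exact ht.closed.not_x_of_good hg hai h2 hw
        have n2 : C = CompType.x → ∀ w, t.Conn (Vertex.bot j) w → ¬ (w.pos < l ∨ r < w.pos) := by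
          rintro rfl w hw
          exact ht.closed.not_x_of_good hg haj h3 hw
        cases hr
        · have e1 := hvc.resolve_right fun h4 => n2 rfl v h4 hv
          have e2 := hu'.resolve_right fun h4 => n2 rfl u h4 hu
          exact e1.symm.trans e2
        · have e1 := hvc.resolve_left fun h4 => n1 rfl v h4 hv
          have e2 := hu'.resolve_left fun h4 => n1 rfl u h4 hu
          exact e1.symm.trans e2
      · exfalso
        obtain ⟨B, C, hr, h2, h3⟩ := hs.split_rule h hc h1 ho
        cases hr
        rcases hvc with hvc | hvc
        · exact ht.closed.not_x_of_good hg hai h2 hvc hv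
        · exact ht.closed.not_x_of_good hg haj h3 hvc hv
    · have hij : t.Conn (Vertex.bot i) (Vertex.bot j) := by
        rw [ht.conn_iff]
        exact hs.cut_conn_pair_bot h hc
      have hvc' : t.Conn (Vertex.bot i) v := hvc.elim id hij.trans
      refine ⟨?_, fun u _ hu => by
        rw [ht.conn_iff]
        exact hs.cut_conn_merge h hc hu⟩
      obtain ⟨A, B, C, hr, h1, h2, h3⟩ := hs.merge_rule hc ho
      have h4 : C ≠ CompType.x := by
        rintro rfl
        exact ht.closed.not_x_of_good hg hai h3 hvc' hv
      have h5 : A = CompType.one ∧ B = CompType.one := by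
        cases hr
        · exact ⟨rfl, rfl⟩
        · exact absurd rfl h4
        · exact absurd rfl h4
        · exact absurd h2 (hs.not_hasType_y _)
        · exact absurd h1 (hs.not_hasType_y _)
      obtain ⟨rfl, rfl⟩ := h5
      rw [ht.conn_iff] at hvc'
      rcases hvc'.of_cut h with h6 | ⟨-, h6⟩ | ⟨h6, -⟩
      · exact hs.hasType_conn hbi h6 h1
      · exact hs.hasType_conn hti h6 h2
      · exact absurd h6 hc
  constructor
  · intro v hv hup
    have hva : s.Arrow v := Or.inr hup
    by_cases hvc : t.Conn (Vertex.bot i) v ∨ t.Conn (Vertex.bot j) v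
    · obtain ⟨h1, h2⟩ := key v (Or.inl hv) hva hvc
      have h3 := hs.label_of_first hva h1 (fun p hp hc => by
        have h4 := h2 _ (Or.inl (by rw [Vertex.pos_line]; omega)) hc
        have := ht.closed.left_unique_of_good hg ((ht.arrow_iff hs h v).mpr hva) h4 hv (by omega)
        omega)
      rw [h3] at hup
      simp at hup
    · rw [not_or] at hvc
      rw [← ht.unchanged v hvc.1 hvc.2] at hup
      exact hg.left v hv hup
  · intro v hv hdn
    have hva : s.Arrow v := Or.inl hdn
    by_cases hvc : t.Conn (Vertex.bot i) v ∨ t.Conn (Vertex.bot j) v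
    · obtain ⟨h1, h2⟩ := key v (Or.inr hv) hva hvc
      have h3 := hs.label_of_last hva h1 (fun p hp hc => by
        have h4 := h2 _ (Or.inr (by rw [Vertex.pos_line]; omega)) hc
        have := ht.closed.right_unique_of_good hg ((ht.arrow_iff hs h v).mpr hva) h4 hv (by omega)
        omega)
      rw [h3] at hdn
      simp at hdn
    · rw [not_or] at hvc
      rw [← ht.unchanged v hvc.1 hvc.2] at hdn
      exact hg.right v hv hdn

/-- A diagram with bad labels contributes nothing. -/
theorem filter_allSurgeries (hs : s.Closed) (hg : ¬ s.Good l r) :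
    (allSurgeries s).filter (Stack.Good l r) = 0 := by
  induction hn : s.mid.numEnds using Nat.strong_induction_on generalizing s with
  | _ n ih =>
  subst hn
  rcases hL : s.mid.leftEnds with _ | ⟨k, L⟩
  · rw [allSurgeries_of_nil hL, Multiset.filter_singleton, if_neg hg]
    rfl
  rw [allSurgeries_of_cons hL, Multiset.filter_bind, Multiset.bind_congr (g := fun _ => 0)]
  · exact Multiset.bind_zero _
  · intro t ht
    have hk := surgerable_iff.mpr (ArcDiagram.leftEnds_eq_cons hL).1
    have ho := mem_outcomes.mp ht
    refine ih _ ?_ (Reoriented.of_outcome hs hk ho).closed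
      (fun hgt => hg (hs.good_of_outcome hk ho hgt)) rfl
    rw [ho.mid_eq hk]
    exact ArcDiagram.numEnds_cut_lt hk

/-- Outcomes with bad labels may be dropped. -/
theorem filter_allSurgeries_eq (hs : s.Closed) {i j : ℤ} (h : Surgerable s i j) :
    (allSurgeries s).filter (Stack.Good l r) =
      (((outcomes s i j).filter (Stack.Good l r)).bind allSurgeries).filter (Stack.Good l r) := by
  rw [hs.allSurgeries_eq h, Multiset.filter_bind, Multiset.filter_bind]
  have : ∀ M : Multiset Stack, (∀ t ∈ M, t.Closed) →
      (M.bind fun t => (allSurgeries t).filter (Stack.Good l r)) =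
        (M.filter (Stack.Good l r)).bind fun t => (allSurgeries t).filter (Stack.Good l r) := by
    intro M hM
    induction M using Multiset.induction_on with
    | empty => rfl
    | cons t M ih =>
      have ih := ih fun u hu => hM u (Multiset.mem_cons_of_mem hu)
      by_cases ht : t.Good l r
      · rw [Multiset.filter_cons_of_pos _ ht, Multiset.cons_bind, Multiset.cons_bind, ih]
      · rw [Multiset.filter_cons_of_neg _ ht, Multiset.cons_bind,
          (hM t (Multiset.mem_cons_self t M)).filter_allSurgeries ht, zero_add, ih]
  exact this _ fun t ht => (Reoriented.of_outcome hs h (mem_outcomes.mp ht)).closed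

end Stack.Closed

end DiagramAlgebra

namespace DiagramAlgebra

/-! ## Changing labels in a window -/

namespace Stack

/-- The condition on the labels at the ends of an edge. -/
def EdgeLabels (s : Stack) : Vertex → Vertex → Prop
  | Vertex.bot i, Vertex.bot j => Opposite (s.wBot.label i) (s.wBot.label j)
  | Vertex.top i, Vertex.top j => Opposite (s.wTop.label i) (s.wTop.label j)
  | Vertex.bot i, Vertex.top j => s.wBot.label i = s.wTop.label j
  | Vertex.top i, Vertex.bot j => s.wTop.label i = s.wBot.label j

theorem Consistent.edgeLabels {s : Stack} (h : s.Consistent) {v w : Vertex} (hvw : s.Adj v w) :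
    s.EdgeLabels v w := by
  cases hvw with
  | bot_cup i j e => exact h.bot.arc i j e
  | mid_cap i j e => exact (h.mid_arc i j e).1
  | mid_cup i j e => exact (h.mid_arc i j e).2
  | top_cap i j e => exact h.top.arc i j e
  | up i e => exact (h.mid_ray i e).1
  | down i e => exact (h.mid_ray i e).1.symm

theorem EdgeLabels.congr {s t : Stack} {v w : Vertex} (h : s.EdgeLabels v w)
    (hv : t.label v = s.label v) (hw : t.label w = s.label w) : t.EdgeLabels v w := by
  cases v <;> cases w <;> simp only [EdgeLabels, label] at * <;> rwa [hv, hw]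

theorem EdgeLabels.transfer {s t : Stack} {v w : Vertex} (h : s.EdgeLabels v w)
    (h' : t.EdgeLabels v w) (hv : t.label v = s.label v) : t.label w = s.label w := by
  cases v <;> cases w <;> simp only [EdgeLabels, label] at *
  · rw [hv] at h'
    exact h'.unique h
  · rw [← h, ← h', hv]
  · rw [← h, ← h', hv]
  · rw [hv] at h'
    exact h'.unique h

theorem _root_.DiagramAlgebra.Oriented.relabel {c : ArcDiagram} {w w' : Weight} (h : Oriented c w)
    (ha : ∀ p, w'.IsArrow p ↔ w.IsArrow p) (hl : ∀ p, ¬ w.IsArrow p → w'.label p = w.label p)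
    (harc : ∀ i j, c.node i = some (Node.arc j) → Opposite (w'.label i) (w'.label j))
    (hray : ∀ i, c.node i = some Node.ray → w'.label i = w.label i) : Oriented c w' := by
  refine ⟨?_, ?_, harc, ?_, ?_⟩
  · intro i
    rw [h.line]
    by_cases hi : w.IsArrow i
    · have hi' := (ha i).mpr hi
      unfold Weight.IsArrow at hi hi'
      refine iff_of_false ?_ ?_
      · rcases hi with h | h <;> simp [h]
      · rcases hi' with h | h <;> simp [h]
    · rw [hl i hi]
  · intro i hi
    have := h.free i hi
    rwa [hl i]
    unfold Weight.IsArrow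
    rcases this with h | h <;> simp [h]
  · intro i hi
    exact (ha i).mpr (h.ray i hi)
  · intro i j hi hj hij
    rw [hray i hi, hray j hj]
    exact h.rays_sorted i j hi hj hij

/-- Consistency is local: apart from rays and vertices without arrows, which are inherited, it is a
condition on each edge. -/
theorem Consistent.of_cut {s t : Stack} (hs : s.Consistent) {i j : ℤ} (h : Surgerable s i j)
    (hst : t.toSkeleton = s.toSkeleton.cut i j) (ha : s.Alike t)
    (he : ∀ v w, t.Adj v w → t.EdgeLabels v w)
    (hr : ∀ v, s.IsRayEnd v → t.label v = s.label v) : t.Consistent := by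
  have hb : t.bot = s.bot := (congrArg Skeleton.bot hst :)
  have ht : t.top = s.top := (congrArg Skeleton.top hst :)
  have hm : t.mid = s.mid.cut i j := (congrArg Skeleton.mid hst :)
  have hnone : ∀ v, t.label v = none ↔ s.label v = none := by
    intro v
    by_cases hv : s.Arrow v
    · exact iff_of_false (Closed.Arrow.label_ne ((ha.arrow_iff v).mpr hv)) (Closed.Arrow.label_ne hv)
    · rw [ha.label_eq v hv]
  have hfree : ∀ v, (s.label v = some Label.nought ∨ s.label v = some Label.cross) →
      t.label v = s.label v := by
    intro v hv
    refine ha.label_eq v ?_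
    unfold Arrow
    rcases hv with h | h <;> simp [h]
  refine ⟨?_, ?_, ?_, ?_, ?_, ?_⟩
  · rw [hb]
    exact hs.bot.relabel (fun p => ha.arrow_iff (Vertex.bot p))
      (fun p => ha.label_eq (Vertex.bot p))
      (fun p q hpq => he _ _ (Skeleton.Adj.bot_cup p q (by rwa [hb])))
      (fun p hp => hr (Vertex.bot p) hp)
  · rw [ht]
    exact hs.top.relabel (fun p => ha.arrow_iff (Vertex.top p))
      (fun p => ha.label_eq (Vertex.top p))
      (fun p q hpq => he _ _ (Skeleton.Adj.top_cap p q (by rwa [ht])))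
      (fun p hp => hr (Vertex.top p) hp)
  · intro p
    have := hs.mid_line p
    rw [hm, ArcDiagram.cut_none h]
    exact ⟨this.1.trans (hnone (Vertex.bot p)).symm, this.2.trans (hnone (Vertex.top p)).symm⟩
  · intro p hp
    rw [hm, ArcDiagram.cut_free h] at hp
    have h1 := hs.mid_free p hp
    have h2 := hfree (Vertex.bot p) h1.2
    have h3 := hfree (Vertex.top p) (by
      change s.wTop.label p = _ ∨ s.wTop.label p = _
      rw [← h1.1]
      exact h1.2)
    change t.wBot.label p = s.wBot.label p at h2
    change t.wTop.label p = s.wTop.label p at h3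
    rw [h2, h3]
    exact h1
  · intro p q hpq
    exact ⟨he _ _ (Skeleton.Adj.mid_cap p q hpq), he _ _ (Skeleton.Adj.mid_cup p q hpq)⟩
  · intro p hp
    refine ⟨he _ _ (Skeleton.Adj.up p hp), (ha.arrow_iff (Vertex.bot p)).mpr ?_⟩
    rw [hm, ArcDiagram.cut_ray h] at hp
    rcases hp with hp | rfl | rfl
    · exact (hs.mid_ray p hp).2
    · exact (hs.mid_arc _ _ h.2.1).1.left_arrow
    · exact (hs.mid_arc _ _ h.2.1).1.symm.left_arrow

end Stack

/-- Replace the labels in the window `[l, r]` by those of another weight. -/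
def Weight.patch (w w' : Weight) (l r : ℤ)
    (h : ∀ p, l ≤ p → p ≤ r → (w'.label p = none ↔ w.label p = none)) : Weight where
  label p := if l ≤ p ∧ p ≤ r then w'.label p else w.label p
  ordConnected := by
    have : {p | (if l ≤ p ∧ p ≤ r then w'.label p else w.label p) ≠ none} =
        {p | w.label p ≠ none} := by
      ext p
      change (if l ≤ p ∧ p ≤ r then w'.label p else w.label p) ≠ none ↔ w.label p ≠ none
      split_ifs with hp
      · exact (h p hp.1 hp.2).not
      · rfl
    rw [this]
    exact w.ordConnected
  eventually_sorted := by
    obtain ⟨S, hS, hs⟩ := w.eventually_sorted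
    refine ⟨S ∪ Set.Icc l r, hS.union (Set.finite_Icc l r), ?_⟩
    intro i j hi hj hij
    rw [Set.mem_union, not_or, Set.mem_Icc] at hi hj
    rw [if_neg hi.2, if_neg hj.2]
    exact hs i j hi.1 hj.1 hij

/-- Replace the labels in the window `[l, r]` by those of another diagram, and the shape too. -/
def Stack.patch (s t : Stack) (σ : Skeleton) (l r : ℤ)
    (h : ∀ v : Vertex, l ≤ v.pos → v.pos ≤ r → (t.label v = none ↔ s.label v = none)) : Stack where
  toSkeleton := σ
  wBot := s.wBot.patch t.wBot l r fun p => h (Vertex.bot p)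
  wTop := s.wTop.patch t.wTop l r fun p => h (Vertex.top p)

theorem Stack.patch_in {s t : Stack} {σ : Skeleton} {l r : ℤ}
    {h : ∀ v : Vertex, l ≤ v.pos → v.pos ≤ r → (t.label v = none ↔ s.label v = none)} {v : Vertex}
    (h1 : l ≤ v.pos) (h2 : v.pos ≤ r) : (s.patch t σ l r h).label v = t.label v := by
  cases v with
  | bot p => exact if_pos ⟨h1, h2⟩
  | top p => exact if_pos ⟨h1, h2⟩

theorem Stack.patch_out {s t : Stack} {σ : Skeleton} {l r : ℤ}
    {h : ∀ v : Vertex, l ≤ v.pos → v.pos ≤ r → (t.label v = none ↔ s.label v = none)} {v : Vertex}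
    (hv : ¬ (l ≤ v.pos ∧ v.pos ≤ r)) : (s.patch t σ l r h).label v = s.label v := by
  cases v with
  | bot p => exact if_neg hv
  | top p => exact if_neg hv

theorem Stack.Alike.none_iff {s t : Stack} (h : s.Alike t) (v : Vertex) :
    t.label v = none ↔ s.label v = none := by
  by_cases hv : s.Arrow v
  · exact iff_of_false (Closed.Arrow.label_ne ((h.arrow_iff v).mpr hv)) (Closed.Arrow.label_ne hv)
  · rw [h.label_eq v hv]

/-! ## Closing diagrams with rays -/

/-- The arc diagram `d` agrees with `c` on the window `[l, r]`, except that some rays of `c` there have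
been turned into arcs ending outside of the window. -/
structure Completes (l r : ℤ) (c d : ArcDiagram) : Prop where
  inside : ∀ p, l ≤ p → p ≤ r → d.node p = c.node p ∨
    (c.node p = some Node.ray ∧ ∃ q, d.node p = some (Node.arc q) ∧ (q < l ∨ r < q))
  outside : ∀ p q, c.node p = some (Node.arc q) → l ≤ p ∧ p ≤ r

theorem Completes.arc {l r : ℤ} {c d : ArcDiagram} (h : Completes l r c d) {p q : ℤ}
    (hpq : c.node p = some (Node.arc q)) :
    d.node p = some (Node.arc q) ∧ (l ≤ p ∧ p ≤ r) ∧ (l ≤ q ∧ q ≤ r) := by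
  have h1 := h.outside p q hpq
  have h2 := h.outside q p (c.arc_symm p q hpq).2
  refine ⟨?_, h1, h2⟩
  rcases h.inside p h1.1 h1.2 with h3 | ⟨h3, -⟩
  · rw [h3, hpq]
  · rw [hpq] at h3
    simp at h3

/-- The position lies in the window. -/
def Vertex.In (l r : ℤ) (v : Vertex) : Prop := l ≤ v.pos ∧ v.pos ≤ r

theorem Vertex.not_in {l r : ℤ} {v : Vertex} :
    ¬ v.In l r ↔ v.pos < l ∨ r < v.pos := by
  unfold Vertex.In
  omega

/-- The diagram `S` completes `s`, and the arcs in its middle section end in the window. -/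
structure Completion (l r : ℤ) (s S : Skeleton) : Prop where
  bot : Completes l r s.bot S.bot
  top : Completes l r s.top S.top
  mid : Completes l r s.mid S.mid
  inner : ∀ p q, S.mid.node p = some (Node.arc q) → l ≤ p ∧ p ≤ r

namespace Completion

variable {l r : ℤ} {s S : Skeleton}

/-- A middle ray of `s` in the window is still a ray in `S`, as the middle arcs of `S` do not leave
the window. -/
theorem mid_node (h : Completion l r s S) {p : ℤ} (h1 : l ≤ p) (h2 : p ≤ r) :
    S.mid.node p = s.mid.node p := by
  rcases h.mid.inside p h1 h2 with h3 | ⟨-, q, h3, h4⟩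
  · exact h3
  · have := h.inner q p (S.mid.arc_symm p q h3).2
    omega

theorem mid_arc_iff (h : Completion l r s S) (p q : ℤ) :
    S.mid.node p = some (Node.arc q) ↔ s.mid.node p = some (Node.arc q) := by
  constructor
  · intro hpq
    have := h.inner p q hpq
    rwa [← h.mid_node this.1 this.2]
  · intro hpq
    exact (h.mid.arc hpq).1

theorem adj (h : Completion l r s S) {v w : Vertex} (hvw : s.Adj v w)
    (hv : v.In l r) : S.Adj v w ∧ w.In l r := by
  cases hvw with
  | bot_cup p q e => exact ⟨Skeleton.Adj.bot_cup p q (h.bot.arc e).1, (h.bot.arc e).2.2⟩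
  | mid_cap p q e => exact ⟨Skeleton.Adj.mid_cap p q (h.mid.arc e).1, (h.mid.arc e).2.2⟩
  | mid_cup p q e => exact ⟨Skeleton.Adj.mid_cup p q (h.mid.arc e).1, (h.mid.arc e).2.2⟩
  | top_cap p q e => exact ⟨Skeleton.Adj.top_cap p q (h.top.arc e).1, (h.top.arc e).2.2⟩
  | up p e => exact ⟨Skeleton.Adj.up p (by rwa [h.mid_node (p := p) hv.1 hv.2]), hv⟩
  | down p e => exact ⟨Skeleton.Adj.down p (by rwa [h.mid_node (p := p) hv.1 hv.2]), hv⟩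

/-- The only edges of the completion that lead out of the window are the arcs replacing rays to
infinity. -/
theorem adj_or (h : Completion l r s S) {v w : Vertex} (hvw : S.Adj v w)
    (hv : v.In l r) : (s.Adj v w ∧ w.In l r) ∨ (s.IsRayEnd v ∧ ¬ w.In l r) := by
  cases hvw with
  | bot_cup p q e =>
    rcases h.bot.inside p hv.1 hv.2 with h1 | ⟨h1, q', h2, h3⟩
    · rw [h1] at e
      exact Or.inl ⟨Skeleton.Adj.bot_cup p q e, (h.bot.arc e).2.2⟩
    · rw [e] at h2
      obtain rfl : q = q' := by simpa using h2
      exact Or.inr ⟨h1, Vertex.not_in.mpr h3⟩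
  | mid_cap p q e =>
    rw [h.mid_arc_iff] at e
    exact Or.inl ⟨Skeleton.Adj.mid_cap p q e, (h.mid.arc e).2.2⟩
  | mid_cup p q e =>
    rw [h.mid_arc_iff] at e
    exact Or.inl ⟨Skeleton.Adj.mid_cup p q e, (h.mid.arc e).2.2⟩
  | top_cap p q e =>
    rcases h.top.inside p hv.1 hv.2 with h1 | ⟨h1, q', h2, h3⟩
    · rw [h1] at e
      exact Or.inl ⟨Skeleton.Adj.top_cap p q e, (h.top.arc e).2.2⟩
    · rw [e] at h2
      obtain rfl : q = q' := by simpa using h2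
      exact Or.inr ⟨h1, Vertex.not_in.mpr h3⟩
  | up p e =>
    rw [h.mid_node (p := p) hv.1 hv.2] at e
    exact Or.inl ⟨Skeleton.Adj.up p e, hv⟩
  | down p e =>
    rw [h.mid_node (p := p) hv.1 hv.2] at e
    exact Or.inl ⟨Skeleton.Adj.down p e, hv⟩

theorem conn (h : Completion l r s S) {v w : Vertex} (hvw : s.Conn v w)
    (hv : v.In l r) : S.Conn v w ∧ w.In l r := by
  induction hvw with
  | refl => exact ⟨Skeleton.Conn.refl v, hv⟩
  | tail _ h2 ih =>
    have := h.adj h2 ih.2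
    exact ⟨ih.1.trans this.1.conn, this.2⟩

/-- A path in the completion can be followed in `s` until it leaves the window, and there it passes
the end of a ray. -/
theorem conn_or (h : Completion l r s S) {v w : Vertex} (hvw : S.Conn v w)
    (hv : v.In l r) : (s.Conn v w ∧ w.In l r) ∨ (∃ u, s.Conn v u ∧ s.IsRayEnd u) := by
  induction hvw with
  | refl => exact Or.inl ⟨Skeleton.Conn.refl v, hv⟩
  | tail _ h2 ih =>
    rcases ih with ih | ih
    · rcases h.adj_or h2 ih.2 with h3 | h3
      · exact Or.inl ⟨ih.1.trans h3.1.conn, h3.2⟩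
      · exact Or.inr ⟨_, ih.1, h3.1⟩
    · exact Or.inr ih

theorem adj_out (h : Completion l r s S) {v w : Vertex} (hvw : s.Adj v w)
    (hv : ¬ v.In l r) : ¬ w.In l r := fun hw => hv (h.adj hvw.symm hw).2

theorem cut (h : Completion l r s S) {i j : ℤ} (ho : s.mid.Outermost i j)
    (hO : S.mid.Outermost i j) : Completion l r (s.cut i j) (S.cut i j) where
  bot := h.bot
  top := h.top
  mid := by
    refine ⟨?_, fun p q hpq => h.mid.outside p q ((ArcDiagram.cut_arc ho).mp hpq).1⟩
    intro p h1 h2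
    left
    change (S.mid.cut i j).node p = (s.mid.cut i j).node p
    rw [ArcDiagram.cut_node ho, ArcDiagram.cut_node hO]
    simp only [Function.update_apply]
    rw [h.mid_node h1 h2]
  inner p q hpq := h.inner p q ((ArcDiagram.cut_arc hO).mp hpq).1

end Completion

/-- `S` is a closed diagram which agrees with `s` on the window `[l, r]`. -/
structure IsClosure (l r : ℤ) (s S : Stack) : Prop where
  consistent : s.Consistent
  closed : S.Closed
  bot : Completes l r s.bot S.bot
  top : Completes l r s.top S.top
  mid : Completes l r s.mid S.mid
  label : ∀ v : Vertex, l ≤ v.pos → v.pos ≤ r → S.label v = s.label v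
  good : S.Good l r

/-- All arcs in the middle section end in the window `[l, r]`. -/
def Stack.Inner (l r : ℤ) (S : Stack) : Prop :=
  ∀ p q, S.mid.node p = some (Node.arc q) → l ≤ p ∧ p ≤ r

namespace IsClosure

variable {l r : ℤ} {s S : Stack}

theorem completion (h : IsClosure l r s S) (hi : S.Inner l r) :
    Completion l r s.toSkeleton S.toSkeleton := ⟨h.bot, h.top, h.mid, hi⟩

theorem surgerable_iff (h : IsClosure l r s S) (hi : S.Inner l r) (i j : ℤ) :
    Surgerable s i j ↔ Surgerable S i j := by
  unfold Surgerable
  simp only [(h.completion hi).mid_arc_iff]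

theorem arrow_iff (h : IsClosure l r s S) {v : Vertex} (hv : v.In l r) : S.Arrow v ↔ s.Arrow v := by
  unfold Stack.Arrow
  rw [h.label v hv.1 hv.2]

theorem conn (h : IsClosure l r s S) (hi : S.Inner l r) {v w : Vertex} (hvw : s.Conn v w)
    (hv : v.In l r) : S.Conn v w ∧ w.In l r := (h.completion hi).conn hvw hv

theorem conn_or (h : IsClosure l r s S) (hi : S.Inner l r) {v w : Vertex} (hvw : S.Conn v w)
    (hv : v.In l r) : (s.Conn v w ∧ w.In l r) ∨ s.OnLine v := (h.completion hi).conn_or hvw hv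

/-- At the end of a ray the closed diagram has an arc that leaves the window. -/
theorem ray_end (h : IsClosure l r s S) {u : Vertex} (hu : u.In l r) (hr : s.IsRayEnd u) :
    ∃ q, S.Adj u (u.line q) ∧ (q < l ∨ r < q) ∧ Opposite (S.label u) (S.label (u.line q)) := by
  cases u with
  | bot p =>
    rcases h.bot.inside p hu.1 hu.2 with h1 | ⟨-, q, h1, h2⟩
    · exact absurd (h1.trans hr) (h.closed.bot p)
    · exact ⟨q, Skeleton.Adj.bot_cup p q h1, h2, h.closed.consistent.bot.arc p q h1⟩
  | top p =>
    rcases h.top.inside p hu.1 hu.2 with h1 | ⟨-, q, h1, h2⟩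
    · exact absurd (h1.trans hr) (h.closed.top p)
    · exact ⟨q, Skeleton.Adj.top_cap p q h1, h2, h.closed.consistent.top.arc p q h1⟩

/-- A ray becomes an arc that leaves the window, and circles reaching out of the window are
anti-clockwise. So lines play the role of circles of type `1`. -/
theorem type_of_onLine (h : IsClosure l r s S) (hi : S.Inner l r) {v : Vertex} (hv : v.In l r)
    (hl : s.OnLine v) : S.HasType v CompType.one := by
  obtain ⟨u, hu, hr⟩ := hl
  have hu' := h.conn hi hu hv
  obtain ⟨q, h1, h2, h3⟩ := h.ray_end hu'.2 hr
  refine h.closed.hasType_conn h3.symm.left_arrow (hu'.1.trans h1.conn).symm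
    (h.closed.type_one_of_good h.good h3.symm.left_arrow ?_)
  rwa [Vertex.pos_line]

/-- Without rays there is no way out of the window, so circles are not affected by the closure. -/
theorem comp_eq (h : IsClosure l r s S) (hi : S.Inner l r) {v : Vertex} (hv : v.In l r)
    (hl : ¬ s.OnLine v) : s.comp v = S.comp v := by
  ext u
  exact ⟨fun hu => (h.conn hi hu hv).1, fun hu => ((h.conn_or hi hu hv).resolve_right hl).1⟩

theorem type_iff_of_not_onLine (h : IsClosure l r s S) (hi : S.Inner l r) {v : Vertex}
    (hv : v.In l r) (hl : ¬ s.OnLine v) (A : CompType) : s.HasType v A ↔ S.HasType v A := by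
  have hc := h.comp_eq hi hv hl
  have hlab : ∀ u ∈ s.comp v, S.label u = s.label u := fun u hu => by
    have := (h.conn hi hu hv).2
    exact h.label u this.1 this.2
  have ho : s.OnLine v ↔ S.OnLine v := iff_of_false hl (h.closed.not_onLine v)
  constructor
  · exact fun h3 => h3.congr ho hc fun u hu => (hlab u hu).symm
  · exact fun h3 => h3.congr ho.symm hc.symm fun u hu => hlab u (hc ▸ hu)

theorem not_onLine_of_type {v : Vertex} {A : CompType} (hA : s.HasType v A) (hne : A ≠ CompType.y) :
    ¬ s.OnLine v := by
  cases hA with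
  | one u h1 => exact h1
  | x u h1 => exact h1
  | y h1 => exact absurd rfl hne

theorem onLine_of_type {v : Vertex} (hA : s.HasType v CompType.y) : s.OnLine v := by
  cases hA with
  | y h1 => exact h1

/-- The types of components, when lines are replaced by anti-clockwise circles. -/
theorem type_of_type (h : IsClosure l r s S) (hi : S.Inner l r) {v : Vertex} (hv : v.In l r)
    {A : CompType} (hA : s.HasType v A) (hne : A ≠ CompType.y) : S.HasType v A :=
  (h.type_iff_of_not_onLine hi hv (not_onLine_of_type hA hne) A).mp hA

theorem type_of_type_y (h : IsClosure l r s S) (hi : S.Inner l r) {v : Vertex} (hv : v.In l r)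
    (hA : s.HasType v CompType.y) : S.HasType v CompType.one :=
  h.type_of_onLine hi hv (onLine_of_type hA)

theorem type_x_of_type_x (h : IsClosure l r s S) (hi : S.Inner l r) {v : Vertex} (hv : v.In l r)
    (ha : S.Arrow v) (hA : S.HasType v CompType.x) : ¬ s.OnLine v ∧ s.HasType v CompType.x := by
  have hn : ¬ s.OnLine v := fun hl =>
    h.closed.not_one_and_x ha (h.type_of_onLine hi hv hl) hA
  exact ⟨hn, (h.type_iff_of_not_onLine hi hv hn _).mpr hA⟩

/-- Connections in the closed diagram that are no connections in the given one join lines. -/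
theorem onLine_of_conn (h : IsClosure l r s S) (hi : S.Inner l r) {v w : Vertex} (hv : v.In l r)
    (hw : w.In l r) (h1 : S.Conn v w) (h2 : ¬ s.Conn v w) : s.OnLine v ∧ s.OnLine w :=
  ⟨(h.conn_or hi h1 hv).resolve_left fun hc => h2 hc.1,
    (h.conn_or hi h1.symm hw).resolve_left fun hc => h2 hc.1.symm⟩

end IsClosure

end DiagramAlgebra

namespace DiagramAlgebra

/-! ## Surgeries on a diagram and on its closure -/

/-- A relation which restricts to a bijection of finite sets relates them as multisets. -/
theorem exists_rel_of_biunique {α : Type*} [Nonempty α] {A B : Finset α} (r : α → α → Prop)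
    (h1 : ∀ a ∈ A, ∃ b ∈ B, r a b) (h2 : ∀ b ∈ B, ∃ a ∈ A, r a b)
    (h3 : ∀ a ∈ A, ∀ b ∈ B, ∀ b' ∈ B, r a b → r a b' → b = b')
    (h4 : ∀ a ∈ A, ∀ a' ∈ A, ∀ b ∈ B, r a b → r a' b → a = a') : Multiset.Rel r A.val B.val := by
  choose! f hf hf' using h1
  have hB : B = A.image f := by
    ext b
    rw [Finset.mem_image]
    constructor
    · intro hb
      obtain ⟨a, ha, hab⟩ := h2 b hb
      exact ⟨a, ha, h3 a ha _ (hf a ha) b hb (hf' a ha) hab⟩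
    · rintro ⟨a, ha, rfl⟩
      exact hf a ha
  have hinj : Set.InjOn f A := by
    intro a ha a' ha' he
    refine h4 a ha a' ha' (f a) (hf a ha) (hf' a ha) ?_
    rw [he]
    exact hf' a' ha'
  rw [hB, Finset.image_val_of_injOn hinj, Multiset.rel_map_right]
  exact Multiset.rel_refl_of_refl_on fun a ha => hf' a ha

namespace Stack

variable {l r : ℤ} {s t S T : Stack} {i j : ℤ}

/-- Outside the window a good diagram leaves no choice for the arrows. -/
theorem Good.label_out (hs : s.Good l r) (ht : t.Good l r) (ha : s.Alike t) {v : Vertex}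
    (hv : ¬ v.In l r) : t.label v = s.label v := by
  by_cases hav : s.Arrow v
  · have hav' := (ha.arrow_iff v).mpr hav
    rcases Vertex.not_in.mp hv with h | h
    · rw [hav'.resolve_right (ht.left v h), hav.resolve_right (hs.left v h)]
    · rw [hav'.resolve_left (ht.right v h), hav.resolve_left (hs.right v h)]
  · exact ha.label_eq v hav

/-- Labels agree along a path that avoids the surgery. -/
theorem Consistent.label_of_path (hs : s.Consistent) (ht : t.Consistent) (h : Surgerable s i j)
    (hst : t.toSkeleton = s.toSkeleton.cut i j) {u v : Vertex} (huv : t.Conn u v)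
    (h1 : ¬ t.Conn (Vertex.bot i) u) (h2 : ¬ t.Conn (Vertex.bot j) u)
    (hu : t.label u = s.label u) : t.label v = s.label v := by
  induction huv with
  | refl => exact hu
  | @tail a b hab hbc ih =>
    have e1 : ¬ t.Conn (Vertex.bot i) a := fun hc => h1 (hc.trans (Skeleton.Conn.symm hab))
    have e2 : ¬ t.Conn (Vertex.bot j) a := fun hc => h2 (hc.trans (Skeleton.Conn.symm hab))
    have e3 : s.Adj a b := by
      have : (s.toSkeleton.cut i j).Adj a b := hst ▸ hbc
      rcases this.of_cut h with h3 | h3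
      · exact h3
      · exfalso
        have v1 : t.Conn (Vertex.bot i) (Vertex.top i) := by
          rw [hst]
          exact (Skeleton.cut_adj_left h).conn
        have v2 : t.Conn (Vertex.bot j) (Vertex.top j) := by
          rw [hst]
          exact (Skeleton.cut_adj_right h).conn
        rcases h3 with h3 | h3 | h3 | h3 <;> obtain ⟨rfl, -⟩ := h3
        all_goals first
          | exact e1 (Skeleton.Conn.refl _)
          | exact e1 v1
          | exact e2 (Skeleton.Conn.refl _)
          | exact e2 v2
    exact (hs.edgeLabels e3).transfer (ht.edgeLabels hbc) ih

end Stack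

namespace IsClosure

variable {l r : ℤ} {s t S T : Stack} {i j : ℤ}

/-- The situation before and after a surgery. -/
structure Surgery (l r : ℤ) (i j : ℤ) (s S t T : Stack) : Prop where
  before : IsClosure l r s S
  inner : S.Inner l r
  after : IsClosure l r t T
  surgerable : Surgerable s i j
  skeleton : t.toSkeleton = s.toSkeleton.cut i j
  reoriented : Reoriented S i j T

namespace Surgery

theorem inner_after (h : Surgery l r i j s S t T) : T.Inner l r := by
  have hS := (h.before.surgerable_iff h.inner i j).mp h.surgerable
  have := ((h.before.completion h.inner).cut h.surgerable hS).inner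
  intro p q hpq
  refine this p q ?_
  rw [← h.reoriented.skeleton]
  exact hpq

theorem surgerable' (h : Surgery l r i j s S t T) : Surgerable S i j :=
  (h.before.surgerable_iff h.inner i j).mp h.surgerable

theorem in_i (h : Surgery l r i j s S t T) :
    (Vertex.bot i).In l r ∧ (Vertex.top i).In l r :=
  ⟨h.inner i j h.surgerable'.2.1, h.inner i j h.surgerable'.2.1⟩

theorem in_j (h : Surgery l r i j s S t T) :
    (Vertex.bot j).In l r ∧ (Vertex.top j).In l r :=
  have h1 := h.inner j i (S.mid.arc_symm i j h.surgerable'.2.1).2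
  ⟨h1, h1⟩

theorem isRayEnd_iff (h : Surgery l r i j s S t T) (u : Vertex) : t.IsRayEnd u ↔ s.IsRayEnd u := by
  rw [h.skeleton]
  cases u <;> rfl

theorem conn_vert (h : Surgery l r i j s S t T) : t.Conn (Vertex.bot i) (Vertex.top i) := by
  rw [h.skeleton]
  exact (Skeleton.cut_adj_left h.surgerable).conn

theorem not_onLine (h : Surgery l r i j s S t T) (h1 : ¬ s.OnLine (Vertex.bot i))
    (h2 : ¬ s.OnLine (Vertex.top i)) :
    ¬ t.OnLine (Vertex.bot i) ∧ ¬ t.OnLine (Vertex.bot j) := by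
  have key : ∀ v, (s.Conn v (Vertex.bot i)) → ¬ t.OnLine v := by
    rintro v hv ⟨u, hu, hr⟩
    rw [h.isRayEnd_iff] at hr
    rw [h.skeleton] at hu
    rcases hu.of_cut h.surgerable with h3 | ⟨-, h3⟩ | ⟨-, h3⟩
    · exact h1 ⟨u, hv.symm.trans h3, hr⟩
    · exact h2 ⟨u, h3, hr⟩
    · exact h1 ⟨u, h3, hr⟩
  exact ⟨key _ (Skeleton.Conn.refl _), key _ (Skeleton.conn_pair_bot h.surgerable).symm⟩

theorem onLine (h : Surgery l r i j s S t T)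
    (h1 : s.OnLine (Vertex.bot i) ∨ s.OnLine (Vertex.top i)) :
    t.OnLine (Vertex.bot i) ∨ t.OnLine (Vertex.bot j) := by
  have key : ∀ v, t.Conn (Vertex.bot i) v → s.OnLine v →
      t.OnLine (Vertex.bot i) ∨ t.OnLine (Vertex.bot j) := by
    rintro v hv ⟨u, hu, hr⟩
    rw [h.skeleton] at hv
    have h3 := hu.cut_or h.surgerable (Or.inl hv)
    rw [← h.skeleton] at h3
    rw [← h.isRayEnd_iff] at hr
    exact h3.imp (fun h4 => ⟨u, h4, hr⟩) (fun h4 => ⟨u, h4, hr⟩)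
  exact h1.elim (key _ (Skeleton.Conn.refl _)) (key _ h.conn_vert)

/-- The merged circle contains `bot i` and `bot j`. Either they are connected in `t`, and then share
the line that exists by `onLine`, or they are connected only through the outside, and then both lie
on lines. -/
theorem onLine_both (h : Surgery l r i j s S t T)
    (hc : ¬ S.Conn (Vertex.bot i) (Vertex.top i))
    (h1 : s.OnLine (Vertex.bot i) ∨ s.OnLine (Vertex.top i)) :
    t.OnLine (Vertex.bot i) ∧ t.OnLine (Vertex.bot j) := by
  have h2 := h.onLine h1
  have h3 : T.Conn (Vertex.bot i) (Vertex.bot j) := by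
    rw [h.reoriented.conn_iff]
    exact h.before.closed.cut_conn_pair_bot h.surgerable' hc
  by_cases h4 : t.Conn (Vertex.bot i) (Vertex.bot j)
  · rcases h2 with ⟨u, hu, hr⟩ | ⟨u, hu, hr⟩
    · exact ⟨⟨u, hu, hr⟩, ⟨u, h4.symm.trans hu, hr⟩⟩
    · exact ⟨⟨u, h4.trans hu, hr⟩, ⟨u, hu, hr⟩⟩
  · exact h.after.onLine_of_conn h.inner_after h.in_i.1 h.in_j.1 h3 h4

theorem type_iff (h : Surgery l r i j s S t T) {A : CompType} :
    (¬ t.OnLine (Vertex.bot i) → (t.HasType (Vertex.bot i) A ↔ T.HasType (Vertex.bot i) A)) ∧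
    (¬ t.OnLine (Vertex.bot j) → (t.HasType (Vertex.bot j) A ↔ T.HasType (Vertex.bot j) A)) :=
  ⟨fun hn => h.after.type_iff_of_not_onLine h.inner_after h.in_i.1 hn A,
    fun hn => h.after.type_iff_of_not_onLine h.inner_after h.in_j.1 hn A⟩

theorem arrow_i (h : Surgery l r i j s S t T) : T.Arrow (Vertex.bot i) :=
  h.reoriented.arrow_left h.surgerable'

theorem arrow_j (h : Surgery l r i j s S t T) : T.Arrow (Vertex.bot j) :=
  h.reoriented.arrow_right h.surgerable'

/-- If a circle is split in the closure, the part that is a clockwise circle comes from a circle or line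
with both of `bot p` and `top p` on it. -/
theorem conn_of_split (h : Surgery l r i j s S t T)
    (hc : S.Conn (Vertex.bot i) (Vertex.top i)) {p q : ℤ} (hp : (p = i ∧ q = j) ∨ (p = j ∧ q = i))
    (hx : T.HasType (Vertex.bot p) CompType.x) : s.Conn (Vertex.bot p) (Vertex.top p) := by
  have hT := h.after.closed
  have hT' := h.inner_after
  have ha : T.Arrow (Vertex.bot p) := by
    rcases hp with ⟨rfl, rfl⟩ | ⟨rfl, rfl⟩
    · exact h.arrow_i
    · exact h.arrow_j
  have hray : T.mid.node p = some Node.ray := by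
    rw [show T.mid = _ from congrArg Skeleton.mid h.reoriented.skeleton]
    rcases hp with ⟨rfl, rfl⟩ | ⟨rfl, rfl⟩
    · exact ArcDiagram.cut_left h.surgerable'
    · exact ArcDiagram.cut_right h.surgerable'
  have hvert : T.Conn (Vertex.bot p) (Vertex.top p) := (Skeleton.Adj.up p hray).conn
  have hnq : ¬ T.Conn (Vertex.bot p) (Vertex.bot q) := by
    rw [h.reoriented.conn_iff]
    have := h.before.closed.cut_conn_split h.surgerable' hc
    rcases hp with ⟨rfl, rfl⟩ | ⟨rfl, rfl⟩
    · exact this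
    · exact fun h1 => this h1.symm
  have hrayq : T.Conn (Vertex.bot q) (Vertex.top q) := by
    rw [h.reoriented.conn_iff]
    rcases hp with ⟨rfl, rfl⟩ | ⟨rfl, rfl⟩
    · exact (Skeleton.cut_adj_right h.surgerable').conn
    · exact (Skeleton.cut_adj_left h.surgerable').conn
  -- A clockwise circle of a good diagram stays in the window.
  have hin : ∀ u, T.Conn (Vertex.bot p) u → u.In l r := by
    intro u hu
    by_contra hn
    exact hT.not_x_of_good h.after.good ha hx hu (Vertex.not_in.mp hn)
  -- Inside the window every edge of this circle other than the new segment at `p` was present in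
  -- `s`; the segment at `q` belongs to the other part.
  have hedge : ∀ u, T.Conn (Vertex.bot p) u →
      ¬ (u = Vertex.bot p ∧ hT.next u = Vertex.top p) →
      ¬ (u = Vertex.top p ∧ hT.next u = Vertex.bot p) → s.Adj u (hT.next u) := by
    intro u hu h1 h2
    have hadj := hT.adj_next (hT.consistent.conn_arrow hu ha)
    have h3 := ((h.after.completion hT').adj_or hadj (hin u hu)).resolve_right
      fun h4 => h4.2 (hin _ (hu.trans hadj.conn))
    have h4 : (s.toSkeleton.cut i j).Adj u (hT.next u) := h.skeleton ▸ h3.1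
    rcases h4.of_cut h.surgerable with h5 | h5
    · exact h5
    · exfalso
      have hub : u ≠ Vertex.bot q := by
        rintro rfl
        exact hnq hu
      have hut : u ≠ Vertex.top q := by
        rintro rfl
        exact hnq (hu.trans hrayq.symm)
      unfold IsVert at h5
      have hnn : hT.next u ≠ u := fun he => by
        have := hT.consistent.edgeLabels hadj
        rw [he] at this
        cases u <;> exact this.ne rfl
      rcases hp with ⟨rfl, rfl⟩ | ⟨rfl, rfl⟩ <;> grind
  have hfin := hT.finite_cycle ha
  have hlab : T.label (Vertex.bot p) = T.label (Vertex.top p) := (hT.consistent.mid_ray p hray).1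
  -- For `∨` one leaves the segment at its bottom end, for `∧` at its top end. Running along the
  -- circle leads to the other end of the segment without passing through it.
  rcases ha with hd | hu
  · have hn : hT.next (Vertex.top p) = Vertex.bot p := by
      rw [hT.next_down (hlab ▸ hd)]
      exact Skeleton.lower_ray hray
    have hpath := path_of_sameCycle _ hfin (hT.conn_iff_sameCycle.mp hvert)
    have : ∀ {a b : Vertex}, Relation.ReflTransGen (fun x y => y = hT.next x ∧ x ≠ Vertex.top p ∧
        hT.next.SameCycle (Vertex.bot p) x) a b → s.Conn a b := by
      intro a b hab
      induction hab with
      | refl => exact Skeleton.Conn.refl _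
      | tail _ hxy ih =>
        obtain ⟨rfl, h1, h2⟩ := hxy
        refine ih.trans (hedge _ (hT.conn_iff_sameCycle.mpr h2) ?_ (fun h3 => h1 h3.1)).conn
        rintro ⟨rfl, h3⟩
        rw [hT.next_down hd] at h3
        simp [Skeleton.lower] at h3
    exact this hpath
  · have hvert' := hT.conn_iff_sameCycle.mp hvert.symm
    have hfin' : {x | hT.next.SameCycle (Vertex.top p) x}.Finite :=
      hT.finite_cycle (Or.inr (hlab ▸ hu))
    have hpath := path_of_sameCycle _ hfin' hvert'
    have : ∀ {a b : Vertex}, Relation.ReflTransGen (fun x y => y = hT.next x ∧ x ≠ Vertex.bot p ∧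
        hT.next.SameCycle (Vertex.top p) x) a b → s.Conn a b := by
      intro a b hab
      induction hab with
      | refl => exact Skeleton.Conn.refl _
      | tail _ hxy ih =>
        obtain ⟨rfl, h1, h2⟩ := hxy
        refine ih.trans (hedge _ (hvert.trans (hT.conn_iff_sameCycle.mpr h2))
          (fun h3 => h1 h3.1) ?_).conn
        rintro ⟨rfl, h3⟩
        rw [hT.next_up (hlab ▸ hu)] at h3
        simp [Skeleton.upper] at h3
    exact (this hpath).symm

end Surgery

/-- The middle arcs stay in the window, so outside of it there are only vertical segments. -/
theorem mid_ray_out (h : IsClosure l r s S) (hi : S.Inner l r) {v : Vertex} (hv : ¬ v.In l r)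
    (ha : S.Arrow v) : S.mid.node v.pos = some Node.ray := by
  have h1 : S.mid.node v.pos = some Node.ray ∨ ∃ q, S.mid.node v.pos = some (Node.arc q) := by
    cases v with
    | bot p => exact h.closed.consistent.mid_node (Or.inl ha)
    | top p => exact h.closed.consistent.mid_node (Or.inr ha)
  rcases h1 with h1 | ⟨q, h1⟩
  · exact h1
  · exact absurd (hi _ q h1) hv

theorem conn_bot_out (h : IsClosure l r s S) (hi : S.Inner l r) {v : Vertex} (hv : ¬ v.In l r)
    (ha : S.Arrow v) : S.Conn v (Vertex.bot v.pos) := by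
  have h1 := h.mid_ray_out hi hv ha
  cases v with
  | bot p => exact Skeleton.Conn.refl _
  | top p => exact (Skeleton.Adj.down p h1).conn

/-- The rays on a line with all rays labelled `∧` are the only way out of it, to a single position. -/
theorem conn_of_labelled_up (h : IsClosure l r s S) (hi : S.Inner l r) {v w : Vertex}
    (hv : v.In l r) (hl : s.OnLine v) (hup : s.RaysLabelled v Label.up) (hvw : S.Conn v w)
    (hw : w.In l r) : s.Conn v w := by
  have hD := s.stable_comp v
  have hin : ∀ u ∈ s.comp v, u.In l r := fun u hu => (h.conn hi hu hv).2
  have hcut : ∀ {c d : ArcDiagram}, Completes l r c d → c.CutAt (r + 1) := by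
    intro c d hcd p q hpq _
    have := (hcd.arc hpq).2.2
    omega
  have ha : ∀ u ∈ s.comp v, l ≤ u.pos := fun u hu => (hin u hu).1
  -- Beyond the right edge of the window all arcs cancel, so the rays of the line have the same
  -- total charge at the bottom and at the top. As they are all `∧`, a ray on one side forces a ray
  -- on the other.
  have hsum := h.consistent.ht_bot_eq_top hD ha (hcut h.mid)
  unfold Stack.ht at hsum
  rw [(h.consistent.compat_bot hD).sum_cut (fun p hp => Stack.Consistent.charge_eq_zero ha (Vertex.bot 0) hp)
    (hcut h.bot), (h.consistent.compat_top hD).sum_cut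
    (fun p hp => Stack.Consistent.charge_eq_zero ha (Vertex.top 0) hp) (hcut h.top)] at hsum
  have hterm : ∀ (u : Vertex) (c : ArcDiagram),
      (∀ p, c.node p = some Node.ray ↔ s.IsRayEnd (u.line p)) → ∀ p,
      (u.line p ∈ s.comp v ∧ s.IsRayEnd (u.line p) ∧
        c.onRays (s.charge (s.comp v) u.line) p = -1) ∨
      (¬ (u.line p ∈ s.comp v ∧ s.IsRayEnd (u.line p)) ∧
        c.onRays (s.charge (s.comp v) u.line) p = 0) := by
    intro u c hc p
    unfold ArcDiagram.onRays
    rw [Stack.Closed.charge_line]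
    by_cases h1 : u.line p ∈ s.comp v <;> by_cases h2 : s.IsRayEnd (u.line p)
    · left
      rw [if_pos ((hc p).mpr h2), if_pos h1, hup _ h1 h2, val_up]
      exact ⟨h1, h2, rfl⟩
    · right
      rw [if_neg (fun h3 => h2 ((hc p).mp h3))]
      exact ⟨fun h3 => h2 h3.2, rfl⟩
    · right
      rw [if_neg h1, ite_self]
      exact ⟨fun h3 => h1 h3.1, rfl⟩
    · right
      rw [if_neg h1, ite_self]
      exact ⟨fun h3 => h1 h3.1, rfl⟩
  have hexists : ∀ (u u' : Vertex) (c c' : ArcDiagram),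
      (∀ p, c.node p = some Node.ray ↔ s.IsRayEnd (u.line p)) →
      (∀ p, c'.node p = some Node.ray ↔ s.IsRayEnd (u'.line p)) →
      ∑ p ∈ Finset.Ico l (r + 1), c.onRays (s.charge (s.comp v) u.line) p =
        ∑ p ∈ Finset.Ico l (r + 1), c'.onRays (s.charge (s.comp v) u'.line) p →
      (∃ p, u.line p ∈ s.comp v ∧ s.IsRayEnd (u.line p)) →
      ∃ p, u'.line p ∈ s.comp v ∧ s.IsRayEnd (u'.line p) := by
    rintro u u' c c' hc hc' he ⟨p, h1, h2⟩
    by_contra hn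
    rw [Finset.sum_eq_zero (f := c'.onRays _) fun p _ =>
      ((hterm u' c' hc' p).resolve_left fun h3 => hn ⟨p, h3.1, h3.2.1⟩).2] at he
    have hle : ∀ p ∈ Finset.Ico l (r + 1), 0 ≤ - c.onRays (s.charge (s.comp v) u.line) p := by
      intro p _
      rcases hterm u c hc p with h3 | h3
      · rw [h3.2.2]
        norm_num
      · rw [h3.2]
        norm_num
    have hp := hin _ h1
    unfold Vertex.In at hp
    rw [Vertex.pos_line] at hp
    have h3 := Finset.single_le_sum hle (Finset.mem_Ico.mpr ⟨hp.1, by omega⟩)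
    rw [Finset.sum_neg_distrib, he,
      ((hterm u c hc p).resolve_right fun h4 => h4.1 ⟨h1, h2⟩).2.2] at h3
    omega
  have hboth : (∃ p, Vertex.bot p ∈ s.comp v ∧ s.IsRayEnd (Vertex.bot p)) ∧
      ∃ p, Vertex.top p ∈ s.comp v ∧ s.IsRayEnd (Vertex.top p) := by
    obtain ⟨u, hu, hr⟩ := hl
    cases u with
    | bot p => exact ⟨⟨p, hu, hr⟩, hexists (Vertex.bot 0) (Vertex.top 0) s.bot s.top
        (fun _ => Iff.rfl) (fun _ => Iff.rfl) hsum ⟨p, hu, hr⟩⟩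
    | top p => exact ⟨hexists (Vertex.top 0) (Vertex.bot 0) s.top s.bot
        (fun _ => Iff.rfl) (fun _ => Iff.rfl) hsum.symm ⟨p, hu, hr⟩, ⟨p, hu, hr⟩⟩
  obtain ⟨⟨p, hp, hpr⟩, ⟨p', hp', hpr'⟩⟩ := hboth
  have hS : ∀ u ∈ s.comp v, S.Conn v u := fun u hu => (h.conn hi hu hv).1
  -- A ray labelled `∧` becomes an arc to a vertex labelled `∨`, which in a good diagram must be on
  -- the left.
  have hleft : ∀ u ∈ s.comp v, s.IsRayEnd u → ∀ y, S.Adj u y → ¬ y.In l r →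
      y.pos < l ∧ S.Arrow y := by
    intro u hu hr y huy hy
    have h1 := h.closed.consistent.edgeLabels huy
    have h2 : S.label u = some Label.up := by
      rw [h.label u (hin u hu).1 (hin u hu).2]
      exact hup u hu hr
    have h3 : Opposite (S.label u) (S.label y) := by
      cases huy with
      | bot_cup a b e => exact h1
      | mid_cap a b e => exact h1
      | mid_cup a b e => exact h1
      | top_cap a b e => exact h1
      | up a e => exact absurd (hin _ hu) hy
      | down a e => exact absurd (hin _ hu) hy
    have h4 := h3.up_left h2
    exact ⟨(Vertex.not_in.mp hy).resolve_right fun h5 => h.good.right y h5 h4, Or.inl h4⟩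
  obtain ⟨q, e1, e2, -⟩ := h.ray_end (hin _ hp) hpr
  obtain ⟨q', e1', e2', -⟩ := h.ray_end (hin _ hp') hpr'
  change S.Adj (Vertex.bot p) (Vertex.bot q) at e1
  change S.Adj (Vertex.top p') (Vertex.top q') at e1'
  have f1 := hleft _ hp hpr _ e1 (Vertex.not_in.mpr e2)
  have f1' := hleft _ hp' hpr' _ e1' (Vertex.not_in.mpr e2')
  have c1 : S.Conn v (Vertex.bot q) := (hS _ hp).trans e1.conn
  have c1' : S.Conn v (Vertex.top q') := (hS _ hp').trans e1'.conn
  have c2 : S.Conn v (Vertex.bot q') :=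
    c1'.trans (h.conn_bot_out hi (Vertex.not_in.mpr e2') f1'.2)
  -- All exits lead to the left, where the circle has only one vertex on the bottom line; so the
  -- bottom and top rays leave to the same position.
  have uniq : ∀ a, S.Conn v (Vertex.bot a) → a < l → a = q := fun a ha1 ha2 =>
    h.closed.left_unique_of_good h.good f1.2 (c1.symm.trans ha1) f1.1 ha2
  obtain rfl := uniq q' c2 f1'.1
  set q := q'
  -- The circle in the closure consists of the line and the one vertical segment at `q`; hence it
  -- meets no other line.
  have key : ∀ y, S.Conn v y → y ∈ s.comp v ∨ y = Vertex.bot q ∨ y = Vertex.top q := by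
    intro y hy
    induction hy with
    | refl => exact Or.inl (Skeleton.Conn.refl _)
    | @tail x y hx hxy ih =>
      have hy' : S.Conn v y := Skeleton.Conn.trans hx hxy.conn
      have arcs : ∀ {c : ArcDiagram} {a b b' : ℤ}, c.node a = some (Node.arc b) →
          c.node b' = some (Node.arc a) → b = b' := by
        intro c a b b' g1 g2
        rw [(c.arc_symm _ _ g2).2] at g1
        simpa using g1.symm
      rcases ih with ih | rfl | rfl
      · rcases (h.completion hi).adj_or hxy (hin x ih) with h1 | h1
        · exact Or.inl (Skeleton.Conn.trans ih h1.1.conn)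
        · right
          have h2 := hleft x ih h1.1 y hxy h1.2
          have h3 := uniq _ (hy'.trans (h.conn_bot_out hi h1.2 h2.2)) h2.1
          cases y with
          | bot a =>
            left
            rw [← h3]
            rfl
          | top a =>
            right
            rw [← h3]
            rfl
      · have f1 := f1.1
        change q < l at f1
        cases hxy with
        | bot_cup _ b e =>
          left
          cases e1 with
          | bot_cup _ _ e' =>
            rw [arcs e e']
            exact hp
          | mid_cap _ _ e' =>
            have := hi _ _ (S.mid.arc_symm _ _ e').2
            omega
        | mid_cap _ b e =>
          have := hi _ _ e
          omega
        | up _ e => exact Or.inr (Or.inr rfl)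
      · have f1 := f1.1
        change q < l at f1
        cases hxy with
        | top_cap _ b e =>
          left
          cases e1' with
          | top_cap _ _ e' =>
            rw [arcs e e']
            exact hp'
          | mid_cup _ _ e' =>
            have := hi _ _ (S.mid.arc_symm _ _ e').2
            omega
        | mid_cup _ b e =>
          have := hi _ _ e
          omega
        | down _ e => exact Or.inr (Or.inl rfl)
  rcases key w hvw with h1 | rfl | rfl
  · exact h1
  · have := f1.1
    have := hw.1
    simp only [Vertex.pos] at *
    omega
  · have := f1.1
    have := hw.1
    simp only [Vertex.pos] at *
    omega

end IsClosure

end DiagramAlgebra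

/-! ### Re-orientation rules for a diagram and for its closure -/

namespace DiagramAlgebra

namespace IsClosure

variable {l r : ℤ} {s t S T : Stack} {i j : ℤ}

namespace Surgery

/-- If two lines get merged in the closure, the rays of the one are all labelled `∧`, those of the other
one are all labelled `∨`. -/
theorem raysLabelled (h : Surgery l r i j s S t T)
    (hc : ¬ S.Conn (Vertex.bot i) (Vertex.top i)) (h1 : s.OnLine (Vertex.bot i))
    (h2 : s.OnLine (Vertex.top i)) :
    (s.RaysLabelled (Vertex.bot i) Label.up ∧ s.RaysLabelled (Vertex.top i) Label.down) ∨
      (s.RaysLabelled (Vertex.bot i) Label.down ∧ s.RaysLabelled (Vertex.top i) Label.up) := by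
  have hS := h.before
  have hi := h.inner
  have hO := h.surgerable'
  -- A ray labelled `∧` leaves to the left and a ray labelled `∨` to the right, since the arrow
  -- outside is forced and opposite.
  have out : ∀ v, v.In l r → ∀ u, s.Conn v u → s.IsRayEnd u → ∃ q, (q < l ∨ r < q) ∧
      S.Conn v (Vertex.bot q) ∧ S.Arrow (Vertex.bot q) ∧
      (q < l → s.label u = some Label.up) ∧ (r < q → s.label u = some Label.down) := by
    intro v hv u hu hr
    have hu' := hS.conn hi hu hv
    obtain ⟨q, e1, e2, e3⟩ := hS.ray_end hu'.2 hr
    have hq : ¬ (u.line q).In l r := by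
      rw [Vertex.not_in, Vertex.pos_line]
      exact e2
    have hqa : S.Arrow (u.line q) := e3.symm.left_arrow
    have hb := hS.conn_bot_out hi hq hqa
    rw [Vertex.pos_line] at hb
    refine ⟨q, e2, hu'.1.trans (e1.conn.trans hb), hS.closed.consistent.conn_arrow hb hqa, ?_, ?_⟩
    · intro hql
      rw [← hS.label u hu'.2.1 hu'.2.2]
      refine e3.symm.down_left (hqa.resolve_right (hS.good.left _ ?_))
      rwa [Vertex.pos_line]
    · intro hrq
      rw [← hS.label u hu'.2.1 hu'.2.2]
      refine e3.symm.up_left (hqa.resolve_left (hS.good.right _ ?_))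
      rwa [Vertex.pos_line]
  -- If both lines left the window on the same side, the merged good circle would have two bottom
  -- vertices on that side; if these coincided, the lines would already be connected in the closure.
  have sides : ∀ q q', S.Conn (Vertex.bot i) (Vertex.bot q) → S.Conn (Vertex.top i) (Vertex.bot q') →
      S.Arrow (Vertex.bot q) → ¬ (q < l ∧ q' < l) ∧ ¬ (r < q ∧ r < q') := by
    intro q q' c1 c2 ha
    have hT : T.Conn (Vertex.bot q) (Vertex.bot q') := by
      rw [h.reoriented.conn_iff]
      exact (hS.closed.cut_conn_merge hO hc c1).symm.trans
        ((Skeleton.cut_adj_left hO).conn.trans (hS.closed.cut_conn_merge hO hc c2))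
    have hTa := (h.reoriented.arrow_iff hS.closed hO (Vertex.bot q)).mpr ha
    have hne : q' = q → False := by
      rintro rfl
      exact hc (c1.trans c2.symm)
    constructor
    · rintro ⟨g1, g2⟩
      exact hne (h.after.closed.left_unique_of_good h.after.good hTa hT g1 g2)
    · rintro ⟨g1, g2⟩
      exact hne (h.after.closed.right_unique_of_good h.after.good hTa hT g1 g2)
  obtain ⟨u1, hu1, hr1⟩ := h1
  obtain ⟨u2, hu2, hr2⟩ := h2
  obtain ⟨q1, a1, b1, c1, -⟩ := out _ h.in_i.1 u1 hu1 hr1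
  obtain ⟨q2, a2, b2, c2, -⟩ := out _ h.in_i.2 u2 hu2 hr2
  have hs := sides q1 q2 b1 b2 c1
  by_cases hq : q1 < l
  · left
    constructor
    · intro u hu hr
      obtain ⟨q, a, b, c, d, -⟩ := out _ h.in_i.1 u hu hr
      have := sides q q2 b b2 c
      exact d (by omega)
    · intro u hu hr
      obtain ⟨q, a, b, c, -, d⟩ := out _ h.in_i.2 u hu hr
      have := sides q1 q b1 b c1
      exact d (by omega)
  · right
    constructor
    · intro u hu hr
      obtain ⟨q, a, b, c, -, d⟩ := out _ h.in_i.1 u hu hr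
      have := sides q q2 b b2 c
      exact d (by omega)
    · intro u hu hr
      obtain ⟨q, a, b, c, d, -⟩ := out _ h.in_i.2 u hu hr
      have := sides q1 q b1 b c1
      exact d (by omega)

theorem merge_one {A : CompType} {C : CompType} (h : MergeRule A CompType.one C) : C = A := by
  cases h <;> rfl

theorem one_merge {A : CompType} {C : CompType} (h : MergeRule CompType.one A C) : C = A := by
  cases h <;> rfl

/-- The rule for the closure gives the rule for the diagram. -/
theorem rule_of_rule (h : Surgery l r i j s S t T) (ho : Outcome S i j T) : Rule s i j t := by
  have hS := h.before
  have hi := h.inner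
  have hO := h.surgerable'
  have hT' := h.inner_after
  have bi := h.in_i.1
  have ti := h.in_i.2
  have abi := hS.closed.arrow_bot_left hO
  have ati := hS.closed.arrow_top_left hO
  have uniq := fun {v : Vertex} (hv : S.Arrow v) {A B : CompType} (h1 : S.HasType v A)
    (h2 : S.HasType v B) => hS.closed.hasType_unique hv h1 h2
  have uniqT := fun {v : Vertex} (hv : T.Arrow v) {A B : CompType} (h1 : T.HasType v A)
    (h2 : T.HasType v B) => h.after.closed.hasType_unique hv h1 h2
  by_cases c : s.Conn (Vertex.bot i) (Vertex.top i)
  · have cS := (hS.conn hi c bi).1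
    by_cases hl : s.OnLine (Vertex.bot i)
    · obtain ⟨B, C, hr, h2, h3⟩ := hS.closed.split_rule hO cS (hS.type_of_onLine hi bi hl) ho
      have h4 := h.onLine (Or.inl hl)
      -- The clockwise part cannot contain a ray, so it is a circle in `t` and the other part is the
      -- line: this is `y ↦ x ⊗ y`.
      cases hr
      · have h5 := h.after.type_x_of_type_x hT' h.in_j.1 h.arrow_j h3
        exact Rule.split _ _ _ c (Stack.HasType.y hl) SplitRule.y_right
          (Stack.HasType.y (h4.resolve_right h5.1)) h5.2
      · have h5 := h.after.type_x_of_type_x hT' h.in_i.1 h.arrow_i h2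
        exact Rule.split _ _ _ c (Stack.HasType.y hl) SplitRule.y_left h5.2
          (Stack.HasType.y (h4.resolve_left h5.1))
    · have hl' : ¬ s.OnLine (Vertex.top i) := by
        rintro ⟨u, hu, hr⟩
        exact hl ⟨u, c.trans hu, hr⟩
      obtain ⟨n1, n2⟩ := h.not_onLine hl hl'
      obtain ⟨A, hA⟩ : ∃ A, S.HasType (Vertex.bot i) A := by
        rcases hS.closed.hasType_cases abi with h1 | h1
        · exact ⟨_, h1⟩
        · exact ⟨_, h1⟩
      obtain ⟨B, C, hr, h2, h3⟩ := hS.closed.split_rule hO cS hA ho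
      exact Rule.split A B C c ((hS.type_iff_of_not_onLine hi bi hl A).mpr hA) hr
        ((h.type_iff.1 n1).mpr h2) ((h.type_iff.2 n2).mpr h3)
  · by_cases cS : S.Conn (Vertex.bot i) (Vertex.top i)
    -- Two different lines lie on one circle of the closure. The surgery splits off a clockwise
    -- part, which by `conn_of_split` would connect cap and cup in `s` already. So there is no good
    -- outcome, as the rule `y ⊗ y ↦ 0` demands.
    · exfalso
      have hl := (hS.onLine_of_conn hi bi ti cS c).1
      obtain ⟨B, C, hr, h2, h3⟩ := hS.closed.split_rule hO cS (hS.type_of_onLine hi bi hl) ho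
      cases hr
      · have h4 := h.conn_of_split cS (Or.inr ⟨rfl, rfl⟩) h3
        exact c ((Skeleton.conn_pair_bot h.surgerable).trans
          (h4.trans (Skeleton.conn_pair_top h.surgerable).symm))
      · exact c (h.conn_of_split cS (Or.inl ⟨rfl, rfl⟩) h2)
    · obtain ⟨A, B, C, hr, h1, h2, h3⟩ := hS.closed.merge_rule cS ho
      by_cases l1 : s.OnLine (Vertex.bot i) <;> by_cases l2 : s.OnLine (Vertex.top i)
      · obtain ⟨m1, m2⟩ := h.onLine_both cS (Or.inl l1)
        exact Rule.lines c (Stack.HasType.y l1) (Stack.HasType.y l2) (h.raysLabelled cS l1 l2)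
          (Stack.HasType.y m1) (Stack.HasType.y m2)
      · obtain ⟨m1, m2⟩ := h.onLine_both cS (Or.inl l1)
        obtain rfl := uniq abi h1 (hS.type_of_onLine hi bi l1)
        -- The merged component reaches out of the window, so it is anti-clockwise and the circle
        -- merged into the line cannot be clockwise: `x ⊗ y ↦ 0`.
        obtain rfl := uniqT h.arrow_i h3 (h.after.type_of_onLine hT' h.in_i.1 m1)
        obtain rfl := one_merge hr
        exact Rule.merge _ _ _ c (Stack.HasType.y l1) ((hS.type_iff_of_not_onLine hi ti l2 _).mpr h2)
          MergeRule.y_one (Stack.HasType.y m1)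
      · obtain ⟨m1, m2⟩ := h.onLine_both cS (Or.inr l2)
        obtain rfl := uniq ati h2 (hS.type_of_onLine hi ti l2)
        obtain rfl := uniqT h.arrow_i h3 (h.after.type_of_onLine hT' h.in_i.1 m1)
        obtain rfl := merge_one hr
        exact Rule.merge _ _ _ c ((hS.type_iff_of_not_onLine hi bi l1 _).mpr h1) (Stack.HasType.y l2)
          MergeRule.one_y (Stack.HasType.y m1)
      · obtain ⟨n1, -⟩ := h.not_onLine l1 l2
        exact Rule.merge A B C c ((hS.type_iff_of_not_onLine hi bi l1 _).mpr h1)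
          ((hS.type_iff_of_not_onLine hi ti l2 _).mpr h2) hr ((h.type_iff.1 n1).mpr h3)

/-- The rule for the diagram gives the rule for the closure. -/
theorem rule_closure (h : Surgery l r i j s S t T) (ho : Rule s i j t) : Rule S i j T := by
  have hS := h.before
  have hi := h.inner
  have hT' := h.inner_after
  have bi := h.in_i.1
  have ti := h.in_i.2
  have circle : ∀ {v : Vertex} {A : CompType}, v.In l r → s.HasType v A → A ≠ CompType.y →
      S.HasType v A := fun hv hA hne => hS.type_of_type hi hv hA hne
  have line := fun {v : Vertex} (hv : v.In l r) (hA : s.HasType v CompType.y) =>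
    hS.type_of_type_y hi hv hA
  have circleT : ∀ {v : Vertex} {A : CompType}, v.In l r → t.HasType v A → A ≠ CompType.y →
      T.HasType v A := fun hv hA hne => h.after.type_of_type hT' hv hA hne
  have lineT := fun {v : Vertex} (hv : v.In l r) (hA : t.HasType v CompType.y) =>
    h.after.type_of_type_y hT' hv hA
  have ncon : ∀ {A : CompType}, ¬ s.Conn (Vertex.bot i) (Vertex.top i) →
      (s.HasType (Vertex.bot i) A ∨ s.HasType (Vertex.top i) A) → A ≠ CompType.y →
      ¬ S.Conn (Vertex.bot i) (Vertex.top i) := by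
    intro A c hA hne cS
    have h1 := hS.onLine_of_conn hi bi ti cS c
    rcases hA with hA | hA
    · exact not_onLine_of_type hA hne h1.1
    · exact not_onLine_of_type hA hne h1.2
  rcases ho with ⟨A, B, C, c, h1, h2, hr, h3⟩ | ⟨A, B, C, c, h1, hr, h2, h3⟩ |
    ⟨c, h1, h2, hlab, h3, h4⟩
  · cases hr
    · exact Rule.merge _ _ _ (ncon c (Or.inl h1) (by simp)) (circle bi h1 (by simp))
        (circle ti h2 (by simp)) MergeRule.one_one (circleT bi h3 (by simp))
    · exact Rule.merge _ _ _ (ncon c (Or.inl h1) (by simp)) (circle bi h1 (by simp))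
        (circle ti h2 (by simp)) MergeRule.one_x (circleT bi h3 (by simp))
    · exact Rule.merge _ _ _ (ncon c (Or.inl h1) (by simp)) (circle bi h1 (by simp))
        (circle ti h2 (by simp)) MergeRule.x_one (circleT bi h3 (by simp))
    · exact Rule.merge _ _ _ (ncon c (Or.inl h1) (by simp)) (circle bi h1 (by simp))
        (line ti h2) MergeRule.one_one (lineT bi h3)
    · exact Rule.merge _ _ _ (ncon c (Or.inr h2) (by simp)) (line bi h1)
        (circle ti h2 (by simp)) MergeRule.one_one (lineT bi h3)
  · have cS := (hS.conn hi c bi).1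
    cases hr
    · exact Rule.split _ _ _ cS (circle bi h1 (by simp)) SplitRule.one_left
        (circleT bi h2 (by simp)) (circleT h.in_j.1 h3 (by simp))
    · exact Rule.split _ _ _ cS (circle bi h1 (by simp)) SplitRule.one_right
        (circleT bi h2 (by simp)) (circleT h.in_j.1 h3 (by simp))
    · exact Rule.split _ _ _ cS (circle bi h1 (by simp)) SplitRule.x
        (circleT bi h2 (by simp)) (circleT h.in_j.1 h3 (by simp))
    · exact Rule.split _ _ _ cS (line bi h1) SplitRule.one_right
        (circleT bi h2 (by simp)) (lineT h.in_j.1 h3)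
    · exact Rule.split _ _ _ cS (line bi h1) SplitRule.one_left
        (lineT bi h2) (circleT h.in_j.1 h3 (by simp))
  · have cS : ¬ S.Conn (Vertex.bot i) (Vertex.top i) := by
      intro cS
      rcases hlab with ⟨g, -⟩ | ⟨-, g⟩
      · exact c (hS.conn_of_labelled_up hi bi (onLine_of_type h1) g cS ti)
      · exact c (hS.conn_of_labelled_up hi ti (onLine_of_type h2) g cS.symm bi).symm
    exact Rule.merge _ _ _ cS (line bi h1) (line ti h2) MergeRule.one_one (lineT bi h3)

end Surgery

/-! ### The bijection of outcomes -/

theorem none_iff (h : IsClosure l r s S) {v : Vertex} (h1 : l ≤ v.pos) (h2 : v.pos ≤ r) :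
    S.label v = none ↔ s.label v = none := by rw [h.label v h1 h2]

/-- The diagram `t` has the labels of `T` inside the window and those of `s` outside. No edge of the
open diagram crosses the boundary of the window, so consistency is inherited from `T` or from `s`.
-/
theorem exists_open (h : IsClosure l r s S) (hi : S.Inner l r) (hO : Surgerable S i j)
    (ho : Outcome S i j T) (hg : T.Good l r) : ∃ t, Outcome s i j t ∧ IsClosure l r t T := by
  have hij := (h.surgerable_iff hi i j).mpr hO
  have hT := Reoriented.of_outcome h.closed hO ho
  have hal := hT.alike h.closed hO
  have hcomp := h.completion hi
  have hcut := hcomp.cut hij hO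
  have hn : ∀ v : Vertex, l ≤ v.pos → v.pos ≤ r → (T.label v = none ↔ s.label v = none) :=
    fun v h1 h2 => (hal.none_iff v).trans (h.none_iff h1 h2)
  set t := s.patch T (s.toSkeleton.cut i j) l r hn with ht
  have hst : t.toSkeleton = s.toSkeleton.cut i j := rfl
  have tin : ∀ v : Vertex, v.In l r → t.label v = T.label v := fun v hv =>
    Stack.patch_in hv.1 hv.2
  have tout : ∀ v : Vertex, ¬ v.In l r → t.label v = s.label v := fun v hv => Stack.patch_out hv
  have Tout : ∀ v : Vertex, ¬ v.In l r → T.label v = S.label v := fun v hv =>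
    h.good.label_out hg hal hv
  -- The arc closing up a ray ends outside the window, where goodness fixes the label before and
  -- after the surgery; hence the label at the ray does not change either.
  have hray : ∀ v, s.IsRayEnd v → t.label v = s.label v := by
    intro v hr
    by_cases hv : v.In l r
    · rw [tin v hv, ← h.label v hv.1 hv.2]
      obtain ⟨q, e1, e2, -⟩ := h.ray_end hv hr
      have hq : ¬ (v.line q).In l r := by
        rw [Vertex.not_in, Vertex.pos_line]
        exact e2
      have e3 : T.Adj (v.line q) v := by
        rw [hT.skeleton]
        refine (e1.symm.cut hO).resolve_right fun h3 => ?_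
        have hi1 := hi i j hO.2.1
        have hj1 := hi j i (S.mid.arc_symm i j hO.2.1).2
        apply hq
        rcases h3 with h3 | h3 | h3 | h3 <;> rw [h3.1]
        · exact hi1
        · exact hj1
        · exact hi1
        · exact hj1
      exact (h.closed.consistent.edgeLabels e1.symm).transfer
        (hT.closed.consistent.edgeLabels e3) (Tout _ hq)
    · exact tout v hv
  have halt : s.Alike t := by
    constructor
    · intro v
      by_cases hv : v.In l r
      · rw [← h.arrow_iff hv, ← hal.arrow_iff]
        unfold Stack.Arrow
        rw [tin v hv]
      · unfold Stack.Arrow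
        rw [tout v hv]
    · intro v hva
      by_cases hv : v.In l r
      · rw [tin v hv, ← h.label v hv.1 hv.2]
        exact hal.label_eq v ((h.arrow_iff hv).not.mpr hva)
      · exact tout v hv
  have hc : t.Consistent := by
    refine h.consistent.of_cut hij hst halt ?_ hray
    intro v w hvw
    have hvw : (s.toSkeleton.cut i j).Adj v w := hvw
    by_cases hv : v.In l r
    · have h1 := hcut.adj hvw hv
      rw [← hT.skeleton] at h1
      exact (hT.closed.consistent.edgeLabels h1.1).congr (tin v hv) (tin w h1.2)
    · have h1 := hcut.adj_out hvw hv
      have h2 := (hvw.of_cut hij).resolve_right fun h3 => by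
        have hi1 := hi i j hO.2.1
        have hj1 := hi j i (S.mid.arc_symm i j hO.2.1).2
        apply hv
        rcases h3 with h3 | h3 | h3 | h3 <;> rw [h3.1]
        · exact hi1
        · exact hi1
        · exact hj1
        · exact hj1
      exact (h.consistent.edgeLabels h2).congr (tout v hv) (tout w h1)
  have hcl : IsClosure l r t T := by
    rw [← hT.skeleton] at hcut
    exact ⟨hc, hT.closed, hcut.bot, hcut.top, hcut.mid, fun v h1 h2 => (tin v ⟨h1, h2⟩).symm, hg⟩
  have hsur : Surgery l r i j s S t T := ⟨h, hi, hcl, hij, hst, hT⟩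
  refine ⟨t, Outcome.of_toSkeleton hij hst hc ?_ hray (hsur.rule_of_rule ho), hcl⟩
  intro v h1 h2
  by_cases hv : v.In l r
  · by_cases h3 : T.Conn (Vertex.bot i) v ∨ T.Conn (Vertex.bot j) v
    -- This vertex meets the surgery only through the outside of the window, so it lies on a line
    -- not affected by the surgery, whose labels are fixed by the label at a ray.
    · have h4 : t.OnLine v := by
        rcases h3 with h3 | h3
        · exact (hcl.onLine_of_conn hsur.inner_after hsur.in_i.1 hv h3 h1).2
        · exact (hcl.onLine_of_conn hsur.inner_after hsur.in_j.1 hv h3 h2).2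
      obtain ⟨u, hu, hr⟩ := h4
      exact h.consistent.label_of_path hc hij hst hu.symm (fun h5 => h1 (h5.trans hu.symm))
        (fun h5 => h2 (h5.trans hu.symm)) (hray u hr)
    · rw [not_or] at h3
      rw [tin v hv, hT.unchanged v h3.1 h3.2, h.label v hv.1 hv.2]
  · exact tout v hv

/-- Here the labels are those of `t` inside the window and of `S` outside. Edges crossing the
boundary start at ends of rays, where an outcome keeps the labels. -/
theorem exists_closure (h : IsClosure l r s S) (hi : S.Inner l r) (hij : Surgerable s i j)
    (ho : Outcome s i j t) : ∃ T, Outcome S i j T ∧ IsClosure l r t T := by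
  have hO := (h.surgerable_iff hi i j).mp hij
  have hst := ho.toSkeleton_eq hij
  have hcomp := h.completion hi
  have hcut := hcomp.cut hij hO
  have hi1 := hi i j hO.2.1
  have hj1 := hi j i (S.mid.arc_symm i j hO.2.1).2
  have harr : ∀ v, t.Arrow v ↔ s.Arrow v := by
    intro v
    have key : ∀ p, (p = i ∨ p = j) → t.Conn (Vertex.bot p) v → (t.Arrow v ↔ s.Arrow v) := by
      intro p hp hv
      have h0 : (s.toSkeleton.cut i j).Adj (Vertex.bot p) (Vertex.top p) := by
        rcases hp with rfl | rfl
        · exact Skeleton.cut_adj_left hij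
        · exact Skeleton.cut_adj_right hij
      have h1 : t.Arrow (Vertex.bot p) := ho.consistent.adj_arrow (w := Vertex.top p) (hst ▸ h0)
      have hbi : s.Arrow (Vertex.bot i) := (h.consistent.mid_arc i j hij.2.1).1.left_arrow
      have hti : s.Arrow (Vertex.top i) := (h.consistent.mid_arc i j hij.2.1).2.left_arrow
      have hbj : s.Arrow (Vertex.bot j) := (h.consistent.mid_arc i j hij.2.1).1.symm.left_arrow
      refine iff_of_true (ho.consistent.conn_arrow hv h1) ?_
      rw [hst] at hv
      rcases hv.of_cut hij with h3 | ⟨-, h3⟩ | ⟨-, h3⟩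
      · refine h.consistent.conn_arrow h3 ?_
        rcases hp with rfl | rfl
        · exact hbi
        · exact hbj
      · exact h.consistent.conn_arrow h3 hti
      · exact h.consistent.conn_arrow h3 hbi
    by_cases h1 : t.Conn (Vertex.bot i) v
    · exact key i (Or.inl rfl) h1
    by_cases h2 : t.Conn (Vertex.bot j) v
    · exact key j (Or.inr rfl) h2
    unfold Stack.Arrow
    rw [ho.unchanged v h1 h2]
  have hvert : ∀ p, (p = i ∨ p = j) → t.Adj (Vertex.bot p) (Vertex.top p) := by
    intro p hp
    rw [hst]
    rcases hp with rfl | rfl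
    · exact Skeleton.cut_adj_left hij
    · exact Skeleton.cut_adj_right hij
  have hlab : ∀ v, ¬ s.Arrow v → t.label v = s.label v := by
    intro v hv
    rw [← harr] at hv
    refine ho.unchanged v (fun hc => hv ?_) (fun hc => hv ?_)
    · exact ho.consistent.conn_arrow hc (ho.consistent.adj_arrow (hvert i (Or.inl rfl)))
    · exact ho.consistent.conn_arrow hc (ho.consistent.adj_arrow (hvert j (Or.inr rfl)))
  have halt : s.Alike t := ⟨harr, hlab⟩
  have hn : ∀ v : Vertex, l ≤ v.pos → v.pos ≤ r → (t.label v = none ↔ S.label v = none) :=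
    fun v h1 h2 => (halt.none_iff v).trans (h.none_iff h1 h2).symm
  set T := S.patch t (S.toSkeleton.cut i j) l r hn with hT
  have hsT : T.toSkeleton = S.toSkeleton.cut i j := rfl
  have tin : ∀ v : Vertex, v.In l r → T.label v = t.label v := fun v hv =>
    Stack.patch_in hv.1 hv.2
  have tout : ∀ v : Vertex, ¬ v.In l r → T.label v = S.label v := fun v hv => Stack.patch_out hv
  have hal : S.Alike T := by
    constructor
    · intro v
      by_cases hv : v.In l r
      · rw [h.arrow_iff hv, ← harr]
        unfold Stack.Arrow
        rw [tin v hv]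
      · unfold Stack.Arrow
        rw [tout v hv]
    · intro v hva
      by_cases hv : v.In l r
      · rw [tin v hv, h.label v hv.1 hv.2]
        exact hlab v ((h.arrow_iff hv).not.mp hva)
      · exact tout v hv
  have hrayin : ∀ v : Vertex, v.In l r → s.IsRayEnd v → T.label v = S.label v := by
    intro v hv hr
    rw [tin v hv, h.label v hv.1 hv.2]
    refine ho.rays_unchanged v ?_
    rw [hst]
    cases v <;> exact hr
  have hedge : ∀ v w, v.In l r → (S.toSkeleton.cut i j).Adj v w → T.EdgeLabels v w := by
    intro v w hv hvw
    rcases hcut.adj_or hvw hv with h1 | h1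
    · rw [← hst] at h1
      exact (ho.consistent.edgeLabels h1.1).congr (tin v hv) (tin w h1.2)
    · have h2 := (hvw.of_cut hO).resolve_right fun h3 => by
        apply h1.2
        rcases h3 with h3 | h3 | h3 | h3 <;> rw [h3.2]
        · exact hi1
        · exact hi1
        · exact hj1
        · exact hj1
      have h3 : s.IsRayEnd v := by
        have := h1.1
        cases v <;> exact this
      exact (h.closed.consistent.edgeLabels h2).congr (hrayin v hv h3) (tout w h1.2)
  have hsymm : ∀ {v w}, T.EdgeLabels v w → T.EdgeLabels w v := by
    intro v w hvw
    cases v <;> cases w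
    · exact Opposite.symm hvw
    · exact Eq.symm hvw
    · exact Eq.symm hvw
    · exact Opposite.symm hvw
  have hc : T.Consistent := by
    refine h.closed.consistent.of_cut hO hsT hal ?_ ?_
    · intro v w hvw
      have hvw : (S.toSkeleton.cut i j).Adj v w := hvw
      by_cases hv : v.In l r
      · exact hedge v w hv hvw
      by_cases hw : w.In l r
      · exact hsymm (hedge w v hw hvw.symm)
      have h2 := (hvw.of_cut hO).resolve_right fun h3 => by
        apply hv
        rcases h3 with h3 | h3 | h3 | h3 <;> rw [h3.1]
        · exact hi1
        · exact hi1
        · exact hj1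
        · exact hj1
      exact (h.closed.consistent.edgeLabels h2).congr (tout v hv) (tout w hw)
    · intro v hv
      exact absurd ⟨v, Skeleton.Conn.refl v, hv⟩ (h.closed.not_onLine v)
  have hTc : T.Closed := by
    refine ⟨hc, h.closed.bot, h.closed.top, ?_⟩
    refine Set.Finite.subset h.closed.bounded fun p hp => ?_
    exact (hal.none_iff (Vertex.bot p)).not.mp hp
  have hg : T.Good l r := by
    constructor
    · intro v hv
      rw [tout v (Vertex.not_in.mpr (Or.inl hv))]
      exact h.good.left v hv
    · intro v hv
      rw [tout v (Vertex.not_in.mpr (Or.inr hv))]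
      exact h.good.right v hv
  have hcl : IsClosure l r t T := by
    rw [← hst, ← hsT] at hcut
    exact ⟨ho.consistent, hTc, hcut.bot, hcut.top, hcut.mid, fun v h1 h2 => tin v ⟨h1, h2⟩, hg⟩
  have hinT : T.Inner l r := hcut.inner
  have hre : Reoriented S i j T := by
    refine ⟨hTc, hsT, ?_⟩
    intro v h1 h2
    by_cases hv : v.In l r
    · rw [tin v hv, h.label v hv.1 hv.2]
      refine ho.unchanged v (fun hc => h1 ?_) (fun hc => h2 ?_)
      · exact (hcl.conn hinT hc hi1).1
      · exact (hcl.conn hinT hc hj1).1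
    · exact tout v hv
  have hsur : Surgery l r i j s S t T := ⟨h, hi, hcl, hij, hst, hre⟩
  exact ⟨T, hre.outcome hO (hsur.rule_closure ho.rule), hcl⟩

/-- The outcomes of a surgery correspond to the outcomes with good labels of the surgery on the
closure. -/
theorem rel_outcomes (h : IsClosure l r s S) (hi : S.Inner l r) (hij : Surgerable s i j) :
    Multiset.Rel (IsClosure l r) (outcomes s i j)
      ((outcomes S i j).filter (Stack.Good l r)) := by
  have hO := (h.surgerable_iff hi i j).mp hij
  have : Nonempty Stack := ⟨s⟩
  unfold outcomes
  rw [← Finset.filter_val]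
  refine exists_rel_of_biunique _ ?_ ?_ ?_ ?_
  · intro t ht
    rw [Set.Finite.mem_toFinset] at ht
    obtain ⟨T, h1, h2⟩ := h.exists_closure hi hij ht
    exact ⟨T, Finset.mem_filter.mpr ⟨(Set.Finite.mem_toFinset _).mpr h1, h2.good⟩, h2⟩
  · intro T hT
    rw [Finset.mem_filter, Set.Finite.mem_toFinset] at hT
    obtain ⟨t, h1, h2⟩ := h.exists_open hi hO hT.1 hT.2
    exact ⟨t, (Set.Finite.mem_toFinset _).mpr h1, h2⟩
  · intro t _ T hT T' hT' h1 h2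
    rw [Finset.mem_filter, Set.Finite.mem_toFinset] at hT hT'
    have e1 := Reoriented.of_outcome h.closed hO hT.1
    have e2 := Reoriented.of_outcome h.closed hO hT'.1
    refine Stack.ext_of_label (e1.skeleton.trans e2.skeleton.symm) fun v => ?_
    by_cases hv : v.In l r
    · rw [h1.label v hv.1 hv.2, h2.label v hv.1 hv.2]
    · rw [h.good.label_out hT.2 (e1.alike h.closed hO) hv,
        h.good.label_out hT'.2 (e2.alike h.closed hO) hv]
  · intro t ht t' ht' T _ h1 h2
    rw [Set.Finite.mem_toFinset] at ht ht'
    refine Stack.ext_of_label ((ht.toSkeleton_eq hij).trans (ht'.toSkeleton_eq hij).symm) fun v => ?_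
    by_cases hv : v.In l r
    · rw [← h1.label v hv.1 hv.2, ← h2.label v hv.1 hv.2]
    -- The new components of an open diagram stay in the window, so outside nothing changes.
    · have key : ∀ u, Outcome s i j u → u.label v = s.label v := by
        intro u hu
        have hcut := (h.completion hi).cut hij hO
        rw [← hu.toSkeleton_eq hij] at hcut
        refine hu.unchanged v (fun hc => hv (hcut.conn hc ?_).2) (fun hc => hv (hcut.conn hc ?_).2)
        · exact hi i j hO.2.1
        · exact hi j i (S.mid.arc_symm i j hO.2.1).2
      rw [key t ht, key t' ht']

/-- A sequence of surgeries on a diagram compared to all surgeries on its closure. -/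
theorem rel_surgeries (h : IsClosure l r s S) (hi : S.Inner l r) {R : Multiset Stack}
    (hR : Surgeries {s} R) : ∃ N : Multiset Stack,
      Multiset.Rel (fun t T => IsClosure l r t T ∧ T.Inner l r) R N ∧
      (allSurgeries S).filter (Stack.Good l r) =
        (N.bind allSurgeries).filter (Stack.Good l r) := by
  induction hR with
  | refl =>
    refine ⟨{S}, ?_, by rw [Multiset.singleton_bind]⟩
    exact Multiset.Rel.cons ⟨h, hi⟩ Multiset.Rel.zero
  | tail _ h2 ih =>
    obtain ⟨N, hN, hf⟩ := ih
    obtain ⟨u, M, i, j, hij⟩ := h2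
    obtain ⟨U, N, ⟨hu, hUi⟩, hM, rfl⟩ := Multiset.rel_cons_left.mp hN
    have hO := (hu.surgerable_iff hUi i j).mp hij
    refine ⟨(outcomes U i j).filter (Stack.Good l r) + N, ?_, ?_⟩
    · refine Multiset.Rel.add ?_ hM
      refine (hu.rel_outcomes hUi hij).mono fun t _ T hT htT => ⟨htT, ?_⟩
      have := ((hu.completion hUi).cut hij hO).inner
      have e := Reoriented.of_outcome hu.closed hO (mem_outcomes.mp (Multiset.mem_filter.mp hT).1)
      rw [← e.skeleton] at this
      exact this
    -- Dropping the bad outcomes is harmless, as they have no good results.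
    · rw [hf, Multiset.cons_bind, Multiset.filter_add, Multiset.add_bind, Multiset.filter_add,
        hu.closed.filter_allSurgeries_eq hO]

/-- The final result of a sequence of surgeries. -/
theorem rel_finished (h : IsClosure l r s S) (hi : S.Inner l r) {R : Multiset Stack}
    (hR : Surgeries {s} R) (hf : Finished R) :
    Multiset.Rel (IsClosure l r) R ((allSurgeries S).filter (Stack.Good l r)) := by
  obtain ⟨N, hN, he⟩ := h.rel_surgeries hi hR
  rw [he]
  have : ∀ {R N : Multiset Stack}, Finished R →
      Multiset.Rel (fun t T => IsClosure l r t T ∧ T.Inner l r) R N →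
      Multiset.Rel (IsClosure l r) R ((N.bind allSurgeries).filter (Stack.Good l r)) := by
    intro R N hf hN
    induction hN with
    | zero => exact Multiset.Rel.zero
    | @cons t T R N htT _ ih =>
      have h1 : T.mid.leftEnds = [] := by
        rw [ArcDiagram.leftEnds_eq_nil]
        intro p q hpq
        rw [(htT.1.completion htT.2).mid_arc_iff] at hpq
        exact hf t (Multiset.mem_cons_self t R) p q hpq
      rw [Multiset.cons_bind, allSurgeries_of_nil h1, Multiset.singleton_add,
        Multiset.filter_cons_of_pos _ htT.1.good]
      exact Multiset.Rel.cons htT.1 (ih fun u hu => hf u (Multiset.mem_cons_of_mem hu))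
  exact this hf hN

end IsClosure

end DiagramAlgebra

namespace DiagramAlgebra

/-! ## Surgeries at arcs that leave the window -/

namespace Stack.Closed

variable {s : Stack} {l r i j : ℤ}

/-- The labels at an outermost arc of a good diagram that leaves the window. -/
theorem labels_of_outer (hs : s.Closed) (hg : s.Good l r) (h : Surgerable s i j)
    (ho : i < l ∨ r < j) :
    (s.wBot.label i = some Label.down ∧ s.wBot.label j = some Label.up) ∧
      s.wTop.label i = some Label.down ∧ s.wTop.label j = some Label.up := by
  have h1 := hs.consistent.mid_arc i j h.2.1
  rcases ho with ho | ho
  · exact ⟨h1.1.resolve_right fun h2 => hg.left (Vertex.bot i) ho h2.1,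
      h1.2.resolve_right fun h2 => hg.left (Vertex.top i) ho h2.1⟩
  · exact ⟨h1.1.resolve_right fun h2 => hg.right (Vertex.bot j) ho h2.2,
      h1.2.resolve_right fun h2 => hg.right (Vertex.top j) ho h2.2⟩

theorem reoriented_cut (hs : s.Closed) (h : Surgerable s i j)
    (hl : s.wBot.label i = s.wTop.label i) : Reoriented s i j (s.cut i j) :=
  ⟨hs.cut h hl, rfl, fun v _ _ => s.cut_label i j v⟩

/-- If an anti-clockwise circle is split without changing labels, the parts cannot both be
anti-clockwise. -/
theorem not_one_one_of_cut (hs : s.Closed) (h : Surgerable s i j)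
    (hc : s.Conn (Vertex.bot i) (Vertex.top i)) (h1 : s.HasType (Vertex.bot i) CompType.one)
    (hl : s.wBot.label i = some Label.down) (hl' : s.wBot.label j = some Label.up)
    (ht : Reoriented s i j (s.cut i j))
    (h2 : (s.cut i j).HasType (Vertex.bot i) CompType.one)
    (h3 : (s.cut i j).HasType (Vertex.bot j) CompType.one) : False := by
  have hv := hs.arrow_bot_left h
  have hi := ht.arrow_left h
  have hj := ht.arrow_right h
  have hn : ¬ (s.cut i j).Conn (Vertex.bot i) (Vertex.bot j) := hs.cut_conn_split h hc
  obtain ⟨a, b, hab⟩ := hs.exists_bounds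
  have ha : ∀ u, s.Arrow u → a ≤ u.pos := fun u hu => (hab u (Arrow.label_ne hu)).1
  have hca : ∀ u, (s.cut i j).Arrow u → s.Arrow u := fun u hu => (ht.arrow_iff hs h u).mp hu
  have w1 := (hs.hasType_one_iff hv).mp h1 a (fun u hu => ha u (hs.comp_arrow hv u hu))
    _ (Skeleton.Conn.refl _)
  have hbi : ∀ u ∈ (s.cut i j).comp (Vertex.bot i), a ≤ u.pos :=
    fun u hu => ha u (hca u (ht.closed.comp_arrow hi u hu))
  have hbj : ∀ u ∈ (s.cut i j).comp (Vertex.bot j), a ≤ u.pos :=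
    fun u hu => ha u (hca u (ht.closed.comp_arrow hj u hu))
  have w2 := (ht.closed.hasType_one_iff hi).mp h2 a hbi _ (Skeleton.Conn.refl _)
  have w3 := (ht.closed.hasType_one_iff hj).mp h3 a hbj _ (Skeleton.Conn.refl _)
  rw [Stack.cut_label] at w2 w3
  change 2 * s.ht (s.comp (Vertex.bot i)) a Vertex.bot i + val (s.wBot.label i) = 1 at w1
  change 2 * (s.cut i j).ht ((s.cut i j).comp (Vertex.bot i)) a Vertex.bot i +
    val (s.wBot.label i) = 1 at w2
  change 2 * (s.cut i j).ht ((s.cut i j).comp (Vertex.bot j)) a Vertex.bot j +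
    val (s.wBot.label j) = 1 at w3
  rw [hl, val_down] at w1 w2
  rw [hl', val_up] at w3
  -- The circle is the disjoint union of its two parts, so heights add up.
  have hadd : s.ht (s.comp (Vertex.bot i)) a Vertex.bot i =
      (s.cut i j).ht ((s.cut i j).comp (Vertex.bot i)) a Vertex.bot i +
        (s.cut i j).ht ((s.cut i j).comp (Vertex.bot j)) a Vertex.bot i := by
    unfold Stack.ht
    rw [← Finset.sum_add_distrib]
    refine Finset.sum_congr rfl fun p _ => ?_
    unfold Stack.charge
    rw [Stack.cut_label]
    have e1 : Vertex.bot p ∈ s.comp (Vertex.bot i) ↔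
        (Vertex.bot p ∈ (s.cut i j).comp (Vertex.bot i) ∨
          Vertex.bot p ∈ (s.cut i j).comp (Vertex.bot j)) := by
      constructor
      · intro hp
        exact Skeleton.Conn.cut_or h hp (Or.inl (Skeleton.Conn.refl _))
      · rintro (hp | hp)
        · exact Skeleton.Conn.of_cut_split h hc hp
        · exact (Skeleton.conn_pair_bot h).trans (Skeleton.Conn.of_cut_split h hc hp)
    have e2 : Vertex.bot p ∈ (s.cut i j).comp (Vertex.bot i) →
        Vertex.bot p ∉ (s.cut i j).comp (Vertex.bot j) := fun hp hp' =>
      hn (Skeleton.Conn.trans hp (Skeleton.Conn.symm hp'))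
    by_cases hp : Vertex.bot p ∈ (s.cut i j).comp (Vertex.bot i)
    · rw [if_pos (e1.mpr (Or.inl hp)), if_pos hp, if_neg (e2 hp), add_zero]
    · by_cases hp' : Vertex.bot p ∈ (s.cut i j).comp (Vertex.bot j)
      · rw [if_pos (e1.mpr (Or.inr hp')), if_neg hp, if_pos hp', zero_add]
      · rw [if_neg (fun hp0 => (e1.mp hp0).elim hp hp'), if_neg hp, if_neg hp', zero_add]
  have hcomp := ht.closed.consistent.compat_mid_bot
    ((s.cut i j).stable_comp (Vertex.bot j))
  have hz : ∀ p, p < a →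
      (s.cut i j).charge ((s.cut i j).comp (Vertex.bot j)) Vertex.bot p = 0 := fun p hp =>
    Stack.Consistent.charge_eq_zero hbj (Vertex.bot p) hp
  -- Between `i` and `j` the charges of the part through `bot j` cancel along arcs, and the ray at
  -- `i` belongs to the other part. So its height is the same at `i` and `j`, whereas anti-clockwise
  -- orientations would require `0` and `1`.
  have c1 := hcomp.sum_cut hz (ArcDiagram.cutAt_ray (ArcDiagram.cut_left h))
  have c2 := hcomp.sum_cut hz (ArcDiagram.cutAt_ray (ArcDiagram.cut_right h))
  have hai := ha _ hv
  change a ≤ i at hai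
  rw [sum_Ico_split ((s.cut i j).mid.onRays _) hai h.1.le, ← c1] at c2
  rw [Finset.sum_eq_zero (s := Finset.Ico i j)] at c2
  · change (s.cut i j).ht _ a Vertex.bot j = (s.cut i j).ht _ a Vertex.bot i + 0 at c2
    omega
  · intro p hp
    rw [Finset.mem_Ico] at hp
    unfold ArcDiagram.onRays
    split_ifs with hray
    · rcases (ArcDiagram.cut_ray h).mp hray with h4 | rfl | rfl
      · rcases eq_or_lt_of_le hp.1 with rfl | h5
        · rw [h.2.1] at h4
          simp at h4
        · exact absurd h4 (s.mid.ray_not_under i j p h.2.1 h5 hp.2)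
      · exact if_neg fun h4 => hn (Skeleton.Conn.symm h4)
      · omega
    · rfl

/-- Only one outcome of a surgery at an arc leaving the window is good, and it has the same labels as
before. -/
theorem filter_outcomes_outer (hs : s.Closed) (hg : s.Good l r) (h : Surgerable s i j)
    (ho : i < l ∨ r < j) : (outcomes s i j).filter (Stack.Good l r) = {s.cut i j} := by
  obtain ⟨⟨e1, e2⟩, e3, e4⟩ := hs.labels_of_outer hg h ho
  have ht := hs.reoriented_cut h (e1.trans e3.symm)
  have htg : (s.cut i j).Good l r :=
    ⟨fun v hv => by rw [Stack.cut_label]; exact hg.left v hv,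
      fun v hv => by rw [Stack.cut_label]; exact hg.right v hv⟩
  have key : ∀ t : Stack, t.Good l r → Reoriented s i j t →
      t.HasType (Vertex.bot i) CompType.one ∨ t.HasType (Vertex.bot j) CompType.one := by
    intro t hg ht
    rcases ho with ho | ho
    · exact Or.inl (ht.closed.type_one_of_good hg (ht.arrow_left h) (Or.inl ho))
    · exact Or.inr (ht.closed.type_one_of_good hg (ht.arrow_right h) (Or.inr ho))
  have hsi : s.HasType (Vertex.bot i) CompType.one := by
    rcases ho with ho | ho
    · exact hs.type_one_of_good hg (hs.arrow_bot_left h) (Or.inl ho)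
    · exact hs.hasType_conn (hs.arrow_bot_right h) (Skeleton.conn_pair_bot h).symm
        (hs.type_one_of_good hg (hs.arrow_bot_right h) (Or.inr ho))
  have hst : s.HasType (Vertex.top i) CompType.one := by
    rcases ho with ho | ho
    · exact hs.type_one_of_good hg (hs.arrow_top_left h) (Or.inl ho)
    · exact hs.hasType_conn (hs.arrow_top_right h) (Skeleton.conn_pair_top h).symm
        (hs.type_one_of_good hg (hs.arrow_top_right h) (Or.inr ho))
  by_cases hc : s.Conn (Vertex.bot i) (Vertex.top i)
  · obtain ⟨t, t', hO, ⟨u1, u2, u3⟩, ⟨v1, v2, v3⟩⟩ := hs.outcome_split_one h hc hsi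
    rw [hO]
    -- With unchanged labels one part is clockwise, and it must be the one not containing the end
    -- outside the window. This identifies the cut with one of the two outcomes; in the other one
    -- the clockwise circle leaves the window.
    have hno := hs.not_one_one_of_cut h hc hsi e1 e2 ht
    rcases ht.closed.hasType_cases (ht.arrow_left h) with h1 | h1
    · have h2 : (s.cut i j).HasType (Vertex.bot j) CompType.x :=
        (ht.closed.hasType_cases (ht.arrow_right h)).resolve_left fun h2 => hno h1 h2
      obtain rfl := v1.eq h ht v2 h1 v3 h2
      have hl : i < l := by
        refine ho.resolve_right fun ho => ht.closed.not_one_and_x (ht.arrow_right h) ?_ h2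
        exact ht.closed.type_one_of_good htg (ht.arrow_right h) (Or.inr ho)
      have : ¬ t.Good l r := fun hgt => u1.closed.not_one_and_x (u1.arrow_left h)
        (u1.closed.type_one_of_good hgt (u1.arrow_left h) (Or.inl hl)) u2
      rw [Multiset.insert_eq_cons, Multiset.filter_cons_of_neg _ this, Multiset.filter_singleton,
        if_pos htg]
    · have h2 : (s.cut i j).HasType (Vertex.bot j) CompType.one :=
        (key _ htg ht).resolve_left fun h2 => ht.closed.not_one_and_x (ht.arrow_left h) h2 h1
      obtain rfl := u1.eq h ht u2 h1 u3 h2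
      have hr : r < j := by
        refine ho.resolve_left fun ho => ht.closed.not_one_and_x (ht.arrow_left h) ?_ h1
        exact ht.closed.type_one_of_good htg (ht.arrow_left h) (Or.inl ho)
      have : ¬ t'.Good l r := fun hgt => v1.closed.not_one_and_x (v1.arrow_right h)
        (v1.closed.type_one_of_good hgt (v1.arrow_right h) (Or.inr hr)) v3
      rw [Multiset.insert_eq_cons, Multiset.filter_cons_of_pos _ htg, Multiset.filter_singleton,
        if_neg this]
      rfl
  · obtain ⟨t, hO, t1, t2⟩ := hs.outcome_merge h hc hsi hst (C := CompType.one)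
      (fun C' => ⟨fun hr => by cases hr; rfl, by rintro rfl; exact MergeRule.one_one⟩) (by simp)
    have hcon : ∀ t', Reoriented s i j t' → t'.Conn (Vertex.bot i) (Vertex.bot j) := by
      intro t' ht'
      rw [ht'.conn_iff]
      exact hs.cut_conn_pair_bot h hc
    have h1 : (s.cut i j).HasType (Vertex.bot i) CompType.one :=
      (key _ htg ht).elim id fun h2 =>
        ht.closed.hasType_conn (ht.arrow_right h) (hcon _ ht).symm h2
    obtain rfl := t1.eq h ht t2 h1 (t1.closed.hasType_conn (t1.arrow_left h) (hcon _ t1) t2)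
      (ht.closed.hasType_conn (ht.arrow_left h) (hcon _ ht) h1)
    rw [hO, Multiset.filter_singleton, if_pos htg]

end Stack.Closed

/-- Performing the surgeries at the arcs that leave the window does not change the labels. -/
theorem IsClosure.exists_inner {l r : ℤ} {s S : Stack} (h : IsClosure l r s S) :
    ∃ T, IsClosure l r s T ∧ T.Inner l r ∧
      (allSurgeries S).filter (Stack.Good l r) = (allSurgeries T).filter (Stack.Good l r) := by
  induction hn : S.mid.numEnds using Nat.strong_induction_on generalizing S with
  | _ n ih =>
  subst hn
  by_cases hi : S.Inner l r
  · exact ⟨S, h, hi, rfl⟩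
  unfold Stack.Inner at hi
  push Not at hi
  obtain ⟨p, q, hpq, hp⟩ := hi
  have hex : ∃ i j, i < j ∧ S.mid.node i = some (Node.arc j) ∧ (i < l ∨ r < j) := by
    obtain ⟨h1, h2⟩ := S.mid.arc_symm p q hpq
    have h3 : p < l ∨ r < p := by
      by_contra hc
      have := hp (by omega)
      omega
    rcases lt_or_gt_of_ne h1 with h4 | h4
    · rcases h3 with h3 | h3
      · exact ⟨q, p, h4, h2, Or.inl (by omega)⟩
      · exact ⟨q, p, h4, h2, Or.inr h3⟩
    · rcases h3 with h3 | h3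
      · exact ⟨p, q, h4, hpq, Or.inl h3⟩
      · exact ⟨p, q, h4, hpq, Or.inr (by omega)⟩
  obtain ⟨i', j', h1, h2, h3⟩ := hex
  -- An arc that encloses one leaving the window leaves it as well.
  obtain ⟨i, j, hij, ho⟩ := S.mid.exists_outermost (fun i j => i < l ∨ r < j)
    (fun i j k m h4 h5 h6 => h4.imp (by omega) (by omega)) h1 h2 h3
  obtain ⟨⟨e1, e2⟩, e3, e4⟩ := h.closed.labels_of_outer h.good hij ho
  have hr := h.closed.reoriented_cut hij (e1.trans e3.symm)
  have hcut : IsClosure l r s (S.cut i j) := by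
    refine ⟨h.consistent, hr.closed, h.bot, h.top, ⟨?_, h.mid.outside⟩, ?_, ?_, ?_⟩
    -- An end of the cut arc inside the window was a ray in `s`, and becomes a ray again.
    · intro p h4 h5
      change (S.mid.cut i j).node p = _ ∨ _ ∧ ∃ q, (S.mid.cut i j).node p = _ ∧ _
      have hji := (S.mid.arc_symm i j hij.2.1).2
      by_cases hpi : p = i
      · subst hpi
        left
        rw [ArcDiagram.cut_left hij]
        rcases h.mid.inside p h4 h5 with h6 | h6
        · rw [hij.2.1] at h6
          have := (h.mid.arc h6.symm).2.2
          omega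
        · exact h6.1.symm
      by_cases hpj : p = j
      · subst hpj
        left
        rw [ArcDiagram.cut_right hij]
        rcases h.mid.inside p h4 h5 with h6 | h6
        · rw [hji] at h6
          have := (h.mid.arc h6.symm).2.2
          omega
        · exact h6.1.symm
      rw [ArcDiagram.cut_of_ne hij hpi hpj]
      exact h.mid.inside p h4 h5
    · intro v h4 h5
      rw [Stack.cut_label]
      exact h.label v h4 h5
    · intro v hv
      rw [Stack.cut_label]
      exact h.good.left v hv
    · intro v hv
      rw [Stack.cut_label]
      exact h.good.right v hv
  obtain ⟨T, k1, k2, k3⟩ := ih _ (ArcDiagram.numEnds_cut_lt hij) hcut rfl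
  refine ⟨T, k1, k2, ?_⟩
  rw [h.closed.filter_allSurgeries_eq hij, h.closed.filter_outcomes_outer h.good hij ho,
    Multiset.singleton_bind, k3]

end DiagramAlgebra

namespace DiagramAlgebra

/-! ## Weights with the same cup diagram -/

theorem Opposite.left_eq {a b a' b' : Option Label} (h : Opposite a b) (h' : Opposite a' b')
    (hne : a' ≠ a) : a' = b ∧ b' = a := by
  rcases h with ⟨rfl, rfl⟩ | ⟨rfl, rfl⟩ <;> rcases h' with ⟨rfl, rfl⟩ | ⟨rfl, rfl⟩ <;> simp_all

/-- Two orientations of a diagram by equivalent weights agree at the rays. -/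
theorem Weight.Equivalent.rays_agree {c : ArcDiagram} {w w' : Weight} (he : w.Equivalent w')
    (h : Oriented c w) (h' : Oriented c w') {k : ℤ} (hk : c.node k = some Node.ray) :
    w'.label k = w.label k := by
  have ha := he.arrow_iff
  have hl := fun i => he.label_eq (i := i)
  obtain ⟨σ, h1, h2, h3⟩ := he
  set d : ℤ → ℤ := fun i => val (w'.label i) - val (w.label i) with hd
  have hcomp : c.Compat d := by
    refine ⟨fun i j hij => ?_, fun i hi => ?_⟩
    · have e1 := (h.arc i j hij).val_add
      have e2 := (h'.arc i j hij).val_add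
      simp only [hd]
      omega
    · by_contra hc
      refine hi ?_
      have : ¬ w.IsArrow i := fun hi => hc (h.arrow_node hi)
      simp only [hd, hl i this, sub_self]
  -- All moved positions are included, so that the total difference vanishes, and all arc ends, so
  -- that arcs cancel within `A`.
  set A := h1.toFinset ∪ c.finite_arcs.toFinset with hA
  have hmem : ∀ i, i ∈ A ↔ σ i ≠ i ∨ ∃ j, c.node i = some (Node.arc j) := by
    intro i
    rw [hA, Finset.mem_union, Set.Finite.mem_toFinset, Set.Finite.mem_toFinset]
    rfl
  have hmemF : ∀ i, i ∈ h1.toFinset ↔ σ i ≠ i := fun i => Set.Finite.mem_toFinset h1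
  have hout : ∀ i, σ i = i → d i = 0 := by
    intro i hi
    simp only [hd, h3, hi, sub_self]
  have htot : ∑ i ∈ A, d i = 0 := by
    rw [← Finset.sum_subset (Finset.subset_union_left : h1.toFinset ⊆ A)
      (fun i _ hi => hout i (by rwa [hmemF, not_not] at hi)), hd, Finset.sum_sub_distrib, sub_eq_zero]
    refine Finset.sum_equiv σ ?_ ?_
    · intro i
      rw [hmemF, hmemF]
      exact (σ.injective.eq_iff).not.symm
    · intro i _
      rw [h3]
  rw [hcomp.sum_eq A fun i j _ _ hij => (hmem j).mpr (Or.inr ⟨i, (c.arc_symm i j hij).2⟩)] at htot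
  by_contra hne
  have hdk : d k ≠ 0 := fun h0 => hne
    (Weight.label_eq_of_val (h'.ray k hk) (h.ray k hk) (by simp only [hd] at h0; omega))
  have hkA : k ∈ A := (hmem k).mpr (Or.inl fun hc => hdk (hout k hc))
  have hdk' : c.onRays d k ≠ 0 := by
    unfold ArcDiagram.onRays
    rwa [if_pos hk]
  -- The differences at rays sum to zero, so a nonzero one is accompanied by one of opposite sign.
  obtain ⟨m, hmA, hm⟩ : ∃ m ∈ A, c.onRays d m * c.onRays d k < 0 := by
    by_contra hc
    push Not at hc
    rcases lt_or_gt_of_ne hdk' with h4 | h4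
    · have h5 : ∀ i ∈ A, 0 ≤ - c.onRays d i := fun i hi => by
        have := hc i hi
        nlinarith
      have h6 := Finset.single_le_sum h5 hkA
      rw [Finset.sum_neg_distrib] at h6
      omega
    · have h5 : ∀ i ∈ A, 0 ≤ c.onRays d i := fun i hi => by
        have := hc i hi
        nlinarith
      have h6 := Finset.single_le_sum h5 hkA
      omega
  have hmr : c.node m = some Node.ray := by
    by_contra hc
    unfold ArcDiagram.onRays at hm
    rw [if_neg hc] at hm
    simp at hm
  unfold ArcDiagram.onRays at hm
  rw [if_pos hk, if_pos hmr] at hm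
  have hkm : k ≠ m := by
    rintro rfl
    nlinarith [mul_self_nonneg (d k)]
  -- Opposite changes at two rays mean that one of the weights has `∨` at the left ray and `∧` at
  -- the right one.
  have key : ∀ p q, p < q → c.node p = some Node.ray → c.node q = some Node.ray →
      d p * d q < 0 → False := by
    intro p q hpq hp hq hlt
    have s1 := h.rays_sorted p q hp hq hpq
    have s2 := h'.rays_sorted p q hp hq hpq
    simp only [hd] at hlt
    rcases h.ray p hp with a1 | a1 <;> rcases h'.ray p hp with a2 | a2 <;>
      rcases h.ray q hq with a3 | a3 <;> rcases h'.ray q hq with a4 | a4 <;>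
      simp [a1, a2, a3, a4, val] at hlt s1 s2
  rcases lt_or_gt_of_ne hkm with h4 | h4
  · exact key k m h4 hk hmr (by rwa [mul_comm])
  · exact key m k h4 hmr hk hm

/-- Within a block, a weight is determined by its cup diagram. -/
theorem Weight.eq_of_cup {a b : Weight} (he : a.Equivalent b) (h : a.cup = b.cup) : a = b := by
  have ha := a.cup_oriented
  have hb := b.cup_oriented
  rw [← h] at hb
  refine Weight.ext (funext fun i => ?_)
  by_cases hi : a.IsArrow i
  · rcases a.cup_arrow_cases hi with hr | ⟨j, hj⟩
    · exact (he.rays_agree ha hb hr).symm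
    · have hj' := hj
      rw [h] at hj'
      rcases lt_or_gt_of_ne (a.cup.arc_symm i j hj).1 with hij | hij
      · rw [(a.cup_anticlockwise j i (a.cup.arc_symm i j hj).2 hij).2,
          (b.cup_anticlockwise j i (b.cup.arc_symm i j hj').2 hij).2]
      · rw [(a.cup_anticlockwise i j hj hij).1, (b.cup_anticlockwise i j hj' hij).1]
  · exact (he.label_eq hi).symm

/-- Two orientations of a diagram that agree away from its arcs differ by exchanging the labels at the
ends of some arcs. -/
theorem Oriented.exists_perm {c : ArcDiagram} {w w' : Weight} (h : Oriented c w) (h' : Oriented c w')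
    (hl : ∀ i, (∀ j, c.node i ≠ some (Node.arc j)) → w'.label i = w.label i) :
    ∃ σ : Equiv.Perm ℤ, {i | σ i ≠ i}.Finite ∧ (∀ i, ¬ w.IsArrow i → σ i = i) ∧
      (∀ i, w'.label i = w.label (σ i)) ∧ ∀ i, σ i ≠ i → ∃ j, c.node i = some (Node.arc j) := by
  set f : ℤ → ℤ := fun i => if w'.label i = w.label i then i else c.partner i with hf
  have key : ∀ i, w'.label i = w.label i ∧ f i = i ∨
      ∃ j, c.node i = some (Node.arc j) ∧ f i = j ∧ w'.label i = w.label j ∧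
        w'.label j = w.label i ∧ w'.label j ≠ w.label j := by
    intro i
    by_cases hi : w'.label i = w.label i
    · exact Or.inl ⟨hi, if_pos hi⟩
    · have : ∃ j, c.node i = some (Node.arc j) := by
        by_contra hc
        push Not at hc
        exact hi (hl i hc)
      obtain ⟨j, hj⟩ := this
      have h1 := (h.arc i j hj).left_eq (h'.arc i j hj) hi
      refine Or.inr ⟨j, hj, (if_neg hi).trans (ArcDiagram.partner_eq hj), h1.1, h1.2, ?_⟩
      rw [h1.2]
      exact (h.arc i j hj).ne
  have hinv : Function.Involutive f := by
    intro i
    rcases key i with ⟨-, h1⟩ | ⟨j, h1, h2, -, -, h3⟩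
    · rw [h1, h1]
    · rw [h2]
      exact (if_neg h3).trans (ArcDiagram.partner_eq (c.arc_symm i j h1).2)
  have harc : ∀ i, f i ≠ i → ∃ j, c.node i = some (Node.arc j) := by
    intro i hi
    rcases key i with ⟨-, h1⟩ | ⟨j, h1, -⟩
    · exact absurd h1 hi
    · exact ⟨j, h1⟩
  refine ⟨hinv.toPerm, c.finite_arcs.subset harc, ?_, ?_, harc⟩
  · intro i hi
    rcases key i with ⟨-, h1⟩ | ⟨j, h1, -⟩
    · exact h1
    · exact absurd (h.arc i j h1).left_arrow hi
  · intro i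
    change w'.label i = w.label (f i)
    rcases key i with ⟨h1, h2⟩ | ⟨j, -, h1, h2, -⟩
    · rw [h1, h2]
    · rw [h1, h2]

/-! ## Stitching -/

/-- Both weights lie in one block and orient the same middle diagram, so they agree at the stitched
rays. -/
theorem stitch_consistent {Λ : Block} {x y : Basis Λ} (hxy : y.left.cup = x.right.cup) :
    (stitch x y).Consistent := by
  have hx := x.right_sub.2
  have hy := y.left_sub.2
  rw [hxy] at hy
  have he := Block.equivalent x.wt_mem y.wt_mem
  refine ⟨x.left_sub.2, y.right_sub.2, fun i => ⟨hx.line i, hy.line i⟩, ?_, ?_, ?_⟩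
  · intro i hi
    have := hx.free i hi
    refine ⟨(he.label_eq ?_).symm, this⟩
    unfold Weight.IsArrow
    rcases this with h | h <;> simp [h]
  · exact fun i j hij => ⟨hx.arc i j hij, hy.arc i j hij⟩
  · exact fun i hi => ⟨(he.rays_agree hx hy hi).symm, hx.ray i hi⟩

/-! ## Invariants of the surgery procedure -/

/-- What does not change under surgeries. -/
structure Stack.Descends (s t : Stack) : Prop where
  consistent : t.Consistent
  bot : t.bot = s.bot
  top : t.top = s.top
  bot_label : ∀ i, (∀ j, s.bot.node i ≠ some (Node.arc j)) → t.wBot.label i = s.wBot.label i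
  top_label : ∀ i, (∀ j, s.top.node i ≠ some (Node.arc j)) → t.wTop.label i = s.wTop.label i
  arrow_iff : ∀ v, t.Arrow v ↔ s.Arrow v

theorem Oriented.arrow_iff {c : ArcDiagram} {w : Weight} (h : Oriented c w) (i : ℤ) :
    w.IsArrow i ↔ (c.node i = some Node.ray ∨ ∃ j, c.node i = some (Node.arc j)) := by
  refine ⟨h.arrow_node, ?_⟩
  rintro (hi | ⟨j, hi⟩)
  · exact h.ray i hi
  · exact (h.arc i j hi).left_arrow

/-- The positions of arrows can be read off from the outer diagrams, which are kept. A vertex that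
is not the end of an outer arc is either the end of a ray, where labels are kept, or carries no
arrow and so lies on no new component. -/
theorem Outcome.descends {s t : Stack} {i j : ℤ} (hs : s.Consistent) (h : Surgerable s i j)
    (ho : Outcome s i j t) : s.Descends t := by
  have ha : ∀ v, t.Arrow v ↔ s.Arrow v := by
    intro v
    cases v with
    | bot p =>
      have := ho.consistent.bot.arrow_iff p
      rw [ho.bot] at this
      exact this.trans (hs.bot.arrow_iff p).symm
    | top p =>
      have := ho.consistent.top.arrow_iff p
      rw [ho.top] at this
      exact this.trans (hs.top.arrow_iff p).symm
  have hsk := ho.toSkeleton_eq h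
  have hi : t.Arrow (Vertex.bot i) := by
    refine ho.consistent.adj_arrow (w := Vertex.top i) ?_
    rw [hsk]
    exact Skeleton.cut_adj_left h
  have hj : t.Arrow (Vertex.bot j) := by
    refine ho.consistent.adj_arrow (w := Vertex.top j) ?_
    rw [hsk]
    exact Skeleton.cut_adj_right h
  have hn : ∀ v, ¬ s.Arrow v → t.label v = s.label v := by
    intro v hv
    rw [← ha] at hv
    exact ho.unchanged v (fun hc => hv (ho.consistent.conn_arrow hc hi))
      (fun hc => hv (ho.consistent.conn_arrow hc hj))
  refine ⟨ho.consistent, ho.bot, ho.top, ?_, ?_, ha⟩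
  · intro p hp
    by_cases hv : s.wBot.IsArrow p
    · refine ho.rays_unchanged (Vertex.bot p) ?_
      change t.bot.node p = _
      rw [ho.bot]
      exact (hs.bot.arrow_node hv).resolve_right fun ⟨q, hq⟩ => hp q hq
    · exact hn (Vertex.bot p) hv
  · intro p hp
    by_cases hv : s.wTop.IsArrow p
    · refine ho.rays_unchanged (Vertex.top p) ?_
      change t.top.node p = _
      rw [ho.top]
      exact (hs.top.arrow_node hv).resolve_right fun ⟨q, hq⟩ => hp q hq
    · exact hn (Vertex.top p) hv

theorem Stack.Descends.refl {s : Stack} (hs : s.Consistent) : s.Descends s :=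
  ⟨hs, rfl, rfl, fun _ _ => rfl, fun _ _ => rfl, fun _ => Iff.rfl⟩

theorem Stack.Descends.trans {s t u : Stack} (h : s.Descends t) (h' : t.Descends u) :
    s.Descends u := by
  refine ⟨h'.consistent, h'.bot.trans h.bot, h'.top.trans h.top, ?_, ?_,
    fun v => (h'.arrow_iff v).trans (h.arrow_iff v)⟩
  · intro i hi
    rw [h'.bot_label i (by rwa [h.bot]), h.bot_label i hi]
  · intro i hi
    rw [h'.top_label i (by rwa [h.top]), h.top_label i hi]

theorem Surgeries.descends {s t : Stack} {R : Multiset Stack} (hs : s.Consistent)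
    (h : Surgeries {s} R) (ht : t ∈ R) : s.Descends t := by
  induction h generalizing t with
  | refl =>
    rw [Multiset.mem_singleton] at ht
    subst ht
    exact Stack.Descends.refl hs
  | tail _ h2 ih =>
    obtain ⟨u, M, i, j, hij⟩ := h2
    rcases Multiset.mem_add.mp ht with h3 | h3
    · have hu := ih (Multiset.mem_cons_self u M)
      exact hu.trans ((mem_outcomes.mp h3).descends hu.consistent hij)
    · exact ih (Multiset.mem_cons_of_mem h3)

theorem allSurgeries_spec {s : Stack} (hs : s.Consistent) :
    ∀ t ∈ allSurgeries s, s.Descends t ∧ ∀ i j, t.mid.node i ≠ some (Node.arc j) := by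
  induction hn : s.mid.numEnds using Nat.strong_induction_on generalizing s with
  | _ n ih =>
  subst hn
  intro t ht
  rcases hL : s.mid.leftEnds with _ | ⟨k, L⟩
  · rw [allSurgeries_of_nil hL, Multiset.mem_singleton] at ht
    subst ht
    exact ⟨Stack.Descends.refl hs, ArcDiagram.leftEnds_eq_nil.mp hL⟩
  rw [allSurgeries_of_cons hL, Multiset.mem_bind] at ht
  obtain ⟨u, hu, ht⟩ := ht
  have hk := surgerable_iff.mpr (ArcDiagram.leftEnds_eq_cons hL).1
  have ho := mem_outcomes.mp hu
  have hd := ho.descends hs hk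
  obtain ⟨h1, h2⟩ := ih _ (by
    rw [ho.mid_eq hk]
    exact ArcDiagram.numEnds_cut_lt hk) hd.consistent rfl t ht
  exact ⟨hd.trans h1, h2⟩

/-- In a finished diagram the labels on the two number lines agree. -/
theorem Stack.Consistent.lines_eq {s : Stack} (h : s.Consistent)
    (hf : ∀ i j, s.mid.node i ≠ some (Node.arc j)) : s.wTop = s.wBot := by
  refine Weight.ext (funext fun i => ?_)
  rcases hi : s.mid.node i with _ | ⟨_ | _ | j⟩
  · rw [(h.mid_line i).1.mp hi, (h.mid_line i).2.mp hi]
  · exact (h.mid_free i hi).1.symm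
  · exact (h.mid_ray i hi).1.symm
  · exact absurd hi (hf i j)

end DiagramAlgebra

namespace DiagramAlgebra

/-! ## Closures in a window -/

theorem Weight.Bounded.exists_window {w : Weight} (h : w.Bounded) :
    ∃ l r : ℤ, ∀ i, w.label i ≠ none ↔ l ≤ i ∧ i ≤ r := by
  by_cases hne : ∃ i, w.label i ≠ none
  · exact ⟨w.lo, w.hi, h.mem_iff hne⟩
  · push Not at hne
    -- A weight without vertices gets an empty window.
    refine ⟨0, -1, fun i => iff_of_false (by simp [hne i]) (by omega)⟩

theorem Weight.cl_label_left {w : Weight} (h : w.Bounded) {l r i : ℤ}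
    (hw : ∀ i, w.label i ≠ none ↔ l ≤ i ∧ i ≤ r) (hi : i < l) :
    (w.cl h).label i ≠ some Label.up := by
  have h0 : ¬ w.label i ≠ none := (hw i).not.mpr (by omega)
  change w.clLabel i ≠ _
  by_cases hne : ∃ k, w.label k ≠ none
  · have hm := h.mem_iff hne
    obtain ⟨k, hk⟩ := hne
    have h1 := (hw k).mp hk
    have h2 := (hm k).mp hk
    unfold Weight.clLabel
    rw [if_neg h0]
    split_ifs
    · simp
    · omega
    · simp
  · push Not at hne
    rw [Weight.clLabel_empty hne]
    simp

theorem Weight.cl_label_right {w : Weight} (h : w.Bounded) {l r i : ℤ}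
    (hw : ∀ i, w.label i ≠ none ↔ l ≤ i ∧ i ≤ r) (hi : r < i) :
    (w.cl h).label i ≠ some Label.down := by
  have h0 : ¬ w.label i ≠ none := (hw i).not.mpr (by omega)
  change w.clLabel i ≠ _
  by_cases hne : ∃ k, w.label k ≠ none
  · have hm := h.mem_iff hne
    obtain ⟨k, hk⟩ := hne
    have h1 := (hw k).mp hk
    have h2 := (hm k).mp hk
    unfold Weight.clLabel
    rw [if_neg h0]
    split_ifs
    · omega
    · simp
    · simp
  · push Not at hne
    rw [Weight.clLabel_empty hne]
    simp

/-- The cup diagram of a closure completes the cup diagram of any extension all of whose cups are in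
the window. -/
theorem Weight.completes_cl {w w' : Weight} (h : w.Bounded) {l r : ℤ}
    (hw : ∀ i, w.label i ≠ none ↔ l ≤ i ∧ i ≤ r)
    (hw' : ∀ i, w.label i ≠ none → w'.label i = w.label i)
    (harc : ∀ i j, w'.cup.node i = some (Node.arc j) → l ≤ i ∧ i ≤ r) :
    Completes l r w'.cup (w.cl h).cup := by
  have hlab : ∀ i, l ≤ i → i ≤ r → (w.cl h).label i = w'.label i := by
    intro i h1 h2
    have h3 := (hw i).mpr ⟨h1, h2⟩
    rw [Weight.cl_label_of_ne h h3, hw' i h3]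
  have hmat : ∀ p q, l ≤ p → p ≤ r → l ≤ q → q ≤ r → ((w.cl h).Matched p q ↔ w'.Matched p q) := by
    intro p q h1 h2 h3 h4
    exact Weight.matched_congr fun k h5 h6 => hlab k (by omega) (by omega)
  have harc' : ∀ p q, l ≤ p → p ≤ r → l ≤ q → q ≤ r →
      ((w.cl h).cup.node p = some (Node.arc q) ↔ w'.cup.node p = some (Node.arc q)) := by
    intro p q h1 h2 h3 h4
    exact Weight.cupNode_arc.trans ((or_congr (hmat p q h1 h2 h3 h4) (hmat q p h3 h4 h1 h2)).trans
      Weight.cupNode_arc.symm)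
  refine ⟨?_, harc⟩
  intro p h1 h2
  rcases hp : w'.cup.node p with _ | ⟨_ | _ | q⟩
  · left
    have := (w'.cup_oriented.line p).mp hp
    rw [← hlab p h1 h2] at this
    exact ((w.cl h).cup_oriented.line p).mpr this
  · left
    have := w'.cup_oriented.free p hp
    rw [← hlab p h1 h2] at this
    exact Weight.cupNode_free.mpr this
  · right
    have h3 : (w.cl h).IsArrow p := by
      unfold Weight.IsArrow
      rw [hlab p h1 h2]
      exact w'.cup_oriented.ray p hp
    -- The closure has no rays. An arc with both ends in the window would be matched in `w'` too, so
    -- the new arc leaves the window.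
    rcases (w.cl h).cup_arrow_cases h3 with h4 | ⟨q, hq⟩
    · exact absurd h4 (Weight.cl_closed h p)
    · refine ⟨rfl, q, hq, ?_⟩
      by_contra hc
      have := (harc' p q h1 h2 (by omega) (by omega)).mp hq
      rw [hp] at this
      simp at this
  · left
    have := harc q p (w'.cup.arc_symm p q hp).2
    exact (harc' p q h1 h2 this.1 this.2).mpr hp

/-! ## Comparing bounded and unbounded blocks -/

/-- An embedding of the basis of `K_Γ` into the basis of `K_Λ`, given by adding the same labels at new
vertices to all weights. -/
structure IsExtension {Γ Λ : Block} (E : Basis Γ → Basis Λ) : Prop where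
  exists_weight : ∃ e : ∀ w, w ∈ Γ → Weight,
    (∀ w h i, w.label i ≠ none → (e w h).label i = w.label i) ∧
    (∀ w h w' h' i, w.label i = none → (e w h).label i = (e w' h').label i) ∧
    ∀ Z : Basis Γ, (E Z).left = e Z.left Z.left_mem ∧ (E Z).wt = e Z.wt Z.wt_mem ∧
      (E Z).right = e Z.right Z.right_mem

/-- Makes the bounded case an instance of the comparison for truncations. -/
theorem isExtension_id (Γ : Block) : IsExtension (id : Basis Γ → Basis Γ) :=
  ⟨fun w _ => w, fun _ _ _ _ => rfl,
    fun _ h _ h' i hi => hi.trans (((Block.equivalent h h').none_iff i).mpr hi).symm,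
    fun _ => ⟨rfl, rfl, rfl⟩⟩

theorem Basis.isExtension_ex {Γ Λ : Block} (h : Γ.Prec Λ) : IsExtension (Basis.ex h) :=
  ⟨fun w hw => Weight.ex h w hw, fun _ _ _ hi => if_neg hi,
    fun _ hw _ hw' i hi => (if_pos hi).trans
      (if_pos (((Block.equivalent hw hw').none_iff i).mpr hi)).symm,
    fun _ => ⟨rfl, rfl, rfl⟩⟩

/-- A common choice of intermediate values for two relations. -/
theorem exists_rel_rel {α β γ : Type*} {p : α → γ → Prop} {q : γ → β → Prop} {A : Multiset α}
    {B : Multiset β} (h : Multiset.Rel (fun a b => ∃ c, p a c ∧ q c b) A B) :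
    ∃ C, Multiset.Rel p A C ∧ Multiset.Rel q C B := by
  induction h with
  | zero => exact ⟨0, Multiset.Rel.zero, Multiset.Rel.zero⟩
  | cons h1 _ ih =>
    obtain ⟨c, h1, h2⟩ := h1
    obtain ⟨C, h3, h4⟩ := ih
    exact ⟨c ::ₘ C, Multiset.Rel.cons h1 h3, Multiset.Rel.cons h2 h4⟩

/-- An oriented circle diagram in a block is determined by the diagram it is drawn with. -/
theorem IdentifiesTo.unique {Λ : Block} {t : Stack} {z z' : Basis Λ} (h : IdentifiesTo t z)
    (h' : IdentifiesTo t z') : z = z' :=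
  Basis.ext
    (Weight.eq_of_cup (Block.equivalent z.left_mem z'.left_mem) (h.bot.symm.trans h'.bot))
    (h.wBot.symm.trans h'.wBot)
    (Weight.eq_of_cup (Block.equivalent z.right_mem z'.right_mem) (h.top.symm.trans h'.top))

/-! ### Products as sums over surgeries -/

section Product

variable (F : Type*) [Field F] {Γ : Block}

theorem H.collapse_of_identifiesTo {Δ : Block} {t : Stack} {z : ClosedBasis Δ}
    (h : IdentifiesTo t z.toBasis) : H.collapse F t = Finsupp.single z 1 := by
  have hex : ∃ z : ClosedBasis Δ, IdentifiesTo t z.toBasis := ⟨z, h⟩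
  unfold H.collapse
  rw [dif_pos hex]
  congr 1
  exact ClosedBasis.ext (congrArg Basis.left (hex.choose_spec.unique h))
    (congrArg Basis.wt (hex.choose_spec.unique h)) (congrArg Basis.right (hex.choose_spec.unique h))

theorem K.opening_single_cl (h : Γ.Bounded) (Z : Basis Γ) :
    K.opening F h (Finsupp.single (Z.cl h) 1) = Finsupp.single Z 1 := by
  ext W
  change (Finsupp.single (Z.cl h) (1 : F)) (W.cl h) = _
  rw [Finsupp.single_apply, Finsupp.single_apply]
  simp only [(Basis.cl_injective h).eq_iff]

/-- Closures of weights are good by construction, so a bad diagram is not a closure and its basis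
vector is killed. -/
theorem K.opening_collapse_of_not_good (h : Γ.Bounded) {l r : ℤ}
    (hw : ∀ w ∈ Γ, ∀ i, w.label i ≠ none ↔ l ≤ i ∧ i ≤ r) {t : Stack} (ht : ¬ t.Good l r) :
    K.opening F h (H.collapse F t) = 0 := by
  unfold H.collapse
  split_ifs with hex
  · ext W
    change (Finsupp.single hex.choose (1 : F)) (W.cl h) = 0
    rw [Finsupp.single_apply, if_neg]
    intro hW
    have hz := hex.choose_spec
    rw [hW] at hz
    refine ht ⟨fun v hv => ?_, fun v hv => ?_⟩
    · cases v with
      | bot p =>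
        change t.wBot.label p ≠ _
        rw [hz.wBot]
        exact Weight.cl_label_left (h _ W.wt_mem) (hw _ W.wt_mem) hv
      | top p =>
        change t.wTop.label p ≠ _
        rw [hz.wTop]
        exact Weight.cl_label_left (h _ W.wt_mem) (hw _ W.wt_mem) hv
    · cases v with
      | bot p =>
        change t.wBot.label p ≠ _
        rw [hz.wBot]
        exact Weight.cl_label_right (h _ W.wt_mem) (hw _ W.wt_mem) hv
      | top p =>
        change t.wTop.label p ≠ _
        rw [hz.wTop]
        exact Weight.cl_label_right (h _ W.wt_mem) (hw _ W.wt_mem) hv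
  · exact map_zero _

/-- The product in the bounded case in terms of surgeries on the closures. -/
theorem K.mulBounded_single (h : Γ.Bounded) {l r : ℤ}
    (hw : ∀ w ∈ Γ, ∀ i, w.label i ≠ none ↔ l ≤ i ∧ i ≤ r) {X Y : Basis Γ}
    (hXY : Y.left = X.right) :
    K.mulBounded F h (Finsupp.single X 1) (Finsupp.single Y 1) =
      (((allSurgeries (stitch (X.cl h).toBasis (Y.cl h).toBasis)).filter (Stack.Good l r)).map
        fun t => K.opening F h (H.collapse F t)).sum := by
  have h1 : K.mulBounded F h (Finsupp.single X 1) (Finsupp.single Y 1) =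
      K.opening F h (H.mulBasis F (X.cl h) (Y.cl h)) := by
    change K.opening F h (H.mul F _ (Finsupp.lmapDomain F F (Basis.cl h) (Finsupp.single X 1))
      (Finsupp.lmapDomain F F (Basis.cl h) (Finsupp.single Y 1))) = _
    unfold H.mul
    simp
  have h2 : (X.cl h).right.cup = (Y.cl h).left.cup := by
    change (X.right.cl (h _ X.right_mem)).cup = (Y.left.cl (h _ Y.left_mem)).cup
    simp only [hXY]
  rw [h1]
  unfold H.mulBasis
  rw [if_pos h2, map_multiset_sum, Multiset.map_map]
  generalize allSurgeries (stitch (X.cl h).toBasis (Y.cl h).toBasis) = M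
  induction M using Multiset.induction_on with
  | empty => rfl
  | cons t M ih =>
    rw [Multiset.map_cons, Multiset.sum_cons, ih]
    by_cases ht : t.Good l r
    · rw [Multiset.filter_cons_of_pos _ ht, Multiset.map_cons, Multiset.sum_cons]
      rfl
    · rw [Multiset.filter_cons_of_neg _ ht, Function.comp_apply,
        K.opening_collapse_of_not_good F h hw ht, zero_add]

end Product

theorem Weight.restrict_eq {w w' : Weight} {l r : ℤ}
    (hw : ∀ i, w.label i ≠ none ↔ l ≤ i ∧ i ≤ r)
    (hw' : ∀ i, w.label i ≠ none → w'.label i = w.label i) : w'.restrict l r = w := by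
  refine Weight.ext (funext fun i => ?_)
  by_cases hi : w.label i = none
  · rw [hi]
    exact Weight.restrict_out ((hw i).not.mp (by simp [hi]))
  · rw [Weight.restrict_in ((hw i).mp hi), hw' i hi]

/-- The window and the labels of the diagrams, when multiplying two extended basis vectors. -/
structure Framed {Γ Λ : Block} (E : Basis Γ → Basis Λ) (l r : ℤ) (X Y : Basis Γ) : Prop where
  ext : IsExtension E
  bounded : Γ.Bounded
  line : ∀ w ∈ Γ, ∀ i, w.label i ≠ none ↔ l ≤ i ∧ i ≤ r
  match_eq : (E Y).left.cup = (E X).right.cup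
  arcs_fst : ∀ i j, ((E X).left.cup.node i = some (Node.arc j) ∨
    (E X).right.cup.node i = some (Node.arc j)) → l ≤ i ∧ i ≤ r
  arcs_snd : ∀ i j, ((E Y).left.cup.node i = some (Node.arc j) ∨
    (E Y).right.cup.node i = some (Node.arc j)) → l ≤ i ∧ i ≤ r

namespace Framed

variable {Γ Λ : Block} {E : Basis Γ → Basis Λ} {l r : ℤ} {X Y : Basis Γ}

theorem label_left (h : Framed E l r X Y) (Z : Basis Γ) {i : ℤ} (hi : Z.left.label i ≠ none) :
    (E Z).left.label i = Z.left.label i := by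
  obtain ⟨e, h1, -, h2⟩ := h.ext
  rw [(h2 Z).1, h1 _ _ i hi]

theorem label_wt (h : Framed E l r X Y) (Z : Basis Γ) {i : ℤ} (hi : Z.wt.label i ≠ none) :
    (E Z).wt.label i = Z.wt.label i := by
  obtain ⟨e, h1, -, h2⟩ := h.ext
  rw [(h2 Z).2.1, h1 _ _ i hi]

theorem label_right (h : Framed E l r X Y) (Z : Basis Γ) {i : ℤ} (hi : Z.right.label i ≠ none) :
    (E Z).right.label i = Z.right.label i := by
  obtain ⟨e, h1, -, h2⟩ := h.ext
  rw [(h2 Z).2.2, h1 _ _ i hi]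

/-- In the block of the extensions a weight is determined by its cup diagram; the equality then
restricts to the smaller line. -/
theorem middle (h : Framed E l r X Y) : Y.left = X.right := by
  have he := Weight.eq_of_cup (Block.equivalent (E Y).left_mem (E X).right_mem) h.match_eq
  refine Weight.ext (funext fun i => ?_)
  have hn := (Block.equivalent Y.left_mem X.right_mem).none_iff i
  by_cases hi : Y.left.label i = none
  · rw [hi, hn.mpr hi]
  · rw [← h.label_left Y hi, ← h.label_right X (hn.not.mpr hi), he]

/-- Connects the comparison of surgeries with the definition of the product: the left diagram may
live on a longer line than the truncation, but all its arcs are in the window. -/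
theorem isClosure (h : Framed E l r X Y) :
    IsClosure l r (stitch (E X) (E Y)) (stitch (X.cl h.bounded).toBasis (Y.cl h.bounded).toBasis) := by
  have hm : (Y.cl h.bounded).left.cup = (X.cl h.bounded).right.cup := by
    change (Y.left.cl (h.bounded _ Y.left_mem)).cup = (X.right.cl (h.bounded _ X.right_mem)).cup
    simp only [h.middle]
  refine ⟨stitch_consistent h.match_eq, ⟨stitch_consistent hm,
    Weight.cl_closed (h.bounded _ X.left_mem), Weight.cl_closed (h.bounded _ Y.right_mem),
    Weight.cl_bounded (h.bounded _ X.wt_mem)⟩, ?_, ?_, ?_, ?_, ⟨?_, ?_⟩⟩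
  · exact Weight.completes_cl (h.bounded _ X.left_mem) (h.line _ X.left_mem) (fun i hi => h.label_left X hi)
      (fun i j hij => h.arcs_fst i j (Or.inl hij))
  · exact Weight.completes_cl (h.bounded _ Y.right_mem) (h.line _ Y.right_mem) (fun i hi => h.label_right Y hi)
      (fun i j hij => h.arcs_snd i j (Or.inr hij))
  · exact Weight.completes_cl (h.bounded _ X.right_mem) (h.line _ X.right_mem) (fun i hi => h.label_right X hi)
      (fun i j hij => h.arcs_fst i j (Or.inr hij))
  · intro v h1 h2
    cases v with
    | bot p =>
      have h3 := (h.line _ X.wt_mem p).mpr ⟨h1, h2⟩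
      exact (Weight.cl_label_of_ne (h.bounded _ X.wt_mem) h3).trans (h.label_wt X h3).symm
    | top p =>
      have h3 := (h.line _ Y.wt_mem p).mpr ⟨h1, h2⟩
      exact (Weight.cl_label_of_ne (h.bounded _ Y.wt_mem) h3).trans (h.label_wt Y h3).symm
  · intro v hv
    cases v with
    | bot p => exact Weight.cl_label_left (h.bounded _ X.wt_mem) (h.line _ X.wt_mem) hv
    | top p => exact Weight.cl_label_left (h.bounded _ Y.wt_mem) (h.line _ Y.wt_mem) hv
  · intro v hv
    cases v with
    | bot p => exact Weight.cl_label_right (h.bounded _ X.wt_mem) (h.line _ X.wt_mem) hv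
    | top p => exact Weight.cl_label_right (h.bounded _ Y.wt_mem) (h.line _ Y.wt_mem) hv

/-- The basis vector obtained from a finished diagram and its closure. -/
theorem exists_basis (h : Framed E l r X Y) {t T : Stack} (htT : IsClosure l r t T)
    (ht : (stitch (E X) (E Y)).Descends t) (htf : ∀ i j, t.mid.node i ≠ some (Node.arc j))
    (hT : (stitch (X.cl h.bounded).toBasis (Y.cl h.bounded).toBasis).Descends T)
    (hTf : ∀ i j, T.mid.node i ≠ some (Node.arc j)) :
    ∃ Z : Basis Γ, IdentifiesTo t (E Z) ∧ IdentifiesTo T (Z.cl h.bounded).toBasis := by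
  have htl := ht.consistent.lines_eq htf
  have hTl := hT.consistent.lines_eq hTf
  have hout : ∀ i, ¬ (l ≤ i ∧ i ≤ r) → t.wBot.label i = (E X).wt.label i := fun i hi =>
    ht.bot_label i fun j hij => hi (h.arcs_fst i j (Or.inl hij))
  have hbo : Oriented (E X).left.cup t.wBot := by
    have := ht.consistent.bot
    rwa [ht.bot] at this
  have hto : Oriented (E Y).right.cup t.wBot := by
    have := ht.consistent.top
    rwa [ht.top, htl] at this
  -- The surgeries altered the bottom weight at most at the ends of outer arcs, all of which lie in
  -- the window. So it remains in the block, and its restriction remains in `Γ`.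
  obtain ⟨σ, p1, p2, p3, p4⟩ := (E X).left_sub.2.exists_perm hbo ht.bot_label
  have he : (E X).wt.Equivalent t.wBot := ⟨σ, p1, p2, p3⟩
  have hXw : (E X).wt.restrict l r = X.wt :=
    Weight.restrict_eq (h.line _ X.wt_mem) fun i hi => h.label_wt X hi
  have hXl : (E X).left.restrict l r = X.left :=
    Weight.restrict_eq (h.line _ X.left_mem) fun i hi => h.label_left X hi
  have hYr : (E Y).right.restrict l r = Y.right :=
    Weight.restrict_eq (h.line _ Y.right_mem) fun i hi => h.label_right Y hi
  have her : X.wt.Equivalent (t.wBot.restrict l r) := by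
    rw [← hXw]
    refine Weight.Equivalent.restrict p1 p2 p3 fun i hi => ?_
    obtain ⟨j, hj⟩ := p4 i hi
    exact h.arcs_fst i j (Or.inl hj)
  have hmem : t.wBot.restrict l r ∈ Γ := her.block_eq.symm.trans X.wt_mem
  have hmat : ∀ w : Weight, (∀ i j, w.cup.node i = some (Node.arc j) → l ≤ i ∧ i ≤ r) →
      ∀ i j, w.Matched i j → (l ≤ i ∧ i ≤ r) ∧ (l ≤ j ∧ j ≤ r) := fun w hw i j hij =>
    ⟨hw i j (Weight.cupNode_arc.mpr (Or.inl hij)), hw j i (Weight.cupNode_arc.mpr (Or.inr hij))⟩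
  have hls : (X.left).Sub (t.wBot.restrict l r) := by
    have := Weight.Sub.restrict (α := (E X).left) (lam := t.wBot) (l := l) (r := r)
      ⟨(E X).left_sub.1.trans he, hbo⟩ (hmat _ fun i j hij => h.arcs_fst i j (Or.inl hij))
      (by rw [hXl]; exact X.left_sub.1.trans her)
    rwa [hXl] at this
  have hrs : (Y.right).Sub (t.wBot.restrict l r) := by
    have := Weight.Sub.restrict (α := (E Y).right) (lam := t.wBot) (l := l) (r := r)
      ⟨(Block.equivalent (E Y).right_mem (E X).wt_mem).trans he, hto⟩
      (hmat _ fun i j hij => h.arcs_snd i j (Or.inr hij))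
      (by rw [hYr]; exact (Block.equivalent Y.right_mem X.wt_mem).trans her)
    rwa [hYr] at this
  have hline := h.line _ hmem
  refine ⟨⟨X.left, t.wBot.restrict l r, Y.right, X.left_mem, hmem, Y.right_mem, hls, hrs⟩, ?_, ?_⟩
  · have hwt : ∀ Z : Basis Γ, Z.wt = t.wBot.restrict l r → t.wBot = (E Z).wt := by
      intro Z hZ
      refine Weight.ext (funext fun i => ?_)
      by_cases hi : l ≤ i ∧ i ≤ r
      · rw [h.label_wt Z (by rw [hZ]; exact (hline i).mpr hi), hZ, Weight.restrict_in hi]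
      · rw [hout i hi]
        obtain ⟨e, -, h2, h3⟩ := h.ext
        rw [(h3 X).2.1, (h3 Z).2.1]
        refine h2 _ _ _ _ i ?_
        have := (h.line _ X.wt_mem i).not.mpr hi
        rwa [not_not] at this
    have hwt := hwt ⟨X.left, t.wBot.restrict l r, Y.right, X.left_mem, hmem, Y.right_mem, hls, hrs⟩ rfl
    refine ⟨htf, ?_, ?_, hwt, htl.trans hwt⟩
    · rw [ht.bot]
      obtain ⟨e, -, -, h3⟩ := h.ext
      rw [(h3 _).1]
      change (E X).left.cup = _
      rw [(h3 _).1]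
    · rw [ht.top]
      obtain ⟨e, -, -, h3⟩ := h.ext
      rw [(h3 _).2.2]
      change (E Y).right.cup = _
      rw [(h3 _).2.2]
  · have hb := h.bounded _ hmem
    -- Inside the window the labels of `T` are those of `t`. Outside, the arrows of `T` are forced
    -- by goodness and agree with those added by the closure.
    have hwt : T.wBot = (t.wBot.restrict l r).cl hb := by
      refine Weight.ext (funext fun i => ?_)
      by_cases hi : l ≤ i ∧ i ≤ r
      · rw [Weight.cl_label_of_ne hb ((hline i).mpr hi), Weight.restrict_in hi]
        exact htT.label (Vertex.bot i) hi.1 hi.2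
      · have hn := (h.line _ X.wt_mem i).not.mpr hi
        rw [not_not] at hn
        rw [her.cl_out (h.bounded _ X.wt_mem) hb hn]
        have ha : T.wBot.IsArrow i ↔ (X.wt.cl (h.bounded _ X.wt_mem)).IsArrow i :=
          hT.arrow_iff (Vertex.bot i)
        by_cases hc : (X.wt.cl (h.bounded _ X.wt_mem)).IsArrow i
        · have hc' := ha.mpr hc
          rcases (show i < l ∨ r < i by omega) with h1 | h1
          · rw [hc.resolve_right (Weight.cl_label_left _ (h.line _ X.wt_mem) h1),
              hc'.resolve_right (htT.good.left (Vertex.bot i) h1)]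
          · rw [hc.resolve_left (Weight.cl_label_right _ (h.line _ X.wt_mem) h1),
              hc'.resolve_left (htT.good.right (Vertex.bot i) h1)]
        · exact hT.bot_label i fun j hij => hc ((X.cl h.bounded).left_sub.2.arc i j hij).left_arrow
    exact ⟨hTf, hT.bot, hT.top, hwt, hTl.trans hwt⟩

/-- Once the pairs leaving the window are cut, the finished diagrams correspond to the good results
on the closure, and each matched pair gives the same basis vector. The opening kills everything
else. -/
theorem exists_product (F : Type*) [Field F] (h : Framed E l r X Y) {R : Multiset Stack}
    (hR : Surgeries {stitch (E X) (E Y)} R) (hf : Finished R) :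
    ∃ Z : Multiset (Basis Γ), Multiset.Rel IdentifiesTo R (Z.map E) ∧
      K.mulBounded F h.bounded (Finsupp.single X 1) (Finsupp.single Y 1) =
        (Z.map fun z => Finsupp.single z (1 : F)).sum := by
  obtain ⟨S, h1, h2, h3⟩ := h.isClosure.exists_inner
  have h4 := h1.rel_finished h2 hR hf
  rw [← h3] at h4
  have h5 : Multiset.Rel (fun t T => ∃ Z : Basis Γ,
      IdentifiesTo t (E Z) ∧ IdentifiesTo T (Z.cl h.bounded).toBasis) R
      ((allSurgeries (stitch (X.cl h.bounded).toBasis (Y.cl h.bounded).toBasis)).filter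
        (Stack.Good l r)) := by
    refine h4.mono fun t ht T hT htT => ?_
    have h6 := allSurgeries_spec h.isClosure.closed.consistent T (Multiset.mem_filter.mp hT).1
    exact h.exists_basis htT (hR.descends h.isClosure.consistent ht) (hf t ht) h6.1 h6.2
  obtain ⟨Z, h6, h7⟩ := exists_rel_rel h5
  refine ⟨Z, Multiset.rel_map_right.mpr h6, ?_⟩
  rw [K.mulBounded_single F h.bounded h.line h.middle]
  congr 1
  generalize (allSurgeries (stitch (X.cl h.bounded).toBasis (Y.cl h.bounded).toBasis)).filter
    (Stack.Good l r) = G at h7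
  clear h4 h5 h6
  induction h7 with
  | zero => rfl
  | cons h8 _ ih =>
    rw [Multiset.map_cons, Multiset.map_cons, ih, H.collapse_of_identifiesTo F h8,
      K.opening_single_cl]

end Framed

end DiagramAlgebra

/-! ### The product in an arbitrary block -/

namespace DiagramAlgebra

theorem Block.Bounded.exists_window {Γ : Block} (h : Γ.Bounded) :
    ∃ l r : ℤ, ∀ w ∈ Γ, ∀ i, w.label i ≠ none ↔ l ≤ i ∧ i ≤ r := by
  obtain ⟨l, r, hlr⟩ := (h _ Γ.out_mem).exists_window
  exact ⟨l, r, fun w hw i => ((Block.equivalent Γ.out_mem hw).none_iff i).not.trans (hlr i)⟩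

theorem Weight.label_ne_of_arc {w w' : Weight} (he : w.Equivalent w') {i j : ℤ}
    (h : w.cup.node i = some (Node.arc j)) : w'.label i ≠ none := by
  rw [Ne, he.none_iff, ← w.cup_oriented.line, h]
  simp

/-- The product of two basis vectors by means of surgeries in any order. -/
theorem K.exists_mul_eq (F : Type*) [Field F] {Λ : Block} {x y : Basis Λ}
    (hxy : y.left.cup = x.right.cup) {R : Multiset Stack} (hR : Surgeries {stitch x y} R)
    (hf : Finished R) : ∃ Z : Multiset (Basis Λ), Multiset.Rel IdentifiesTo R Z ∧
      K.mul F Λ (Finsupp.single x 1) (Finsupp.single y 1) =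
        (Z.map fun z => Finsupp.single z (1 : F)).sum := by
  by_cases hΛ : Λ.Bounded
  · obtain ⟨l, r, hlr⟩ := hΛ.exists_window
    have h : Framed (id : Basis Λ → Basis Λ) l r x y := by
      refine ⟨isExtension_id Λ, hΛ, hlr, hxy, fun i j hij => ?_, fun i j hij => ?_⟩
      · rw [← hlr _ x.wt_mem]
        exact hij.elim (Weight.label_ne_of_arc x.left_sub.1) (Weight.label_ne_of_arc x.right_sub.1)
      · rw [← hlr _ y.wt_mem]
        exact hij.elim (Weight.label_ne_of_arc y.left_sub.1) (Weight.label_ne_of_arc y.right_sub.1)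
    obtain ⟨Z, h1, h2⟩ := h.exists_product F hR hf
    rw [Multiset.map_id] at h1
    refine ⟨Z, h1, ?_⟩
    unfold K.mul
    rw [dif_pos hΛ]
    exact h2
  -- The truncation is an arbitrary choice; the argument only uses that it carries all cups and caps
  -- of `x` and `y`.
  · set T : Truncation x y := Classical.choice (Basis.exists_truncation x y) with hT
    obtain ⟨l, r, hlr⟩ := T.prec.bounded.exists_window
    have h : Framed (Basis.ex T.prec) l r T.fst T.snd := by
      refine ⟨Basis.isExtension_ex T.prec, T.prec.bounded, hlr, ?_, ?_, ?_⟩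
      · rw [T.ex_fst, T.ex_snd]
        exact hxy
      · rw [T.ex_fst]
        intro i j hij
        rw [← hlr _ T.fst.wt_mem]
        exact T.arcs_fst i j hij
      · rw [T.ex_snd]
        intro i j hij
        rw [← hlr _ T.snd.wt_mem]
        exact T.arcs_snd i j hij
    obtain ⟨Z, h1, h2⟩ := h.exists_product F (R := R) (by rwa [T.ex_fst, T.ex_snd]) hf
    refine ⟨Z.map (Basis.ex T.prec), h1, ?_⟩
    have h3 : K.mul F Λ (Finsupp.single x 1) (Finsupp.single y 1) = K.mulLimit F x y := by
      unfold K.mul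
      rw [dif_neg hΛ]
      simp
    rw [h3]
    change K.ex F T.prec (K.mulBounded F T.prec.bounded (Finsupp.single T.fst 1)
      (Finsupp.single T.snd 1)) = _
    rw [h2, map_multiset_sum, Multiset.map_map, Multiset.map_map]
    refine congrArg Multiset.sum (Multiset.map_congr rfl fun z _ => ?_)
    exact Finsupp.mapDomain_single

end DiagramAlgebra

end

theorem theorem6p1 (F : Type*) [Field F] (Λ : DiagramAlgebra.Block)
    (x y : DiagramAlgebra.Basis Λ) (hxy : y.left.cup = x.right.cup) :
    (DiagramAlgebra.stitch x y).Consistent ∧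
    (∀ R, DiagramAlgebra.Surgeries {DiagramAlgebra.stitch x y} R →
      ∃ R', DiagramAlgebra.Surgeries R R' ∧ DiagramAlgebra.Finished R') ∧
    ∀ R, DiagramAlgebra.Surgeries {DiagramAlgebra.stitch x y} R → DiagramAlgebra.Finished R →
      ∃ Z : Multiset (DiagramAlgebra.Basis Λ),
        Multiset.Rel DiagramAlgebra.IdentifiesTo R Z ∧
        DiagramAlgebra.K.mul F Λ (Finsupp.single x 1) (Finsupp.single y 1) =
          (Z.map fun z => Finsupp.single z (1 : F)).sum := by
  refine ⟨DiagramAlgebra.stitch_consistent hxy, fun R _ => DiagramAlgebra.exists_finished R, ?_⟩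
  intro R hR hf
  exact DiagramAlgebra.K.exists_mul_eq F hxy hR hf
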